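/- **Setting.** Let $n\ge 1$ and $\lambda>n$. Write $\langle z,w\rangle=\sum_i z_i\overline{w_i}$ on $\mathbb C^n$, let $\mathbb B^n$ be the open unit ball, and let $$d\mu_\lambda(z)=\frac{\Gamma(\lambda)}{n!\,\Gamma(\lambda-n)}(1-|z|^2)^{\lambda-n-1}\,dv(z),$$ where $v$ is Lebesgue measure on $\mathbb B^n$ normalised to total mass $1$. Let $\mathcal H^2_\lambda\subset L^2(\mathbb B^n,\mu_\lambda)$ be the closed subspace of (classes of) holomorphic functions, $P_\lambda$ the orthogonal projection onto it, $T_\varphi f=P_\lambda(\varphi f)$ the Toeplitz operator with symbol $\varphi\in L^\infty(\mathbb B^n,\mu_\lambda)$, and $K_w(z)=K_\lambda(z,w)=(1-\langle z,w\rangle)^{-\lambda}$. Let $J=\mathrm{diag}(-1,\dots,-1,1)$ and let $\mathrm{SU}(n,1)$ be the group of the $g\in \mathrm{SL}(n+1,\mathbb C)$ with $gJg^*=J$, acting on $\mathbb B^n$ by $g\cdot z=(az+v)/(w^tz+d)$ for $g=\begin{pmatrix}a&v\\ w^t&d\end{pmatrix}$. Put $\mathrm{den}(g,z)=w^tz+d$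 (for any matrix with this block form). Let $\widetilde{\mathrm{SU}}(n,1)$ be the universal covering group, realised as the group of pairs of an element $g\in \mathrm{SU}(n,1)$ and a continuous logarithm $\ell_g$ of $z\mapsto\mathrm{den}(g,z)$ on $\mathbb B^n$, and put $j_\lambda(g,z)=e^{-\lambda \ell_g(z)}$ ("$=\mathrm{den}(g,z)^{-\lambda}$"). A symbol $\varphi$ is $H$-invariant if for every $h\in H$ one has $\varphi(h\cdot z)=\varphi(z)$ for almost every $z$. **Standard maximal abelian subgroups and base points.** Consider the following families of matrices $A_\xi$ and points $z_0$, up to a permutation of the coordinates of $\mathbb C^n$: * (quasi-elliptic) $\xi=t\in\mathbb T^n$, $A_\xi=\mathrm{diag}(t_1,\dots,t_n,1)$, $z_0=\frac1{\sqrt{2n}}(1,\dots,1)$; * (quasi-hyperbolic) $\xi=(t,s)\in\mathbb T^{n-1}\times\mathbb R$, $A_\xi=\mathrm{diag}(t)\oplus\begin{pmatrix}\cosh s&\sinh s\\ \sinh s&\cosh s\end{pmatrix}$, $z_0=\frac1{\sqrt{2(n-1)}}(1,\dots,1,0)$; * (nilpotent for $k=0$, quasi-nilpotent for $1\le k\le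 n-2$, quasi-parabolic for $k=n-1$; here $0\le k\le n-1$ and $l=n-1-k$) $\xi=(t,b,s)\in\mathbb T^k\times\mathbb R^{l}\times\mathbb R$, $$A_\xi=\mathrm{diag}(t)\oplus\begin{pmatrix}I_l&-ib&-ib\\ -ib^t&1-q&-q\\ ib^t&q&1+q\end{pmatrix},\qquad q=\tfrac12\bigl(|b|^2-is\bigr),$$ $z_0$ with entries $\frac1{\sqrt{2k}}$ in the first $k$ coordinates and $0$ in the others. In each case let $X=\mathbb T^k\times\mathbb R^m$ be the group of the parameters $\xi$ (so $k+m=n$), and let the standard group be $H_0=\{aA_\xi : \xi\in X,\ a\in\mathbb T,\ \det(aA_\xi)=1\}$. For $H=\gamma H_0\gamma^{-1}$ with $\gamma\in\widetilde{\mathrm{SU}}(n,1)$ take the base point $\gamma\cdot z_0$, again denoted $z_0$. Let $\widetilde H$ be the preimage of $H$ in $\widetilde{\mathrm{SU}}(n,1)$. Each $h\in\widetilde H$ has unique coordinates $(\xi,x)\in X\times\mathbb R$ such that $\gamma^{-1}h\gamma$ has matrix $e^{2\pi i x}A_\xi$ and its logarithm of the denominator at $\gamma^{-1}\cdot z_0$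 is $2\pi i x+\mathrm{Log}\,\mathrm{den}(A_\xi,\gamma^{-1}\cdot z_0)$, with $\mathrm{Log}$ the principal logarithm. The map $h\mapsto\xi$ identifies $H/H_{z_0}$ with $X$. Put $\chi_\lambda(h)=e^{2\pi i\lambda x}$ and $D_\lambda(h)=j_\lambda(h,z_0)$. On the stabiliser $\widetilde H_{z_0}$ one has $\chi_\lambda=j_\lambda(\cdot,z_0)^{-1}$. **Operators and functions attached to $H$ and $z_0$.** Give $X$ the product of the normalised Haar measure of $\mathbb T^k$ and Lebesgue measure on $\mathbb R^m$. If $f:\widetilde H\to\mathbb C$ satisfies $f(hh_1)=\chi_\lambda(h_1)^{-1}f(h)$ for all $h_1\in\widetilde H_{z_0}$, then $\tilde f=\chi_\lambda f$ is a function on $X$; let $L^2_{\chi_\lambda}$ be the Hilbert space of such $f$ with $\tilde f\in L^2(X)$, modulo equality a.e., with $\|f\|=\|\tilde f\|$. Let $(Rf)(h)=D_\lambda(h)f(h\cdot z_0)$ for $f\in\mathcal H^2_\lambda$, let $\mathcal B_\lambda$ be the closure of the range of $R$ in $L^2_{\chi_\lambda}$, and let $U_\lambda:\mathcal B_\lambda\to\mathcal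 H^2_\lambda$ (the Segal–Bargmann transform) be defined by $R^*=U_\lambda\sqrt{RR^*}$. Let $\phi_H$ and, for an $H$-invariant $\varphi$, $\nu_\varphi$ be the functions on $X$ given, at the class of $h\in\widetilde H$, by $$\phi_H=\chi_\lambda(h)\,D_\lambda(h)\,K_\lambda(h\cdot z_0,z_0),\qquad \nu_\varphi=\chi_\lambda(h)\,j_\lambda(h,z_0)\,\langle\varphi K_{z_0},K_{h\cdot z_0}\rangle_{L^2(\mathbb B^n,\mu_\lambda)}.$$ For $u\in L^1(X)$ and $(\alpha,\eta)\in\widehat X=\mathbb Z^k\times\mathbb R^m$ (counting measure times Lebesgue measure) let $$\hat u(\alpha,\eta)=(2\pi)^{-m/2}\int_{X}u(t,y)\,t^{-\alpha}e^{-i\langle y,\eta\rangle}\,dt\,dy,$$ and let $\mathcal F_X:L^2(X)\to L^2(\widehat X)$ be its unitary extension. Finally let $A=\{\alpha\in\widehat X:\widehat{\phi_H}(\alpha)\ne0\}$, and let $L^2(A)\subseteq L^2(\widehat X)$ be the subspace of functions vanishing a.e. off $A$. **Statement.** Let $H$ be a maximal abelian subgroup of $\mathrm{SU}(n,1)$.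 Then $H$ is conjugate to one of the standard groups $H_0$ above, and for every such description of $H$, with its base point $z_0$: 1. $\phi_H\in L^1(X)$; $R$ is a well-defined bounded operator $\mathcal H^2_\lambda\to L^2_{\chi_\lambda}$; $(RR^*f)^{\sim}=\tilde f*\phi_H$ for all $f\in L^2_{\chi_\lambda}$; $U_\lambda$ is a well-defined unitary operator of $\mathcal B_\lambda$ onto $\mathcal H^2_\lambda$; and the modified Fourier transform $\mathcal F f=\mathcal F_X\tilde f$ is a unitary operator of $\mathcal B_\lambda$ onto $L^2(A)$. 2. For every $H$-invariant symbol $\varphi\in L^\infty(\mathbb B^n)$ one has $\nu_\varphi\in L^1(X)$, and for every $\omega\in L^2(A)$ $$\bigl(\mathcal F\,U_\lambda^{-1}\,T_\varphi\,U_\lambda\,\mathcal F^{-1}\omega\bigr)(\alpha)=\frac{\widehat{\nu_\varphi}(\alpha)}{\widehat{\phi_H}(\alpha)}\,\omega(\alpha)\qquad\text{for almost every }\alpha\in A .$$ Since $\mathcal F U_\lambda^{-1}$ does not depend on $\varphi$, all Toeplitz operators with $H$-invariant symbols are simultaneously diagonalised; in particular $T_\varphi T_\psi=T_\psi T_\varphi$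 for all $H$-invariant $\varphi,\psi\in L^\infty(\mathbb B^n)$. -/

import Mathlib

open MeasureTheory Metric Filter Topology
open scoped ENNReal NNReal Matrix

noncomputable section

namespace BallToeplitz

/-! ### The group `SU(n,1)` and its action on the unit ball -/

/-- `ℂⁿ` with its Hermitian norm. -/
abbrev Cn (n : ℕ) := EuclideanSpace ℂ (Fin n)

/-- The open unit ball of `ℂⁿ`. -/
abbrev UnitBall (n : ℕ) := ball (0 : Cn n) 1

/-- The index set of `(n+1) × (n+1)` matrices; the last index is `Sum.inr ()`. -/
abbrev Ix (n : ℕ) := Fin n ⊕ Unit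

/-- The matrix `J_{n,1} = diag(-1, …, -1, 1)`. -/
def J (n : ℕ) : Matrix (Ix n) (Ix n) ℂ := Matrix.fromBlocks (-1) 0 0 1

/-- The group `SU(n,1)`: the matrices `A` of determinant one with `A J A* = J`. -/
def SU (n : ℕ) : Subgroup (Matrix.SpecialLinearGroup (Ix n) ℂ) where
  carrier := {A | A.1 * J n * A.1ᴴ = J n}
  one_mem' := by simp
  mul_mem' := by
    intro A B hA hB
    simp only [Set.mem_ofPred_eq, Matrix.SpecialLinearGroup.coe_mul,
      Matrix.conjTranspose_mul] at hA hB ⊢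
    calc A.1 * B.1 * J n * (B.1ᴴ * A.1ᴴ) = A.1 * (B.1 * J n * B.1ᴴ) * A.1ᴴ := by
          simp only [Matrix.mul_assoc]
      _ = J n := by rw [hB, hA]
  inv_mem' := by
    intro A hA
    simp only [Set.mem_ofPred_eq] at hA ⊢
    have h1 : (A⁻¹).1 * A.1 = 1 := by
      rw [← Matrix.SpecialLinearGroup.coe_mul, inv_mul_cancel, Matrix.SpecialLinearGroup.coe_one]
    have h2 : A.1ᴴ * ((A⁻¹).1)ᴴ = 1 := by
      rw [← Matrix.conjTranspose_mul, h1, Matrix.conjTranspose_one]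
    calc (A⁻¹).1 * J n * ((A⁻¹).1)ᴴ
        = (A⁻¹).1 * (A.1 * J n * A.1ᴴ) * ((A⁻¹).1)ᴴ := by rw [hA]
      _ = ((A⁻¹).1 * A.1) * J n * (A.1ᴴ * ((A⁻¹).1)ᴴ) := by simp only [Matrix.mul_assoc]
      _ = J n := by rw [h1, h2, Matrix.one_mul, Matrix.mul_one]

/-- The matrix of an element of `SU(n,1)`. -/
def mat {n : ℕ} (g : SU n) : Matrix (Ix n) (Ix n) ℂ := g.1.1

/-- The vector `(z, 1)`. -/
def hvec {n : ℕ} (z : Cn n) : Ix n → ℂ := Sum.elim z (fun _ => 1)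

/-- The denominator `wᵗ z + d` of the fractional linear map of a matrix with last row `(wᵗ, d)`. -/
def den {n : ℕ} (A : Matrix (Ix n) (Ix n) ℂ) (z : Cn n) : ℂ :=
  (A *ᵥ hvec z) (Sum.inr ())

/-- The fractional linear map `z ↦ (a z + v) / (wᵗ z + d)`. -/
def moeb {n : ℕ} (A : Matrix (Ix n) (Ix n) ℂ) (z : Cn n) : Cn n :=
  WithLp.toLp 2 (fun i => (A *ᵥ hvec z) (Sum.inl i) / den A z)

lemma mulVec_hvec {n : ℕ} (A : Matrix (Ix n) (Ix n) ℂ) (z : Cn n) (h : den A z ≠ 0) :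
    A *ᵥ hvec z = den A z • hvec (moeb A z) := by
  funext i
  rcases i with i | ⟨⟩
  · simp [hvec, moeb, mul_div_cancel₀ _ h]
  · simp [hvec, den]

lemma den_mul {n : ℕ} (A B : Matrix (Ix n) (Ix n) ℂ) (z : Cn n) (h : den B z ≠ 0) :
    den (A * B) z = den A (moeb B z) * den B z := by
  change ((A * B) *ᵥ hvec z) (Sum.inr ()) = (A *ᵥ hvec (moeb B z)) (Sum.inr ()) * den B z
  rw [← Matrix.mulVec_mulVec, mulVec_hvec B z h, Matrix.mulVec_smul, Pi.smul_apply,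
    smul_eq_mul, mul_comm]

lemma moeb_mul {n : ℕ} (A B : Matrix (Ix n) (Ix n) ℂ) (z : Cn n) (h : den B z ≠ 0) :
    moeb (A * B) z = moeb A (moeb B z) := by
  ext i
  change ((A * B) *ᵥ hvec z) (Sum.inl i) / den (A * B) z =
    (A *ᵥ hvec (moeb B z)) (Sum.inl i) / den A (moeb B z)
  rw [den_mul A B z h, ← Matrix.mulVec_mulVec, mulVec_hvec B z h, Matrix.mulVec_smul,
    Pi.smul_apply, smul_eq_mul, mul_comm (den A _), mul_div_mul_left _ _ h]

lemma den_one {n : ℕ} (z : Cn n) : den (1 : Matrix (Ix n) (Ix n) ℂ) z = 1 := by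
  simp [den, hvec]

lemma moeb_one {n : ℕ} (z : Cn n) : moeb (1 : Matrix (Ix n) (Ix n) ℂ) z = z := by
  ext i
  simp [moeb, den_one, hvec]

lemma form_eq {n : ℕ} (g : SU n) : (mat g)ᴴ * J n * (mat g) = J n := by
  have hJ : J n * J n = 1 := by
    simp [J, Matrix.fromBlocks_multiply]
  have h : (mat g) * J n * (mat g)ᴴ = J n := g.2
  have h1 : (mat g) * (J n * (mat g)ᴴ * J n) = 1 := by
    rw [← Matrix.mul_assoc, ← Matrix.mul_assoc, h, hJ]
  have h2 := mul_eq_one_comm.mp h1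
  calc (mat g)ᴴ * J n * (mat g) = (J n * J n) * (mat g)ᴴ * J n * (mat g) := by rw [hJ, Matrix.one_mul]
    _ = J n * (J n * (mat g)ᴴ * J n * (mat g)) := by simp only [Matrix.mul_assoc]
    _ = J n := by rw [h2, Matrix.mul_one]

lemma star_J {n : ℕ} (u : Ix n → ℂ) :
    star u ⬝ᵥ (J n *ᵥ u) = ((‖u (Sum.inr ())‖ ^ 2 - ∑ i, ‖u (Sum.inl i)‖ ^ 2 : ℝ) : ℂ) := by
  have : J n *ᵥ u = Sum.elim (fun i => - u (Sum.inl i)) (fun _ => u (Sum.inr ())) := by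
    rw [J, Matrix.fromBlocks_mulVec]
    funext i
    rcases i with i | ⟨⟩ <;> simp [Matrix.neg_mulVec]
  rw [this]
  simp only [dotProduct, Fintype.sum_sum_type]
  push_cast
  simp only [Sum.elim_inl, Sum.elim_inr, Pi.star_apply, mul_neg, Finset.sum_neg_distrib,
    Finset.univ_unique, Finset.sum_singleton, RCLike.star_def, Complex.conj_mul']
  rw [add_comm, ← sub_eq_add_neg]

lemma norm_form {n : ℕ} (g : SU n) (z : Cn n) :
    ‖den (mat g) z‖ ^ 2 - ∑ i, ‖((mat g) *ᵥ hvec z) (Sum.inl i)‖ ^ 2 = 1 - ‖z‖ ^ 2 := by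
  have h : star ((mat g) *ᵥ hvec z) ⬝ᵥ (J n *ᵥ ((mat g) *ᵥ hvec z)) =
      star (hvec z) ⬝ᵥ (J n *ᵥ hvec z) := by
    rw [Matrix.star_mulVec, ← Matrix.dotProduct_mulVec, Matrix.mulVec_mulVec,
      Matrix.mulVec_mulVec, form_eq]
  rw [star_J, star_J] at h
  have h' := Complex.ofReal_injective h
  simpa [hvec, EuclideanSpace.norm_sq_eq, den] using h'

lemma den_ne_zero {n : ℕ} (g : SU n) {z : Cn n} (hz : z ∈ UnitBall n) : den (mat g) z ≠ 0 := by
  intro h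
  have h1 := norm_form g z
  rw [h] at h1
  have h2 : ‖z‖ < 1 := by simpa using hz
  have h3 : 0 ≤ ∑ i, ‖((mat g) *ᵥ hvec z) (Sum.inl i)‖ ^ 2 :=
    Finset.sum_nonneg fun i _ => by positivity
  have h4 := norm_nonneg z
  simp only [norm_zero] at h1
  nlinarith

lemma moeb_mem {n : ℕ} (g : SU n) {z : Cn n} (hz : z ∈ UnitBall n) :
    moeb (mat g) z ∈ UnitBall n := by
  have h0 := den_ne_zero g hz
  have h1 := norm_form g z
  have h2 : ‖z‖ < 1 := by simpa using hz
  have h4 := norm_nonneg z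
  have h5 : ‖moeb (mat g) z‖ ^ 2 < 1 := by
    rw [EuclideanSpace.norm_sq_eq]
    simp only [moeb, norm_div, div_pow]
    rw [← Finset.sum_div, div_lt_one (by positivity)]
    nlinarith
  have h6 : ‖moeb (mat g) z‖ < 1 := by
    have := norm_nonneg (moeb (mat g) z)
    nlinarith
  simpa using h6

lemma mat_mul {n : ℕ} (g h : SU n) : mat (g * h) = (mat g) * (mat h) := by
  simp [mat]

lemma mat_one {n : ℕ} : mat (1 : SU n) = 1 := by simp [mat]

/-- The action of `SU(n,1)` on the unit ball by fractional linear maps. -/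
instance {n : ℕ} : MulAction (SU n) (UnitBall n) where
  smul g z := ⟨moeb (mat g) z.1, moeb_mem g z.2⟩
  one_smul z := Subtype.ext (by
    change moeb (mat (1 : SU n)) z.1 = z.1
    rw [mat_one, moeb_one])
  mul_smul g h z := Subtype.ext (by
    change moeb (mat (g * h)) z.1 = moeb (mat g) (moeb (mat h) z.1)
    rw [mat_mul, moeb_mul _ _ _ (den_ne_zero h z.2)])

lemma smul_coe {n : ℕ} (g : SU n) (z : UnitBall n) : ((g • z : UnitBall n) : Cn n) = moeb (mat g) z :=
  rfl

lemma continuous_den {n : ℕ} (A : Matrix (Ix n) (Ix n) ℂ) :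
    Continuous fun z : Cn n => den A z := by
  have h : Continuous fun z : Cn n => hvec z := by
    refine continuous_pi fun i => ?_
    rcases i with i | ⟨⟩
    · exact (continuous_apply i).comp (PiLp.continuous_ofLp 2 _)
    · exact continuous_const
  exact (continuous_apply (Sum.inr ())).comp (Continuous.matrix_mulVec continuous_const h)

lemma continuous_smul {n : ℕ} (g : SU n) : Continuous fun z : UnitBall n => g • z := by
  refine Continuous.subtype_mk ?_ _
  have h : Continuous fun z : UnitBall n => hvec (z : Cn n) := by
    refine continuous_pi fun i => ?_
    rcases i with i | ⟨⟩
    · exact (continuous_apply i).comp ((PiLp.continuous_ofLp 2 _).comp continuous_subtype_val)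
    · exact continuous_const
  refine (PiLp.continuous_toLp 2 _).comp (continuous_pi fun i => ?_)
  refine Continuous.div ?_ ((continuous_den (mat g)).comp continuous_subtype_val)
    fun z => den_ne_zero g z.2
  exact (continuous_apply (Sum.inl i)).comp (Continuous.matrix_mulVec continuous_const h)

/-! ### The universal covering group -/

/-- The universal covering group of `SU(n,1)`, realised as the group of pairs of an element
`g` of `SU(n,1)` and a continuous logarithm on the ball of its denominator `z ↦ wᵗ z + d`.
(The fundamental group of `SU(n,1)` is `ℤ`, detected on `K = S(U(n) × U(1))` by the
lower right entry `d`.) -/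
@[ext]
structure Cover (n : ℕ) where
  /-- the covered element of `SU(n,1)` -/
  proj : SU n
  /-- the logarithm of the denominator -/
  logDen : UnitBall n → ℂ
  continuous_logDen : Continuous logDen
  exp_logDen : ∀ z, Complex.exp (logDen z) = den (mat proj) z

namespace Cover

variable {n : ℕ}

instance : Mul (Cover n) where
  mul g h :=
    { proj := g.proj * h.proj
      logDen := fun z => g.logDen (h.proj • z) + h.logDen z
      continuous_logDen :=
        (g.continuous_logDen.comp (continuous_smul h.proj)).add h.continuous_logDen
      exp_logDen := fun z => by
        rw [Complex.exp_add, g.exp_logDen, h.exp_logDen, mat_mul,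
          den_mul _ _ _ (den_ne_zero h.proj z.2)]
        rfl }

instance : One (Cover n) where
  one :=
    { proj := 1
      logDen := fun _ => 0
      continuous_logDen := continuous_const
      exp_logDen := fun z => by rw [mat_one, den_one, Complex.exp_zero] }

instance : Inv (Cover n) where
  inv g :=
    { proj := g.proj⁻¹
      logDen := fun z => - g.logDen (g.proj⁻¹ • z)
      continuous_logDen := (g.continuous_logDen.comp (continuous_smul _)).neg
      exp_logDen := fun z => by
        have h : den (mat (g.proj * g.proj⁻¹)) (z : Cn n) = 1 := by
          rw [mul_inv_cancel, mat_one, den_one]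
        rw [mat_mul, den_mul _ _ _ (den_ne_zero _ z.2)] at h
        rw [Complex.exp_neg, g.exp_logDen]
        exact (eq_inv_of_mul_eq_one_right h).symm }

@[simp] lemma mul_proj (g h : Cover n) : (g * h).proj = g.proj * h.proj := rfl
@[simp] lemma mul_logDen (g h : Cover n) (z : UnitBall n) :
    (g * h).logDen z = g.logDen (h.proj • z) + h.logDen z := rfl
@[simp] lemma one_proj : (1 : Cover n).proj = 1 := rfl
@[simp] lemma one_logDen (z : UnitBall n) : (1 : Cover n).logDen z = 0 := rfl
@[simp] lemma inv_proj (g : Cover n) : (g⁻¹).proj = g.proj⁻¹ := rfl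
@[simp] lemma inv_logDen (g : Cover n) (z : UnitBall n) :
    (g⁻¹).logDen z = - g.logDen (g.proj⁻¹ • z) := rfl

instance : Group (Cover n) where
  mul_assoc a b c := by
    refine Cover.ext (mul_assoc _ _ _) (funext fun z => ?_)
    simp [mul_smul, add_assoc]
  one_mul a := by
    refine Cover.ext (one_mul _) (funext fun z => ?_)
    simp
  mul_one a := by
    refine Cover.ext (mul_one _) (funext fun z => ?_)
    simp
  inv_mul_cancel a := by
    refine Cover.ext (inv_mul_cancel _) (funext fun z => ?_)
    simp

/-- The covering map `p`. -/
def p : Cover n →* SU n where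
  toFun := Cover.proj
  map_one' := rfl
  map_mul' _ _ := rfl

/-- The covering group acts on the ball through `p`. -/
instance : MulAction (Cover n) (UnitBall n) := MulAction.compHom (UnitBall n) (p (n := n))

lemma smul_def (g : Cover n) (z : UnitBall n) : g • z = g.proj • z := rfl

/-- The cocycle `j_λ(g, z) = (wᵗ z + d)^{-λ}` on the covering group. -/
def j (lam : ℝ) (g : Cover n) (z : UnitBall n) : ℂ := Complex.exp (-(lam : ℂ) * g.logDen z)

lemma j_mul (lam : ℝ) (g h : Cover n) (z : UnitBall n) :
    j lam (g * h) z = j lam g (h • z) * j lam h z := by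
  rw [j, j, j, ← Complex.exp_add, mul_logDen, smul_def]
  congr 1
  ring

lemma den_eq (A : Matrix (Ix n) (Ix n) ℂ) (z : Cn n) :
    den A z = (∑ i, A (Sum.inr ()) (Sum.inl i) * z i) + A (Sum.inr ()) (Sum.inr ()) := by
  simp [den, hvec, Matrix.mulVec, dotProduct, Fintype.sum_sum_type]

/-- Every element of `SU(n,1)` has a lift. -/
lemma p_surjective : Function.Surjective (p (n := n)) := by
  intro g
  set d := mat g (Sum.inr ()) (Sum.inr ()) with hd
  set w : Cn n → ℂ := fun z => ∑ i, mat g (Sum.inr ()) (Sum.inl i) * z i with hw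
  have hden : ∀ z, den (mat g) z = w z + d := den_eq (mat g)
  have hd0 : d ≠ 0 := by
    have h := den_ne_zero g (z := 0) (by simp)
    rw [hden] at h
    simpa [hw] using h
  have hlt : ∀ z ∈ UnitBall n, ‖w z / d‖ < 1 := by
    intro z hz
    by_contra hcon
    rw [not_lt, norm_div, one_le_div (norm_pos_iff.mpr hd0)] at hcon
    have hwz : w z ≠ 0 := by
      intro h0
      rw [h0, norm_zero] at hcon
      exact hd0 (norm_le_zero_iff.mp hcon)
    have hc : ‖-d / w z‖ ≤ 1 := by
      rw [norm_div, norm_neg]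
      exact div_le_one_of_le₀ hcon (norm_nonneg _)
    refine den_ne_zero g (z := (-d / w z) • z) ?_ ?_
    · have hz' : ‖z‖ < 1 := by simpa using hz
      have : ‖(-d / w z) • z‖ < 1 := by
        rw [norm_smul]
        nlinarith [norm_nonneg z, norm_nonneg (-d / w z)]
      simpa using this
    · have : w ((-d / w z) • z) = (-d / w z) * w z := by
        simp only [hw, PiLp.smul_apply, smul_eq_mul, Finset.mul_sum]
        exact Finset.sum_congr rfl fun i _ => by ring
      rw [hden, this, div_mul_cancel₀ _ hwz, neg_add_cancel]
  have hslit : ∀ z ∈ UnitBall n, 1 + w z / d ∈ Complex.slitPlane := by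
    intro z hz
    left
    have h1 := (abs_le.mp (Complex.abs_re_le_norm (w z / d))).1
    have h2 := hlt z hz
    simp only [Complex.add_re, Complex.one_re]
    linarith
  have hwc : Continuous w := by
    have h : w = fun z => den (mat g) z - d := by
      funext z
      rw [hden, add_sub_cancel_right]
    rw [h]
    exact (continuous_den (mat g)).sub continuous_const
  refine ⟨⟨g, fun z => Complex.log d + Complex.log (1 + w z / d), ?_, fun z => ?_⟩, rfl⟩
  · refine continuous_const.add (Continuous.clog ?_ fun z => hslit z z.2)
    exact continuous_const.add ((hwc.comp continuous_subtype_val).div_const d)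
  · rw [Complex.exp_add, Complex.exp_log hd0,
      Complex.exp_log (Complex.slitPlane_ne_zero (hslit z z.2)), hden]
    field_simp
    ring

end Cover
/-! ### The weighted Bergman spaces -/

/-- The measure `dμ_λ = c_λ (1 - |z|²)^{λ-n-1} dv` on the ball, where `dv` is the normalised
Lebesgue measure on the ball and `c_λ = Γ(λ) / (n! Γ(λ-n))`. -/
def bergmanMeasure (n : ℕ) (lam : ℝ) : Measure (Cn n) :=
  (ProbabilityTheory.cond volume (UnitBall n)).withDensity fun z =>
    ENNReal.ofReal (Real.Gamma lam / (n.factorial * Real.Gamma (lam - n)) *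
      (1 - ‖z‖ ^ 2) ^ (lam - n - 1))

/-- `L²(𝔹ⁿ, μ_λ)`. -/
abbrev L2Ball (n : ℕ) (lam : ℝ) := Lp ℂ 2 (bergmanMeasure n lam)

/-- The weighted Bergman space: the classes in `L²(𝔹ⁿ, μ_λ)` of functions holomorphic on the
ball. -/
def bergman (n : ℕ) (lam : ℝ) : Submodule ℂ (L2Ball n lam) where
  carrier := {f | ∃ F : Cn n → ℂ, DifferentiableOn ℂ F (UnitBall n) ∧
    f =ᵐ[bergmanMeasure n lam] F}
  zero_mem' := ⟨0, differentiableOn_const _, Lp.coeFn_zero _ _ _⟩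
  add_mem' := by
    rintro f g ⟨F, hF, hf⟩ ⟨G, hG, hg⟩
    exact ⟨F + G, hF.add hG, (Lp.coeFn_add f g).trans (hf.add hg)⟩
  smul_mem' := by
    rintro c f ⟨F, hF, hf⟩
    exact ⟨c • F, hF.const_smul c, (Lp.coeFn_smul c f).trans (hf.const_smul c)⟩

/-- The sub-mean value property over balls. -/
lemma sub_mean_value {n : ℕ} {F : Cn n → ℂ} (hF : DifferentiableOn ℂ F (UnitBall n)) {z : Cn n}
    {r : ℝ} (hz : ball z r ⊆ UnitBall n) :
    ‖F z‖ₑ * volume (ball z r) ≤ ∫⁻ u in ball z r, ‖F u‖ₑ := by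
  classical
  set G : Cn n → ℂ := (UnitBall n).piecewise F (fun _ => 0) with hG
  have hGm : Measurable G :=
    hF.continuousOn.measurable_piecewise continuousOn_const isOpen_ball.measurableSet
  have hGF : ∀ u ∈ UnitBall n, G u = F u := fun u hu => Set.piecewise_eq_of_mem _ _ _ hu
  have htr : ∀ c : ℂ, ‖c‖ = 1 →
      ∫⁻ u in ball (0 : Cn n) r, ‖G (z + c • u)‖ₑ = ∫⁻ u in ball z r, ‖F u‖ₑ := by
    intro c hc
    have hc0 : c ≠ 0 := by
      rintro rfl
      simp at hc
    let e : Cn n ≃ₗᵢ[ℝ] Cn n :=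
      ⟨(LinearEquiv.smulOfNeZero ℂ (Cn n) c hc0).restrictScalars ℝ, fun x => by
        simp [norm_smul, hc]⟩
    have he : ∀ x, e x = c • x := fun x => rfl
    have hmp := (measurePreserving_add_left (volume : Measure (Cn n)) z).comp e.measurePreserving
    have h1 := hmp.setLIntegral_comp_preimage (s := ball z r) isOpen_ball.measurableSet
      (f := fun u => ‖G u‖ₑ) hGm.enorm
    have hpre : ((fun x => z + x) ∘ e) ⁻¹' ball z r = ball (0 : Cn n) r := by
      ext u
      simp [he, norm_smul, hc]
    rw [hpre] at h1
    calc ∫⁻ u in ball (0 : Cn n) r, ‖G (z + c • u)‖ₑ = ∫⁻ u in ball z r, ‖G u‖ₑ := h1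
      _ = ∫⁻ u in ball z r, ‖F u‖ₑ :=
        setLIntegral_congr_fun isOpen_ball.measurableSet fun u hu => by
          simp only [hGF u (hz hu)]
  have havg : ∀ u ∈ ball (0 : Cn n) r,
      ENNReal.ofReal (2 * Real.pi) * ‖F z‖ₑ ≤
        ∫⁻ θ in Set.Ioc 0 (2 * Real.pi), ‖G (z + circleMap 0 1 θ • u)‖ₑ := by
    intro u hu
    have hmem : ∀ c : ℂ, ‖c‖ ≤ 1 → z + c • u ∈ UnitBall n := by
      intro c hc
      apply hz
      have hu' : ‖u‖ < r := by simpa using hu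
      have : ‖c • u‖ < r := by
        rw [norm_smul]
        nlinarith [norm_nonneg u, norm_nonneg c]
      simpa using this
    have hdiff : DiffContOnCl ℂ (fun c : ℂ => F (z + c • u)) (ball 0 |1|) := by
      have hd : DifferentiableOn ℂ (fun c : ℂ => F (z + c • u)) (closedBall 0 1) := by
        refine hF.comp (by fun_prop) fun c hc => hmem c (by simpa using hc)
      rw [abs_one]
      refine DifferentiableOn.diffContOnCl ?_
      rwa [closure_ball _ one_ne_zero]
    have hca := hdiff.circleAverage
    rw [Real.circleAverage_def] at hca
    simp only [zero_smul, add_zero] at hca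
    have h2 : ∫ θ in (0 : ℝ)..2 * Real.pi, F (z + circleMap 0 1 θ • u) =
        (2 * Real.pi) • F z := by
      rw [← hca, smul_smul, mul_inv_cancel₀ (by positivity), one_smul]
    rw [intervalIntegral.integral_of_le (by positivity)] at h2
    have h3 : ‖(2 * Real.pi) • F z‖ₑ = ENNReal.ofReal (2 * Real.pi) * ‖F z‖ₑ := by
      rw [enorm_smul, Real.enorm_eq_ofReal (by positivity)]
    rw [← h3, ← h2]
    refine (enorm_integral_le_lintegral_enorm _).trans (le_of_eq ?_)
    refine lintegral_congr fun θ => ?_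
    rw [hGF _ (hmem _ (by simp))]
  have hvol : volume (ball z r) = volume (ball (0 : Cn n) r) :=
    Measure.addHaar_ball_center _ _ _
  have hpi0 : ENNReal.ofReal (2 * Real.pi) ≠ 0 := by
    simp [Real.pi_pos]
  have key : ENNReal.ofReal (2 * Real.pi) * (‖F z‖ₑ * volume (ball z r)) ≤
      ENNReal.ofReal (2 * Real.pi) * ∫⁻ u in ball z r, ‖F u‖ₑ := by
    calc ENNReal.ofReal (2 * Real.pi) * (‖F z‖ₑ * volume (ball z r))
        = ∫⁻ _ in ball (0 : Cn n) r, ENNReal.ofReal (2 * Real.pi) * ‖F z‖ₑ := by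
          rw [setLIntegral_const, hvol, mul_assoc]
      _ ≤ ∫⁻ u in ball (0 : Cn n) r,
            ∫⁻ θ in Set.Ioc 0 (2 * Real.pi), ‖G (z + circleMap 0 1 θ • u)‖ₑ :=
          setLIntegral_mono' isOpen_ball.measurableSet havg
      _ = ∫⁻ θ in Set.Ioc 0 (2 * Real.pi),
            ∫⁻ u in ball (0 : Cn n) r, ‖G (z + circleMap 0 1 θ • u)‖ₑ := by
          refine lintegral_lintegral_swap (Measurable.aemeasurable ?_)
          refine (hGm.comp ?_).enorm
          exact (Continuous.measurable (by fun_prop))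
      _ = ∫⁻ _ in Set.Ioc 0 (2 * Real.pi), ∫⁻ u in ball z r, ‖F u‖ₑ :=
          lintegral_congr fun θ => htr _ (by simp)
      _ = ENNReal.ofReal (2 * Real.pi) * ∫⁻ u in ball z r, ‖F u‖ₑ := by
          rw [setLIntegral_const, Real.volume_Ioc, sub_zero, mul_comm]
  exact (ENNReal.mul_le_mul_iff_right hpi0 ENNReal.ofReal_ne_top).mp key

/-- Lebesgue measure on a smaller ball is dominated by `μ_λ`. -/
lemma volume_restrict_le {n : ℕ} {lam : ℝ}
    (hc : 0 < Real.Gamma lam / (n.factorial * Real.Gamma (lam - n))) {ρ : ℝ} (hρ : ρ < 1) :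
    ∃ C : ℝ≥0, (volume : Measure (Cn n)).restrict (ball 0 ρ) ≤ C • bergmanMeasure n lam := by
  rcases le_or_gt ρ 0 with h0 | h0
  · exact ⟨0, by simp [ball_eq_empty.mpr h0]⟩
  set c := Real.Gamma lam / (n.factorial * Real.Gamma (lam - n)) with hcdef
  set t := 1 - ρ ^ 2 with ht
  have ht0 : 0 < t := by nlinarith
  have ht1 : t ≤ 1 := by nlinarith [sq_nonneg ρ]
  set δ := c * min 1 (t ^ (lam - n - 1)) with hδ
  have hδ0 : 0 < δ := mul_pos hc (lt_min one_pos (Real.rpow_pos_of_pos ht0 _))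
  have hdens : ∀ z ∈ ball (0 : Cn n) ρ, δ ≤ c * (1 - ‖z‖ ^ 2) ^ (lam - n - 1) := by
    intro z hz
    have hz' : ‖z‖ < ρ := by simpa using hz
    have h1 : t ≤ 1 - ‖z‖ ^ 2 := by nlinarith [norm_nonneg z]
    have h2 : 1 - ‖z‖ ^ 2 ≤ 1 := by nlinarith [norm_nonneg z]
    refine mul_le_mul_of_nonneg_left ?_ hc.le
    rcases le_or_gt 0 (lam - n - 1) with hs | hs
    · exact (min_le_right _ _).trans (Real.rpow_le_rpow ht0.le h1 hs)
    · exact (min_le_left _ _).trans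
        (Real.one_le_rpow_of_pos_of_le_one_of_nonpos (ht0.trans_le h1) h2 hs.le)
  set V := volume (UnitBall n) with hV
  have hV0 : V ≠ 0 := (measure_ball_pos volume _ one_pos).ne'
  have hVt : V ≠ ∞ := measure_ball_lt_top.ne
  have hδe0 : ENNReal.ofReal δ ≠ 0 := by simpa using hδ0
  refine ⟨(V / ENNReal.ofReal δ).toNNReal, Measure.le_iff.mpr fun S hS => ?_⟩
  rw [Measure.smul_apply, Measure.restrict_apply hS]
  have hCt : V / ENNReal.ofReal δ ≠ ∞ := ENNReal.div_ne_top hVt hδe0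
  have hm : MeasurableSet (S ∩ ball (0 : Cn n) ρ) := hS.inter isOpen_ball.measurableSet
  have h1 : ENNReal.ofReal δ * (V⁻¹ * volume (S ∩ ball (0 : Cn n) ρ)) ≤
      bergmanMeasure n lam S := by
    calc ENNReal.ofReal δ * (V⁻¹ * volume (S ∩ ball (0 : Cn n) ρ))
        = ∫⁻ _ in S ∩ ball (0 : Cn n) ρ, ENNReal.ofReal δ
            ∂(ProbabilityTheory.cond volume (UnitBall n)) := by
          rw [setLIntegral_const, ProbabilityTheory.cond_apply isOpen_ball.measurableSet]
          congr 3
          symm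
          apply Set.inter_eq_right.mpr
          exact Set.inter_subset_right.trans (ball_subset_ball hρ.le)
      _ ≤ ∫⁻ z in S ∩ ball (0 : Cn n) ρ, ENNReal.ofReal (c * (1 - ‖z‖ ^ 2) ^ (lam - n - 1))
            ∂(ProbabilityTheory.cond volume (UnitBall n)) :=
          setLIntegral_mono' hm fun z hz => ENNReal.ofReal_le_ofReal (hdens z hz.2)
      _ = bergmanMeasure n lam (S ∩ ball (0 : Cn n) ρ) := (withDensity_apply _ hm).symm
      _ ≤ bergmanMeasure n lam S := measure_mono Set.inter_subset_left
  calc volume (S ∩ ball (0 : Cn n) ρ)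
      = V / ENNReal.ofReal δ *
          (ENNReal.ofReal δ * (V⁻¹ * volume (S ∩ ball (0 : Cn n) ρ))) := by
        rw [← mul_assoc, ENNReal.div_mul_cancel hδe0 ENNReal.ofReal_ne_top, ← mul_assoc,
          ENNReal.mul_inv_cancel hV0 hVt, one_mul]
    _ ≤ V / ENNReal.ofReal δ * bergmanMeasure n lam S := by gcongr
    _ = (V / ENNReal.ofReal δ).toNNReal • bergmanMeasure n lam S := by
        rw [ENNReal.smul_def, ENNReal.coe_toNNReal hCt, smul_eq_mul]

/-- Point evaluations are locally uniformly bounded. -/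
lemma eval_bound {n : ℕ} {lam : ℝ}
    (hc : 0 < Real.Gamma lam / (n.factorial * Real.Gamma (lam - n))) {ρ : ℝ} (hρ : ρ < 1) :
    ∃ C : ℝ≥0, ∀ F : Cn n → ℂ, DifferentiableOn ℂ F (UnitBall n) → ∀ z ∈ ball (0 : Cn n) ρ,
      ‖F z‖ₑ ≤ C * eLpNorm F 2 (bergmanMeasure n lam) := by
  obtain ⟨C, hC⟩ := volume_restrict_le (n := n) hc (ρ := (1 + ρ) / 2) (by linarith)
  set r := (1 - ρ) / 2 with hr
  have hr0 : 0 < r := by simp only [hr]; linarith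
  set V := volume (ball (0 : Cn n) r) with hV
  have hV0 : V ≠ 0 := (measure_ball_pos volume _ hr0).ne'
  have hVt : V ≠ ∞ := measure_ball_lt_top.ne
  have hK : V⁻¹ * ((C : ℝ≥0∞) ^ (1 / (2 : ℝ≥0∞)).toReal * V ^ (1 / 2 : ℝ)) ≠ ∞ := by
    refine ENNReal.mul_ne_top (ENNReal.inv_ne_top.mpr hV0) (ENNReal.mul_ne_top ?_ ?_)
    · exact ENNReal.rpow_ne_top_of_nonneg (by positivity) ENNReal.coe_ne_top
    · exact ENNReal.rpow_ne_top_of_nonneg (by positivity) hVt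
  refine ⟨(V⁻¹ * ((C : ℝ≥0∞) ^ (1 / (2 : ℝ≥0∞)).toReal * V ^ (1 / 2 : ℝ))).toNNReal,
    fun F hF z hz => ?_⟩
  · have hz' : ‖z‖ < ρ := by simpa using hz
    have hsub : ball z r ⊆ ball (0 : Cn n) ((1 + ρ) / 2) := by
      apply ball_subset_ball'
      simp only [dist_zero_right, hr]
      linarith
    have hsub1 : ball z r ⊆ UnitBall n := hsub.trans (ball_subset_ball (by linarith))
    have h1 := sub_mean_value hF hsub1
    have hmeas : AEStronglyMeasurable F (volume.restrict (ball z r)) :=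
      (hF.continuousOn.mono hsub1).aestronglyMeasurable isOpen_ball.measurableSet
    have h2 := eLpNorm_le_eLpNorm_mul_rpow_measure_univ (p := 1) (q := 2) (by norm_num) hmeas
    have hvol : volume (ball z r) = V := Measure.addHaar_ball_center _ _ _
    rw [eLpNorm_one_eq_lintegral_enorm, Measure.restrict_apply_univ, hvol] at h2
    have h3 : eLpNorm F 2 (volume.restrict (ball z r)) ≤
        (C : ℝ≥0∞) ^ (1 / (2 : ℝ≥0∞)).toReal * eLpNorm F 2 (bergmanMeasure n lam) := by
      have h4 : (volume : Measure (Cn n)).restrict (ball z r) ≤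
          (C : ℝ≥0∞) • bergmanMeasure n lam :=
        (Measure.restrict_mono hsub le_rfl).trans hC
      refine (eLpNorm_mono_measure F h4).trans (le_of_eq ?_)
      rw [eLpNorm_smul_measure_of_ne_top (by norm_num), smul_eq_mul]
    have h5 : (1 / (1 : ℝ≥0∞).toReal - 1 / (2 : ℝ≥0∞).toReal : ℝ) = 1 / 2 := by norm_num
    rw [h5] at h2
    rw [hvol] at h1
    calc ‖F z‖ₑ = V⁻¹ * (‖F z‖ₑ * V) := by
          rw [mul_comm ‖F z‖ₑ, ← mul_assoc, ENNReal.inv_mul_cancel hV0 hVt, one_mul]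
      _ ≤ V⁻¹ * (((C : ℝ≥0∞) ^ (1 / (2 : ℝ≥0∞)).toReal *
            eLpNorm F 2 (bergmanMeasure n lam)) * V ^ (1 / 2 : ℝ)) := by
          exact mul_le_mul' le_rfl (h1.trans (h2.trans (mul_le_mul' h3 le_rfl)))
      _ = ((V⁻¹ * ((C : ℝ≥0∞) ^ (1 / (2 : ℝ≥0∞)).toReal * V ^ (1 / 2 : ℝ))).toNNReal : ℝ≥0∞) *
            eLpNorm F 2 (bergmanMeasure n lam) := by
          rw [ENNReal.coe_toNNReal hK]
          ring

/-- A locally uniform limit of holomorphic functions on the ball is holomorphic. -/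
lemma differentiableOn_of_cauchy {n : ℕ} {F : ℕ → Cn n → ℂ} {G : Cn n → ℂ}
    (hF : ∀ k, DifferentiableOn ℂ (F k) (UnitBall n))
    (hG : ∀ z ∈ UnitBall n, Tendsto (fun k => F k z) atTop (𝓝 (G z)))
    (hC : ∀ ρ < 1, ∀ ε > 0, ∃ N, ∀ k ≥ N, ∀ l ≥ N, ∀ z ∈ ball (0 : Cn n) ρ,
      ‖F k z - F l z‖ ≤ ε) :
    DifferentiableOn ℂ G (UnitBall n) := by
  have hbound : ∀ ρ < 1, ∀ ε > 0, ∃ N, ∀ k ≥ N, ∀ l ≥ N, ∀ z ∈ ball (0 : Cn n) ρ,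
      ‖fderiv ℂ (F k) z - fderiv ℂ (F l) z‖ ≤ ε := by
    intro ρ hρ ε hε
    set r := (1 - ρ) / 4 with hr
    have hr0 : 0 < r := by simp only [hr]; linarith
    obtain ⟨N, hN⟩ := hC ((1 + ρ) / 2) (by linarith) (ε * r) (by positivity)
    refine ⟨N, fun k hk l hl z hz => ?_⟩
    have hz' : ‖z‖ < ρ := by simpa using hz
    have hz1 : z ∈ UnitBall n := by
      have : ‖z‖ < 1 := by linarith
      simpa using this
    have hdk := (hF k).differentiableAt (isOpen_ball.mem_nhds hz1)
    have hdl := (hF l).differentiableAt (isOpen_ball.mem_nhds hz1)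
    rw [← fderiv_sub hdk hdl]
    have hmem : ∀ w : Cn n, ‖w‖ ≤ r → z + w ∈ ball (0 : Cn n) ((1 + ρ) / 2) := by
      intro w hw
      have : ‖z + w‖ < (1 + ρ) / 2 := by
        refine (norm_add_le _ _).trans_lt ?_
        simp only [hr] at hw
        linarith
      simpa using this
    refine ContinuousLinearMap.opNorm_le_bound _ hε.le fun v => ?_
    rcases eq_or_ne v 0 with rfl | hv
    · simp
    have hv0 : 0 < ‖v‖ := norm_pos_iff.mpr hv
    set R := r / ‖v‖ with hR
    have hR0 : 0 < R := by positivity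
    have hsmall : ∀ c : ℂ, ‖c‖ ≤ R → ‖c • v‖ ≤ r := by
      intro c hc
      rw [norm_smul]
      calc ‖c‖ * ‖v‖ ≤ R * ‖v‖ := by gcongr
        _ = r := by simp only [hR]; field_simp
    have hD : ∀ c : ℂ, ‖c‖ ≤ R →
        DifferentiableAt ℂ (fun w => F k w - F l w) (z + c • v) := by
      intro c hc
      have hm := ball_subset_ball (by linarith : (1 + ρ) / 2 ≤ 1) (hmem _ (hsmall c hc))
      exact ((hF k).differentiableAt (isOpen_ball.mem_nhds hm)).sub
        ((hF l).differentiableAt (isOpen_ball.mem_nhds hm))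
    have hline : DiffContOnCl ℂ (fun c : ℂ => F k (z + c • v) - F l (z + c • v)) (ball 0 R) := by
      refine DifferentiableOn.diffContOnCl fun c hc => ?_
      rw [closure_ball _ hR0.ne'] at hc
      refine DifferentiableAt.differentiableWithinAt ?_
      have := (hD c (by simpa using hc)).comp c
        (f := fun c : ℂ => z + c • v) (by fun_prop)
      exact this
    have hder := Complex.norm_deriv_le_of_forall_mem_sphere_norm_le hR0 hline
      (C := ε * r) fun c hc => by
        have hc' : ‖c‖ = R := by simpa using hc
        exact hN k hk l hl _ (hmem _ (hsmall c hc'.le))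
    have heq : deriv (fun c : ℂ => F k (z + c • v) - F l (z + c • v)) 0 =
        fderiv ℂ (F k - F l) z v := by
      have h0 := hD 0 (by simpa using hR0.le)
      rw [zero_smul, add_zero] at h0
      have h1 : HasFDerivAt (fun w => F k w - F l w) (fderiv ℂ (F k - F l) z)
          (z + (0 : ℂ) • v) := by
        rw [zero_smul, add_zero]
        exact h0.hasFDerivAt
      have h2 : HasDerivAt (fun c : ℂ => z + c • v) v 0 := by
        simpa using ((hasDerivAt_id (0 : ℂ)).smul_const v).const_add z
      exact (h1.comp_hasDerivAt (0 : ℂ) h2).deriv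
    rw [heq] at hder
    refine hder.trans (le_of_eq ?_)
    simp only [hR]
    field_simp
  -- the pointwise limit of the derivatives
  have hlim : ∀ z, ∃ L : Cn n →L[ℂ] ℂ, z ∈ UnitBall n →
      Tendsto (fun k => fderiv ℂ (F k) z) atTop (𝓝 L) := by
    intro z
    by_cases hz : z ∈ UnitBall n
    · have hz' : ‖z‖ < 1 := by simpa using hz
      have hcs : CauchySeq fun k => fderiv ℂ (F k) z := by
        refine Metric.cauchySeq_iff.mpr fun ε hε => ?_
        obtain ⟨N, hN⟩ := hbound ((1 + ‖z‖) / 2) (by linarith) (ε / 2) (by positivity)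
        refine ⟨N, fun k hk l hl => ?_⟩
        rw [dist_eq_norm]
        have hm : z ∈ ball (0 : Cn n) ((1 + ‖z‖) / 2) := by
          have : ‖z‖ < (1 + ‖z‖) / 2 := by linarith
          simpa using this
        exact (hN k hk l hl z hm).trans_lt (by linarith)
      obtain ⟨L, hL⟩ := cauchySeq_tendsto_of_complete hcs
      exact ⟨L, fun _ => hL⟩
    · exact ⟨0, fun h => absurd h hz⟩
  choose G' hG' using hlim
  have hunif : TendstoLocallyUniformlyOn (fun k z => fderiv ℂ (F k) z) G' atTop (UnitBall n) := by
    refine tendstoLocallyUniformlyOn_of_forall_exists_nhds fun z hz => ?_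
    have hz' : ‖z‖ < 1 := by simpa using hz
    have hm : z ∈ ball (0 : Cn n) ((1 + ‖z‖) / 2) := by
      have : ‖z‖ < (1 + ‖z‖) / 2 := by linarith
      simpa using this
    refine ⟨ball 0 ((1 + ‖z‖) / 2), mem_nhdsWithin_of_mem_nhds (isOpen_ball.mem_nhds hm), ?_⟩
    refine UniformCauchySeqOn.tendstoUniformlyOn_of_tendsto ?_ fun w hw =>
      hG' w (ball_subset_ball (by linarith) hw)
    refine Metric.uniformCauchySeqOn_iff.mpr fun ε hε => ?_
    obtain ⟨N, hN⟩ := hbound ((1 + ‖z‖) / 2) (by linarith) (ε / 2) (by positivity)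
    refine ⟨N, fun k hk l hl w hw => ?_⟩
    rw [dist_eq_norm]
    exact (hN k hk l hl w hw).trans_lt (by linarith)
  intro z hz
  have h := hasFDerivAt_of_tendstoLocallyUniformlyOn isOpen_ball hunif
    (fun k w hw => ((hF k).differentiableAt (isOpen_ball.mem_nhds hw)).hasFDerivAt) hG hz
  exact h.differentiableAt.differentiableWithinAt

/-- The weighted Bergman space is closed in `L²`. -/
lemma isClosed_bergman (n : ℕ) (lam : ℝ) : IsClosed (bergman n lam : Set (L2Ball n lam)) := by
  have hball : ∀ᵐ z ∂bergmanMeasure n lam, z ∈ UnitBall n :=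
    (withDensity_absolutelyContinuous _ _).ae_le
      (ProbabilityTheory.ae_cond_mem isOpen_ball.measurableSet)
  rcases lt_or_ge 0 (Real.Gamma lam / (n.factorial * Real.Gamma (lam - n))) with hc | hc
  swap
  · have hzero : bergmanMeasure n lam = 0 := by
      rw [bergmanMeasure, ← withDensity_zero]
      refine withDensity_congr_ae ?_
      filter_upwards [ProbabilityTheory.ae_cond_mem (μ := (volume : Measure (Cn n)))
        (s := UnitBall n) isOpen_ball.measurableSet] with z hz
      have hz' : ‖z‖ < 1 := by simpa using hz
      have h1 : 0 ≤ 1 - ‖z‖ ^ 2 := by nlinarith [norm_nonneg z]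
      exact ENNReal.ofReal_of_nonpos
        (mul_nonpos_of_nonpos_of_nonneg hc (Real.rpow_nonneg h1 _))
    have huniv : (bergman n lam : Set (L2Ball n lam)) = Set.univ := by
      refine Set.eq_univ_of_forall fun f => ⟨0, differentiableOn_const _, ?_⟩
      have h0 : ae (bergmanMeasure n lam) = ⊥ := by rw [hzero, ae_zero]
      rw [Filter.EventuallyEq, h0]
      exact eventually_bot
    rw [huniv]
    exact isClosed_univ
  refine IsSeqClosed.isClosed fun f g hf hfg => ?_
  choose F hF hfF using hf
  have hcau := hfg.cauchySeq
  have hC : ∀ ρ < 1, ∀ ε > 0, ∃ N, ∀ k ≥ N, ∀ l ≥ N, ∀ z ∈ ball (0 : Cn n) ρ,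
      ‖F k z - F l z‖ ≤ ε := by
    intro ρ hρ ε hε
    obtain ⟨C, hC⟩ := eval_bound (n := n) hc hρ
    obtain ⟨N, hN⟩ := Metric.cauchySeq_iff.mp hcau (ε / (C + 1)) (by positivity)
    refine ⟨N, fun k hk l hl z hz => ?_⟩
    have h1 := hC (F k - F l) ((hF k).sub (hF l)) z hz
    have h2 : eLpNorm (F k - F l) 2 (bergmanMeasure n lam) = ENNReal.ofReal ‖f k - f l‖ := by
      rw [Lp.norm_def, ENNReal.ofReal_toReal (Lp.eLpNorm_ne_top _)]
      refine eLpNorm_congr_ae ?_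
      filter_upwards [Lp.coeFn_sub (f k) (f l), hfF k, hfF l] with w h1 h2 h3
      rw [h1, Pi.sub_apply, Pi.sub_apply, h2, h3]
    have h3 := hN k hk l hl
    rw [dist_eq_norm] at h3
    rw [h2, ← ofReal_norm, ← ENNReal.ofReal_coe_nnreal, ← ENNReal.ofReal_mul C.coe_nonneg,
      ENNReal.ofReal_le_ofReal_iff (by positivity)] at h1
    calc ‖F k z - F l z‖ ≤ C * ‖f k - f l‖ := h1
      _ ≤ C * (ε / (C + 1)) := by gcongr
      _ ≤ ε := by
        rw [mul_div_assoc', div_le_iff₀ (by positivity)]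
        nlinarith [C.2]
  have hex : ∀ z, ∃ y : ℂ, z ∈ UnitBall n → Tendsto (fun k => F k z) atTop (𝓝 y) := by
    intro z
    by_cases hz : z ∈ UnitBall n
    · have hz' : ‖z‖ < 1 := by simpa using hz
      have hcs : CauchySeq fun k => F k z := by
        refine Metric.cauchySeq_iff.mpr fun ε hε => ?_
        obtain ⟨N, hN⟩ := hC ((1 + ‖z‖) / 2) (by linarith) (ε / 2) (by positivity)
        refine ⟨N, fun k hk l hl => ?_⟩
        rw [dist_eq_norm]
        have hm : z ∈ ball (0 : Cn n) ((1 + ‖z‖) / 2) := by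
          have : ‖z‖ < (1 + ‖z‖) / 2 := by linarith
          simpa using this
        exact (hN k hk l hl z hm).trans_lt (by linarith)
      obtain ⟨L, hL⟩ := cauchySeq_tendsto_of_complete hcs
      exact ⟨L, fun _ => hL⟩
    · exact ⟨0, fun h => absurd h hz⟩
  choose G hG using hex
  refine ⟨G, differentiableOn_of_cauchy hF hG hC, ?_⟩
  obtain ⟨ns, hns, hae⟩ := (tendstoInMeasure_of_tendsto_Lp hfg).exists_seq_tendsto_ae
  have hall : ∀ᵐ z ∂bergmanMeasure n lam, ∀ k, f k z = F k z := ae_all_iff.mpr hfF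
  filter_upwards [hae, hall, hball] with z h1 h2 h3
  refine tendsto_nhds_unique h1 ?_
  have h4 := (hG z h3).comp hns.tendsto_atTop
  refine h4.congr fun k => ?_
  simp [h2]

instance (n : ℕ) (lam : ℝ) : CompleteSpace (bergman n lam) :=
  (isClosed_bergman n lam).completeSpace_coe


/-- The holomorphic representative on the ball of an element of the Bergman space. -/
def holo {n : ℕ} {lam : ℝ} (f : bergman n lam) : Cn n → ℂ := f.2.choose

lemma holo_spec {n : ℕ} {lam : ℝ} (f : bergman n lam) :
    DifferentiableOn ℂ (holo f) (UnitBall n) ∧ f.1 =ᵐ[bergmanMeasure n lam] holo f :=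
  f.2.choose_spec

/-- The Bergman projection `P_λ`, the orthogonal projection of `L²(𝔹ⁿ, μ_λ)` onto the Bergman
space. -/
def bergmanProj (n : ℕ) (lam : ℝ) : L2Ball n lam →L[ℂ] bergman n lam :=
  (bergman n lam).orthogonalProjectionOnto

/-- Multiplication `M_φ` by a bounded symbol, on `L²(𝔹ⁿ, μ_λ)`. -/
def mulOp {n : ℕ} {lam : ℝ} (φ : Lp ℂ ∞ (bergmanMeasure n lam)) : L2Ball n lam →L[ℂ] L2Ball n lam :=
  (ContinuousLinearMap.mul ℂ ℂ).holderL (bergmanMeasure n lam) ∞ 2 2 φ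

lemma mulOp_ae {n : ℕ} {lam : ℝ} (φ : Lp ℂ ∞ (bergmanMeasure n lam)) (f : L2Ball n lam) :
    mulOp φ f =ᵐ[bergmanMeasure n lam] fun z => φ z * f z :=
  (ContinuousLinearMap.mul ℂ ℂ).coeFn_holder _ _

/-- The Toeplitz operator `T_φ f = P_λ (φ f)` on the Bergman space. -/
def toeplitz {n : ℕ} {lam : ℝ} (φ : Lp ℂ ∞ (bergmanMeasure n lam)) :
    bergman n lam →L[ℂ] bergman n lam :=
  bergmanProj n lam ∘L mulOp φ ∘L (bergman n lam).subtypeL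

/-- The reproducing kernel `K_λ(z, w) = (1 - ⟨z, w⟩)^{-λ}`, where `⟨z, w⟩ = ∑ zᵢ w̄ᵢ`. -/
def bergmanKernel {n : ℕ} (lam : ℝ) (z w : Cn n) : ℂ := (1 - inner ℂ w z) ^ (-(lam : ℂ))

/-! ### The maximal abelian subgroups -/

/-- The standard maximal abelian subgroups of `SU(n,1)`: quasi-elliptic, quasi-hyperbolic, and
(with `k` compact directions) the family made of the nilpotent (`k = 0`), the quasi-nilpotent
(`1 ≤ k ≤ n - 2`) and the quasi-parabolic (`k = n - 1`) ones. The equivalence `e` labels the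
coordinates of `ℂⁿ`. -/
inductive Model (n : ℕ) : Type
  | elliptic : Model n
  | hyperbolic (k : ℕ) (e : (Fin k ⊕ Unit) ≃ Fin n) : Model n
  | nilpotent (k l : ℕ) (e : (Fin k ⊕ Fin l ⊕ Unit) ≃ Fin n) : Model n

namespace Model

variable {n : ℕ}

/-- The number of circle factors of `H / H_{z₀}`. -/
def tor : Model n → ℕ
  | elliptic => n
  | hyperbolic k _ => k
  | nilpotent k _ _ => k

/-- The number of real line factors of `H / H_{z₀}`. -/
def dim : Model n → ℕ
  | elliptic => 0
  | hyperbolic _ _ => 1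
  | nilpotent _ l _ => l + 1

/-- The group `𝕋ᵏ × ℝᵐ`, with which `H / H_{z₀}` is identified. It carries the product of the
normalised Haar measure of the torus and of Lebesgue measure. -/
abbrev X (M : Model n) : Type :=
  UnitAddTorus (Fin M.tor) × EuclideanSpace ℝ (Fin M.dim)

/-- The quasi-hyperbolic matrices. -/
def hypCore {k : ℕ} (t : Fin k → ℂ) (s : ℝ) :
    Matrix ((Fin k ⊕ Unit) ⊕ Unit) ((Fin k ⊕ Unit) ⊕ Unit) ℂ := fun i j =>
  match i, j with
  | .inl (.inl i), .inl (.inl j) => if i = j then t i else 0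
  | .inl (.inr _), .inl (.inr _) => Complex.cosh s
  | .inl (.inr _), .inr _ => Complex.sinh s
  | .inr _, .inl (.inr _) => Complex.sinh s
  | .inr _, .inr _ => Complex.cosh s
  | _, _ => 0

/-- The (quasi-)nilpotent matrices. -/
def nilCore {k l : ℕ} (t : Fin k → ℂ) (b : Fin l → ℝ) (s : ℝ) :
    Matrix ((Fin k ⊕ Fin l ⊕ Unit) ⊕ Unit) ((Fin k ⊕ Fin l ⊕ Unit) ⊕ Unit) ℂ := fun i j =>
  match i, j with
  | .inl (.inl i), .inl (.inl j) => if i = j then t i else 0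
  | .inl (.inr (.inl i)), .inl (.inr (.inl j)) => if i = j then 1 else 0
  | .inl (.inr (.inl i)), .inl (.inr (.inr _)) => -Complex.I * b i
  | .inl (.inr (.inl i)), .inr _ => -Complex.I * b i
  | .inl (.inr (.inr _)), .inl (.inr (.inl j)) => -Complex.I * b j
  | .inl (.inr (.inr _)), .inl (.inr (.inr _)) => (Complex.I * s - ∑ i, (b i : ℂ) ^ 2) / 2 + 1
  | .inl (.inr (.inr _)), .inr _ => (Complex.I * s - ∑ i, (b i : ℂ) ^ 2) / 2
  | .inr _, .inl (.inr (.inl j)) => Complex.I * b j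
  | .inr _, .inl (.inr (.inr _)) => (-Complex.I * s + ∑ i, (b i : ℂ) ^ 2) / 2
  | .inr _, .inr _ => (-Complex.I * s + ∑ i, (b i : ℂ) ^ 2) / 2 + 1
  | _, _ => 0

/-- The matrix `A_ξ` attached to `ξ = (t, y)`, before normalisation of the determinant. The
coordinates are `t` in the elliptic case, `(t, s)` in the hyperbolic case, and `(t, (b, s))` in the
nilpotent cases. -/
def core : (M : Model n) → M.X → Matrix (Ix n) (Ix n) ℂ
  | elliptic, ξ => Matrix.fromBlocks (Matrix.diagonal fun i => ((ξ.1 i).toCircle : ℂ)) 0 0 1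
  | hyperbolic _ e, ξ => Matrix.reindex (e.sumCongr (Equiv.refl Unit)) (e.sumCongr (Equiv.refl Unit))
      (hypCore (fun i => ((ξ.1 i).toCircle : ℂ)) (ξ.2 (0 : Fin 1)))
  | nilpotent _ l e, ξ => Matrix.reindex (e.sumCongr (Equiv.refl Unit)) (e.sumCongr (Equiv.refl Unit))
      (nilCore (fun i => ((ξ.1 i).toCircle : ℂ)) (fun i : Fin l => ξ.2 i.castSucc) (ξ.2 (Fin.last l)))

/-- The coordinates of the base point `z₀`. -/
def z0vec : Model n → Fin n → ℂ
  | elliptic => fun _ => (1 / Real.sqrt (2 * n) : ℝ)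
  | hyperbolic k e => fun i => match e.symm i with
    | .inl _ => (1 / Real.sqrt (2 * k) : ℝ)
    | .inr _ => 0
  | nilpotent k _ e => fun i => match e.symm i with
    | .inl _ => (1 / Real.sqrt (2 * k) : ℝ)
    | .inr _ => 0

lemma aux_sum (k : ℕ) : ∑ _i : Fin k, ‖((1 / Real.sqrt (2 * k) : ℝ) : ℂ)‖ ^ 2 < 1 := by
  rcases Nat.eq_zero_or_pos k with rfl | hk
  · simp
  · have hk' : (0 : ℝ) < k := by exact_mod_cast hk
    have h : ‖((1 / Real.sqrt (2 * k) : ℝ) : ℂ)‖ ^ 2 = 1 / (2 * k) := by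
      rw [Complex.norm_real, Real.norm_eq_abs, sq_abs, div_pow, one_pow,
        Real.sq_sqrt (by positivity)]
    rw [Finset.sum_congr rfl fun _ _ => h]
    simp only [Finset.sum_const, Finset.card_univ, Fintype.card_fin, nsmul_eq_mul]
    field_simp
    norm_num

lemma z0_mem (M : Model n) : (WithLp.toLp 2 M.z0vec : Cn n) ∈ UnitBall n := by
  have h : ∑ i, ‖M.z0vec i‖ ^ 2 < 1 := by
    cases M with
    | elliptic => exact aux_sum n
    | hyperbolic k e =>
      rw [← e.sum_comp, Fintype.sum_sum_type]
      simpa [z0vec] using aux_sum k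
    | nilpotent k l e =>
      rw [← e.sum_comp, Fintype.sum_sum_type]
      simpa [z0vec] using aux_sum k
  have h2 : ‖(WithLp.toLp 2 M.z0vec : Cn n)‖ ^ 2 < 1 := by
    rw [EuclideanSpace.norm_sq_eq]
    exact h
  have h3 : ‖(WithLp.toLp 2 M.z0vec : Cn n)‖ < 1 := by
    have := norm_nonneg (WithLp.toLp 2 M.z0vec : Cn n)
    nlinarith
  simpa using h3

/-- The base point `z₀`: `(1/√(2n), …, 1/√(2n))` in the elliptic case, and `1/√(2k)` in the `k`
compact directions and `0` in the others otherwise. -/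
def z0 (M : Model n) : UnitBall n := ⟨WithLp.toLp 2 M.z0vec, M.z0_mem⟩

lemma toCircle_conj (x : UnitAddCircle) :
    (x.toCircle : ℂ) * (starRingEnd ℂ) (x.toCircle : ℂ) = 1 := by
  rw [Complex.mul_conj', Circle.norm_coe]
  simp

lemma hyp_form {k : ℕ} (x : Fin k → UnitAddCircle) (s : ℝ) :
    hypCore (fun i => ((x i).toCircle : ℂ)) s * Matrix.fromBlocks (-1) 0 0 1 *
      (hypCore (fun i => ((x i).toCircle : ℂ)) s)ᴴ = Matrix.fromBlocks (-1) 0 0 1 := by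
  have hc := Complex.cosh_sq_sub_sinh_sq (s : ℂ)
  have hcs : (starRingEnd ℂ) (Complex.cosh s) = Complex.cosh s := by
    rw [← Complex.cosh_conj, Complex.conj_ofReal]
  have hss : (starRingEnd ℂ) (Complex.sinh s) = Complex.sinh s := by
    rw [← Complex.sinh_conj, Complex.conj_ofReal]
  ext i j
  rcases i with (i | i) | i <;> rcases j with (j | j) | j
  case inl.inl.inl.inl =>
    rcases eq_or_ne i j with rfl | h
    · simp [Matrix.mul_apply, Fintype.sum_sum_type, hypCore, Matrix.one_apply,
        Matrix.fromBlocks, apply_ite, toCircle_conj]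
    · simp [Matrix.mul_apply, Fintype.sum_sum_type, hypCore, Matrix.one_apply,
        Matrix.fromBlocks, apply_ite, h, h.symm]
  all_goals
    simp [Matrix.mul_apply, Fintype.sum_sum_type, hypCore, Matrix.one_apply,
      Matrix.fromBlocks, hcs, hss, apply_ite]
  · linear_combination -hc
  · ring
  · ring
  · linear_combination hc

lemma nil_form {k l : ℕ} (x : Fin k → UnitAddCircle) (b : Fin l → ℝ) (s : ℝ) :
    nilCore (fun i => ((x i).toCircle : ℂ)) b s * Matrix.fromBlocks (-1) 0 0 1 *
      (nilCore (fun i => ((x i).toCircle : ℂ)) b s)ᴴ = Matrix.fromBlocks (-1) 0 0 1 := by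
  have hs : ∑ i, Complex.I * (b i : ℂ) * (Complex.I * b i) = -∑ i, (b i : ℂ) ^ 2 := by
    rw [← Finset.sum_neg_distrib]
    refine Finset.sum_congr rfl fun i _ => ?_
    linear_combination (b i : ℂ) ^ 2 * Complex.I_sq
  have h2 : (starRingEnd ℂ) 2 = 2 := Complex.conj_ofNat 2
  ext i j
  rcases i with (i | i | i) | i <;> rcases j with (j | j | j) | j
  case inl.inl.inl.inl =>
    rcases eq_or_ne i j with rfl | h
    · simp [Matrix.mul_apply, Fintype.sum_sum_type, nilCore, Matrix.one_apply,
        Matrix.fromBlocks, apply_ite, toCircle_conj]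
    · simp [Matrix.mul_apply, Fintype.sum_sum_type, nilCore, Matrix.one_apply,
        Matrix.fromBlocks, apply_ite, h, h.symm]
  case inl.inr.inl.inl.inr.inl =>
    rcases eq_or_ne i j with rfl | h
    · simp [Matrix.mul_apply, Fintype.sum_sum_type, nilCore, Matrix.one_apply]
    · simp [Matrix.mul_apply, Fintype.sum_sum_type, nilCore, Matrix.one_apply, h]
  all_goals
    simp [Matrix.mul_apply, Fintype.sum_sum_type, nilCore, Matrix.one_apply]
  all_goals
    try rw [hs]
    try rw [h2]
    ring

lemma core_form (M : Model n) (ξ : M.X) : M.core ξ * J n * (M.core ξ)ᴴ = J n := by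
  have key : ∀ {ι : Type} [Fintype ι] [DecidableEq ι] (e : ι ≃ Fin n)
      (A : Matrix (ι ⊕ Unit) (ι ⊕ Unit) ℂ),
      A * Matrix.fromBlocks (-1) 0 0 1 * Aᴴ = Matrix.fromBlocks (-1) 0 0 1 →
      Matrix.reindex (e.sumCongr (Equiv.refl Unit)) (e.sumCongr (Equiv.refl Unit)) A * J n *
        (Matrix.reindex (e.sumCongr (Equiv.refl Unit)) (e.sumCongr (Equiv.refl Unit)) A)ᴴ =
          J n := by
    intro ι _ _ e A hA
    have hJ : J n = Matrix.reindex (e.sumCongr (Equiv.refl Unit)) (e.sumCongr (Equiv.refl Unit))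
        (Matrix.fromBlocks (-1) 0 0 1) := by
      ext i j
      rcases i with i | i <;> rcases j with j | j <;>
        simp [J, Matrix.fromBlocks, Matrix.one_apply]
    rw [hJ, Matrix.conjTranspose_reindex]
    simp only [Matrix.reindex_apply, Matrix.submatrix_mul_equiv]
    rw [hA]
  cases M with
  | elliptic =>
    simp only [core, J, Matrix.fromBlocks_multiply, Matrix.fromBlocks_conjTranspose]
    ext i j
    rcases i with i | i <;> rcases j with j | j
    case inl.inl =>
      rcases eq_or_ne i j with rfl | h
      · simp [Matrix.fromBlocks, toCircle_conj]
      · simp [Matrix.fromBlocks, h]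
    all_goals simp [Matrix.fromBlocks]
  | hyperbolic k e => exact key e _ (hyp_form _ _)
  | nilpotent k l e => exact key e _ (nil_form _ _ _)

lemma toCircle_zero' : (((0 : UnitAddCircle).toCircle : Circle) : ℂ) = 1 := by
  rw [AddCircle.toCircle_zero, Circle.coe_one]

/-- `A_0 = 1`. -/
lemma core_zero (M : Model n) : M.core 0 = 1 := by
  cases M with
  | elliptic =>
    change Matrix.fromBlocks (Matrix.diagonal fun _ => ((0 : UnitAddCircle).toCircle : ℂ)) 0 0 1 = 1
    simp only [toCircle_zero', Matrix.diagonal_one, Matrix.fromBlocks_one]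
  | hyperbolic k e =>
    change Matrix.reindex (e.sumCongr (Equiv.refl Unit)) (e.sumCongr (Equiv.refl Unit))
      (hypCore (fun _ => ((0 : UnitAddCircle).toCircle : ℂ)) 0) = 1
    rw [toCircle_zero']
    ext i j
    obtain ⟨i, rfl⟩ := (e.sumCongr (Equiv.refl Unit)).surjective i
    obtain ⟨j, rfl⟩ := (e.sumCongr (Equiv.refl Unit)).surjective j
    rcases i with (i | i) | i <;> rcases j with (j | j) | j <;>
      simp [hypCore, Matrix.one_apply]
  | nilpotent k l e =>
    change Matrix.reindex (e.sumCongr (Equiv.refl Unit)) (e.sumCongr (Equiv.refl Unit))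
      (nilCore (fun _ => ((0 : UnitAddCircle).toCircle : ℂ)) (fun _ => 0) 0) = 1
    rw [toCircle_zero']
    ext i j
    obtain ⟨i, rfl⟩ := (e.sumCongr (Equiv.refl Unit)).surjective i
    obtain ⟨j, rfl⟩ := (e.sumCongr (Equiv.refl Unit)).surjective j
    rcases i with (i | i | i) | i <;> rcases j with (j | j | j) | j <;>
      simp [nilCore, Matrix.one_apply]

lemma reindex_mulVec {ι : Type} [Fintype ι] (e : ι ≃ Fin n)
    (A : Matrix (ι ⊕ Unit) (ι ⊕ Unit) ℂ) (z : Cn n) (i : ι ⊕ Unit) :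
    (Matrix.reindex (e.sumCongr (Equiv.refl Unit)) (e.sumCongr (Equiv.refl Unit)) A *ᵥ hvec z)
      (e.sumCongr (Equiv.refl Unit) i) = ∑ j, A i (.inl j) * z (e j) + A i (.inr ()) := by
  simp only [Matrix.mulVec, dotProduct]
  rw [← (e.sumCongr (Equiv.refl Unit)).sum_comp, Fintype.sum_sum_type]
  simp [hvec]

lemma moeb_reindex {ι : Type} [Fintype ι] (e : ι ≃ Fin n)
    (A : Matrix (ι ⊕ Unit) (ι ⊕ Unit) ℂ) (z : Cn n) (i : ι) :
    moeb (Matrix.reindex (e.sumCongr (Equiv.refl Unit)) (e.sumCongr (Equiv.refl Unit)) A) z (e i) =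
      (∑ j, A (.inl i) (.inl j) * z (e j) + A (.inl i) (.inr ())) /
        (∑ j, A (.inr ()) (.inl j) * z (e j) + A (.inr ()) (.inr ())) := by
  have h1 := reindex_mulVec e A z (.inl i)
  have h2 := reindex_mulVec e A z (.inr ())
  simp only [Equiv.sumCongr_apply, Sum.map_inl, Sum.map_inr, Equiv.refl_apply] at h1 h2
  change _ / den _ z = _
  rw [den, h2, h1]

lemma base_ne_zero {k : ℕ} (i : Fin k) : ((1 / Real.sqrt (2 * k) : ℝ) : ℂ) ≠ 0 := by
  have hk : (0 : ℝ) < k := by exact_mod_cast i.pos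
  have : (1 / Real.sqrt (2 * k) : ℝ) ≠ 0 := by positivity
  exact_mod_cast this

lemma toCircle_inj {x y : UnitAddCircle} (h : (x.toCircle : ℂ) = y.toCircle) : x = y :=
  AddCircle.injective_toCircle one_ne_zero (Circle.ext h)

/-- The orbit map `ξ ↦ A_ξ · z₀` is injective. -/
lemma orbit_injective (M : Model n) :
    Function.Injective fun ξ : M.X => moeb (M.core ξ) (M.z0 : Cn n) := by
  cases M with
  | elliptic =>
    rintro ⟨t, y⟩ ⟨t', y'⟩ h
    have hc : ∀ (t : Fin n → UnitAddCircle) (y : EuclideanSpace ℝ (Fin 0)) (i : Fin n),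
        moeb (core elliptic (t, y)) (z0 (n := n) elliptic : Cn n) i =
          (t i).toCircle * ((1 / Real.sqrt (2 * n) : ℝ) : ℂ) := by
      intro t y i
      simp [moeb, den, core, z0, z0vec, hvec, Matrix.fromBlocks, Matrix.mulVec, dotProduct,
        Fintype.sum_sum_type, Matrix.diagonal_apply]
    refine Prod.ext (funext fun i => ?_) (Subsingleton.elim (α := EuclideanSpace ℝ (Fin 0)) _ _)
    have h1 := congrFun (congrArg WithLp.ofLp h) i
    erw [hc t y i, hc t' y' i] at h1
    exact toCircle_inj (mul_right_cancel₀ (base_ne_zero i) h1)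
  | hyperbolic k e =>
    rintro ⟨t, y⟩ ⟨t', y'⟩ h
    change Fin k → UnitAddCircle at t t'
    change EuclideanSpace ℝ (Fin 1) at y y'
    have hc : ∀ (t : Fin k → UnitAddCircle) (y : EuclideanSpace ℝ (Fin 1)) (i : Fin k ⊕ Unit),
        moeb (core (hyperbolic k e) (t, y)) (z0 (hyperbolic k e) : Cn n) (e i) =
          Sum.elim (fun i => ((t i).toCircle : ℂ) * ((1 / Real.sqrt (2 * k) : ℝ) : ℂ))
            (fun _ => Complex.sinh (y 0)) i / Complex.cosh (y 0) := by
      intro t y i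
      refine (moeb_reindex e _ _ i).trans ?_
      rcases i with i | i <;>
        simp [hypCore, Fintype.sum_sum_type, z0, z0vec]
    have hcosh : ∀ s : ℝ, Complex.cosh s ≠ 0 := by
      intro s
      rw [← Complex.ofReal_cosh]
      exact_mod_cast (Real.cosh_pos s).ne'
    have h1 : ∀ i, _ := fun i => congrFun (congrArg WithLp.ofLp h) (e i)
    have hy : y 0 = y' 0 := by
      have h2 := h1 (.inr ())
      erw [hc t y, hc t' y'] at h2
      simp only [Sum.elim_inr] at h2
      rw [div_eq_div_iff (hcosh _) (hcosh _)] at h2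
      rw [← Complex.ofReal_cosh, ← Complex.ofReal_cosh, ← Complex.ofReal_sinh,
        ← Complex.ofReal_sinh] at h2
      have h3 : Real.sinh (y 0) * Real.cosh (y' 0) = Real.sinh (y' 0) * Real.cosh (y 0) := by
        exact_mod_cast h2
      have h4 : Real.sinh (y 0 - y' 0) = 0 := by
        rw [Real.sinh_sub]
        linarith
      exact sub_eq_zero.mp (Real.sinh_eq_zero.mp h4)
    refine Prod.ext (funext fun i => ?_) ?_
    · have h2 := h1 (.inl i)
      erw [hc t y, hc t' y'] at h2
      simp only at h2
      rw [hy, div_left_inj' (hcosh _)] at h2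
      exact toCircle_inj (mul_right_cancel₀ (base_ne_zero i) h2)
    · change y = y'
      ext i
      rw [Subsingleton.elim i 0, hy]
  | nilpotent k l e =>
    rintro ⟨t, y⟩ ⟨t', y'⟩ h
    change Fin k → UnitAddCircle at t t'
    change EuclideanSpace ℝ (Fin (l + 1)) at y y'
    set q : EuclideanSpace ℝ (Fin (l + 1)) → ℂ := fun y =>
      (-Complex.I * y (Fin.last l) + ∑ i : Fin l, (y i.castSucc : ℂ) ^ 2) / 2 with hq
    have hc : ∀ (t : Fin k → UnitAddCircle) (y : EuclideanSpace ℝ (Fin (l + 1)))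
        (i : Fin k ⊕ Fin l ⊕ Unit),
        moeb (core (nilpotent k l e) (t, y)) (z0 (nilpotent k l e) : Cn n) (e i) =
          Sum.elim (fun i => ((t i).toCircle : ℂ) * ((1 / Real.sqrt (2 * k) : ℝ) : ℂ))
            (Sum.elim (fun i => -Complex.I * y i.castSucc) (fun _ => -q y)) i / (q y + 1) := by
      intro t y i
      refine (moeb_reindex e _ _ i).trans ?_
      rcases i with i | i | i <;>
        simp [nilCore, Fintype.sum_sum_type, z0, z0vec, hq]
      congr 1
      ring
    have hre : ∀ y, (q y).re = (∑ i : Fin l, (y i.castSucc) ^ 2) / 2 := by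
      intro y
      have : q y = ((((∑ i : Fin l, (y i.castSucc) ^ 2) / 2 : ℝ) : ℂ) +
          ((-(y (Fin.last l)) / 2 : ℝ) : ℂ) * Complex.I) := by
        simp only [hq]
        push_cast
        ring
      rw [this, Complex.add_re, Complex.ofReal_re, Complex.re_ofReal_mul, Complex.I_re, mul_zero,
        add_zero]
    have him : ∀ y, (q y).im = -(y (Fin.last l)) / 2 := by
      intro y
      have : q y = ((((∑ i : Fin l, (y i.castSucc) ^ 2) / 2 : ℝ) : ℂ) +
          ((-(y (Fin.last l)) / 2 : ℝ) : ℂ) * Complex.I) := by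
        simp only [hq]
        push_cast
        ring
      rw [this, Complex.add_im, Complex.ofReal_im, Complex.im_ofReal_mul, Complex.I_im, mul_one,
        zero_add]
    have hq0 : ∀ y, q y + 1 ≠ 0 := by
      intro y h0
      have h1 := congrArg Complex.re h0
      rw [Complex.add_re, hre, Complex.one_re, Complex.zero_re] at h1
      have h2 : 0 ≤ ∑ i : Fin l, (y i.castSucc) ^ 2 := Finset.sum_nonneg fun i _ => sq_nonneg _
      linarith
    have h1 : ∀ i, _ := fun i => congrFun (congrArg WithLp.ofLp h) (e i)
    have hqq : q y = q y' := by
      have h2 := h1 (.inr (.inr ()))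
      erw [hc t y, hc t' y'] at h2
      simp only [Sum.elim_inr] at h2
      rw [div_eq_div_iff (hq0 _) (hq0 _)] at h2
      linear_combination -h2
    refine Prod.ext (funext fun i => ?_) ?_
    · have h2 := h1 (.inl i)
      erw [hc t y, hc t' y'] at h2
      simp only at h2
      rw [hqq, div_left_inj' (hq0 _)] at h2
      exact toCircle_inj (mul_right_cancel₀ (base_ne_zero i) h2)
    · change y = y'
      ext i
      refine Fin.lastCases ?_ (fun i => ?_) i
      · have h3 := congrArg Complex.im hqq
        rw [him, him] at h3
        linarith
      · have h2 := h1 (.inr (.inl i))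
        erw [hc t y, hc t' y'] at h2
        simp only [Sum.elim_inr, Sum.elim_inl] at h2
        rw [hqq, div_left_inj' (hq0 _)] at h2
        have h3 := mul_left_cancel₀ (neg_ne_zero.mpr Complex.I_ne_zero) h2
        exact_mod_cast h3

/-- Some scalar multiple `a A_ξ` with `|a| = 1` lies in `SU(n,1)`. -/
lemma exists_mem (M : Model n) (ξ : M.X) : ∃ (a : Circle) (g : SU n), mat g = (a : ℂ) • M.core ξ := by
  have hdet : ‖(M.core ξ).det‖ = 1 := by
    have h := congrArg Matrix.det (M.core_form ξ)
    have hJ : (J n).det ≠ 0 := by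
      have h : (J n).det * (J n).det = 1 := by
        rw [← Matrix.det_mul, show J n * J n = 1 by simp [J, Matrix.fromBlocks_multiply],
          Matrix.det_one]
      exact left_ne_zero_of_mul_eq_one h
    rw [Matrix.det_mul, Matrix.det_mul, Matrix.det_conjTranspose] at h
    have h1 : (M.core ξ).det * star (M.core ξ).det = 1 := by
      apply mul_right_cancel₀ hJ
      rw [one_mul]
      linear_combination h
    rw [RCLike.star_def, Complex.mul_conj'] at h1
    have h2 : ‖(M.core ξ).det‖ ^ 2 = 1 := by exact_mod_cast h1
    have := norm_nonneg (M.core ξ).det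
    nlinarith
  obtain ⟨a, ha⟩ := IsAlgClosed.exists_pow_nat_eq ((M.core ξ).det)⁻¹ (Nat.succ_pos n)
  have hna : ‖a‖ = 1 := by
    have h := congrArg norm ha
    rw [norm_pow, norm_inv, hdet, inv_one] at h
    exact (pow_eq_one_iff_of_nonneg (norm_nonneg _) (Nat.succ_ne_zero n)).mp h
  have hd0 : (M.core ξ).det ≠ 0 := by
    intro h
    rw [h, norm_zero] at hdet
    exact zero_ne_one hdet
  have haa : a * star a = 1 := by
    rw [RCLike.star_def, Complex.mul_conj', hna]
    simp
  refine ⟨⟨a, mem_sphere_zero_iff_norm.mpr hna⟩, ⟨⟨a • M.core ξ, ?_⟩, ?_⟩, rfl⟩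
  · rw [Matrix.det_smul]
    have : Fintype.card (Ix n) = n + 1 := by simp
    rw [this, ha, inv_mul_cancel₀ hd0]
  · change (a • M.core ξ) * J n * (a • M.core ξ)ᴴ = J n
    rw [Matrix.conjTranspose_smul, Matrix.smul_mul, Matrix.smul_mul, Matrix.mul_smul, smul_smul,
      core_form, haa, one_smul]

end Model

/-- `H` is a maximal abelian subgroup. -/
def IsMaximalAbelian {G : Type*} [Group G] (H : Subgroup G) : Prop :=
  Maximal (fun K : Subgroup G => ∀ a ∈ K, ∀ b ∈ K, a * b = b * a) H

/-- A description of `H` as the conjugate by (the image of) `γ` of the standard group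
`{a A_ξ ∈ SU(n,1)}` of a model. It determines the base point `z₀` and the coordinates on `H`. -/
structure Chart {n : ℕ} (H : Subgroup (SU n)) where
  /-- the conjugacy class -/
  model : Model n
  /-- the conjugating element, in the covering group -/
  γ : Cover n
  mem_iff : ∀ h : SU n, h ∈ H ↔
    ∃ (ξ : model.X) (a : Circle), mat ((Cover.p γ)⁻¹ * h * Cover.p γ) = (a : ℂ) • model.core ξ

/-- The preimage `H̃` of `H` in the covering group. -/
abbrev tilde {n : ℕ} (H : Subgroup (SU n)) : Subgroup (Cover n) := H.comap Cover.p

namespace Chart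

variable {n : ℕ} {H : Subgroup (SU n)} (c : Chart H)

/-- The base point `z₀`. -/
def base : UnitBall n := c.γ • c.model.z0

/-- The conjugate `γ⁻¹ h γ`. -/
def conj (h : tilde H) : Cover n := c.γ⁻¹ * (h : Cover n) * c.γ

/-- The element `h` of `H̃` has coordinates `(ξ, x)`: after conjugation by `γ⁻¹` its matrix is
`e^{2πix} A_ξ`, and its logarithm of the denominator at `z₀` is `2πix` plus the principal logarithm
of the denominator of `A_ξ`. -/
def IsCoord (h : tilde H) (ξ : c.model.X) (x : ℝ) : Prop :=
  mat (Cover.p (c.conj h)) = Complex.exp (2 * Real.pi * Complex.I * x) • c.model.core ξ ∧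
  (c.conj h).logDen c.model.z0 =
    2 * Real.pi * Complex.I * x + Complex.log (den (c.model.core ξ) c.model.z0)

lemma den_smul (a : ℂ) (A : Matrix (Ix n) (Ix n) ℂ) (z : Cn n) : den (a • A) z = a * den A z := by
  simp [den, Matrix.smul_mulVec]

lemma moeb_smul {a : ℂ} (ha : a ≠ 0) (A : Matrix (Ix n) (Ix n) ℂ) (z : Cn n) :
    moeb (a • A) z = moeb A z := by
  ext i
  simp only [moeb, den_smul, Matrix.smul_mulVec, Pi.smul_apply, smul_eq_mul]
  exact mul_div_mul_left _ _ ha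

lemma core_den_ne_zero (M : Model n) (ξ : M.X) : den (M.core ξ) M.z0 ≠ 0 := by
  obtain ⟨a, g, hg⟩ := M.exists_mem ξ
  have h := den_ne_zero g M.z0.2
  rw [hg, den_smul] at h
  exact right_ne_zero_of_mul h

lemma exists_x (M : Model n) (ξ : M.X) (a : Circle) (g : Cover n)
    (hg : mat (Cover.p g) = (a : ℂ) • M.core ξ) :
    ∃ x : ℝ, (a : ℂ) = Complex.exp (2 * Real.pi * Complex.I * x) ∧
      g.logDen M.z0 = 2 * Real.pi * Complex.I * x + Complex.log (den (M.core ξ) M.z0) := by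
  have h0 := core_den_ne_zero M ξ
  set w := g.logDen M.z0 - Complex.log (den (M.core ξ) M.z0) with hw
  have h1 : Complex.exp w = a := by
    have h2 := g.exp_logDen M.z0
    change _ = den (mat (Cover.p g)) _ at h2
    rw [hw, Complex.exp_sub, Complex.exp_log h0, h2, hg, den_smul, mul_div_cancel_right₀ _ h0]
  have hre : w.re = 0 := by
    have h3 := congrArg norm h1
    rw [Complex.norm_exp, Circle.norm_coe] at h3
    exact Real.exp_eq_one_iff _ |>.mp h3
  have hwx : w = 2 * Real.pi * Complex.I * ((w.im / (2 * Real.pi) : ℝ) : ℂ) := by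
    have hpi : (Real.pi : ℂ) ≠ 0 := by exact_mod_cast Real.pi_ne_zero
    have h4 : w = w.im * Complex.I := by
      apply Complex.ext <;> simp [hre]
    push_cast
    field_simp
    rw [mul_comm]
    exact h4
  refine ⟨w.im / (2 * Real.pi), ?_, ?_⟩
  · rw [← hwx, h1]
  · rw [← hwx, hw]
    ring

/-- Every element of `H̃` has coordinates. -/
lemma exists_coord (h : tilde H) : ∃ p : c.model.X × ℝ, c.IsCoord h p.1 p.2 := by
  obtain ⟨ξ, a, ha⟩ := (c.mem_iff (Cover.p h)).mp h.2
  have ha' : mat (Cover.p (c.conj h)) = (a : ℂ) • c.model.core ξ := by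
    rw [conj, map_mul, map_mul, map_inv, ha]
  obtain ⟨x, hx, hx'⟩ := exists_x c.model ξ a _ ha'
  exact ⟨(ξ, x), by rw [← hx]; exact ha', hx'⟩

/-- Every `ξ` is the coordinate of an element of `H̃`. -/
lemma exists_lift (ξ : c.model.X) : ∃ p : tilde H × ℝ, c.IsCoord p.1 ξ p.2 := by
  obtain ⟨a, g, hg⟩ := c.model.exists_mem ξ
  obtain ⟨g', rfl⟩ := Cover.p_surjective g
  have hconj : c.γ⁻¹ * (c.γ * g' * c.γ⁻¹) * c.γ = g' := by group
  have hmem : c.γ * g' * c.γ⁻¹ ∈ tilde H := by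
    rw [Subgroup.mem_comap, c.mem_iff]
    refine ⟨ξ, a, ?_⟩
    rw [← map_inv, ← map_mul, ← map_mul, hconj, hg]
  obtain ⟨x, hx, hx'⟩ := exists_x c.model ξ a _ hg
  refine ⟨(⟨_, hmem⟩, x), ?_, ?_⟩
  · change mat (Cover.p (c.γ⁻¹ * (c.γ * g' * c.γ⁻¹) * c.γ)) = _
    rw [hconj, hg, hx]
  · change (c.γ⁻¹ * (c.γ * g' * c.γ⁻¹) * c.γ).logDen _ = _
    rw [hconj, hx']

/-- The embedding `H̃ → H / H_{z₀} × ℝ`. -/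
def coord (h : tilde H) : c.model.X × ℝ := (c.exists_coord h).choose

lemma coord_spec (h : tilde H) : c.IsCoord h (c.coord h).1 (c.coord h).2 :=
  (c.exists_coord h).choose_spec

lemma coord_orbit {h : tilde H} {ξ : c.model.X} {x : ℝ} (hc : c.IsCoord h ξ x) :
    (c.conj h • c.model.z0 : UnitBall n).1 =
      moeb (c.model.core ξ) c.model.z0 := by
  rw [Cover.smul_def, smul_coe]
  change moeb (mat (Cover.p (c.conj h))) _ = _
  rw [hc.1, moeb_smul (Complex.exp_ne_zero _)]

lemma two_pi_inj {x x' : ℝ} (h : 2 * Real.pi * Complex.I * x = 2 * Real.pi * Complex.I * x') :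
    x = x' := by
  have hpi : (2 * Real.pi * Complex.I : ℂ) ≠ 0 := by
    simp [Real.pi_ne_zero]
  exact_mod_cast mul_left_cancel₀ hpi h

/-- Coordinates are unique. -/
lemma coord_unique {h : tilde H} {ξ ξ' : c.model.X} {x x' : ℝ} (hc : c.IsCoord h ξ x)
    (hc' : c.IsCoord h ξ' x') : ξ = ξ' ∧ x = x' := by
  have h1 : ξ = ξ' := c.model.orbit_injective ((c.coord_orbit hc).symm.trans (c.coord_orbit hc'))
  subst h1
  exact ⟨rfl, two_pi_inj (add_right_cancel (hc.2.symm.trans hc'.2))⟩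

lemma coord_eq {h : tilde H} {ξ : c.model.X} {x : ℝ} (hc : c.IsCoord h ξ x) :
    c.coord h = (ξ, x) :=
  have h := c.coord_unique (c.coord_spec h) hc
  Prod.ext h.1 h.2

/-- A section `H / H_{z₀} → H̃` of the projection. -/
def lift (ξ : c.model.X) : tilde H := (c.exists_lift ξ).choose.1

lemma coord_lift (ξ : c.model.X) : (c.coord (c.lift ξ)).1 = ξ :=
  congrArg Prod.fst (c.coord_eq (c.exists_lift ξ).choose_spec)

variable (lam : ℝ)

/-- The extension of the character `χ_λ` to `H̃`, namely `χ_λ(ξ, x) = e^{2πiλx}`. -/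
def chi (h : tilde H) : ℂ := Complex.exp (2 * Real.pi * Complex.I * lam * (c.coord h).2)

/-- The function `D_λ(h) = j_λ(h, z₀)` on `H̃`. -/
def D (h : tilde H) : ℂ := Cover.j lam (h : Cover n) c.base

lemma smul_base (h : tilde H) : (h : Cover n) • c.base =
    c.γ • (c.conj h • c.model.z0 : UnitBall n) := by
  rw [base, conj, ← mul_smul, ← mul_smul]
  congr 1
  group

/-- Compatibility of the coordinates with the stabiliser `H̃_{z₀}`, on which
`χ_λ = j_λ(·, z₀)⁻¹`. -/
lemma coord_mul {h h₁ : tilde H} (hs : (h₁ : Cover n) • c.base = c.base) :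
    c.coord (h * h₁) = ((c.coord h).1, (c.coord h).2 + (c.coord h₁).2) ∧
      c.D lam h₁ = (c.chi lam h₁)⁻¹ := by
  have hk : c.conj h₁ • c.model.z0 = c.model.z0 := by
    rw [smul_base, base] at hs
    exact smul_left_cancel _ hs
  have h1 := c.coord_spec h
  have h2 := c.coord_spec h₁
  have hξ : (c.coord h₁).1 = 0 := by
    apply c.model.orbit_injective
    have h3 := c.coord_orbit h2
    rw [hk] at h3
    change moeb _ _ = moeb _ _
    rw [← h3, c.model.core_zero, moeb_one]
  rw [IsCoord, hξ, c.model.core_zero, den_one, Complex.log_one, add_zero] at h2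
  have hconj : c.conj (h * h₁) = c.conj h * c.conj h₁ := by
    simp only [conj, Subgroup.coe_mul]
    group
  refine ⟨c.coord_eq ⟨?_, ?_⟩, ?_⟩
  · rw [hconj, map_mul, mat_mul, h1.1, h2.1, Matrix.smul_mul, Matrix.mul_smul, smul_smul,
      Matrix.mul_one, ← Complex.exp_add]
    push_cast
    rw [mul_add]
  · rw [hconj, Cover.mul_logDen, ← Cover.smul_def, hk, h1.2, h2.2]
    push_cast
    ring
  · have hcl : (h₁ : Cover n).logDen c.base = (c.conj h₁).logDen c.model.z0 := by
      have h4 : (h₁ : Cover n) = c.γ * c.conj h₁ * c.γ⁻¹ := by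
        rw [conj]
        group
      have h5 : c.γ.proj⁻¹ • c.base = c.model.z0 := inv_smul_smul c.γ.proj c.model.z0
      rw [h4, Cover.mul_logDen, Cover.mul_logDen, Cover.inv_logDen, Cover.inv_proj, h5,
        ← Cover.smul_def, hk]
      ring
    rw [D, Cover.j, hcl, h2.2, chi, ← Complex.exp_neg]
    congr 1
    ring

/-- The sections: the functions `f` on `H̃` with `f(h h₁) = χ_λ(h₁)⁻¹ f(h) = j_λ(h₁, z₀) f(h)` for
`h₁` in the stabiliser of `z₀`. For such `f` the product `χ_λ f` descends to a function on
`H / H_{z₀}`. -/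
def IsCovariant (f : tilde H → ℂ) : Prop :=
  ∀ h h₁ : tilde H, (h₁ : Cover n) • c.base = c.base →
    f (h * h₁) = Cover.j lam (h₁ : Cover n) c.base * f h

/-- The function `f̃ = χ_λ f` on `H / H_{z₀}`. -/
def descend (f : tilde H → ℂ) (ξ : c.model.X) : ℂ := c.chi lam (c.lift ξ) * f (c.lift ξ)

/-- The function `f̃ = χ_λ f` does not depend on the choice of representatives. -/
lemma descend_coord {f : tilde H → ℂ} (hf : c.IsCovariant lam f) (h : tilde H) :
    c.descend lam f (c.coord h).1 = c.chi lam h * f h := by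
  set k := c.lift (c.coord h).1 with hk
  have hkξ : (c.coord k).1 = (c.coord h).1 := c.coord_lift _
  have hkh : h * (h⁻¹ * k) = k := by group
  have hs : ((h⁻¹ * k : tilde H) : Cover n) • c.base = c.base := by
    have h1 := c.coord_orbit (c.coord_spec h)
    have h2 := c.coord_orbit (c.coord_spec k)
    rw [hkξ, ← h1] at h2
    have h3 : (k : Cover n) • c.base = (h : Cover n) • c.base := by
      rw [smul_base, smul_base, Subtype.ext h2]
    rw [Subgroup.coe_mul, mul_smul, h3, ← mul_smul, Subgroup.coe_inv, inv_mul_cancel, one_smul]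
  have h1 := c.coord_mul lam (h := h) hs
  have h2 := hf h _ hs
  have h3 := h1.2
  rw [D] at h3
  rw [hkh] at h1 h2
  rw [h3] at h2
  rw [descend, ← hk, h2]
  have h4 : c.chi lam k = c.chi lam h * c.chi lam (h⁻¹ * k) := by
    simp only [chi]
    rw [h1.1, ← Complex.exp_add]
    congr 1
    push_cast
    ring
  have h5 : c.chi lam (h⁻¹ * k) ≠ 0 := Complex.exp_ne_zero _
  rw [h4]
  field_simp

/-- The covariant functions with `∫_M |f|² dμ < ∞`, where `M = H · z₀ ≅ H / H_{z₀}`. -/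
def sections : Submodule ℂ (tilde H → ℂ) where
  carrier := {f | c.IsCovariant lam f ∧ MemLp (c.descend lam f) 2}
  zero_mem' := by
    refine ⟨fun h h₁ _ => by simp, ?_⟩
    have : c.descend lam 0 = 0 := by
      funext ξ
      simp [descend]
    rw [this]
    exact MemLp.zero
  add_mem' := by
    rintro f g ⟨hf, hf'⟩ ⟨hg, hg'⟩
    refine ⟨fun h h₁ hs => ?_, ?_⟩
    · rw [Pi.add_apply, Pi.add_apply, hf h h₁ hs, hg h h₁ hs, mul_add]
    · have : c.descend lam (f + g) = c.descend lam f + c.descend lam g := by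
        funext ξ
        simp [descend, mul_add]
      rw [this]
      exact hf'.add hg'
  smul_mem' := by
    rintro a f ⟨hf, hf'⟩
    refine ⟨fun h h₁ hs => ?_, ?_⟩
    · rw [Pi.smul_apply, Pi.smul_apply, hf h h₁ hs, smul_eq_mul, smul_eq_mul]
      ring
    · have : c.descend lam (a • f) = a • c.descend lam f := by
        funext ξ
        simp only [descend, Pi.smul_apply, smul_eq_mul]
        ring
      rw [this]
      exact hf'.const_smul a

/-- The map `f ↦ f̃` into `L²(H / H_{z₀})`. -/
def descendL : c.sections lam →ₗ[ℂ] Lp ℂ 2 (volume : Measure c.model.X) where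
  toFun f := f.2.2.toLp
  map_add' f g := by
    rw [← MemLp.toLp_add]
    congr 1
    funext ξ
    simp [descend, mul_add]
  map_smul' a f := by
    rw [RingHom.id_apply, ← MemLp.toLp_const_smul]
    congr 1
    funext ξ
    simp only [descend, Submodule.coe_smul, Pi.smul_apply, smul_eq_mul]
    ring

lemma descendL_surjective : Function.Surjective (c.descendL lam) := by
  intro u
  set f : tilde H → ℂ := fun h => (c.chi lam h)⁻¹ * u (c.coord h).1 with hf
  have hd : c.descend lam f = u := by
    funext ξ
    have h0 : c.chi lam (c.lift ξ) ≠ 0 := Complex.exp_ne_zero _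
    simp only [descend, hf, coord_lift]
    field_simp
  have hcov : c.IsCovariant lam f := by
    intro h h₁ hs
    obtain ⟨h1, h2⟩ := c.coord_mul lam (h := h) hs
    rw [D] at h2
    have h4 : c.chi lam (h * h₁) = c.chi lam h * c.chi lam h₁ := by
      simp only [chi]
      rw [h1, ← Complex.exp_add]
      congr 1
      push_cast
      ring
    simp only [hf]
    rw [h2, h4, h1, mul_inv]
    ring
  have hm : MemLp (c.descend lam f) 2 := by
    rw [hd]
    exact Lp.memLp u
  refine ⟨⟨f, hcov, hm⟩, ?_⟩
  refine Lp.ext ?_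
  refine (MemLp.coeFn_toLp hm).trans ?_
  rw [hd]

/-- The Hilbert space `L²_{χ_λ}(M, μ)`: square integrable sections modulo equality almost
everywhere. -/
def L2chi : Type := c.sections lam ⧸ LinearMap.ker (c.descendL lam)

instance : AddCommGroup (c.L2chi lam) :=
  inferInstanceAs (AddCommGroup (c.sections lam ⧸ LinearMap.ker (c.descendL lam)))

instance : Module ℂ (c.L2chi lam) :=
  inferInstanceAs (Module ℂ (c.sections lam ⧸ LinearMap.ker (c.descendL lam)))

/-- The class of a square integrable section. -/
def toClass : c.sections lam →ₗ[ℂ] c.L2chi lam := (LinearMap.ker (c.descendL lam)).mkQ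

/-- The bijection `f ↦ f̃ = χ_λ f` of `L²_{χ_λ}(M, μ)` onto `L²(H / H_{z₀})`. -/
def toL2 : c.L2chi lam ≃ₗ[ℂ] Lp ℂ 2 (volume : Measure c.model.X) :=
  (c.descendL lam).quotKerEquivOfSurjective (c.descendL_surjective lam)

lemma toL2_toClass (f : c.sections lam) : c.toL2 lam (c.toClass lam f) = c.descendL lam f := rfl

/-- The norm `‖f‖² = ∫_M |f|² dμ`; note that `|f| = |f̃|`. -/
instance : NormedAddCommGroup (c.L2chi lam) :=
  NormedAddCommGroup.induced _ _ (c.toL2 lam) (c.toL2 lam).injective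

lemma norm_toL2 (f : c.L2chi lam) : ‖c.toL2 lam f‖ = ‖f‖ := rfl

/-- The inner product `⟨f, g⟩ = ∫_M f ḡ dμ` (in Mathlib's order of the arguments). -/
instance : InnerProductSpace ℂ (c.L2chi lam) where
  norm_smul_le a f := by
    rw [← norm_toL2, ← norm_toL2, map_smul]
    exact norm_smul_le _ _
  inner f g := inner ℂ (c.toL2 lam f) (c.toL2 lam g)
  norm_sq_eq_re_inner f := by
    rw [← norm_toL2]
    exact norm_sq_eq_re_inner (𝕜 := ℂ) _
  conj_inner_symm f g := inner_conj_symm _ _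
  add_left f g h := by
    rw [map_add]
    exact inner_add_left _ _ _
  smul_left f g a := by
    rw [map_smul]
    exact inner_smul_left _ _ _

/-- The unitary map `f ↦ f̃`. -/
def toL2ₗᵢ : c.L2chi lam ≃ₗᵢ[ℂ] Lp ℂ 2 (volume : Measure c.model.X) :=
  ⟨c.toL2 lam, c.norm_toL2 lam⟩

instance : CompleteSpace (c.L2chi lam) :=
  (c.toL2ₗᵢ lam).toIsometryEquiv.completeSpace

end Chart

/-! ### The restriction operator, the Segal–Bargmann transform and the Fourier transform -/

/-- The square root of a positive operator. -/
def posSqrt {E : Type*} [NormedAddCommGroup E] [InnerProductSpace ℂ E] [CompleteSpace E]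
    (A : E →L[ℂ] E) : E →L[ℂ] E := CFC.sqrt A

namespace Chart

variable {n : ℕ} {H : Subgroup (SU n)} (c : Chart H) (lam : ℝ)

/-- The bounded operator `R` is the restriction operator `(R f)(h) = D_λ(h) f(h · z₀)`. -/
def IsRestriction (R : bergman n lam →L[ℂ] c.L2chi lam) : Prop :=
  ∀ f : bergman n lam,
    ∃ hf : (fun h : tilde H => c.D lam h * holo f ((h : Cover n) • c.base : UnitBall n).1) ∈
        c.sections lam,
      R f = c.toClass lam ⟨_, hf⟩

/-- The kernel `R_λ(h, k) = D_λ(h) K_λ(h · z₀, k · z₀) conj D_λ(k)`. -/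
def kernelR (h k : tilde H) : ℂ :=
  c.D lam h * bergmanKernel lam ((h : Cover n) • c.base : UnitBall n).1
    ((k : Cover n) • c.base : UnitBall n).1 * (starRingEnd ℂ) (c.D lam k)

/-- The function `φ_H` on `H / H_{z₀}`, namely `φ_H = χ_λ R_λ(·, 1)`. -/
def phiH : c.model.X → ℂ := c.descend lam fun h => c.kernelR lam h 1

/-- `RR* f = χ_{-λ} (f̃ * φ_H)` for all `f`, that is `(RR* f)~ = f̃ * φ_H`. -/
def IsConvolution (R : bergman n lam →L[ℂ] c.L2chi lam) : Prop :=
  ∀ f : c.L2chi lam,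
    c.toL2 lam (R (R.adjoint f)) =ᵐ[volume] fun ξ => ∫ η, c.toL2 lam f η * c.phiH lam (ξ - η)

/-- The space `𝓑_λ`, the closure of the range of `R`. -/
abbrev rangeClosure (R : bergman n lam →L[ℂ] c.L2chi lam) : Submodule ℂ (c.L2chi lam) :=
  (LinearMap.range (R : bergman n lam →ₗ[ℂ] c.L2chi lam)).topologicalClosure

/-- The unitary `U : 𝓑_λ → 𝓗²_λ` is the Segal–Bargmann transform: `R* = U √(RR*)`. -/
def IsSegalBargmann (R : bergman n lam →L[ℂ] c.L2chi lam)
    (U : c.rangeClosure lam R ≃ₗᵢ[ℂ] bergman n lam) : Prop :=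
  ∀ f : c.L2chi lam, ∃ hf : posSqrt (R ∘L R.adjoint) f ∈ c.rangeClosure lam R,
    U ⟨posSqrt (R ∘L R.adjoint) f, hf⟩ = R.adjoint f

/-- The dual group `ℤᵏ × ℝᵐ` of `H / H_{z₀} = 𝕋ᵏ × ℝᵐ`. -/
abbrev Xhat : Type := (Fin c.model.tor → ℤ) × EuclideanSpace ℝ (Fin c.model.dim)

/-- The product of the counting measure and of Lebesgue measure on the dual group. -/
abbrev dualMeasure : Measure c.Xhat := Measure.count.prod volume

/-- The Fourier transform of an integrable function on `H / H_{z₀}`, with the normalisations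
`∫ f(t) t^{-α} dt` on `𝕋ᵏ` and `(2π)^{-m/2} ∫ f(y) e^{-i⟨y, η⟩} dy` on `ℝᵐ`. -/
def hat (u : c.model.X → ℂ) (α : c.Xhat) : ℂ :=
  (((2 * Real.pi) ^ (-(c.model.dim : ℝ) / 2) : ℝ) : ℂ) *
    ∫ ξ : c.model.X, u ξ * UnitAddTorus.mFourier (-α.1) ξ.1 *
      Complex.exp (-Complex.I * (inner ℝ ξ.2 α.2 : ℝ))

/-- The unitary `P` is the Fourier transform on `L²(H / H_{z₀})`: it is given by the Fourier integral
on the dense subspace `L¹ ∩ L²`. -/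
def IsPlancherel (P : Lp ℂ 2 (volume : Measure c.model.X) ≃ₗᵢ[ℂ] Lp ℂ 2 c.dualMeasure) : Prop :=
  ∀ u : Lp ℂ 2 (volume : Measure c.model.X), Integrable u → P u =ᵐ[c.dualMeasure] c.hat u

/-- The set `A` of the characters at which the Fourier transform of `φ_H` does not vanish. -/
def A : Set c.Xhat := {α | c.hat (c.phiH lam) α ≠ 0}

/-- The space `L²(A)`, the subspace of `L²` of the dual group of functions vanishing off `A`. -/
def L2A : Submodule ℂ (Lp ℂ 2 c.dualMeasure) where
  carrier := {ω | ∀ᵐ α ∂c.dualMeasure, α ∉ c.A lam → ω α = 0}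
  zero_mem' := by
    change ∀ᵐ α ∂c.dualMeasure, α ∉ c.A lam → (0 : Lp ℂ 2 c.dualMeasure) α = 0
    filter_upwards [Lp.coeFn_zero ℂ 2 c.dualMeasure] with α hα _
    rw [hα, Pi.zero_apply]
  add_mem' := by
    intro f g hf hg
    change ∀ᵐ α ∂c.dualMeasure, α ∉ c.A lam → f α = 0 at hf
    change ∀ᵐ α ∂c.dualMeasure, α ∉ c.A lam → g α = 0 at hg
    change ∀ᵐ α ∂c.dualMeasure, α ∉ c.A lam → (f + g) α = 0
    filter_upwards [Lp.coeFn_add f g, hf, hg] with α h hf hg hα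
    rw [h, Pi.add_apply, hf hα, hg hα, add_zero]
  smul_mem' := by
    intro a f hf
    change ∀ᵐ α ∂c.dualMeasure, α ∉ c.A lam → f α = 0 at hf
    change ∀ᵐ α ∂c.dualMeasure, α ∉ c.A lam → (a • f) α = 0
    filter_upwards [Lp.coeFn_smul a f, hf] with α h hf hα
    rw [h, Pi.smul_apply, hf hα, smul_zero]

/-- The function `ν_φ` on `H / H_{z₀}`, namely
`χ_λ(h) j_λ(h, z₀) ⟨φ K_{z₀}, K_{h · z₀}⟩` with the inner product of `L²(𝔹ⁿ, μ_λ)`. -/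
def nu (φ : Lp ℂ ∞ (bergmanMeasure n lam)) : c.model.X → ℂ :=
  c.descend lam fun h => c.D lam h *
    ∫ z, φ z * bergmanKernel lam z c.base.1 *
      (starRingEnd ℂ) (bergmanKernel lam z ((h : Cover n) • c.base : UnitBall n).1)
      ∂bergmanMeasure n lam

end Chart

/-- The symbol `φ ∈ L^∞(𝔹ⁿ)` is `H`-invariant. -/
def IsInvariant {n : ℕ} {lam : ℝ} (H : Subgroup (SU n)) (φ : Lp ℂ ∞ (bergmanMeasure n lam)) :
    Prop :=
  ∀ h ∈ H, ∀ᵐ z ∂bergmanMeasure n lam, φ (moeb (mat h) z) = φ z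

end BallToeplitz

end

open BallToeplitz

/-! ### The coordinates as a homomorphism on the covering of `H` -/

noncomputable section

namespace BallToeplitz

namespace Model

variable {n : ℕ}

/-! The proof reduces everything to one family of vectors, the reproducing kernels along the orbit
of the base point. For `ξ` in `X` and a lift `h` of `ξ`, let `κ_ξ` be the kernel vector at `h · z₀`
times the conjugate of `χ_λ(h) D_λ(h)` (`Chart.frame`). The coordinates on `H̃` are additive
(`Chart.coord_mul'`) and the kernel is covariant under the covering group
(`Cover.bergmanKernel_smul`). Hence `⟨κ_ξ, κ_η⟩ = φ_H(ξ - η)`, with the kernel conjugate-linear in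
its first slot. For an `H`-invariant symbol the kernel `⟨K_z, T_φ K_w⟩` is covariant as well, so
that `⟨κ_ξ, T_φ κ_η⟩ = ν_φ(ξ - η)`. Both identities are instances of `Chart.descend_sub`.

By the reproducing property `(R f)~(ξ) = ⟨κ_ξ, f⟩`. Consequently `R R*` is convolution with `φ_H`
and `R T_φ R*` is convolution with `ν_φ` (`analysis_conv`). Integrability of `φ_H` makes `R` bounded
by Schur's test. Under the Plancherel transform both operators become multiplications, by
`(2π)^(m/2)` times the transforms of `φ_H` and `ν_φ` (`plancherel_convolution`). The closure of the
range of `R` is the orthogonal complement of `ker R R*`, which the transform carries onto `L²(A)`.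
The operator `R` is injective because the orbit is a set of uniqueness for holomorphic functions
(`Model.eq_zero_of_orbit`), so the polar decomposition of `R*` has a unitary part `U` onto the whole
Bergman space. The square root `S` of `R R*` commutes with `N = R T_φ R*`, and `S U⁻¹ = R`;
therefore `S² (U⁻¹ T_φ U) S = N S`. In the Fourier picture this says that the transform of `φ_H`
times the diagonalised operator is the transform of `ν_φ`, and on `A` one divides. This is
`exists_diagonalization`; the powers of `2π` cancel.

The analytic inputs are these. The reproducing property follows by moving the point to the origin
and applying the mean value property (`inner_kernelVec`). The denominators grow at least linearly in
the noncompact parameters, and there are at most `n < λ` of those, which gives integrability of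
`φ_H`; for `ν_φ` the Forelli–Rudin estimate costs only an arbitrarily small power.

The classification is linear algebra for the form of signature `(1, n)`. Commuting elements have a
common eigenvector that is timelike or null. A timelike one gives the quasi-elliptic case. If a null
one has an eigenvalue of modulus other than one, there is a second null eigenvector, and the case is
quasi-hyperbolic. Otherwise the elements act by eigenvectors and translations on an adapted basis,
and commutativity forces the translation vectors to have real scalar products, which is the
nilpotent family. In each case `H` lies in a conjugate of a standard group; that group is abelian,
so maximality gives equality. -/

lemma hypCore_mul {k : ℕ} (t t' : Fin k → ℂ) (s s' : ℝ) :
    hypCore t s * hypCore t' s' = hypCore (fun i => t i * t' i) (s + s') := by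
  ext i j
  rcases i with (i | i) | i <;> rcases j with (j | j) | j
  case inl.inl.inl.inl =>
    rcases eq_or_ne i j with rfl | h
    · simp [Matrix.mul_apply, Fintype.sum_sum_type, hypCore]
    · simp [Matrix.mul_apply, Fintype.sum_sum_type, hypCore, h]
  all_goals
    simp [Matrix.mul_apply, Fintype.sum_sum_type, hypCore, Complex.cosh_add, Complex.sinh_add,
      add_comm, mul_comm]

lemma nilCore_mul {k l : ℕ} (t t' : Fin k → ℂ) (b b' : Fin l → ℝ) (s s' : ℝ) :
    nilCore t b s * nilCore t' b' s' =
      nilCore (fun i => t i * t' i) (fun i => b i + b' i) (s + s') := by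
  have h1 : ∑ i, Complex.I * (b i : ℂ) * (Complex.I * b' i) = -∑ i, (b i : ℂ) * b' i := by
    rw [← Finset.sum_neg_distrib]
    refine Finset.sum_congr rfl fun i _ => ?_
    linear_combination (b i : ℂ) * b' i * Complex.I_sq
  have h2 : ∑ i, ((b i : ℂ) + b' i) ^ 2 =
      ∑ i, (b i : ℂ) ^ 2 + ∑ i, (b' i : ℂ) ^ 2 + 2 * ∑ i, (b i : ℂ) * b' i := by
    rw [Finset.mul_sum, ← Finset.sum_add_distrib, ← Finset.sum_add_distrib]
    exact Finset.sum_congr rfl fun i _ => by ring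
  ext i j
  rcases i with (i | i | i) | i <;> rcases j with (j | j | j) | j
  case inl.inl.inl.inl =>
    rcases eq_or_ne i j with rfl | h
    · simp [Matrix.mul_apply, Fintype.sum_sum_type, nilCore]
    · simp [Matrix.mul_apply, Fintype.sum_sum_type, nilCore, h]
  case inl.inr.inl.inl.inr.inl =>
    rcases eq_or_ne i j with rfl | h
    · simp [Matrix.mul_apply, Fintype.sum_sum_type, nilCore]
    · simp [Matrix.mul_apply, Fintype.sum_sum_type, nilCore, h]
  all_goals
    simp [Matrix.mul_apply, Fintype.sum_sum_type, nilCore]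
  all_goals
    try rw [h1]
    try rw [h2]
    ring

lemma toCircle_add' (x y : UnitAddCircle) :
    ((x + y).toCircle : ℂ) = x.toCircle * y.toCircle := by
  rw [AddCircle.toCircle_add, Circle.coe_mul]

lemma ellipticCore_mul (t t' : Fin n → ℂ) :
    Matrix.fromBlocks (Matrix.diagonal t) 0 0 (1 : Matrix Unit Unit ℂ) *
      Matrix.fromBlocks (Matrix.diagonal t') 0 0 1 =
      Matrix.fromBlocks (Matrix.diagonal fun i => t i * t' i) 0 0 1 := by
  rw [Matrix.fromBlocks_multiply]
  simp

/-- `A_{ξ + ξ'} = A_ξ A_{ξ'}`. -/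
lemma core_add (M : Model n) (ξ ξ' : M.X) : M.core (ξ + ξ') = M.core ξ * M.core ξ' := by
  cases M with
  | elliptic =>
    refine Eq.trans ?_ (ellipticCore_mul _ _).symm
    simp only [core]
    congr 2
    funext i
    exact toCircle_add' _ _
  | hyperbolic k e =>
    simp only [core, Matrix.reindex_apply, Matrix.submatrix_mul_equiv]
    rw [hypCore_mul]
    congr 2
    funext i
    exact toCircle_add' _ _
  | nilpotent k l e =>
    simp only [core, Matrix.reindex_apply, Matrix.submatrix_mul_equiv]
    rw [nilCore_mul]
    congr 2
    funext i
    exact toCircle_add' _ _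

/-- The denominators at the base point and at the origin agree. -/
lemma den_core_z0 (M : Model n) (ξ : M.X) :
    den (M.core ξ) (M.z0 : Cn n) = M.core ξ (Sum.inr ()) (Sum.inr ()) := by
  rw [Cover.den_eq]
  refine (add_eq_right).mpr (Finset.sum_eq_zero fun i _ => ?_)
  cases M with
  | elliptic => simp [core, Matrix.fromBlocks]
  | hyperbolic k e =>
    obtain ⟨i, rfl⟩ := e.surjective i
    rcases i with i | i <;> simp [core, z0, z0vec, hypCore]
  | nilpotent k l e =>
    obtain ⟨i, rfl⟩ := e.surjective i
    rcases i with i | i | i <;> simp [core, z0, z0vec, nilCore]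

lemma den_core_hyperbolic {k : ℕ} (e : (Fin k ⊕ Unit) ≃ Fin n) (ξ : (hyperbolic k e).X) :
    den ((hyperbolic k e).core ξ) ((hyperbolic k e).z0 : Cn n) =
      (Real.cosh (ξ.2 (0 : Fin 1)) : ℝ) := by
  rw [den_core_z0]
  simp [core, hypCore]

lemma den_core_nilpotent {k l : ℕ} (e : (Fin k ⊕ Fin l ⊕ Unit) ≃ Fin n)
    (ξ : (nilpotent k l e).X) :
    den ((nilpotent k l e).core ξ) ((nilpotent k l e).z0 : Cn n) =
      ((1 + (∑ i : Fin l, (ξ.2 i.castSucc : ℝ) ^ 2) / 2 : ℝ) : ℂ) +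
        ((-(ξ.2 (Fin.last l)) / 2 : ℝ) : ℂ) * Complex.I := by
  rw [den_core_z0]
  simp [core, nilCore]
  ring

lemma den_core_elliptic (ξ : (elliptic : Model n).X) :
    den ((elliptic : Model n).core ξ) ((elliptic : Model n).z0 : Cn n) = 1 := by
  rw [den_core_z0]
  simp [core, Matrix.fromBlocks]

/-- The denominators at the base point stay in the right half plane, where the principal logarithm
is continuous and its imaginary part is below `π / 2`. This is what makes the coordinate `x`
additive. -/
lemma one_le_re_den_core (M : Model n) (ξ : M.X) : 1 ≤ (den (M.core ξ) (M.z0 : Cn n)).re := by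
  cases M with
  | elliptic => rw [den_core_elliptic, Complex.one_re]
  | hyperbolic k e =>
    rw [den_core_hyperbolic, Complex.ofReal_re]
    exact Real.one_le_cosh _
  | nilpotent k l e =>
    rw [den_core_nilpotent, Complex.add_re, Complex.ofReal_re, Complex.re_ofReal_mul,
      Complex.I_re, mul_zero, add_zero]
    have : 0 ≤ ∑ i : Fin l, (ξ.2 i.castSucc : ℝ) ^ 2 := Finset.sum_nonneg fun i _ => sq_nonneg _
    linarith

end Model

/-- The denominator of an element of `SU(n,1)`, divided by its value at the origin, has positive
real part on the ball. -/
lemma re_den_div_pos {n : ℕ} (g : SU n) {z : Cn n} (hz : z ∈ UnitBall n) :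
    0 < (den (mat g) z / mat g (Sum.inr ()) (Sum.inr ())).re := by
  set d := mat g (Sum.inr ()) (Sum.inr ()) with hd
  set w : Cn n → ℂ := fun z => ∑ i, mat g (Sum.inr ()) (Sum.inl i) * z i with hw
  have hden : ∀ z, den (mat g) z = w z + d := Cover.den_eq (mat g)
  have hd0 : d ≠ 0 := by
    have h := den_ne_zero g (z := 0) (by simp)
    rw [hden] at h
    simpa [hw] using h
  have hlt : ‖w z / d‖ < 1 := by
    -- If `|w z| ≥ |d|`, the multiple `(-d / w z) • z` still lies in the ball and is a zero of the
    -- denominator.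
    by_contra hcon
    rw [not_lt, norm_div, one_le_div (norm_pos_iff.mpr hd0)] at hcon
    have hwz : w z ≠ 0 := by
      intro h0
      rw [h0, norm_zero] at hcon
      exact hd0 (norm_le_zero_iff.mp hcon)
    have hc : ‖-d / w z‖ ≤ 1 := by
      rw [norm_div, norm_neg]
      exact div_le_one_of_le₀ hcon (norm_nonneg _)
    refine den_ne_zero g (z := (-d / w z) • z) ?_ ?_
    · have hz' : ‖z‖ < 1 := by simpa using hz
      have : ‖(-d / w z) • z‖ < 1 := by
        rw [norm_smul]
        nlinarith [norm_nonneg z, norm_nonneg (-d / w z)]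
      simpa using this
    · have : w ((-d / w z) • z) = (-d / w z) * w z := by
        simp only [hw, PiLp.smul_apply, smul_eq_mul, Finset.mul_sum]
        exact Finset.sum_congr rfl fun i _ => by ring
      rw [hden, this, div_mul_cancel₀ _ hwz, neg_add_cancel]
  rw [hden, add_div, div_self hd0, Complex.add_re, Complex.one_re]
  have := (abs_le.mp (Complex.abs_re_le_norm (w z / d))).1
  linarith

/-- Logarithms in the right half plane are multiplicative when the product stays there. -/
lemma log_mul_of_re_pos {a b r : ℂ} (ha : 0 < a.re) (hb : 0 < b.re) (hr : 0 < r.re)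
    (hab : 0 < (a * b * r).re) :
    Complex.log (a * b * r) = Complex.log a + Complex.log b + Complex.log r := by
  have h0 : ∀ {x : ℂ}, 0 < x.re → x ≠ 0 := by
    rintro x hx rfl
    simp at hx
  have harg : ∀ {x : ℂ}, 0 < x.re → |(Complex.log x).im| < Real.pi / 2 := by
    intro x hx
    rw [Complex.log_im]
    exact Complex.abs_arg_lt_pi_div_two_iff.mpr (Or.inl hx)
  have h1 : Complex.exp (Complex.log (a * b * r)) =
      Complex.exp (Complex.log a + Complex.log b + Complex.log r) := by
    rw [Complex.exp_log (h0 hab), Complex.exp_add, Complex.exp_add, Complex.exp_log (h0 ha),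
      Complex.exp_log (h0 hb), Complex.exp_log (h0 hr)]
  obtain ⟨N, hN⟩ := Complex.exp_eq_exp_iff_exists_int.mp h1
  have h2 := congrArg Complex.im hN
  have h3 : ((N : ℂ) * (2 * Real.pi * Complex.I)).im = N * (2 * Real.pi) := by simp
  rw [Complex.add_im, Complex.add_im, Complex.add_im, h3] at h2
  have ea := abs_lt.mp (harg ha)
  have eb := abs_lt.mp (harg hb)
  have er := abs_lt.mp (harg hr)
  have ep := abs_lt.mp (harg hab)
  have hpi := Real.pi_pos
  -- The two sides differ by `2πiN`, and four imaginary parts below `π / 2` in modulus give `2π|N| <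
  -- 2π`.
  have hN0 : N = 0 := by
    have h4 : (N : ℝ) < 1 := by nlinarith
    have h5 : (-1 : ℝ) < N := by nlinarith
    have h6 : N < 1 := by exact_mod_cast h4
    have h7 : -1 < N := by exact_mod_cast h5
    omega
  rw [hN, hN0]
  simp

/-- A continuous function on a connected space is constant if its exponential is. -/
lemma eq_of_exp_eq {X : Type*} [TopologicalSpace X] [PreconnectedSpace X] {f : X → ℂ}
    (hf : Continuous f) (hexp : ∀ z w, Complex.exp (f z) = Complex.exp (f w)) (z w : X) :
    f z = f w := by
  choose N hN using fun z => Complex.exp_eq_exp_iff_exists_int.mp (hexp z w)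
  have hNc : Continuous N := by
    have h1 : Continuous fun z => ((N z : ℤ) : ℂ) := by
      have h2 : (fun z => ((N z : ℤ) : ℂ)) = fun z => (f z - f w) / (2 * Real.pi * Complex.I) := by
        funext z
        rw [hN z]
        have hpi : (2 * Real.pi * Complex.I : ℂ) ≠ 0 := by simp [Real.pi_ne_zero]
        field_simp
        ring
      rw [h2]
      fun_prop
    have h3 : Continuous fun z => ((N z : ℤ) : ℝ) := by
      have h4 := Complex.continuous_re.comp h1
      simpa only [Function.comp_def, Complex.intCast_re] using h4
    exact Int.isClosedEmbedding_coe_real.isInducing.continuous_iff.mpr h3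
  have h0 : N w = N z := PreconnectedSpace.constant ‹_› hNc
  have h1 := hN w
  rw [h0] at h1
  have h2 := left_eq_add.mp h1
  rw [hN z, h2, add_zero]

namespace Chart

variable {n : ℕ} {H : Subgroup (SU n)} (c : Chart H)

lemma conj_mul (h k : tilde H) : c.conj (h * k) = c.conj h * c.conj k := by
  simp only [conj, Subgroup.coe_mul]
  group

/-- The quotient of the denominator by its value `d` at the origin has positive real part, so its
principal logarithm is continuous on the ball. It differs from `g.logDen` by a continuous function
whose exponential is the constant `d`, and the ball is connected. -/
lemma continuous_logDen_sub (g : Cover n) (z w : UnitBall n) :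
    g.logDen z - g.logDen w = Complex.log (den (mat g.proj) z / mat g.proj (Sum.inr ()) (Sum.inr ()))
      - Complex.log (den (mat g.proj) w / mat g.proj (Sum.inr ()) (Sum.inr ())) := by
  set d := mat g.proj (Sum.inr ()) (Sum.inr ()) with hd
  have hd0 : d ≠ 0 := by
    intro h
    have := re_den_div_pos g.proj (z := 0) (by simp)
    rw [← hd, h] at this
    simp at this
  set f : UnitBall n → ℂ := fun z => (g.logDen z - Complex.log (den (mat g.proj) z / d)) with hf
  have hcont : Continuous f := by
    refine g.continuous_logDen.sub (Continuous.clog ?_ fun z => Or.inl (re_den_div_pos g.proj z.2))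
    exact ((continuous_den _).comp continuous_subtype_val).div_const d
  have hexp : ∀ z, Complex.exp (f z) = d := by
    intro z
    have h0 := den_ne_zero g.proj z.2
    rw [hf, Complex.exp_sub, g.exp_logDen, Complex.exp_log (div_ne_zero h0 hd0)]
    field_simp
  have : PreconnectedSpace (UnitBall n) :=
    Subtype.preconnectedSpace (convex_ball (0 : Cn n) 1).isPreconnected
  have h := eq_of_exp_eq hcont (fun z w => (hexp z).trans (hexp w).symm) z w
  simp only [hf] at h
  linear_combination h

/-- The coordinates are multiplicative. -/
lemma coord_mul' (h k : tilde H) : c.coord (h * k) = c.coord h + c.coord k := by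
  have h1 := c.coord_spec h
  have h2 := c.coord_spec k
  set ξ := (c.coord h).1
  set η := (c.coord k).1
  have horb := c.coord_orbit h2
  have hA := h1.1
  set x := (c.coord h).2
  set y := (c.coord k).2
  refine c.coord_eq (ξ := ξ + η) (x := x + y) ⟨?_, ?_⟩
  · rw [conj_mul, map_mul, mat_mul, h1.1, h2.1, c.model.core_add, Matrix.smul_mul, Matrix.mul_smul,
      smul_smul, ← Complex.exp_add]
    push_cast
    rw [mul_add]
  · rw [conj_mul, Cover.mul_logDen, ← Cover.smul_def]
    set w := c.conj k • c.model.z0 with hw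
    -- The cocycle evaluates the logarithm for `h` at `w = k · z₀` instead of `z₀`. Since the
    -- denominator at `z₀` equals the lower right entry, the correction is the principal logarithm
    -- of a ratio with positive real part.
    have h3 := continuous_logDen_sub (c.conj h) w c.model.z0
    have hpos := fun z : UnitBall n => re_den_div_pos (c.conj h).proj z.2
    change mat (c.conj h).proj = _ at hA
    simp only [hA, den_smul, Matrix.smul_apply, smul_eq_mul] at h3 hpos
    simp only [mul_div_mul_left _ _ (Complex.exp_ne_zero _)] at h3 hpos
    rw [← Model.den_core_z0 c.model] at h3
    simp_rw [← Model.den_core_z0 c.model] at hpos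
    have hd0 := core_den_ne_zero c.model ξ
    rw [div_self hd0, Complex.log_one, sub_zero] at h3
    have hden : den (c.model.core (ξ + η)) (c.model.z0 : Cn n) =
        den (c.model.core ξ) (c.model.z0 : Cn n) * den (c.model.core η) (c.model.z0 : Cn n) *
          (den (c.model.core ξ) w / den (c.model.core ξ) (c.model.z0 : Cn n)) := by
      rw [c.model.core_add, den_mul _ _ _ (core_den_ne_zero c.model η), hw, horb]
      field_simp
    have hge := c.model.one_le_re_den_core
    -- All three factors in `hden` and their product lie in the right half plane, so the principal
    -- logarithms add without a multiple of `2πi`.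
    have h4 := log_mul_of_re_pos (zero_lt_one.trans_le (hge ξ)) (zero_lt_one.trans_le (hge η))
      (hpos w) (by rw [← hden]; exact zero_lt_one.trans_le (hge (ξ + η)))
    rw [← hden] at h4
    rw [h4, ← h3, h2.2]
    have := h1.2
    push_cast
    linear_combination this

variable (lam : ℝ)

lemma chi_mul (h k : tilde H) : c.chi lam (h * k) = c.chi lam h * c.chi lam k := by
  simp only [chi, coord_mul', Prod.snd_add]
  rw [← Complex.exp_add]
  congr 1
  push_cast
  ring

lemma norm_chi (h : tilde H) : ‖c.chi lam h‖ = 1 := by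
  rw [chi, Complex.norm_exp]
  simp

lemma chi_one : c.chi lam 1 = 1 := by
  have h := c.chi_mul lam 1 1
  rw [mul_one] at h
  have h0 : c.chi lam 1 ≠ 0 := Complex.exp_ne_zero _
  exact (mul_eq_left₀ h0).mp h.symm

lemma coord_one : c.coord 1 = 0 := by
  have h := c.coord_mul' 1 1
  rw [mul_one] at h
  exact left_eq_add.mp h

lemma coord_inv (h : tilde H) : c.coord h⁻¹ = -c.coord h := by
  have h1 := c.coord_mul' h⁻¹ h
  rw [inv_mul_cancel, coord_one] at h1
  exact eq_neg_of_add_eq_zero_left h1.symm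

lemma chi_inv_mul (h k : tilde H) :
    c.chi lam (k⁻¹ * h) = (starRingEnd ℂ) (c.chi lam k) * c.chi lam h := by
  rw [chi_mul]
  congr 1
  have h1 := c.chi_mul lam k⁻¹ k
  rw [inv_mul_cancel, chi_one] at h1
  have h2 : (starRingEnd ℂ) (c.chi lam k) * c.chi lam k = 1 := by
    rw [Complex.conj_mul', norm_chi]
    simp
  have h0 : c.chi lam k ≠ 0 := Complex.exp_ne_zero _
  exact mul_right_cancel₀ h0 (h1.symm.trans h2.symm)

lemma D_mul (h k : tilde H) :
    c.D lam (h * k) = Cover.j lam (h : Cover n) ((k : Cover n) • c.base) * c.D lam k := by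
  rw [D, D, Subgroup.coe_mul, Cover.j_mul]

lemma D_one : c.D lam 1 = 1 := by
  simp [D, Cover.j]

end Chart

end BallToeplitz

end

/-! ### Fourier integrals on Euclidean space and on `𝕋ᵏ × ℝᵐ` -/

noncomputable section

namespace BallToeplitz

section Fourier

open FourierTransform SchwartzMap

variable {V : Type*} [NormedAddCommGroup V] [InnerProductSpace ℝ V] [FiniteDimensional ℝ V]
  [MeasurableSpace V] [BorelSpace V]

lemma integral_fourier_mul_eq {f g : V → ℂ} (hf : Integrable f) (hg : Integrable g) :
    ∫ ξ, 𝓕 f ξ • g ξ = ∫ x, f x • 𝓕 g x := by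
  have h := VectorFourier.integral_fourierIntegral_smul_eq_flip (L := innerₗ V)
    (μ := (volume : Measure V)) (ν := (volume : Measure V))
    Real.continuous_fourierChar continuous_inner hf hg
  rwa [flip_innerₗ] at h

lemma continuous_fourier_integrable {f : V → ℂ} (hf : Integrable f) : Continuous (𝓕 f) :=
  VectorFourier.fourierIntegral_continuous Real.continuous_fourierChar
    (by exact continuous_inner) hf

/-- On `L¹ ∩ L²` the Fourier transform on `L²` is given by the Fourier integral. -/
lemma fourier_L2_ae_eq (f : Lp ℂ 2 (volume : Measure V)) (hf : Integrable f) :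
    Lp.fourierTransformₗᵢ V ℂ f =ᵐ[volume] 𝓕 (f : V → ℂ) := by
  have hloc : LocallyIntegrable (fun x => Lp.fourierTransformₗᵢ V ℂ f x - 𝓕 (f : V → ℂ) x)
      (volume : Measure V) := by
    refine LocallyIntegrable.sub ?_ (continuous_fourier_integrable hf).locallyIntegrable
    exact (Lp.memLp _).locallyIntegrable (by norm_num)
  have h := ae_eq_zero_of_integral_contDiff_smul_eq_zero hloc fun g hg hgc => ?_
  · filter_upwards [h] with x hx
    exact sub_eq_zero.mp hx
  · have hgc' : HasCompactSupport fun x => (g x : ℂ) := hgc.comp_left (g := fun r : ℝ => (r : ℂ)) (by simp)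
    -- A smooth compactly supported test function is a Schwartz function. The distributional
    -- description of the `L²` transform therefore applies to it, and on the other side the
    -- transform of the integrable `f` is moved onto `G`.
    set G : 𝓢(V, ℂ) := hgc'.toSchwartzMap (Complex.ofRealCLM.contDiff.comp hg) with hG
    have hGx : ∀ x, G x = (g x : ℂ) := fun x => rfl
    have h1 := congrArg (fun T : 𝓢'(V, ℂ) => T G) (Lp.fourier_toTemperedDistribution_eq f)
    simp only [TemperedDistribution.fourier_apply, Lp.toTemperedDistribution_apply] at h1
    have h2 := integral_fourier_mul_eq hf G.integrable
    have h3 : ∫ x, (𝓕 G) x • f x = ∫ x, f x • 𝓕 (G : V → ℂ) x := by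
      refine integral_congr_ae (ae_of_all _ fun x => ?_)
      simp only [smul_eq_mul, SchwartzMap.fourier_coe]
      ring
    have hint1 : Integrable fun x => g x • Lp.fourierTransformₗᵢ V ℂ f x :=
      ((Lp.memLp (Lp.fourierTransformₗᵢ V ℂ f)).locallyIntegrable
        (by norm_num)).integrable_smul_left_of_hasCompactSupport hg.continuous hgc
    have hint2 : Integrable fun x => g x • 𝓕 (f : V → ℂ) x :=
      (continuous_fourier_integrable hf).locallyIntegrable.integrable_smul_left_of_hasCompactSupport
        hg.continuous hgc
    simp only [smul_sub]
    rw [integral_sub hint1 hint2, sub_eq_zero]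
    have h4 : ∫ x, g x • Lp.fourierTransformₗᵢ V ℂ f x = ∫ x, G x • (𝓕 f : Lp ℂ 2 (volume : Measure V)) x := by
      refine integral_congr_ae (ae_of_all _ fun x => ?_)
      simp only [hGx, Complex.real_smul, smul_eq_mul]
      rfl
    have h5 : ∫ x, g x • 𝓕 (f : V → ℂ) x = ∫ x, 𝓕 (f : V → ℂ) x • G x := by
      refine integral_congr_ae (ae_of_all _ fun x => ?_)
      simp only [hGx, Complex.real_smul, smul_eq_mul]
      ring
    rw [h4, h5, h2, ← h3, ← h1]

lemma lintegral_fourier_sq {f : V → ℂ} (hf : Integrable f) (hf2 : MemLp f 2) :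
    ∫⁻ ξ, ‖𝓕 f ξ‖ₑ ^ 2 = ∫⁻ x, ‖f x‖ₑ ^ 2 := by
  have hae := hf2.coeFn_toLp
  have h1 := fourier_L2_ae_eq hf2.toLp (hf.congr hae.symm)
  have h2 : 𝓕 (hf2.toLp : V → ℂ) = 𝓕 f := funext fun x => Real.fourier_congr_ae hae x
  rw [h2] at h1
  have h3 := (Lp.fourierTransformₗᵢ V ℂ).norm_map hf2.toLp
  rw [Lp.norm_def, Lp.norm_def, ENNReal.toReal_eq_toReal_iff' (Lp.eLpNorm_ne_top _)
    (Lp.eLpNorm_ne_top _), eLpNorm_congr_ae h1, eLpNorm_congr_ae hae,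
    eLpNorm_eq_lintegral_rpow_enorm_toReal (by norm_num) (by norm_num),
    eLpNorm_eq_lintegral_rpow_enorm_toReal (by norm_num) (by norm_num)] at h3
  have h4 := ENNReal.rpow_left_injective (x := 1 / (2 : ℝ≥0∞).toReal) (by norm_num) h3
  simpa using h4

end Fourier

/-- The group `𝕋ᵏ × ℝᵐ`. -/
abbrev TR (k m : ℕ) : Type := UnitAddTorus (Fin k) × EuclideanSpace ℝ (Fin m)

/-- The dual group `ℤᵏ × ℝᵐ`. -/
abbrev ZR (k m : ℕ) : Type := (Fin k → ℤ) × EuclideanSpace ℝ (Fin m)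

/-- The product of counting measure and Lebesgue measure. -/
abbrev dualVol (k m : ℕ) : Measure (ZR k m) := Measure.count.prod volume

section Plancherel

open FourierTransform SchwartzMap

variable {k m : ℕ}

/-- The Fourier transform of an integrable function on `𝕋ᵏ × ℝᵐ`. -/
def fhat (u : TR k m → ℂ) (α : ZR k m) : ℂ :=
  (((2 * Real.pi) ^ (-(m : ℝ) / 2) : ℝ) : ℂ) *
    ∫ ξ : TR k m, u ξ * UnitAddTorus.mFourier (-α.1) ξ.1 *
      Complex.exp (-Complex.I * (inner ℝ ξ.2 α.2 : ℝ))

/-- The character of `𝕋ᵏ × ℝᵐ` in the Fourier integral. -/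
def fchar (α : ZR k m) (ξ : TR k m) : ℂ :=
  UnitAddTorus.mFourier (-α.1) ξ.1 * Complex.exp (-Complex.I * (inner ℝ ξ.2 α.2 : ℝ))

lemma norm_mFourier (a : Fin k → ℤ) (t : UnitAddTorus (Fin k)) :
    ‖UnitAddTorus.mFourier a t‖ = 1 := by
  simp only [UnitAddTorus.mFourier, ContinuousMap.coe_mk, norm_prod]
  exact Finset.prod_eq_one fun i _ => Circle.norm_coe _

lemma norm_exp_I_inner (r : ℝ) : ‖Complex.exp (-Complex.I * (r : ℂ))‖ = 1 := by
  rw [Complex.norm_exp]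
  simp

lemma norm_fchar (α : ZR k m) (ξ : TR k m) : ‖fchar α ξ‖ = 1 := by
  rw [fchar, norm_mul, norm_mFourier, norm_exp_I_inner, one_mul]

lemma continuous_mFourier_neg : Continuous fun p : (Fin k → ℤ) × UnitAddTorus (Fin k) =>
    UnitAddTorus.mFourier (-p.1) p.2 :=
  continuous_prod_of_discrete_left.mpr fun a => (UnitAddTorus.mFourier (-a)).continuous

lemma continuous_fchar : Continuous fun p : ZR k m × TR k m => fchar p.1 p.2 := by
  have h2 : Continuous fun p : ZR k m × TR k m => UnitAddTorus.mFourier (-p.1.1) p.2.1 :=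
    Continuous.comp (g := fun p : (Fin k → ℤ) × UnitAddTorus (Fin k) =>
      UnitAddTorus.mFourier (-p.1) p.2) (f := fun p : ZR k m × TR k m => (p.1.1, p.2.1))
      continuous_mFourier_neg
      ((continuous_fst.comp continuous_fst).prodMk (continuous_fst.comp continuous_snd))
  have h3 : Continuous fun p : ZR k m × TR k m => (inner ℝ p.2.2 p.1.2 : ℝ) :=
    (continuous_snd.comp continuous_snd).inner (continuous_snd.comp continuous_fst)
  have h4 : Continuous fun p : ZR k m × TR k m =>
      Complex.exp (-Complex.I * (inner ℝ p.2.2 p.1.2 : ℝ)) :=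
    Complex.continuous_exp.comp (continuous_const.mul (Complex.continuous_ofReal.comp h3))
  exact Continuous.mul h2 h4

lemma continuous_fchar_left (ξ : TR k m) : Continuous fun α : ZR k m => fchar α ξ :=
  Continuous.comp (g := fun p : ZR k m × TR k m => fchar p.1 p.2) (f := fun α => (α, ξ))
    continuous_fchar (Continuous.prodMk_left ξ)

lemma continuous_fchar_right (α : ZR k m) : Continuous fun ξ : TR k m => fchar α ξ :=
  Continuous.comp (g := fun p : ZR k m × TR k m => fchar p.1 p.2) (f := fun ξ => (α, ξ))
    continuous_fchar (Continuous.prodMk_right α)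

lemma fhat_eq (u : TR k m → ℂ) (α : ZR k m) :
    fhat u α = (((2 * Real.pi) ^ (-(m : ℝ) / 2) : ℝ) : ℂ) * ∫ ξ, u ξ * fchar α ξ := by
  simp only [fhat, fchar, mul_assoc]

lemma fchar_add (α : ZR k m) (ξ η : TR k m) : fchar α (ξ + η) = fchar α ξ * fchar α η := by
  have h1 : UnitAddTorus.mFourier (-α.1) (ξ.1 + η.1) =
      UnitAddTorus.mFourier (-α.1) ξ.1 * UnitAddTorus.mFourier (-α.1) η.1 := by
    simp only [UnitAddTorus.mFourier, ContinuousMap.coe_mk, ← Finset.prod_mul_distrib]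
    refine Finset.prod_congr rfl fun i _ => ?_
    simp only [fourier_apply, Pi.add_apply, smul_add]
    exact Model.toCircle_add' _ _
  simp only [fchar, Prod.fst_add, Prod.snd_add, h1, inner_add_left]
  push_cast
  rw [mul_add, Complex.exp_add]
  ring

lemma integrable_mul_fchar {u : TR k m → ℂ} (hu : Integrable u) (α : ZR k m) :
    Integrable fun ξ => u ξ * fchar α ξ := by
  refine hu.mul_bdd (c := 1) ?_ (ae_of_all _ fun ξ => (norm_fchar α ξ).le)
  exact (continuous_fchar_right α).aestronglyMeasurable

lemma norm_fhat_le (u : TR k m → ℂ) (α : ZR k m) :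
    ‖fhat u α‖ ≤ (2 * Real.pi) ^ (-(m : ℝ) / 2) * ∫ ξ, ‖u ξ‖ := by
  rw [fhat_eq, norm_mul, Complex.norm_real, Real.norm_of_nonneg (by positivity)]
  refine mul_le_mul_of_nonneg_left ?_ (by positivity)
  refine (norm_integral_le_integral_norm _).trans (le_of_eq ?_)
  simp [norm_fchar]

lemma continuous_fhat {u : TR k m → ℂ} (hu : Integrable u) : Continuous (fhat u) := by
  have h : fhat u = fun α => (((2 * Real.pi) ^ (-(m : ℝ) / 2) : ℝ) : ℂ) * ∫ ξ, u ξ * fchar α ξ :=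
    funext (fhat_eq u)
  rw [h]
  have hc : Continuous fun α : ZR k m => ∫ ξ, u ξ * fchar α ξ := by
    refine continuous_of_dominated (bound := fun ξ => ‖u ξ‖)
      (fun α => (integrable_mul_fchar hu α).aestronglyMeasurable) (fun α => ae_of_all _ fun ξ => ?_)
      hu.norm (ae_of_all _ fun ξ => ?_)
    · rw [norm_mul, norm_fchar, mul_one]
    · exact (continuous_fchar_left ξ).const_mul (u ξ)
  exact hc.const_mul _

end Plancherel

end BallToeplitz

end

/-! ### Parseval on the torus and the isometry of the Fourier transform -/

noncomputable section

namespace BallToeplitz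

/-- Two densely defined maps with the same norms extend to a unitary. -/
lemma exists_isometryEquiv_of_norm_eq {D E F : Type*} [AddCommGroup D] [Module ℂ D]
    [NormedAddCommGroup E] [NormedSpace ℂ E] [CompleteSpace E]
    [NormedAddCommGroup F] [NormedSpace ℂ F] [CompleteSpace F]
    (e₁ : D →ₗ[ℂ] E) (e₂ : D →ₗ[ℂ] F) (h₁ : DenseRange e₁) (h₂ : DenseRange e₂)
    (h : ∀ x, ‖e₂ x‖ = ‖e₁ x‖) : ∃ P : E ≃ₗᵢ[ℂ] F, ∀ x, P (e₁ x) = e₂ x :=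
  ⟨(LinearEquiv.refl ℂ D).extendOfIsometry e₁ e₂ h₁ h₂ h, fun x =>
    LinearEquiv.extendOfIsometry_eq _ e₁ e₂ h₁ h₂ h x⟩

lemma lintegral_comp_smul_eq {V : Type*} [NormedAddCommGroup V] [NormedSpace ℝ V]
    [FiniteDimensional ℝ V] [MeasurableSpace V] [BorelSpace V] (μ : Measure V)
    [μ.IsAddHaarMeasure] (f : V → ℝ≥0∞) {r : ℝ} (hr : r ≠ 0) :
    ∫⁻ x, f (r • x) ∂μ = ENNReal.ofReal |(r ^ Module.finrank ℝ V)⁻¹| * ∫⁻ x, f x ∂μ := by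
  have h := Measure.map_addHaar_smul μ hr
  have he : MeasurableEmbedding fun x : V => r • x :=
    (Homeomorph.smulOfNeZero r hr).measurableEmbedding
  rw [← he.lintegral_map, h, lintegral_smul_measure, smul_eq_mul]

/-- The circle `ℝ/ℤ` has length one, so Lebesgue measure on it is already the normalised Haar
measure for which the characters are orthonormal. -/
lemma pi_haarAddCircle (k : ℕ) :
    Measure.pi (fun _ : Fin k => (AddCircle.haarAddCircle : Measure UnitAddCircle)) = volume := by
  rw [volume_pi]
  congr 1
  funext _
  rw [AddCircle.volume_eq_smul_haarAddCircle, ENNReal.ofReal_one, one_smul]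

lemma tsum_sq_mFourierCoeff_haar {k : ℕ} {f : UnitAddTorus (Fin k) → ℂ}
    (hf : MemLp f 2 (Measure.pi fun _ => AddCircle.haarAddCircle)) :
    ∑' a, ‖∫ t, f t * UnitAddTorus.mFourier (-a) t
      ∂(Measure.pi fun _ => AddCircle.haarAddCircle)‖ₑ ^ 2 =
      ∫⁻ t, ‖f t‖ₑ ^ 2 ∂(Measure.pi fun _ => AddCircle.haarAddCircle) := by
  set μ : Measure (UnitAddTorus (Fin k)) := Measure.pi fun _ => AddCircle.haarAddCircle with hμ
  have hae := hf.coeFn_toLp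
  have h1 := UnitAddTorus.hasSum_sq_mFourierCoeff (d := Fin k) (hf.toLp f)
  have h2 : ∀ a, UnitAddTorus.mFourierCoeff (hf.toLp f) a =
      ∫ t, f t * UnitAddTorus.mFourier (-a) t ∂μ := by
    intro a
    refine integral_congr_ae ?_
    refine Filter.Eventually.mono hae fun t ht => ?_
    simp only [smul_eq_mul]
    rw [ht, mul_comm]
  have h3 : ∫ t, ‖(hf.toLp f) t‖ ^ 2 ∂μ = ∫ t, ‖f t‖ ^ 2 ∂μ := by
    refine integral_congr_ae ?_
    filter_upwards [hae] with t ht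
    rw [ht]
  simp only [h2] at h1
  replace h1 : HasSum _ (∫ t, ‖f t‖ ^ 2 ∂μ) := h3 ▸ h1
  have h4 : Integrable (fun t => ‖f t‖ ^ 2) μ := hf.integrable_norm_pow (by norm_num)
  have h5 : ∀ z : ℂ, ‖z‖ₑ ^ 2 = ENNReal.ofReal (‖z‖ ^ 2) := fun z => by
    rw [← ofReal_norm, ENNReal.ofReal_pow (norm_nonneg _)]
  simp only [h5]
  rw [← ofReal_integral_eq_lintegral_ofReal h4 (ae_of_all _ fun t => by positivity), ← h1.tsum_eq,
    ENNReal.ofReal_tsum_of_nonneg (fun a => by positivity) h1.summable]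

lemma tsum_sq_mFourierCoeff {k : ℕ} {f : UnitAddTorus (Fin k) → ℂ} (hf : MemLp f 2) :
    ∑' a, ‖∫ t, f t * UnitAddTorus.mFourier (-a) t‖ₑ ^ 2 = ∫⁻ t, ‖f t‖ₑ ^ 2 := by
  rw [← pi_haarAddCircle] at hf ⊢
  exact tsum_sq_mFourierCoeff_haar hf

section Plancherel

open FourierTransform SchwartzMap

variable {k m : ℕ}

/-- The partial Fourier coefficient in the torus variables. -/
def torusCoeff (u : TR k m → ℂ) (a : Fin k → ℤ) (y : EuclideanSpace ℝ (Fin m)) : ℂ :=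
  ∫ t, u (t, y) * UnitAddTorus.mFourier (-a) t

lemma integrable_mul_mFourier {u : TR k m → ℂ} (hu : Integrable u) (a : Fin k → ℤ) :
    Integrable fun ξ : TR k m => u ξ * UnitAddTorus.mFourier (-a) ξ.1 := by
  refine hu.mul_bdd (c := 1) ?_ (ae_of_all _ fun ξ => (norm_mFourier _ ξ.1).le)
  exact ((UnitAddTorus.mFourier (-a)).continuous.comp continuous_fst).aestronglyMeasurable

lemma integrable_torusCoeff {u : TR k m → ℂ} (hu : Integrable u) (a : Fin k → ℤ) :
    Integrable (torusCoeff u a) := by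
  have h := integrable_mul_mFourier hu a
  rw [Measure.volume_eq_prod] at h
  exact h.integral_prod_right

/-- Fubini integrates the torus variables first. The dilation by `(2π)⁻¹` translates between the
phases `e^{-i⟨y, η⟩}` and `e^{-2πi⟨y, η⟩}`. -/
lemma fhat_eq_fourier {u : TR k m → ℂ} (hu : Integrable u) (a : Fin k → ℤ)
    (η : EuclideanSpace ℝ (Fin m)) :
    fhat u (a, η) = (((2 * Real.pi) ^ (-(m : ℝ) / 2) : ℝ) : ℂ) *
      𝓕 (torusCoeff u a) ((2 * Real.pi)⁻¹ • η) := by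
  have h := integrable_mul_fchar hu (a, η)
  rw [fhat_eq]
  congr 1
  rw [Measure.volume_eq_prod] at h ⊢
  rw [integral_prod_symm _ h, Real.fourier_eq']
  refine integral_congr_ae (ae_of_all _ fun y => ?_)
  have hpi : (Real.pi : ℂ) ≠ 0 := by exact_mod_cast Real.pi_ne_zero
  simp only [fchar, torusCoeff, smul_eq_mul, ← mul_assoc]
  rw [integral_mul_const, mul_comm]
  congr 2
  rw [inner_smul_right]
  push_cast
  field_simp

/-- Parseval's identity on the torus holds on almost every fibre over `y`, since almost every fibre
of an `L²` function is in `L²`; Tonelli then integrates over `y`. -/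
lemma lintegral_torusCoeff_sq {u : TR k m → ℂ} (hu : Integrable u) (hu2 : MemLp u 2) :
    ∑' a, ∫⁻ y, ‖torusCoeff u a y‖ₑ ^ 2 = ∫⁻ ξ, ‖u ξ‖ₑ ^ 2 := by
  rw [← lintegral_tsum fun a => ((integrable_torusCoeff hu a).aestronglyMeasurable.enorm.pow_const 2)]
  have hmeas : AEMeasurable (fun ξ => ‖u ξ‖ₑ ^ 2) (volume : Measure (TR k m)) :=
    hu.aestronglyMeasurable.enorm.pow_const 2
  rw [Measure.volume_eq_prod] at hmeas ⊢
  rw [lintegral_prod_symm _ hmeas]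
  have hu' := hu.aestronglyMeasurable
  have hsq : ∫⁻ ξ, ‖u ξ‖ₑ ^ 2 ≠ ∞ := by
    have := hu2.eLpNorm_ne_top
    have h2 := (eLpNorm_lt_top_iff_lintegral_rpow_enorm_lt_top (p := 2) (by norm_num) (by norm_num)).mp
      hu2.2
    simpa using h2.ne
  rw [Measure.volume_eq_prod] at hu' hsq
  have hfin : ∀ᵐ y : EuclideanSpace ℝ (Fin m), ∫⁻ t : UnitAddTorus (Fin k), ‖u (t, y)‖ₑ ^ 2 < ∞ := by
    refine ae_lt_top' hmeas.lintegral_prod_left' ?_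
    rwa [← lintegral_prod_symm _ hmeas]
  have hsec : ∀ᵐ y : EuclideanSpace ℝ (Fin m),
      AEStronglyMeasurable (fun t : UnitAddTorus (Fin k) => u (t, y)) := by
    exact hu'.prodMk_right
  refine lintegral_congr_ae ?_
  filter_upwards [hfin, hsec] with y h1 h2
  refine tsum_sq_mFourierCoeff ⟨h2, ?_⟩
  refine (eLpNorm_lt_top_iff_lintegral_rpow_enorm_lt_top (p := 2) (by norm_num) (by norm_num)).mpr ?_
  simpa using h1

/-- Plancherel's theorem on `L¹ ∩ L²`. -/
lemma lintegral_fhat_sq {u : TR k m → ℂ} (hu : Integrable u) (hu2 : MemLp u 2) :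
    ∫⁻ α, ‖fhat u α‖ₑ ^ 2 ∂(dualVol k m) = ∫⁻ ξ, ‖u ξ‖ₑ ^ 2 := by
  have hmeas : AEMeasurable (fun α => ‖fhat u α‖ₑ ^ 2) (dualVol k m) :=
    ((continuous_fhat hu).measurable.enorm.pow_const 2).aemeasurable
  rw [lintegral_prod _ hmeas, lintegral_count, ← lintegral_torusCoeff_sq hu hu2]
  congr 1
  funext a
  have hfin : ∫⁻ y, ‖torusCoeff u a y‖ₑ ^ 2 < ∞ := by
    refine (ENNReal.le_tsum (f := fun a => ∫⁻ y, ‖torusCoeff u a y‖ₑ ^ 2) a).trans_lt ?_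
    rw [lintegral_torusCoeff_sq hu hu2]
    have h2 := (eLpNorm_lt_top_iff_lintegral_rpow_enorm_lt_top (p := 2) (by norm_num) (by norm_num)).mp
      hu2.2
    simpa using h2
  have hc2 : MemLp (torusCoeff u a) 2 := by
    refine ⟨(integrable_torusCoeff hu a).aestronglyMeasurable, ?_⟩
    refine (eLpNorm_lt_top_iff_lintegral_rpow_enorm_lt_top (p := 2) (by norm_num) (by norm_num)).mpr ?_
    simpa using hfin
  rw [← lintegral_fourier_sq (integrable_torusCoeff hu a) hc2]
  simp only [fhat_eq_fourier hu, enorm_mul, mul_pow]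
  rw [lintegral_const_mul' _ _ (by finiteness),
    lintegral_comp_smul_eq volume (fun η => ‖𝓕 (torusCoeff u a) η‖ₑ ^ 2) (by positivity),
    ← mul_assoc]
  -- The dilation contributes `(2π)^m`, which cancels the square of the normalising factor
  -- `(2π)^(-m/2)`.
  convert one_mul _
  have hpos : (0 : ℝ) < 2 * Real.pi := by positivity
  rw [← ofReal_norm, ← ENNReal.ofReal_pow (norm_nonneg _), ← ENNReal.ofReal_mul (by positivity),
    Complex.norm_real, Real.norm_of_nonneg (by positivity), finrank_euclideanSpace_fin,
    abs_of_pos (by positivity), inv_pow, inv_inv, ← Real.rpow_natCast (_ ^ _) 2,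
    ← Real.rpow_mul hpos.le, ← Real.rpow_natCast (2 * Real.pi) m, ← Real.rpow_add hpos]
  have : (-(m : ℝ) / 2 * (2 : ℕ) + m) = 0 := by push_cast; ring
  rw [this, Real.rpow_zero, ENNReal.ofReal_one]

lemma memLp_fhat {u : TR k m → ℂ} (hu : Integrable u) (hu2 : MemLp u 2) :
    MemLp (fhat u) 2 (dualVol k m) := by
  refine ⟨(continuous_fhat hu).measurable.aestronglyMeasurable, ?_⟩
  refine (eLpNorm_lt_top_iff_lintegral_rpow_enorm_lt_top (p := 2) (by norm_num) (by norm_num)).mpr ?_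
  have h2 := (eLpNorm_lt_top_iff_lintegral_rpow_enorm_lt_top (p := 2) (by norm_num) (by norm_num)).mp
      hu2.2
  have h3 := lintegral_fhat_sq hu hu2
  simp only [ENNReal.toReal_ofNat, ENNReal.rpow_ofNat] at h2 ⊢
  rwa [h3]

lemma eLpNorm_fhat {u : TR k m → ℂ} (hu : Integrable u) (hu2 : MemLp u 2) :
    eLpNorm (fhat u) 2 (dualVol k m) = eLpNorm u 2 volume := by
  rw [eLpNorm_eq_lintegral_rpow_enorm_toReal (by norm_num) (by norm_num),
    eLpNorm_eq_lintegral_rpow_enorm_toReal (by norm_num) (by norm_num)]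
  simp only [ENNReal.toReal_ofNat, ENNReal.rpow_ofNat]
  rw [lintegral_fhat_sq hu hu2]

lemma fhat_congr_ae {u v : TR k m → ℂ} (h : u =ᵐ[volume] v) : fhat u = fhat v := by
  funext α
  rw [fhat_eq, fhat_eq]
  congr 1
  refine integral_congr_ae ?_
  filter_upwards [h] with ξ hξ
  rw [hξ]

lemma fhat_add {u v : TR k m → ℂ} (hu : Integrable u) (hv : Integrable v) :
    fhat (u + v) = fhat u + fhat v := by
  funext α
  simp only [fhat_eq, Pi.add_apply, add_mul]
  rw [integral_add (integrable_mul_fchar hu α) (integrable_mul_fchar hv α), mul_add]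

lemma fhat_smul (a : ℂ) (u : TR k m → ℂ) : fhat (a • u) = a • fhat u := by
  funext α
  simp only [fhat_eq, Pi.smul_apply, smul_eq_mul, mul_assoc]
  rw [integral_const_mul]
  ring

/-- The integrable elements of `L²`. -/
def integrableLp (k m : ℕ) : Submodule ℂ (Lp ℂ 2 (volume : Measure (TR k m))) where
  carrier := {u | Integrable u volume}
  zero_mem' := (integrable_zero _ _ _).congr (Lp.coeFn_zero _ _ _).symm
  add_mem' := by
    intro u v hu hv
    have hu' : Integrable u volume := hu
    have hv' : Integrable v volume := hv
    exact (hu'.add hv').congr (Lp.coeFn_add u v).symm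
  smul_mem' := by
    intro c u hu
    have hu' : Integrable u volume := hu
    exact (hu'.smul c).congr (Lp.coeFn_smul c u).symm

/-- Simple functions in `L²` are supported on sets of finite measure, hence integrable, and they are
dense. -/
lemma dense_integrableLp : DenseRange (integrableLp k m).subtype := by
  have h := Lp.simpleFunc.denseRange (E := ℂ) (p := 2) (μ := (volume : Measure (TR k m)))
    (by norm_num)
  refine Dense.mono ?_ h
  rintro _ ⟨f, rfl⟩
  refine ⟨⟨f, ?_⟩, rfl⟩
  have h1 := Lp.simpleFunc.memLp f
  have h2 := (SimpleFunc.memLp_iff_integrable (by norm_num) (by norm_num)).mp h1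
  exact h2.congr (Lp.simpleFunc.toSimpleFunc_eq_toFun f)

/-- The Fourier transform on `L¹ ∩ L²`. -/
def fhatLp (k m : ℕ) : integrableLp k m →ₗ[ℂ] Lp ℂ 2 (dualVol k m) where
  toFun u := (memLp_fhat u.2 (Lp.memLp u.1)).toLp
  map_add' u v := by
    rw [← MemLp.toLp_add]
    refine MemLp.toLp_congr _ _ (Filter.EventuallyEq.of_eq ?_)
    rw [← fhat_add u.2 v.2]
    exact fhat_congr_ae (Lp.coeFn_add _ _)
  map_smul' a u := by
    rw [RingHom.id_apply, ← MemLp.toLp_const_smul]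
    refine MemLp.toLp_congr _ _ (Filter.EventuallyEq.of_eq ?_)
    rw [← fhat_smul]
    exact fhat_congr_ae (Lp.coeFn_smul _ _)

end Plancherel

end BallToeplitz

end

/-! ### Plancherel's theorem and convolution operators -/

noncomputable section

namespace BallToeplitz

section Plancherel

open FourierTransform SchwartzMap

variable {k m : ℕ}

lemma integral_mFourier_mul_haar (a b : Fin k → ℤ) :
    ∫ t : UnitAddTorus (Fin k), UnitAddTorus.mFourier b t * UnitAddTorus.mFourier (-a) t
      ∂(Measure.pi fun _ => AddCircle.haarAddCircle) = if a = b then 1 else 0 := by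
  have h := orthonormal_iff_ite.mp (UnitAddTorus.orthonormal_mFourier (d := Fin k)) a b
  simp only [UnitAddTorus.mFourierLp, ContinuousMap.inner_toLp] at h
  rw [← h]
  refine integral_congr_ae (ae_of_all _ fun t => ?_)
  simp only [UnitAddTorus.mFourier_neg]

lemma integral_mFourier_mul (a b : Fin k → ℤ) :
    ∫ t : UnitAddTorus (Fin k), UnitAddTorus.mFourier b t * UnitAddTorus.mFourier (-a) t =
      if a = b then 1 else 0 := by
  rw [← pi_haarAddCircle]
  exact integral_mFourier_mul_haar a b

/-- For a product with counting measure, a measurable property holds almost everywhere as soon as it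
holds almost everywhere on each slice. -/
lemma dualVol_ae {p : ZR k m → Prop} (hp : MeasurableSet {x | p x})
    (h : ∀ a, ∀ᵐ η, p (a, η)) : ∀ᵐ α ∂(dualVol k m), p α :=
  (Measure.ae_prod_iff_ae_ae hp).mpr (ae_of_all _ h)

lemma integral_count_single {F : (Fin k → ℤ) → ℂ} (b : Fin k → ℤ) (hF : ∀ a, a ≠ b → F a = 0) :
    ∫ a, F a ∂Measure.count = F b := by
  rw [← setIntegral_eq_integral_of_forall_compl_eq_zero (s := {b}) fun a ha => hF a (by simpa using ha)]
  rw [integral_singleton]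
  simp [Measure.real]

/-- A vector orthogonal to the range is tested against transforms of functions `t^b g(y)`. These are
supported on the slice of index `b`, and `g` can be chosen so that an arbitrary smooth compactly
supported function appears there. Hence every slice of the vector vanishes almost everywhere. -/
lemma dense_range_fhatLp : DenseRange (fhatLp k m) := by
  have hr : (LinearMap.range (fhatLp k m)).topologicalClosure = ⊤ := by
    rw [Submodule.topologicalClosure_eq_top_iff, Submodule.eq_bot_iff]
    intro v hv
    have hvm : StronglyMeasurable v := Lp.stronglyMeasurable v
    have hv2 : ∀ a, MemLp (fun η => v (a, η)) 2 := by
      intro a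
      refine ⟨(hvm.comp_measurable measurable_prodMk_left).aestronglyMeasurable, ?_⟩
      refine (eLpNorm_lt_top_iff_lintegral_rpow_enorm_lt_top (p := 2) (by norm_num) (by norm_num)).mpr ?_
      have h2 := (eLpNorm_lt_top_iff_lintegral_rpow_enorm_lt_top (p := 2) (by norm_num) (by norm_num)).mp
        (Lp.memLp v).2
      rw [lintegral_prod _ (hvm.measurable.enorm.pow_const _).aemeasurable, lintegral_count] at h2
      exact (ENNReal.le_tsum (f := fun a => ∫⁻ η, ‖v (a, η)‖ₑ ^ (2 : ℝ≥0∞).toReal) a).trans_lt h2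
    have hz : ∀ b, ∀ᵐ η, v (b, η) = 0 := by
      intro b
      refine ae_eq_zero_of_integral_contDiff_smul_eq_zero
        ((hv2 b).locallyIntegrable (by norm_num)) fun φ hφ hφc => ?_
      have hpi : (2 * Real.pi : ℝ) ≠ 0 := by positivity
      -- The dilation by `2π` undoes the one in `fhat_eq_fourier`, so that the transform of `u` on
      -- the slice `b` is a constant multiple of `φ` itself.
      set ψ : EuclideanSpace ℝ (Fin m) → ℂ := fun η => (φ ((2 * Real.pi) • η) : ℂ) with hψ
      have hψc : HasCompactSupport ψ :=
        (hφc.comp_homeomorph (Homeomorph.smulOfNeZero (2 * Real.pi) hpi)).comp_left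
          (g := fun r : ℝ => (r : ℂ)) (by simp)
      have hψd : ContDiff ℝ ((⊤ : ℕ∞) : WithTop ℕ∞) ψ :=
        Complex.ofRealCLM.contDiff.comp (hφ.comp (contDiff_const_smul _))
      set G : 𝓢(EuclideanSpace ℝ (Fin m), ℂ) := hψc.toSchwartzMap hψd with hG
      set g : 𝓢(EuclideanSpace ℝ (Fin m), ℂ) := 𝓕⁻ G with hg
      have hFg : 𝓕 (g : EuclideanSpace ℝ (Fin m) → ℂ) = ψ := by
        rw [← SchwartzMap.fourier_coe, hg, FourierTransform.fourier_fourierInv_eq]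
        rfl
      set u : TR k m → ℂ := fun ξ => UnitAddTorus.mFourier b ξ.1 * g ξ.2 with hu
      have hui : Integrable u := by
        have h1 : Integrable (fun t : UnitAddTorus (Fin k) => UnitAddTorus.mFourier b t) :=
          (UnitAddTorus.mFourier b).continuous.integrable_of_hasCompactSupport
            (HasCompactSupport.of_compactSpace _)
        exact h1.mul_prod g.integrable
      have hu2 : MemLp u 2 := by
        rw [memLp_two_iff_integrable_sq_norm hui.aestronglyMeasurable]
        have h1 : Integrable (fun _ : UnitAddTorus (Fin k) => (1 : ℝ)) := integrable_const _
        have h2 : Integrable fun y => ‖g y‖ ^ 2 := (g.memLp 2).integrable_norm_pow (by norm_num)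
        refine (h1.mul_prod h2).congr (ae_of_all _ fun ξ => ?_)
        simp only [hu, norm_mul, norm_mFourier, one_mul]
      have htc : ∀ a, torusCoeff u a = fun y => (if a = b then 1 else 0) * g y := by
        intro a
        funext y
        rw [← integral_mFourier_mul a b, ← integral_mul_const]
        refine integral_congr_ae (ae_of_all _ fun t => ?_)
        simp only [hu]
        ring
      have hfh : ∀ a η, fhat u (a, η) =
          if a = b then (((2 * Real.pi) ^ (-(m : ℝ) / 2) : ℝ) : ℂ) * φ η else 0 := by
        intro a η
        rw [fhat_eq_fourier hui, htc]
        split_ifs with h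
        · simp only [one_mul]
          rw [hFg, hψ]
          simp only [smul_smul, mul_inv_cancel₀ hpi, one_smul]
        · simp [Real.fourier_eq]
      set w : integrableLp k m := ⟨hu2.toLp, hui.congr hu2.coeFn_toLp.symm⟩ with hw
      have hwv := (Submodule.mem_orthogonal _ _).mp hv (fhatLp k m w) ⟨w, rfl⟩
      have hwae : fhatLp k m w =ᵐ[dualVol k m] fhat u := by
        refine (memLp_fhat w.2 (Lp.memLp w.1)).coeFn_toLp.trans (Filter.EventuallyEq.of_eq ?_)
        exact fhat_congr_ae hu2.coeFn_toLp
      have hint := L2.integrable_inner (𝕜 := ℂ) (fhatLp k m w) v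
      rw [L2.inner_def, integral_prod _ hint] at hwv
      have h3 : ∫ a, ∫ η, inner ℂ (fhatLp k m w (a, η)) (v (a, η)) ∂volume ∂Measure.count =
          ∫ a, ∫ η, v (a, η) * (starRingEnd ℂ) (fhat u (a, η)) ∂volume ∂Measure.count := by
        refine integral_congr_ae ?_
        filter_upwards [Measure.ae_ae_of_ae_prod hwae] with a ha
        refine integral_congr_ae ?_
        filter_upwards [ha] with η hη
        rw [hη, RCLike.inner_apply]
      rw [h3, integral_count_single b] at hwv
      · simp only [hfh, if_true, map_mul, Complex.conj_ofReal] at hwv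
        have h4 : ∫ η, v (b, η) * ((((2 * Real.pi) ^ (-(m : ℝ) / 2) : ℝ) : ℂ) * φ η) =
            (((2 * Real.pi) ^ (-(m : ℝ) / 2) : ℝ) : ℂ) * ∫ η, φ η • v (b, η) := by
          rw [← integral_const_mul]
          refine integral_congr_ae (ae_of_all _ fun η => ?_)
          simp only [Complex.real_smul]
          ring
        rw [h4, mul_eq_zero] at hwv
        refine hwv.resolve_left ?_
        exact_mod_cast (Real.rpow_pos_of_pos (by positivity) _).ne'
      · intro a ha
        simp [hfh, ha]
    have hz' : ∀ᵐ α ∂(dualVol k m), v α = 0 :=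
      dualVol_ae (measurableSet_eq_fun hvm.measurable measurable_const) hz
    exact Lp.eq_zero_iff_ae_eq_zero.mpr hz'
  rw [Submodule.topologicalClosure_eq_top_iff, ← Submodule.topologicalClosure_eq_top_iff] at hr
  intro x
  have := (Submodule.mem_top (R := ℂ) (x := x))
  rw [← hr] at this
  exact this

/-- **Plancherel's theorem** for `𝕋ᵏ × ℝᵐ`. -/
lemma exists_plancherel (k m : ℕ) :
    ∃ P : Lp ℂ 2 (volume : Measure (TR k m)) ≃ₗᵢ[ℂ] Lp ℂ 2 (dualVol k m),
      ∀ u : Lp ℂ 2 (volume : Measure (TR k m)), Integrable u → P u =ᵐ[dualVol k m] fhat u := by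
  obtain ⟨P, hP⟩ := exists_isometryEquiv_of_norm_eq (integrableLp k m).subtype (fhatLp k m)
    dense_integrableLp dense_range_fhatLp fun u => by
      change ‖(memLp_fhat u.2 (Lp.memLp u.1)).toLp‖ = ‖u.1‖
      rw [Lp.norm_toLp, Lp.norm_def, eLpNorm_fhat u.2 (Lp.memLp u.1)]
  refine ⟨P, fun u hu => ?_⟩
  have h := hP ⟨u, hu⟩
  change P u = _ at h
  rw [h]
  exact (memLp_fhat hu (Lp.memLp u)).coeFn_toLp

instance : (volume : Measure (TR k m)).IsAddRightInvariant := by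
  have h1 : (volume : Measure (UnitAddTorus (Fin k))).IsAddLeftInvariant :=
    inferInstanceAs (Measure.pi fun _ : Fin k => (volume : Measure UnitAddCircle)).IsAddLeftInvariant
  have h2 : (volume : Measure (TR k m)).IsAddLeftInvariant :=
    Measure.prod.instIsAddLeftInvariant (μ := (volume : Measure (UnitAddTorus (Fin k))))
      (ν := (volume : Measure (EuclideanSpace ℝ (Fin m))))
  infer_instance

/-- Characters are multiplicative, so their integral against a convolution factors. The left side
carries one normalising factor `(2π)^(-m/2)` and the right side two, whence the constant
`(2π)^(m/2)`. -/
lemma fhat_convolution {u ν : TR k m → ℂ} (hu : Integrable u) (hν : Integrable ν) (α : ZR k m) :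
    fhat (fun ξ => ∫ η, u η * ν (ξ - η)) α =
      (((2 * Real.pi) ^ ((m : ℝ) / 2) : ℝ) : ℂ) * fhat ν α * fhat u α := by
  have h := integral_convolution (μ := (volume : Measure (TR k m)))
    (ν := (volume : Measure (TR k m))) (ContinuousLinearMap.mul ℂ ℂ)
    (integrable_mul_fchar hu α) (integrable_mul_fchar hν α)
  have h1 : ∫ ξ, (∫ η, u η * ν (ξ - η)) * fchar α ξ = (∫ ξ, u ξ * fchar α ξ) * ∫ ξ, ν ξ * fchar α ξ := by
    refine Eq.trans (integral_congr_ae (ae_of_all _ fun ξ => ?_)) h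
    simp only [convolution_def, ContinuousLinearMap.mul_apply']
    rw [← integral_mul_const]
    refine integral_congr_ae (ae_of_all _ fun η => ?_)
    have h2 := fchar_add α η (ξ - η)
    rw [add_sub_cancel] at h2
    simp only [h2]
    ring
  simp only [fhat_eq]
  rw [h1]
  have hc : (((2 * Real.pi) ^ ((m : ℝ) / 2) : ℝ) : ℂ) *
      (((2 * Real.pi) ^ (-(m : ℝ) / 2) : ℝ) : ℂ) = 1 := by
    rw [← Complex.ofReal_mul, ← Real.rpow_add (by positivity)]
    have : (m : ℝ) / 2 + -(m : ℝ) / 2 = 0 := by ring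
    rw [this, Real.rpow_zero, Complex.ofReal_one]
  linear_combination (-(((2 * Real.pi) ^ (-(m : ℝ) / 2) : ℝ) : ℂ) * (∫ ξ, u ξ * fchar α ξ) *
    ∫ ξ, ν ξ * fchar α ξ) * hc

lemma integrable_convolution {u ν : TR k m → ℂ} (hu : Integrable u) (hν : Integrable ν) :
    Integrable fun ξ => ∫ η, u η * ν (ξ - η) :=
  Integrable.integrable_convolution (ContinuousLinearMap.mul ℂ ℂ) hu hν

end Plancherel

/-- Multiplication by an essentially bounded function on `L²`. -/
def mulBdd {α : Type*} [MeasurableSpace α] {μ : Measure α} {b : α → ℂ} (hb : MemLp b ∞ μ) :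
    Lp ℂ 2 μ →L[ℂ] Lp ℂ 2 μ :=
  (ContinuousLinearMap.mul ℂ ℂ).holderL μ ∞ 2 2 hb.toLp

lemma mulBdd_ae {α : Type*} [MeasurableSpace α] {μ : Measure α} {b : α → ℂ} (hb : MemLp b ∞ μ)
    (f : Lp ℂ 2 μ) : mulBdd hb f =ᵐ[μ] fun x => b x * f x := by
  have h := (ContinuousLinearMap.mul ℂ ℂ).coeFn_holder (r := 2) hb.toLp f
  filter_upwards [h, hb.coeFn_toLp] with x hx hb
  refine hx.trans ?_
  rw [hb]
  rfl

lemma memLp_top_fhat {k m : ℕ} {ν : TR k m → ℂ} (hν : Integrable ν) :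
    MemLp (fhat ν) ∞ (dualVol k m) :=
  memLp_top_of_bound (continuous_fhat hν).measurable.aestronglyMeasurable _
    (ae_of_all _ (norm_fhat_le ν))

/-- A bounded operator on `L²` that is a convolution becomes a multiplication operator. -/
lemma plancherel_convolution {k m : ℕ}
    (P : Lp ℂ 2 (volume : Measure (TR k m)) ≃ₗᵢ[ℂ] Lp ℂ 2 (dualVol k m))
    (hP : ∀ u : Lp ℂ 2 (volume : Measure (TR k m)), Integrable u → P u =ᵐ[dualVol k m] fhat u)
    {ν : TR k m → ℂ} (hν : Integrable ν)
    (N : Lp ℂ 2 (volume : Measure (TR k m)) →L[ℂ] Lp ℂ 2 (volume : Measure (TR k m)))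
    (hN : ∀ u, N u =ᵐ[volume] fun ξ => ∫ η, u η * ν (ξ - η))
    (u : Lp ℂ 2 (volume : Measure (TR k m))) :
    P (N u) = (((2 * Real.pi) ^ ((m : ℝ) / 2) : ℝ) : ℂ) • mulBdd (memLp_top_fhat hν) (P u) := by
  have hd := dense_integrableLp (k := k) (m := m)
  have hc : Continuous fun u : Lp ℂ 2 (volume : Measure (TR k m)) =>
      mulBdd (memLp_top_fhat hν) (P u) :=
    (mulBdd (memLp_top_fhat hν)).continuous.comp P.continuous
  -- Both sides are continuous in `u`, so it suffices to compare them on integrable `u`, where the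
  -- Fourier integrals are available.
  have heq := hd.equalizer (g := fun u => P (N u))
    (h := fun u : Lp ℂ 2 (volume : Measure (TR k m)) =>
      (((2 * Real.pi) ^ ((m : ℝ) / 2) : ℝ) : ℂ) • mulBdd (memLp_top_fhat hν) (P u))
    (P.continuous.comp N.continuous)
    (by fun_prop) ?_
  · exact congrFun heq u
  · funext ⟨u, hu⟩
    have hu' : Integrable u := hu
    change P (N u) = (((2 * Real.pi) ^ ((m : ℝ) / 2) : ℝ) : ℂ) • mulBdd (memLp_top_fhat hν) (P u)
    have hNi : Integrable (N u) := (integrable_convolution hu' hν).congr (hN u).symm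
    refine Lp.ext ?_
    filter_upwards [hP _ hNi, hP u hu', mulBdd_ae (memLp_top_fhat hν) (P u),
      Lp.coeFn_smul (((2 * Real.pi) ^ ((m : ℝ) / 2) : ℝ) : ℂ) (mulBdd (memLp_top_fhat hν) (P u))]
      with α h1 h2 h3 h4
    rw [h1, h4, Pi.smul_apply, h3, h2, fhat_congr_ae (hN u), fhat_convolution hu' hν, smul_eq_mul,
      mul_assoc]

end BallToeplitz

end

/-! ### Frames with a translation invariant Gram kernel -/

noncomputable section

namespace BallToeplitz

section Frame

variable {E : Type*} [NormedAddCommGroup E] [InnerProductSpace ℂ E] {k m : ℕ}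
  {κ : TR k m → E} {φ : TR k m → ℂ}

lemma norm_sq_frame (hκ : ∀ ξ η, inner ℂ (κ ξ) (κ η) = φ (ξ - η)) (ξ : TR k m) :
    ‖κ ξ‖ ^ 2 = (φ 0).re := by
  have h := inner_self_eq_norm_sq (𝕜 := ℂ) (κ ξ)
  rw [hκ, sub_self] at h
  exact h.symm

lemma norm_frame_le (hκ : ∀ ξ η, inner ℂ (κ ξ) (κ η) = φ (ξ - η)) (ξ : TR k m) :
    ‖κ ξ‖ ≤ Real.sqrt (φ 0).re := by
  rw [← norm_sq_frame hκ ξ, Real.sqrt_sq (norm_nonneg _)]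

/-- Expanding the square gives `‖κ ξ - κ η‖² = 2 Re φ(0) - 2 Re φ(ξ - η)`, so continuity of `φ` is
enough for norm continuity of the frame. -/
lemma continuous_frame (hκ : ∀ ξ η, inner ℂ (κ ξ) (κ η) = φ (ξ - η)) (hφ : Continuous φ) :
    Continuous κ := by
  rw [continuous_iff_continuousAt]
  intro η
  rw [ContinuousAt, tendsto_iff_norm_sub_tendsto_zero]
  have h1 : ∀ ξ, ‖κ ξ - κ η‖ ^ 2 = 2 * (φ 0).re - 2 * (φ (ξ - η)).re := by
    intro ξ
    rw [@norm_sub_sq ℂ, norm_sq_frame hκ, norm_sq_frame hκ, hκ]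
    change (φ 0).re - 2 * (φ (ξ - η)).re + (φ 0).re = _
    ring
  have h2 : Tendsto (fun ξ => ‖κ ξ - κ η‖ ^ 2) (𝓝 η) (𝓝 0) := by
    simp only [h1]
    have h3 : Continuous fun ξ => 2 * (φ 0).re - 2 * (φ (ξ - η)).re :=
      continuous_const.sub (continuous_const.mul
        (Complex.continuous_re.comp (hφ.comp (continuous_id.sub continuous_const))))
    have h4 := h3.tendsto η
    simpa using h4
  have h5 := h2.sqrt
  simpa [Real.sqrt_sq (norm_nonneg _)] using h5

lemma norm_neg_frame (hκ : ∀ ξ η, inner ℂ (κ ξ) (κ η) = φ (ξ - η)) (ξ : TR k m) :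
    ‖φ (-ξ)‖ = ‖φ ξ‖ := by
  have h1 := hκ 0 ξ
  have h2 := hκ ξ 0
  rw [zero_sub] at h1
  rw [sub_zero] at h2
  rw [← h1, ← h2, norm_inner_symm]

/-- Schur's test for a convolution kernel. -/
lemma lintegral_lintegral_mul_le {a p : TR k m → ℝ≥0∞} (ha : Measurable a) (hp : Measurable p)
    (hneg : ∀ ξ, p (-ξ) = p ξ) :
    ∫⁻ ξ, ∫⁻ η, a ξ * a η * p (ξ - η) ≤ (∫⁻ ξ, p ξ) * ∫⁻ ξ, a ξ ^ 2 := by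
  have hin : ∀ ξ : TR k m, ∫⁻ η, p (ξ - η) = ∫⁻ η, p η := by
    intro ξ
    rw [← lintegral_sub_right_eq_self p ξ]
    refine lintegral_congr fun η => ?_
    rw [← hneg, neg_sub]
  have hin' : ∀ η : TR k m, ∫⁻ ξ, p (ξ - η) = ∫⁻ ξ, p ξ := fun η =>
    lintegral_sub_right_eq_self p η
  have hpm : Measurable fun q : TR k m × TR k m => p (q.1 - q.2) :=
    hp.comp (measurable_fst.sub measurable_snd)
  -- Splitting the product by the arithmetic-geometric mean leaves two terms, each with a single
  -- function `a`; the other variable is integrated out against the kernel.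
  have hle : ∀ x y : ℝ≥0∞, x * y ≤ (x ^ 2 + y ^ 2) / 2 := by
    intro x y
    rw [ENNReal.le_div_iff_mul_le (by norm_num) (by norm_num)]
    rcases eq_or_ne x ∞ with rfl | hx
    · simp
    rcases eq_or_ne y ∞ with rfl | hy
    · simp
    lift x to ℝ≥0 using hx
    lift y to ℝ≥0 using hy
    norm_cast
    have h := two_mul_le_add_sq (x : ℝ) y
    have h' : (x : ℝ) * y * 2 ≤ x ^ 2 + y ^ 2 := by linarith
    exact_mod_cast h'
  calc ∫⁻ ξ, ∫⁻ η, a ξ * a η * p (ξ - η)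
      ≤ ∫⁻ ξ, ∫⁻ η, (2⁻¹ * (a ξ ^ 2 * p (ξ - η)) + 2⁻¹ * (a η ^ 2 * p (ξ - η))) := by
        refine lintegral_mono fun ξ => lintegral_mono fun η => ?_
        have h := mul_le_mul_left (hle (a ξ) (a η)) (p (ξ - η))
        refine h.trans (le_of_eq ?_)
        rw [ENNReal.div_eq_inv_mul]
        ring
    _ = ∫⁻ ξ, ((∫⁻ η, 2⁻¹ * (a ξ ^ 2 * p (ξ - η))) + ∫⁻ η, 2⁻¹ * (a η ^ 2 * p (ξ - η))) := by
        refine lintegral_congr fun ξ => lintegral_add_left ?_ _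
        exact ((hpm.comp measurable_prodMk_left).const_mul _).const_mul _
    _ = (∫⁻ ξ, ∫⁻ η, 2⁻¹ * (a ξ ^ 2 * p (ξ - η))) +
          ∫⁻ ξ, ∫⁻ η, 2⁻¹ * (a η ^ 2 * p (ξ - η)) := by
        refine lintegral_add_left ?_ _
        exact Measurable.lintegral_prod_right'
          ((((ha.comp measurable_fst).pow_const 2).mul hpm).const_mul _)
    _ = 2⁻¹ * ((∫⁻ ξ, p ξ) * ∫⁻ ξ, a ξ ^ 2) + 2⁻¹ * ((∫⁻ ξ, p ξ) * ∫⁻ ξ, a ξ ^ 2) := by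
        congr 1
        · simp_rw [lintegral_const_mul' _ _ (by norm_num : (2⁻¹ : ℝ≥0∞) ≠ ∞)]
          congr 1
          rw [← lintegral_const_mul _ (ha.pow_const 2)]
          refine lintegral_congr fun ξ => ?_
          have hm : Measurable fun η => p (ξ - η) := hpm.comp measurable_prodMk_left
          rw [lintegral_const_mul _ hm]
          rw [hin, mul_comm]
        · rw [lintegral_lintegral_swap]
          · simp_rw [lintegral_const_mul' _ _ (by norm_num : (2⁻¹ : ℝ≥0∞) ≠ ∞)]
            congr 1
            rw [← lintegral_const_mul _ (ha.pow_const 2)]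
            refine lintegral_congr fun η => ?_
            have hm : Measurable fun ξ => p (ξ - η) := hp.comp (measurable_id.sub_const η)
            rw [lintegral_const_mul _ hm]
            rw [hin', mul_comm]
          · exact ((((ha.comp measurable_snd).pow_const 2).mul hpm).const_mul _).aemeasurable
    _ = (∫⁻ ξ, p ξ) * ∫⁻ ξ, a ξ ^ 2 := by
        rw [← add_mul, ENNReal.inv_two_add_inv_two, one_mul]

variable [CompleteSpace E]

/-- The analysis of a vector with respect to the frame, on a set of finite measure. -/
lemma setLIntegral_frame_sq_le (hκ : ∀ ξ η, inner ℂ (κ ξ) (κ η) = φ (ξ - η)) (hφc : Continuous φ)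
    (f : E) {s : Set (TR k m)} (hs : MeasurableSet s) (hsf : volume s ≠ ∞) :
    ∫⁻ ξ in s, ‖inner ℂ (κ ξ) f‖ₑ ^ 2 ≤ (∫⁻ ξ, ‖φ ξ‖ₑ) * ‖f‖ₑ ^ 2 := by
  have hκc := continuous_frame hκ hφc
  have hgc : Continuous fun ξ => inner ℂ (κ ξ) f := hκc.inner continuous_const
  -- The coefficients of `f` are cut off to a set of finite measure, where they are bounded. This
  -- makes the synthesised vector `v` a genuine Bochner integral and `A` finite, so that `A` can be
  -- cancelled at the end.
  set u : TR k m → ℂ := s.indicator fun ξ => inner ℂ (κ ξ) f with hu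
  have hum : Measurable u := hgc.measurable.indicator hs
  have hbound : ∀ ξ, ‖inner ℂ (κ ξ) f‖ ≤ Real.sqrt (φ 0).re * ‖f‖ := fun ξ =>
    (norm_inner_le_norm _ _).trans (mul_le_mul_of_nonneg_right (norm_frame_le hκ ξ) (norm_nonneg _))
  have hui : Integrable u := by
    rw [hu, integrable_indicator_iff hs]
    exact Measure.integrableOn_of_bounded hsf hgc.aestronglyMeasurable (ae_of_all _ hbound)
  have huκ : Integrable fun ξ => u ξ • κ ξ := by
    refine (hui.norm.mul_const (Real.sqrt (φ 0).re)).mono'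
      (hum.aestronglyMeasurable.smul hκc.aestronglyMeasurable) (ae_of_all _ fun ξ => ?_)
    rw [norm_smul]
    exact mul_le_mul_of_nonneg_left (norm_frame_le hκ ξ) (norm_nonneg _)
  set v : E := ∫ ξ, u ξ • κ ξ with hv
  set A : ℝ≥0∞ := ∫⁻ ξ in s, ‖inner ℂ (κ ξ) f‖ₑ ^ 2 with hA
  have husq : ∫⁻ ξ, ‖u ξ‖ₑ ^ 2 = A := by
    rw [hA, ← lintegral_indicator hs]
    refine lintegral_congr fun ξ => ?_
    by_cases h : ξ ∈ s <;> simp [hu, h]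
  have hAf : A ≠ ∞ := by
    rw [hA]
    refine (lt_of_le_of_lt (setLIntegral_mono (g := fun _ => (ENNReal.ofReal (Real.sqrt (φ 0).re * ‖f‖)) ^ 2)
      measurable_const fun ξ _ => ?_) ?_).ne
    · gcongr
      rw [← ofReal_norm]
      exact ENNReal.ofReal_le_ofReal (hbound ξ)
    · rw [setLIntegral_const]
      exact ENNReal.mul_lt_top (by finiteness) hsf.lt_top
  -- `⟨f, v⟩ = A`
  have h1 : inner ℂ f v = (A.toReal : ℂ) := by
    rw [hv, ← integral_inner huκ]
    have h2 : ∀ ξ, inner ℂ f (u ξ • κ ξ) = ((‖u ξ‖ ^ 2 : ℝ) : ℂ) := by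
      intro ξ
      rw [inner_smul_right, ← inner_conj_symm]
      by_cases h : ξ ∈ s
      · simp only [hu, Set.indicator_of_mem h]
        rw [Complex.mul_conj']
        push_cast
        rfl
      · simp [hu, h]
    simp only [h2]
    rw [integral_complex_ofReal]
    congr 1
    rw [integral_eq_lintegral_of_nonneg_ae (ae_of_all _ fun ξ => by positivity)
      (hum.norm.pow_const 2).aestronglyMeasurable, ← husq]
    congr 1
    refine lintegral_congr fun ξ => ?_
    rw [ENNReal.ofReal_pow (norm_nonneg _), ofReal_norm]
  have h3 : A ≤ ‖f‖ₑ * ‖v‖ₑ := by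
    have h4 := norm_inner_le_norm (𝕜 := ℂ) f v
    rw [h1, Complex.norm_real, Real.norm_of_nonneg ENNReal.toReal_nonneg] at h4
    rw [← ENNReal.ofReal_toReal hAf, ← ofReal_norm, ← ofReal_norm,
      ← ENNReal.ofReal_mul (norm_nonneg _)]
    exact ENNReal.ofReal_le_ofReal h4
  -- Expanding `⟨v, v⟩` produces the double integral of `u` against the convolution kernel `φ`, to
  -- which Schur's test applies. Combined with `A = ⟨f, v⟩ ≤ ‖f‖ ‖v‖`, this bounds `A²` by a
  -- multiple of `A`.
  have h5 : ‖v‖ₑ ^ 2 ≤ (∫⁻ ξ, ‖φ ξ‖ₑ) * A := by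
    have h6 : ‖v‖ₑ ^ 2 = ‖inner ℂ v v‖ₑ := by
      rw [inner_self_eq_norm_sq_to_K, enorm_pow]
      congr 1
      rw [← ofReal_norm, ← ofReal_norm]
      simp
    have h7 : ∀ ξ, inner ℂ v (u ξ • κ ξ) = ∫ η, (starRingEnd ℂ) (u η) * (u ξ * φ (η - ξ)) := by
      intro ξ
      rw [← inner_conj_symm, hv, ← integral_inner huκ, ← integral_conj]
      refine integral_congr_ae (ae_of_all _ fun η => ?_)
      change (starRingEnd ℂ) (inner ℂ (u ξ • κ ξ) (u η • κ η)) = _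
      rw [inner_conj_symm, inner_smul_left, inner_smul_right, hκ]
    calc ‖v‖ₑ ^ 2 = ‖∫ ξ, ∫ η, (starRingEnd ℂ) (u η) * (u ξ * φ (η - ξ))‖ₑ := by
          rw [h6]
          nth_rw 2 [hv]
          rw [← integral_inner huκ]
          simp only [h7]
      _ ≤ ∫⁻ ξ, ‖∫ η, (starRingEnd ℂ) (u η) * (u ξ * φ (η - ξ))‖ₑ :=
          enorm_integral_le_lintegral_enorm _
      _ ≤ ∫⁻ ξ, ∫⁻ η, ‖(starRingEnd ℂ) (u η) * (u ξ * φ (η - ξ))‖ₑ :=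
          lintegral_mono fun ξ => enorm_integral_le_lintegral_enorm _
      _ = ∫⁻ ξ, ∫⁻ η, ‖u ξ‖ₑ * ‖u η‖ₑ * ‖φ (ξ - η)‖ₑ := by
          refine lintegral_congr fun ξ => lintegral_congr fun η => ?_
          have h8 : ‖φ (η - ξ)‖ₑ = ‖φ (ξ - η)‖ₑ := by
            rw [← ofReal_norm, ← ofReal_norm, ← neg_sub, norm_neg_frame hκ]
          rw [enorm_mul, enorm_mul, h8, RCLike.enorm_conj]
          ring
      _ ≤ (∫⁻ ξ, ‖φ ξ‖ₑ) * ∫⁻ ξ, ‖u ξ‖ₑ ^ 2 := by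
          refine lintegral_lintegral_mul_le hum.enorm hφc.measurable.enorm fun ξ => ?_
          rw [← ofReal_norm, ← ofReal_norm, norm_neg_frame hκ]
      _ = (∫⁻ ξ, ‖φ ξ‖ₑ) * A := by rw [husq]
  rcases eq_or_ne A 0 with h0 | h0
  · rw [h0]
    exact zero_le
  · have h9 : A * A ≤ (∫⁻ ξ, ‖φ ξ‖ₑ) * ‖f‖ₑ ^ 2 * A := by
      calc A * A ≤ (‖f‖ₑ * ‖v‖ₑ) * (‖f‖ₑ * ‖v‖ₑ) := mul_le_mul' h3 h3
        _ = ‖f‖ₑ ^ 2 * ‖v‖ₑ ^ 2 := by ring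
        _ ≤ ‖f‖ₑ ^ 2 * ((∫⁻ ξ, ‖φ ξ‖ₑ) * A) := mul_le_mul' le_rfl h5
        _ = _ := by ring
    exact (ENNReal.mul_le_mul_iff_left h0 hAf).mp h9

/-- The bound on sets of finite measure does not depend on the set, so it passes to the union of an
exhaustion. -/
lemma lintegral_frame_sq_le (hκ : ∀ ξ η, inner ℂ (κ ξ) (κ η) = φ (ξ - η)) (hφc : Continuous φ)
    (f : E) :
    ∫⁻ ξ, ‖inner ℂ (κ ξ) f‖ₑ ^ 2 ≤ (∫⁻ ξ, ‖φ ξ‖ₑ) * ‖f‖ₑ ^ 2 := by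
  have hU := iUnion_spanningSets (volume : Measure (TR k m))
  have h := setLIntegral_iUnion_of_directed (μ := (volume : Measure (TR k m)))
    (fun ξ => ‖inner ℂ (κ ξ) f‖ₑ ^ 2) (s := spanningSets volume)
    (monotone_spanningSets volume).directed_le
  rw [hU, setLIntegral_univ] at h
  rw [h]
  exact iSup_le fun i => setLIntegral_frame_sq_le hκ hφc f (measurableSet_spanningSets _ i)
    (measure_spanningSets_lt_top _ i).ne

lemma memLp_frame (hκ : ∀ ξ η, inner ℂ (κ ξ) (κ η) = φ (ξ - η)) (hφc : Continuous φ)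
    (hφ : Integrable φ) (f : E) : MemLp (fun ξ => inner ℂ (κ ξ) f) 2 := by
  refine ⟨((continuous_frame hκ hφc).inner continuous_const).aestronglyMeasurable, ?_⟩
  refine (eLpNorm_lt_top_iff_lintegral_rpow_enorm_lt_top (p := 2) (by norm_num) (by norm_num)).mpr ?_
  simp only [ENNReal.toReal_ofNat, ENNReal.rpow_ofNat]
  refine (lintegral_frame_sq_le hκ hφc f).trans_lt ?_
  exact ENNReal.mul_lt_top hφ.2 (by finiteness)

/-- The analysis operator of the frame. -/
lemma exists_analysis (hκ : ∀ ξ η, inner ℂ (κ ξ) (κ η) = φ (ξ - η)) (hφc : Continuous φ)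
    (hφ : Integrable φ) :
    ∃ R : E →L[ℂ] Lp ℂ 2 (volume : Measure (TR k m)),
      ∀ f, R f = (memLp_frame hκ hφc hφ f).toLp := by
  let R₀ : E →ₗ[ℂ] Lp ℂ 2 (volume : Measure (TR k m)) :=
    { toFun := fun f => (memLp_frame hκ hφc hφ f).toLp
      map_add' := fun f g => by
        rw [← MemLp.toLp_add]
        congr 1
        funext ξ
        simp
      map_smul' := fun a f => by
        rw [RingHom.id_apply, ← MemLp.toLp_const_smul]
        congr 1
        funext ξ
        simp }
  refine ⟨R₀.mkContinuous (Real.sqrt (∫⁻ ξ, ‖φ ξ‖ₑ).toReal) fun f => ?_, fun f => rfl⟩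
  change ‖(memLp_frame hκ hφc hφ f).toLp‖ ≤ _
  have hfin : (∫⁻ ξ, ‖φ ξ‖ₑ) ≠ ∞ := hφ.2.ne
  have h := lintegral_frame_sq_le hκ hφc f
  rw [Lp.norm_toLp, eLpNorm_eq_lintegral_rpow_enorm_toReal (by norm_num) (by norm_num)]
  simp only [ENNReal.toReal_ofNat, ENNReal.rpow_ofNat]
  have h2 : ((∫⁻ ξ, ‖inner ℂ (κ ξ) f‖ₑ ^ 2) ^ (1 / 2 : ℝ)).toReal ≤
      (((∫⁻ ξ, ‖φ ξ‖ₑ) * ‖f‖ₑ ^ 2) ^ (1 / 2 : ℝ)).toReal := by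
    refine ENNReal.toReal_mono ?_ (ENNReal.rpow_le_rpow h (by norm_num))
    exact ENNReal.rpow_ne_top_of_nonneg (by norm_num) (ENNReal.mul_ne_top hfin (by finiteness))
  refine h2.trans (le_of_eq ?_)
  rw [← ENNReal.toReal_rpow, ENNReal.toReal_mul, ← Real.sqrt_eq_rpow,
    Real.sqrt_mul ENNReal.toReal_nonneg, ENNReal.toReal_pow, toReal_enorm,
    Real.sqrt_sq (norm_nonneg _)]

/-- The operator `R T R*` is a convolution operator if `T` is invariant. -/
lemma analysis_conv (R : E →L[ℂ] Lp ℂ 2 (volume : Measure (TR k m)))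
    (hR : ∀ f, R f =ᵐ[volume] fun ξ => inner ℂ (κ ξ) f) (T : E →L[ℂ] E) {ν : TR k m → ℂ}
    (hν : ∀ ξ η, inner ℂ (κ ξ) (T (κ η)) = ν (ξ - η))
    (u : Lp ℂ 2 (volume : Measure (TR k m))) :
    R (T (R.adjoint u)) =ᵐ[volume] fun ξ => ∫ η, u η * ν (ξ - η) := by
  filter_upwards [hR (T (R.adjoint u))] with ξ hξ
  -- Moving `T` and `R*` to the first slot gives `⟨κ ξ, T R* u⟩ = ⟨R T* κ ξ, u⟩`, an `L²` inner
  -- product whose integrand is known explicitly.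
  rw [hξ, ← ContinuousLinearMap.adjoint_inner_left, ContinuousLinearMap.adjoint_inner_right,
    L2.inner_def]
  refine integral_congr_ae ?_
  filter_upwards [hR (T.adjoint (κ ξ))] with η hη
  rw [RCLike.inner_apply, hη, inner_conj_symm, ContinuousLinearMap.adjoint_inner_left, hν]

end Frame

end BallToeplitz

end

/-! ### Polar decomposition of the adjoint of the restriction operator -/

noncomputable section

namespace BallToeplitz

section Polar

variable {E L : Type*} [NormedAddCommGroup E] [InnerProductSpace ℂ E] [CompleteSpace E]
  [NormedAddCommGroup L] [InnerProductSpace ℂ L] [CompleteSpace L]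

lemma nonneg_comp_adjoint (R : E →L[ℂ] L) : 0 ≤ R ∘L R.adjoint := by
  rw [ContinuousLinearMap.nonneg_iff_isPositive]
  exact ContinuousLinearMap.isPositive_self_comp_adjoint R

lemma posSqrt_mul_self (R : E →L[ℂ] L) :
    posSqrt (R ∘L R.adjoint) * posSqrt (R ∘L R.adjoint) = R ∘L R.adjoint :=
  CFC.sqrt_mul_sqrt_self _ (nonneg_comp_adjoint R)

lemma inner_posSqrt (A : L →L[ℂ] L) (f g : L) :
    inner ℂ (posSqrt A f) g = inner ℂ f (posSqrt A g) := by
  have h : IsSelfAdjoint (posSqrt A) := IsSelfAdjoint.of_nonneg (CFC.sqrt_nonneg A)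
  rw [← ContinuousLinearMap.adjoint_inner_right, ← ContinuousLinearMap.star_eq_adjoint, h.star_eq]

/-- With `S` the self-adjoint square root, `‖S f‖² = ⟨f, R R* f⟩ = ‖R* f‖²`. In particular `S` and
`R*` have the same kernel, and `S f ↦ R* f` is well defined and isometric. -/
lemma norm_posSqrt (R : E →L[ℂ] L) (f : L) :
    ‖posSqrt (R ∘L R.adjoint) f‖ = ‖R.adjoint f‖ := by
  have h : ‖posSqrt (R ∘L R.adjoint) f‖ ^ 2 = ‖R.adjoint f‖ ^ 2 := by
    rw [← inner_self_eq_norm_sq (𝕜 := ℂ), ← inner_self_eq_norm_sq (𝕜 := ℂ), inner_posSqrt]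
    have h1 : posSqrt (R ∘L R.adjoint) (posSqrt (R ∘L R.adjoint) f) = R (R.adjoint f) :=
      congrArg (fun T : L →L[ℂ] L => T f) (posSqrt_mul_self R)
    rw [h1, ContinuousLinearMap.adjoint_inner_left]
  exact (sq_eq_sq₀ (norm_nonneg _) (norm_nonneg _)).mp h

/-- The closure of the range is the double orthogonal complement, and the orthogonal complement of
the range is the kernel of the adjoint. -/
lemma mem_range_closure_iff (R : E →L[ℂ] L) (g : L) :
    g ∈ (LinearMap.range (R : E →ₗ[ℂ] L)).topologicalClosure ↔
      ∀ f, R.adjoint f = 0 → inner ℂ f g = 0 := by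
  rw [← Submodule.orthogonal_orthogonal_eq_closure, Submodule.mem_orthogonal]
  refine forall_congr' fun f => imp_congr_left ?_
  rw [Submodule.mem_orthogonal]
  constructor
  · intro h
    refine ext_inner_left ℂ fun x => ?_
    rw [ContinuousLinearMap.adjoint_inner_right, inner_zero_right]
    exact h _ ⟨x, rfl⟩
  · rintro h _ ⟨x, rfl⟩
    change inner ℂ (R x) f = 0
    rw [← ContinuousLinearMap.adjoint_inner_right, h, inner_zero_right]

lemma posSqrt_mem (R : E →L[ℂ] L) (f : L) :
    posSqrt (R ∘L R.adjoint) f ∈ (LinearMap.range (R : E →ₗ[ℂ] L)).topologicalClosure := by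
  rw [mem_range_closure_iff]
  intro g hg
  have h : posSqrt (R ∘L R.adjoint) g = 0 := by
    rw [← norm_eq_zero, norm_posSqrt, hg, norm_zero]
  rw [← inner_posSqrt, h, inner_zero_left]

/-- The square root as a map into the closure of the range. -/
def posSqrtB (R : E →L[ℂ] L) :
    L →ₗ[ℂ] (LinearMap.range (R : E →ₗ[ℂ] L)).topologicalClosure :=
  (posSqrt (R ∘L R.adjoint) : L →ₗ[ℂ] L).codRestrict _ (posSqrt_mem R)

lemma denseRange_of_forall_inner {D F : Type*} [AddCommGroup D] [Module ℂ D]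
    [NormedAddCommGroup F] [InnerProductSpace ℂ F] [CompleteSpace F] (e : D →ₗ[ℂ] F)
    (h : ∀ v, (∀ x, inner ℂ (e x) v = 0) → v = 0) : DenseRange e := by
  have hr : (LinearMap.range e).topologicalClosure = ⊤ := by
    rw [Submodule.topologicalClosure_eq_top_iff, Submodule.eq_bot_iff]
    intro v hv
    exact h v fun x => (Submodule.mem_orthogonal _ _).mp hv _ ⟨x, rfl⟩
  intro x
  have := (Submodule.mem_top (R := ℂ) (x := x))
  rw [← hr] at this
  exact this

/-- A vector of the closed range that is orthogonal to the range of `S` is killed by `S`, hence by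
`R*`; it is then orthogonal to itself. -/
lemma denseRange_posSqrtB (R : E →L[ℂ] L) : DenseRange (posSqrtB R) := by
  have : CompleteSpace (LinearMap.range (R : E →ₗ[ℂ] L)).topologicalClosure :=
    (Submodule.isClosed_topologicalClosure _).completeSpace_coe
  refine denseRange_of_forall_inner _ fun v hv => ?_
  have h1 : ∀ f, inner ℂ f (posSqrt (R ∘L R.adjoint) v) = 0 := fun f => by
    rw [← inner_posSqrt]
    exact hv f
  have h2 : posSqrt (R ∘L R.adjoint) v = 0 := inner_self_eq_zero (𝕜 := ℂ).mp (h1 _)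
  have h3 : R.adjoint (v : L) = 0 := by
    rw [← norm_eq_zero, ← norm_posSqrt, h2, norm_zero]
  have h4 := (mem_range_closure_iff R v).mp v.2 v h3
  exact Subtype.ext (inner_self_eq_zero (𝕜 := ℂ).mp h4)

/-- The polar decomposition of the adjoint of an injective operator. -/
lemma exists_polar (R : E →L[ℂ] L) (hinj : ∀ x, R x = 0 → x = 0) :
    ∃ U : (LinearMap.range (R : E →ₗ[ℂ] L)).topologicalClosure ≃ₗᵢ[ℂ] E,
      ∀ f, U (posSqrtB R f) = R.adjoint f := by
  have : CompleteSpace (LinearMap.range (R : E →ₗ[ℂ] L)).topologicalClosure :=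
    (Submodule.isClosed_topologicalClosure _).completeSpace_coe
  refine exists_isometryEquiv_of_norm_eq (posSqrtB R) (R.adjoint : L →ₗ[ℂ] E)
    (denseRange_posSqrtB R) ?_ fun f => (norm_posSqrt R f).symm
  -- Injectivity of `R` is density of the range of `R*`: if `v` is orthogonal to that range, then
  -- `⟨R* R v, v⟩ = ‖R v‖²` vanishes.
  refine denseRange_of_forall_inner _ fun v hv => hinj v ?_
  have h := hv (R v)
  change inner ℂ (R.adjoint (R v)) v = 0 at h
  rw [ContinuousLinearMap.adjoint_inner_left] at h
  exact inner_self_eq_zero (𝕜 := ℂ).mp h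

/-- The operator `U⁻¹ T U` is determined by `R T R*`: on the range of the square root `S`,
`S (U⁻¹ T U) S = R T R*`. -/
lemma posSqrt_conj (R : E →L[ℂ] L)
    (U : (LinearMap.range (R : E →ₗ[ℂ] L)).topologicalClosure ≃ₗᵢ[ℂ] E)
    (hU : ∀ f, U (posSqrtB R f) = R.adjoint f) (x : E) :
    posSqrt (R ∘L R.adjoint) (U.symm x : L) = R x := by
  refine ext_inner_left ℂ fun f => ?_
  rw [← inner_posSqrt, ← ContinuousLinearMap.adjoint_inner_left, ← hU]
  have h : inner ℂ (posSqrtB R f) (U.symm x) = inner ℂ (U (posSqrtB R f)) x := by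
    rw [← U.inner_map_map, U.apply_symm_apply]
  exact h

/-- The square root is obtained from `A` by the functional calculus, so it commutes with whatever
commutes with `A`. -/
lemma commute_posSqrt {A N : L →L[ℂ] L} (h : Commute A N) : Commute (posSqrt A) N :=
  Commute.cfcₙ_nnreal h _

end Polar

end BallToeplitz

end

/-! ### Abstract diagonalisation -/

noncomputable section

namespace BallToeplitz

instance {k m : ℕ} : (volume : Measure (TR k m)).IsOpenPosMeasure := by
  have h1 : (volume : Measure (UnitAddTorus (Fin k))).IsOpenPosMeasure :=
    inferInstanceAs (Measure.pi fun _ : Fin k => (volume : Measure UnitAddCircle)).IsOpenPosMeasure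
  exact Measure.prod.instIsOpenPosMeasure (μ := (volume : Measure (UnitAddTorus (Fin k))))
      (ν := (volume : Measure (EuclideanSpace ℝ (Fin m))))

lemma mulBdd_comm {α : Type*} [MeasurableSpace α] {μ : Measure α} {b b' : α → ℂ}
    (hb : MemLp b ∞ μ) (hb' : MemLp b' ∞ μ) (f : Lp ℂ 2 μ) :
    mulBdd hb (mulBdd hb' f) = mulBdd hb' (mulBdd hb f) := by
  refine Lp.ext ?_
  filter_upwards [mulBdd_ae hb (mulBdd hb' f), mulBdd_ae hb' (mulBdd hb f), mulBdd_ae hb f,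
    mulBdd_ae hb' f] with x h1 h2 h3 h4
  rw [h1, h2, h3, h4]
  ring

/-- Vectors orthogonal to all functions killed by `b` are those vanishing where `b` vanishes. -/
lemma forall_inner_mulBdd_iff {α : Type*} [MeasurableSpace α] {μ : Measure α} {b : α → ℂ}
    (hb : MemLp b ∞ μ) (hbm : Measurable b) (w : Lp ℂ 2 μ) :
    (∀ v, mulBdd hb v = 0 → inner ℂ v w = 0) ↔ ∀ᵐ x ∂μ, b x = 0 → w x = 0 := by
  constructor
  · intro h
    set s : Set α := {x | b x = 0} with hs
    have hsm : MeasurableSet s := measurableSet_eq_fun hbm measurable_const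
    have hi : MemLp (s.indicator fun _ => (1 : ℂ)) ∞ μ :=
      memLp_top_of_bound (measurable_const.indicator hsm).aestronglyMeasurable 1
        (ae_of_all _ fun x => by by_cases hx : x ∈ s <;> simp [hx])
    -- The part of `w` on the zero set of `b` is killed by `b`; its inner product with `w` is its
    -- own squared norm.
    set v := mulBdd hi w with hv
    have hvae := mulBdd_ae hi w
    have h0 : mulBdd hb v = 0 := by
      rw [Lp.eq_zero_iff_ae_eq_zero]
      filter_upwards [mulBdd_ae hb v, hvae] with x h1 h2
      rw [h1, h2]
      by_cases hx : x ∈ s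
      · have : b x = 0 := hx
        simp [this]
      · simp [hx]
    have h1 := h v h0
    have h2 : inner ℂ v w = inner ℂ v v := by
      rw [L2.inner_def, L2.inner_def]
      refine integral_congr_ae ?_
      filter_upwards [hvae] with x h2
      rw [h2, RCLike.inner_apply, RCLike.inner_apply]
      by_cases hx : x ∈ s <;> simp [hx]
    rw [h2, inner_self_eq_zero] at h1
    have h3 := Lp.eq_zero_iff_ae_eq_zero.mp h1
    filter_upwards [h3, hvae] with x h3 h4 hx
    have hx' : x ∈ s := hx
    rw [h3] at h4
    simpa [hx'] using h4.symm
  · intro h v hv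
    rw [Lp.eq_zero_iff_ae_eq_zero] at hv
    rw [L2.inner_def]
    refine (integral_congr_ae ?_).trans (integral_zero _ _)
    filter_upwards [h, hv, mulBdd_ae hb v] with x h1 h2 h3
    rw [h2] at h3
    rcases mul_eq_zero.mp h3.symm with h4 | h4
    · simp [h1 h4]
    · simp [h4]

section Diagonalization

variable {E L : Type*} [NormedAddCommGroup E] [InnerProductSpace ℂ E] [CompleteSpace E]
  [NormedAddCommGroup L] [InnerProductSpace ℂ L] [CompleteSpace L] {k m : ℕ}
  {κ : TR k m → E} {φ : TR k m → ℂ}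

/-- Since `⟨R* f, R* f⟩ = ⟨f, R R* f⟩`, the kernel of `R*` can be computed from the convolution
operator `R R*`. -/
lemma adjoint_eq_zero_iff (R : E →L[ℂ] L) (f : L) :
    R.adjoint f = 0 ↔ R (R.adjoint f) = 0 := by
  refine ⟨fun h => by rw [h, map_zero], fun h => ?_⟩
  have h1 : inner ℂ (R.adjoint f) (R.adjoint f) = 0 := by
    rw [ContinuousLinearMap.adjoint_inner_left, h, inner_zero_right]
  exact inner_self_eq_zero (𝕜 := ℂ).mp h1

set_option maxHeartbeats 1600000 in
/-- **Diagonalisation** of the operators that are invariant with respect to a frame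
`(κ ξ)` with `⟨κ ξ, κ η⟩ = φ (ξ - η)`. -/
theorem exists_diagonalization (W : L ≃ₗᵢ[ℂ] Lp ℂ 2 (volume : Measure (TR k m)))
    (hκ : ∀ ξ η, inner ℂ (κ ξ) (κ η) = φ (ξ - η)) (hφc : Continuous φ) (hφ : Integrable φ)
    (htot : ∀ f, (∀ ξ, inner ℂ (κ ξ) f = 0) → f = 0)
    (K : Submodule ℂ (Lp ℂ 2 (dualVol k m)))
    (hK : ∀ ω, ω ∈ K ↔ ∀ᵐ α ∂(dualVol k m), fhat φ α = 0 → ω α = 0) :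
    ∃ R : E →L[ℂ] L,
      (∀ f, W (R f) = (memLp_frame hκ hφc hφ f).toLp) ∧
      (∀ f, W (R (R.adjoint f)) =ᵐ[volume] fun ξ => ∫ η, W f η * φ (ξ - η)) ∧
      ∃ U : (LinearMap.range (R : E →ₗ[ℂ] L)).topologicalClosure ≃ₗᵢ[ℂ] E,
        (∀ f, U (posSqrtB R f) = R.adjoint f) ∧
      ∃ P : Lp ℂ 2 (volume : Measure (TR k m)) ≃ₗᵢ[ℂ] Lp ℂ 2 (dualVol k m),
        (∀ u : Lp ℂ 2 (volume : Measure (TR k m)), Integrable u → P u =ᵐ[dualVol k m] fhat u) ∧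
      ∃ F : (LinearMap.range (R : E →ₗ[ℂ] L)).topologicalClosure ≃ₗᵢ[ℂ] K,
        (∀ f, (F f : Lp ℂ 2 (dualVol k m)) = P (W f)) ∧
        ∀ (T : E →L[ℂ] E) (ν : TR k m → ℂ), Integrable ν →
          (∀ ξ η, inner ℂ (κ ξ) (T (κ η)) = ν (ξ - η)) →
          ∀ ω : K, ∀ᵐ α ∂(dualVol k m), fhat φ α ≠ 0 →
            (F (U.symm (T (U (F.symm ω)))) : Lp ℂ 2 (dualVol k m)) α =
              fhat ν α / fhat φ α * (ω : Lp ℂ 2 (dualVol k m)) α := by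
  obtain ⟨R₀, hR₀⟩ := exists_analysis hκ hφc hφ
  set R : E →L[ℂ] L := (W.symm : Lp ℂ 2 (volume : Measure (TR k m)) →L[ℂ] L) ∘L R₀ with hRdef
  have hR : ∀ f, W (R f) = (memLp_frame hκ hφc hφ f).toLp := fun f => by
    rw [← hR₀]
    exact W.apply_symm_apply _
  have hRR : ∀ f, R f = W.symm (R₀ f) := fun f => rfl
  have hadj : ∀ f, R.adjoint f = R₀.adjoint (W f) := by
    intro f
    refine ext_inner_right ℂ fun x => ?_
    rw [ContinuousLinearMap.adjoint_inner_left, ContinuousLinearMap.adjoint_inner_left, hRR,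
      ← W.inner_map_map, W.apply_symm_apply]
  have hR₀ae : ∀ f, R₀ f =ᵐ[volume] fun ξ => inner ℂ (κ ξ) f := fun f => by
    rw [hR₀]
    exact MemLp.coeFn_toLp _
  have hinj : ∀ x, R x = 0 → x = 0 := by
    intro x hx
    have h1 : R₀ x = 0 := by
      have := congrArg W hx
      rwa [hRR, W.apply_symm_apply, map_zero] at this
    have h2 := hR₀ae x
    rw [h1] at h2
    have h3 : (fun ξ => inner ℂ (κ ξ) x) =ᵐ[volume] fun _ => (0 : ℂ) :=
      h2.symm.trans (Lp.coeFn_zero _ _ _)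
    -- The coefficient function is continuous and nonempty open sets have positive measure, so
    -- vanishing almost everywhere means vanishing everywhere, and totality of the frame applies.
    have h4 := (((continuous_frame hκ hφc).inner continuous_const).ae_eq_iff_eq volume
      continuous_const).mp h3
    exact htot x fun ξ => congrFun h4 ξ
  obtain ⟨U, hU⟩ := exists_polar R hinj
  obtain ⟨P, hP⟩ := exists_plancherel k m
  set cc : ℂ := (((2 * Real.pi) ^ ((m : ℝ) / 2) : ℝ) : ℂ) with hcc
  have hc0 : cc ≠ 0 := by
    rw [hcc]
    exact_mod_cast (Real.rpow_pos_of_pos (by positivity) _).ne'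
  have hconv : ∀ (T : E →L[ℂ] E) (ν : TR k m → ℂ) (hν : Integrable ν),
      (∀ ξ η, inner ℂ (κ ξ) (T (κ η)) = ν (ξ - η)) → ∀ f : L,
      P (W (R (T (R.adjoint f)))) = cc • mulBdd (memLp_top_fhat hν) (P (W f)) := by
    intro T ν hν hT f
    have h := plancherel_convolution P hP hν (R₀ ∘L T ∘L R₀.adjoint)
      (fun u => analysis_conv R₀ hR₀ae T hT u) (W f)
    rw [hRR, W.apply_symm_apply, hadj]
    exact h
  have hconv1 : ∀ f : L, P (W (R (R.adjoint f))) = cc • mulBdd (memLp_top_fhat hφ) (P (W f)) :=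
    fun f => hconv (ContinuousLinearMap.id ℂ E) φ hφ hκ f
  -- The kernel of `R R*` corresponds to the functions killed by the transform of `φ`. Its
  -- orthogonal complement consists of the functions vanishing where that transform vanishes, which
  -- is `K`.
  have hmem : ∀ g : L, g ∈ (LinearMap.range (R : E →ₗ[ℂ] L)).topologicalClosure ↔ P (W g) ∈ K := by
    intro g
    rw [hK, ← forall_inner_mulBdd_iff (memLp_top_fhat hφ) (continuous_fhat hφ).measurable,
      mem_range_closure_iff]
    constructor
    · intro h v hv
      have h1 := h (W.symm (P.symm v)) ?_
      · rw [← W.inner_map_map, ← P.inner_map_map, W.apply_symm_apply, P.apply_symm_apply] at h1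
        exact h1
      · rw [adjoint_eq_zero_iff]
        apply W.injective
        apply P.injective
        rw [hconv1, W.apply_symm_apply, P.apply_symm_apply, hv, smul_zero, map_zero, map_zero]
    · intro h f hf
      rw [← W.inner_map_map, ← P.inner_map_map]
      refine h _ ?_
      have h1 := hconv1 f
      rw [hf, map_zero, map_zero, map_zero] at h1
      exact (smul_eq_zero.mp h1.symm).resolve_left hc0
  have hmap : (LinearMap.range (R : E →ₗ[ℂ] L)).topologicalClosure.map
      ((W.trans P : L ≃ₗᵢ[ℂ] Lp ℂ 2 (dualVol k m)) : L →ₗ[ℂ] Lp ℂ 2 (dualVol k m)) = K := by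
    ext ω
    rw [Submodule.mem_map]
    constructor
    · rintro ⟨g, hg, rfl⟩
      exact (hmem g).mp hg
    · intro hω
      refine ⟨W.symm (P.symm ω), (hmem _).mpr ?_, ?_⟩
      · rwa [W.apply_symm_apply, P.apply_symm_apply]
      · change P (W _) = ω
        rw [W.apply_symm_apply, P.apply_symm_apply]
  let F : (LinearMap.range (R : E →ₗ[ℂ] L)).topologicalClosure ≃ₗᵢ[ℂ] K := ((W.trans P).submoduleMap
    (LinearMap.range (R : E →ₗ[ℂ] L)).topologicalClosure).trans (LinearIsometryEquiv.ofEq _ _ hmap)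
  have hF : ∀ f, (F f : Lp ℂ 2 (dualVol k m)) = P (W f) := fun f => rfl
  refine ⟨R, hR, ?_, U, hU, P, hP, F, hF, fun T ν hν hT ω => ?_⟩
  · intro f
    rw [hRR, W.apply_symm_apply, hadj]
    exact analysis_conv R₀ hR₀ae (ContinuousLinearMap.id ℂ E) hκ (W f)
  · set S := posSqrt (R ∘L R.adjoint) with hS
    set N : L →L[ℂ] L := R ∘L T ∘L R.adjoint with hN
    -- `R R*` and `N` both become multiplication operators, so they commute, and the square root of
    -- `R R*` inherits this.
    have hcomm : Commute S N := by
      refine commute_posSqrt (ContinuousLinearMap.ext fun f => ?_)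
      apply W.injective
      apply P.injective
      change P (W (R (R.adjoint (R (T (R.adjoint f)))))) =
        P (W (R (T (R.adjoint (R (R.adjoint f))))))
      rw [hconv1, hconv T ν hν hT, hconv T ν hν hT, hconv1, map_smul, map_smul, mulBdd_comm]
    -- On the dense set of vectors `g = S f` one computes `S² U⁻¹ T U S f = S R T R* f = S N f = N S
    -- f`, using `U S = R*` and `S U⁻¹ = R`. After the Fourier transform this is an identity between
    -- multiplications; the common constant `cc` is cancelled.
    have key : ∀ g : (LinearMap.range (R : E →ₗ[ℂ] L)).topologicalClosure, mulBdd (memLp_top_fhat hφ) (P (W (U.symm (T (U g)) : L))) =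
        mulBdd (memLp_top_fhat hν) (P (W (g : L))) := by
      intro g
      have hc1 : Continuous fun g : (LinearMap.range (R : E →ₗ[ℂ] L)).topologicalClosure =>
          mulBdd (memLp_top_fhat hφ) (P (W (U.symm (T (U g)) : L))) := by fun_prop
      have hc2 : Continuous fun g : (LinearMap.range (R : E →ₗ[ℂ] L)).topologicalClosure => mulBdd (memLp_top_fhat hν) (P (W (g : L))) := by fun_prop
      have heq := (denseRange_posSqrtB R).equalizer (g := fun g : (LinearMap.range (R : E →ₗ[ℂ] L)).topologicalClosure =>
          mulBdd (memLp_top_fhat hφ) (P (W (U.symm (T (U g)) : L))))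
        (h := fun g : (LinearMap.range (R : E →ₗ[ℂ] L)).topologicalClosure => mulBdd (memLp_top_fhat hν) (P (W (g : L)))) hc1 hc2 ?_
      · exact congrFun heq g
      · funext f
        simp only [Function.comp_apply]
        rw [hU]
        apply smul_right_injective _ hc0
        change cc • mulBdd (memLp_top_fhat hφ) _ = cc • mulBdd (memLp_top_fhat hν) _
        rw [← hconv1, ← hconv T ν hν hT]
        congr 2
        have h1 : ∀ x, R (R.adjoint x) = S (S x) := fun x =>
          (congrArg (fun A : L →L[ℂ] L => A x) (posSqrt_mul_self R)).symm
        rw [h1, posSqrt_conj R U hU]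
        exact congrArg (fun A : L →L[ℂ] L => A f) hcomm.eq
    have h1 := key (F.symm ω)
    have h2 : P (W (F.symm ω : L)) = ω := by
      rw [← hF, F.apply_symm_apply]
    rw [h2] at h1
    filter_upwards [mulBdd_ae (memLp_top_fhat hφ) (P (W (U.symm (T (U (F.symm ω))) : L))),
      mulBdd_ae (memLp_top_fhat hν) (ω : Lp ℂ 2 (dualVol k m))] with α h3 h4 hα
    rw [h1, h4] at h3
    rw [hF, div_mul_eq_mul_div, h3, mul_div_cancel_left₀ _ hα]

end Diagonalization

end BallToeplitz

end

/-! ### The invariant Hermitian form and the covariance of the kernel -/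

noncomputable section

namespace BallToeplitz

variable {n : ℕ}

/-- The Hermitian form of signature `(1, n)` that is preserved by `SU(n,1)`. -/
def herm (u v : Ix n → ℂ) : ℂ := star u ⬝ᵥ (J n *ᵥ v)

lemma herm_eq (u v : Ix n → ℂ) :
    herm u v = star (u (Sum.inr ())) * v (Sum.inr ()) -
      ∑ i, star (u (Sum.inl i)) * v (Sum.inl i) := by
  have : J n *ᵥ v = Sum.elim (fun i => - v (Sum.inl i)) (fun _ => v (Sum.inr ())) := by
    rw [J, Matrix.fromBlocks_mulVec]
    funext i
    rcases i with i | ⟨⟩ <;> simp [Matrix.neg_mulVec]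
  rw [herm, this]
  simp only [dotProduct, Fintype.sum_sum_type]
  simp only [Sum.elim_inl, Sum.elim_inr, Pi.star_apply, mul_neg, Finset.sum_neg_distrib,
    Finset.univ_unique, Finset.sum_singleton]
  rw [add_comm, ← sub_eq_add_neg]

lemma herm_mulVec (g : SU n) (u v : Ix n → ℂ) :
    herm (mat g *ᵥ u) (mat g *ᵥ v) = herm u v := by
  rw [herm, herm, Matrix.star_mulVec, ← Matrix.dotProduct_mulVec, Matrix.mulVec_mulVec,
    Matrix.mulVec_mulVec, form_eq]

lemma herm_hvec (z w : Cn n) : herm (hvec w) (hvec z) = 1 - inner ℂ w z := by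
  rw [herm_eq]
  simp [hvec, PiLp.inner_apply, mul_comm]

lemma herm_smul_left (a : ℂ) (u v : Ix n → ℂ) : herm (a • u) v = star a * herm u v := by
  rw [herm, star_smul, smul_dotProduct, smul_eq_mul, herm]

lemma herm_smul_right (a : ℂ) (u v : Ix n → ℂ) : herm u (a • v) = a * herm u v := by
  rw [herm, Matrix.mulVec_smul, dotProduct_smul, smul_eq_mul, herm]

lemma herm_add_left (u u' v : Ix n → ℂ) : herm (u + u') v = herm u v + herm u' v := by
  rw [herm, star_add, add_dotProduct, herm, herm]

lemma herm_add_right (u v v' : Ix n → ℂ) : herm u (v + v') = herm u v + herm u v' := by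
  rw [herm, Matrix.mulVec_add, dotProduct_add, herm, herm]

lemma herm_star (u v : Ix n → ℂ) : star (herm u v) = herm v u := by
  simp only [herm_eq, star_sub, star_mul', star_sum, star_star]
  rw [mul_comm]
  congr 1
  exact Finset.sum_congr rfl fun i _ => mul_comm _ _

/-- `1 - ⟨gz, gw⟩ = (1 - ⟨z, w⟩) / (den(g,z) conj(den(g,w)))`. -/
lemma one_sub_inner_moeb (g : SU n) {z w : Cn n} (hz : z ∈ UnitBall n) (hw : w ∈ UnitBall n) :
    (1 - inner ℂ (moeb (mat g) w) (moeb (mat g) z)) * (den (mat g) z * star (den (mat g) w)) =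
      1 - inner ℂ w z := by
  rw [← herm_hvec, ← herm_hvec, ← herm_mulVec g (hvec w), mulVec_hvec _ _ (den_ne_zero g hz),
    mulVec_hvec _ _ (den_ne_zero g hw), herm_smul_left, herm_smul_right]
  ring

lemma norm_lt_one {z : Cn n} (hz : z ∈ UnitBall n) : ‖z‖ < 1 := mem_ball_zero_iff.mp hz

lemma norm_inner_lt_one {z w : Cn n} (hz : z ∈ UnitBall n) (hw : w ∈ UnitBall n) :
    ‖inner ℂ w z‖ < 1 := by
  have hz' := norm_lt_one hz
  have hw' := norm_lt_one hw
  refine (norm_inner_le_norm w z).trans_lt ?_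
  nlinarith [norm_nonneg z, norm_nonneg w]

lemma re_one_sub_inner_pos {z w : Cn n} (hz : z ∈ UnitBall n) (hw : w ∈ UnitBall n) :
    0 < (1 - inner ℂ w z : ℂ).re := by
  have h1 := (abs_le.mp (Complex.abs_re_le_norm (inner ℂ w z))).2
  have h2 := norm_inner_lt_one hz hw
  rw [Complex.sub_re, Complex.one_re]
  linarith

lemma one_sub_inner_ne_zero {z w : Cn n} (hz : z ∈ UnitBall n) (hw : w ∈ UnitBall n) :
    (1 - inner ℂ w z : ℂ) ≠ 0 := by
  intro h
  have := re_one_sub_inner_pos hz hw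
  rw [h, Complex.zero_re] at this
  exact lt_irrefl _ this

lemma one_sub_inner_self (z : Cn n) : (1 - inner ℂ z z : ℂ) = ((1 - ‖z‖ ^ 2 : ℝ) : ℂ) := by
  rw [inner_self_eq_norm_sq_to_K]
  push_cast
  rfl

lemma bergmanKernel_eq (lam : ℝ) {z w : Cn n} (hz : z ∈ UnitBall n) (hw : w ∈ UnitBall n) :
    bergmanKernel lam z w = Complex.exp (-(lam : ℂ) * Complex.log (1 - inner ℂ w z)) := by
  rw [bergmanKernel, Complex.cpow_def_of_ne_zero (one_sub_inner_ne_zero hz hw), mul_comm]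

lemma bergmanKernel_zero (lam : ℝ) (z : Cn n) : bergmanKernel lam z 0 = 1 := by
  simp [bergmanKernel]

lemma norm_bergmanKernel (lam : ℝ) (z w : Cn n) :
    ‖bergmanKernel lam z w‖ = ‖(1 - inner ℂ w z : ℂ)‖ ^ (-lam) := by
  have h := Complex.norm_cpow_real (1 - inner ℂ w z) (-lam)
  push_cast at h
  rw [bergmanKernel, h]

lemma bergmanKernel_self (lam : ℝ) {z : Cn n} (hz : z ∈ UnitBall n) :
    bergmanKernel lam z z = (((1 - ‖z‖ ^ 2) ^ (-lam) : ℝ) : ℂ) := by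
  have hz' := norm_lt_one hz
  have h : 0 ≤ 1 - ‖z‖ ^ 2 := by nlinarith [norm_nonneg z]
  rw [bergmanKernel, one_sub_inner_self, Complex.ofReal_cpow h]
  push_cast
  rfl

namespace Cover

variable (lam : ℝ)

lemma j_ne_zero (g : Cover n) (z : UnitBall n) : j lam g z ≠ 0 := Complex.exp_ne_zero _

lemma norm_j (g : Cover n) (z : UnitBall n) :
    ‖j lam g z‖ = ‖den (mat g.proj) z‖ ^ (-lam) := by
  have h := congrArg norm (g.exp_logDen z)
  rw [Complex.norm_exp] at h
  rw [j, Complex.norm_exp, ← h, ← Real.exp_mul]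
  congr 1
  simp [mul_comm]

/-- The covariance of the reproducing kernel. -/
lemma bergmanKernel_smul (g : Cover n) (z w : UnitBall n) :
    bergmanKernel lam (g • z : UnitBall n).1 (g • w : UnitBall n).1 * j lam g z *
      (starRingEnd ℂ) (j lam g w) = bergmanKernel lam z.1 w.1 := by
  have : PreconnectedSpace (UnitBall n) :=
    Subtype.preconnectedSpace (convex_ball (0 : Cn n) 1).isPreconnected
  -- Taking logarithms on both sides, `f` is their difference. Its exponential is one by
  -- `one_sub_inner_moeb`, so it is a constant multiple of `2πi` on the connected ball, and one
  -- value decides which.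
  set f : UnitBall n → ℂ := fun z => Complex.log (1 - inner ℂ (g • w : UnitBall n).1
    (g • z : UnitBall n).1) + g.logDen z + (starRingEnd ℂ) (g.logDen w) -
      Complex.log (1 - inner ℂ w.1 z.1) with hf
  have hc : Continuous f := by
    have h1 : Continuous fun z : UnitBall n => ((g • z : UnitBall n) : Cn n) :=
      continuous_subtype_val.comp (continuous_smul g.proj)
    refine ((Continuous.add (Continuous.clog ?_ fun z => ?_) g.continuous_logDen).add
      continuous_const).sub (Continuous.clog ?_ fun z => ?_)
    · exact continuous_const.sub (continuous_const.inner h1)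
    · exact Or.inl (re_one_sub_inner_pos (g • z).2 (g • w).2)
    · exact continuous_const.sub (continuous_const.inner continuous_subtype_val)
    · exact Or.inl (re_one_sub_inner_pos z.2 w.2)
  have hexp : ∀ z, Complex.exp (f z) = 1 := by
    intro z
    rw [hf, Complex.exp_sub, Complex.exp_add, Complex.exp_add, Complex.exp_conj, g.exp_logDen,
      g.exp_logDen, Complex.exp_log (one_sub_inner_ne_zero z.2 w.2),
      Complex.exp_log (one_sub_inner_ne_zero (g • z).2 (g • w).2), mul_assoc]
    have h := one_sub_inner_moeb g.proj z.2 w.2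
    rw [div_eq_one_iff_eq (one_sub_inner_ne_zero z.2 w.2)]
    exact h
  -- At `z = w` the logarithms of `1 - ⟨z, z⟩` are real and the two values of `logDen` are
  -- conjugate, so the imaginary part vanishes and the multiple of `2πi` is zero.
  have him : f w = 0 := by
    have hb : ∀ u : UnitBall n, (Complex.log (1 - inner ℂ u.1 u.1)).im = 0 := by
      intro u
      have hu := norm_lt_one u.2
      rw [one_sub_inner_self, ← Complex.ofReal_log (by nlinarith [norm_nonneg u.1]),
        Complex.ofReal_im]
    have h2 : (f w).im = 0 := by
      simp only [hf, Complex.sub_im, Complex.add_im, Complex.conj_im, hb]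
      ring
    obtain ⟨N, hN⟩ := Complex.exp_eq_one_iff.mp (hexp w)
    have h3 : N = 0 := by
      have h4 := congrArg Complex.im hN
      rw [h2] at h4
      have h5 : ((N : ℂ) * (2 * Real.pi * Complex.I)).im = N * (2 * Real.pi) := by simp
      rw [h5] at h4
      have h6 := mul_eq_zero.mp h4.symm
      exact_mod_cast h6.resolve_right (by positivity)
    rw [hN, h3]
    simp
  have h0 : f z = 0 := by
    rw [eq_of_exp_eq hc (fun a b => (hexp a).trans (hexp b).symm) z w, him]
  rw [bergmanKernel_eq lam (g • z).2 (g • w).2, bergmanKernel_eq lam z.2 w.2, j, j,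
    ← Complex.exp_conj, ← Complex.exp_add, ← Complex.exp_add]
  congr 1
  rw [map_mul, map_neg, Complex.conj_ofReal]
  simp only [hf] at h0
  linear_combination (-(lam : ℂ)) * h0

end Cover

end BallToeplitz

end

noncomputable section

namespace BallToeplitz

variable {n : ℕ}

/-! ### The Jacobian of a fractional linear map -/

/-- The linear functional given by the first `n` entries of a row of a matrix. -/
def rowCLM (A : Matrix (Ix n) (Ix n) ℂ) (i : Ix n) : Cn n →L[ℂ] ℂ :=
  ∑ j, A i (Sum.inl j) • EuclideanSpace.proj j

lemma mulVec_hvec_apply (A : Matrix (Ix n) (Ix n) ℂ) (z : Cn n) (i : Ix n) :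
    (A *ᵥ hvec z) i = rowCLM A i z + A i (Sum.inr ()) := by
  simp [hvec, Matrix.mulVec, dotProduct, Fintype.sum_sum_type, rowCLM]

lemma den_eq_rowCLM (A : Matrix (Ix n) (Ix n) ℂ) (z : Cn n) :
    den A z = rowCLM A (Sum.inr ()) z + A (Sum.inr ()) (Sum.inr ()) := mulVec_hvec_apply A z _

/-- The derivative of `z ↦ A · z`. -/
def moebDeriv (A : Matrix (Ix n) (Ix n) ℂ) (z : Cn n) : Matrix (Fin n) (Fin n) ℂ := fun i j =>
  (den A z)⁻¹ * (A (Sum.inl i) (Sum.inl j) -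
    (A *ᵥ hvec z) (Sum.inl i) * (den A z)⁻¹ * A (Sum.inr ()) (Sum.inl j))

lemma hasFDerivAt_moeb (A : Matrix (Ix n) (Ix n) ℂ) {z : Cn n} (h : den A z ≠ 0) :
    HasFDerivAt (moeb A) (Matrix.toLpLin 2 2 (moebDeriv A z)).toContinuousLinearMap z := by
  rw [← hasFDerivWithinAt_univ, hasFDerivWithinAt_euclidean]
  intro i
  rw [hasFDerivWithinAt_univ]
  have h1 : HasFDerivAt (fun z => (A *ᵥ hvec z) (Sum.inl i)) (rowCLM A (Sum.inl i)) z := by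
    simp only [mulVec_hvec_apply]
    exact (rowCLM A _).hasFDerivAt.add_const _
  have h2 : HasFDerivAt (fun z => den A z) (rowCLM A (Sum.inr ())) z := by
    simp only [den_eq_rowCLM]
    exact (rowCLM A _).hasFDerivAt.add_const _
  have h3 := h1.mul ((hasDerivAt_inv h).comp_hasFDerivAt z h2)
  refine h3.congr_fderiv (ContinuousLinearMap.ext fun v => ?_)
  simp only [rowCLM, moebDeriv, ContinuousLinearMap.coe_comp, Function.comp_apply,
    LinearMap.coe_toContinuousLinearMap', PiLp.proj_apply, Matrix.ofLp_toLpLin, Matrix.toLin'_apply,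
    Matrix.mulVec, dotProduct, add_apply, smul_apply,
    sum_apply, smul_eq_mul, Finset.mul_sum,
    ← Finset.sum_add_distrib]
  refine Finset.sum_congr rfl fun j _ => ?_
  field_simp
  ring

/-- Multiplying `A` by the unipotent `T` replaces its last column by `A (z, 1)`. The Schur
complement of the denominator in this matrix is the denominator times the derivative, and its
determinant supplies `n` further powers. -/
lemma det_moebDeriv (A : Matrix (Ix n) (Ix n) ℂ) {z : Cn n} (h : den A z ≠ 0) :
    den A z ^ (n + 1) * (moebDeriv A z).det = A.det := by
  set N : Matrix (Fin n) Unit ℂ := Matrix.of fun i _ => (A *ᵥ hvec z) (Sum.inl i) with hN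
  set d : Matrix Unit Unit ℂ := Matrix.of fun _ _ => den A z with hd
  set T : Matrix (Ix n) (Ix n) ℂ := Matrix.fromBlocks 1 (Matrix.of fun i _ => z i) 0 1 with hT
  have hAT : A * T = Matrix.fromBlocks A.toBlocks₁₁ N A.toBlocks₂₁ d := by
    have h2 : ∀ i, (A *ᵥ hvec z) i = ∑ j, A i (Sum.inl j) * z j + A i (Sum.inr ()) := by
      intro i
      simp [hvec, Matrix.mulVec, dotProduct, Fintype.sum_sum_type]
    have h3 : den A z = ∑ j, A (Sum.inr ()) (Sum.inl j) * z j + A (Sum.inr ()) (Sum.inr ()) := h2 _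
    ext i j
    rcases i with i | i <;> rcases j with j | j <;>
      simp [Matrix.mul_apply, Fintype.sum_sum_type, hT, hN, hd, Matrix.one_apply,
        Matrix.toBlocks₁₁, Matrix.toBlocks₂₁, h2, h3]
  have hTdet : T.det = 1 := by rw [hT, Matrix.det_fromBlocks_zero₂₁]; simp
  have hinv : (Matrix.of fun _ _ => (den A z)⁻¹ : Matrix Unit Unit ℂ) * d = 1 := by
    ext i j
    simp [Matrix.mul_apply, hd, h]
  let _ : Invertible d := ⟨Matrix.of fun _ _ => (den A z)⁻¹, hinv, mul_eq_one_comm.mp hinv⟩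
  have hM : moebDeriv A z = (den A z)⁻¹ • (A.toBlocks₁₁ - N * ⅟d * A.toBlocks₂₁) := by
    ext i j
    change _ = (den A z)⁻¹ * (A (Sum.inl i) (Sum.inl j) - _)
    simp only [Matrix.mul_apply, Finset.univ_unique, Finset.sum_singleton]
    rfl
  have hdd : d.det = den A z := by simp [hd]
  calc den A z ^ (n + 1) * (moebDeriv A z).det
      = d.det * (A.toBlocks₁₁ - N * ⅟d * A.toBlocks₂₁).det := by
        rw [hM, Matrix.det_smul, Fintype.card_fin, hdd, pow_succ, inv_pow]
        field_simp
    _ = (A * T).det := by rw [hAT, Matrix.det_fromBlocks₂₂]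
    _ = A.det := by rw [Matrix.det_mul, hTdet, mul_one]

lemma moeb_inv_moeb (g : SU n) {z : Cn n} (hz : z ∈ UnitBall n) :
    moeb (mat g⁻¹) (moeb (mat g) z) = z := by
  rw [← moeb_mul _ _ _ (den_ne_zero g hz), ← mat_mul, inv_mul_cancel, mat_one, moeb_one]

lemma image_moeb (g : SU n) : moeb (mat g) '' UnitBall n = UnitBall n := by
  refine Set.Subset.antisymm ?_ fun z hz => ⟨moeb (mat g⁻¹) z, moeb_mem _ hz, ?_⟩
  · rintro _ ⟨z, hz, rfl⟩
    exact moeb_mem g hz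
  · have := moeb_inv_moeb g⁻¹ hz
    rwa [inv_inv] at this

lemma one_sub_norm_sq_moeb (g : SU n) {z : Cn n} (hz : z ∈ UnitBall n) :
    1 - ‖moeb (mat g) z‖ ^ 2 = (1 - ‖z‖ ^ 2) / ‖den (mat g) z‖ ^ 2 := by
  have h0 := den_ne_zero g hz
  have h := one_sub_inner_moeb g hz hz
  rw [one_sub_inner_self, one_sub_inner_self, RCLike.star_def, Complex.mul_conj'] at h
  rw [eq_div_iff (by positivity)]
  exact_mod_cast h

lemma measurable_den (A : Matrix (Ix n) (Ix n) ℂ) : Measurable (den A) :=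
  (continuous_den A).measurable

lemma measurable_moeb (A : Matrix (Ix n) (Ix n) ℂ) : Measurable (moeb A) := by
  refine (PiLp.continuous_toLp 2 _).measurable.comp (measurable_pi_lambda _ fun i => ?_)
  have h : Measurable fun z => (A *ᵥ hvec z) (Sum.inl i) := by
    simp only [mulVec_hvec_apply]
    exact ((rowCLM A _).continuous.measurable).add_const _
  exact h.div (measurable_den A)

/-! ### The measure -/

/-- The density of `μ_λ`. -/
def dens (n : ℕ) (lam : ℝ) (z : Cn n) : ℝ :=
  Real.Gamma lam / (n.factorial * Real.Gamma (lam - n)) * (1 - ‖z‖ ^ 2) ^ (lam - n - 1)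

lemma measurable_dens (n : ℕ) (lam : ℝ) : Measurable (dens n lam) := by
  unfold dens
  fun_prop

lemma lintegral_bergmanMeasure (lam : ℝ) (F : Cn n → ℝ≥0∞) :
    ∫⁻ z, F z ∂bergmanMeasure n lam =
      (volume (UnitBall n))⁻¹ * ∫⁻ z in UnitBall n, ENNReal.ofReal (dens n lam z) * F z := by
  have h : bergmanMeasure n lam = (ProbabilityTheory.cond volume (UnitBall n)).withDensity
      fun z => ENNReal.ofReal (dens n lam z) := rfl
  rw [h, lintegral_withDensity_eq_lintegral_mul_non_measurable₀ _
    (measurable_dens n lam).ennreal_ofReal.aemeasurable (ae_of_all _ fun _ => ENNReal.ofReal_lt_top),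
    ProbabilityTheory.cond, lintegral_smul_measure, smul_eq_mul]
  rfl

lemma ae_mem_ball (n : ℕ) (lam : ℝ) : ∀ᵐ z ∂bergmanMeasure n lam, z ∈ UnitBall n :=
  (withDensity_absolutelyContinuous _ _).ae_le
    (ProbabilityTheory.ae_cond_mem isOpen_ball.measurableSet)

/-- The quasi-invariance of `μ_λ`. -/
lemma lintegral_moeb (lam : ℝ) (g : SU n) (F : Cn n → ℝ≥0∞) :
    ∫⁻ z, F z ∂bergmanMeasure n lam =
      ∫⁻ z, ENNReal.ofReal (‖den (mat g) z‖ ^ (-(2 * lam))) * F (moeb (mat g) z)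
        ∂bergmanMeasure n lam := by
  rw [lintegral_bergmanMeasure, lintegral_bergmanMeasure]
  congr 1
  have hinj : Set.InjOn (moeb (mat g)) (UnitBall n) := fun z hz w hw h => by
    rw [← moeb_inv_moeb g hz, h, moeb_inv_moeb g hw]
  have h := lintegral_image_eq_lintegral_abs_det_fderiv_mul volume isOpen_ball.measurableSet
    (fun z hz => ((hasFDerivAt_moeb (mat g) (den_ne_zero g hz)).restrictScalars
      ℝ).hasFDerivWithinAt) hinj (fun z => ENNReal.ofReal (dens n lam z) * F z)
  rw [image_moeb] at h
  rw [h]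
  refine setLIntegral_congr_fun isOpen_ball.measurableSet fun z hz => ?_
  have h0 := den_ne_zero g hz
  -- The real Jacobian of a complex linear map is the squared modulus of its complex determinant;
  -- `det g = 1` leaves only the power of the denominator.
  have hdet : |((Matrix.toLpLin 2 2 (moebDeriv (mat g) z)).toContinuousLinearMap.restrictScalars
      ℝ).det| = ‖den (mat g) z‖ ^ (-(2 * (n + 1) : ℝ)) := by
    have h1 : ((Matrix.toLpLin 2 2 (moebDeriv (mat g) z)).toContinuousLinearMap.restrictScalars
      ℝ).det = LinearMap.det ((Matrix.toLpLin 2 2 (moebDeriv (mat g) z)).restrictScalars ℝ) := rfl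
    rw [h1, LinearMap.det_restrictScalars, Matrix.toLpLin_eq_toLin, LinearMap.det_toLin,
      Algebra.norm_complex_apply, Complex.normSq_eq_norm_sq, abs_of_nonneg (by positivity)]
    have h2 := congrArg norm (det_moebDeriv (mat g) h0)
    have h3 : (mat g).det = 1 := g.1.2
    rw [h3, norm_mul, norm_pow, norm_one] at h2
    have h4 : ‖(moebDeriv (mat g) z).det‖ = (‖den (mat g) z‖ ^ (n + 1))⁻¹ :=
      eq_inv_of_mul_eq_one_right h2
    rw [h4, Real.rpow_neg (norm_nonneg _), ← inv_pow, ← pow_mul, inv_pow]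
    congr 1
    rw [← Real.rpow_natCast]
    congr 1
    push_cast
    ring
  rw [hdet, ← mul_assoc, ← mul_assoc, ← ENNReal.ofReal_mul (by positivity),
    mul_comm (ENNReal.ofReal (dens n lam z)), ← ENNReal.ofReal_mul (by positivity)]
  congr 2
  have hz' := norm_lt_one hz
  have h1z : 0 ≤ 1 - ‖z‖ ^ 2 := by nlinarith [norm_nonneg z]
  have hp : 0 < ‖den (mat g) z‖ := norm_pos_iff.mpr h0
  rw [dens, dens, one_sub_norm_sq_moeb g hz, Real.div_rpow h1z (by positivity),
    ← Real.rpow_natCast ‖den (mat g) z‖, ← Real.rpow_mul hp.le,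
    div_eq_mul_inv ((1 - ‖z‖ ^ 2) ^ (lam - n - 1)), ← Real.rpow_neg hp.le]
  -- The Jacobian contributes `-2(n + 1)` and the transformed density contributes `-2(λ - n - 1)`;
  -- the sum is `-2λ`.
  have h5 : ‖den (mat g) z‖ ^ (-(2 * lam)) = ‖den (mat g) z‖ ^ (-(2 * (n + 1) : ℝ)) *
      ‖den (mat g) z‖ ^ (-((2 : ℕ) * (lam - n - 1))) := by
    rw [← Real.rpow_add hp]
    congr 1
    push_cast
    ring
  rw [h5]
  ring

/-- The total mass of `μ_λ` is one. -/
lemma isProbabilityMeasure_bergmanMeasure (hn : 1 ≤ n) {lam : ℝ} (hlam : (n : ℝ) < lam) :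
    IsProbabilityMeasure (bergmanMeasure n lam) := by
  have : Nonempty (Fin n) := ⟨⟨0, hn⟩⟩
  have hn0 : (0 : ℝ) < n := by exact_mod_cast hn
  set p := lam - n - 1 with hp
  set B := ProbabilityTheory.beta n (lam - n) with hB
  have hB0 : 0 < B := ProbabilityTheory.beta_pos hn0 (by linarith)
  set c := Real.Gamma lam / (n.factorial * Real.Gamma (lam - n)) with hc
  have hG1 : 0 < Real.Gamma lam := Real.Gamma_pos_of_pos (by linarith)
  have hG2 : 0 < Real.Gamma (lam - n) := Real.Gamma_pos_of_pos (by linarith)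
  have hc0 : 0 < c := by positivity
  -- Here `B = Γ(n) Γ(λ - n) / Γ(λ)` and `n! = n Γ(n)`, so `c` is exactly the constant that
  -- normalises the radial integral.
  have hcB : c * B * n = 1 := by
    rw [hB, hc, ProbabilityTheory.beta, add_sub_cancel]
    obtain ⟨m, rfl⟩ : ∃ m, n = m + 1 := ⟨n - 1, by omega⟩
    have h1 : Real.Gamma ((m + 1 : ℕ) : ℝ) = m.factorial := by
      push_cast
      exact Real.Gamma_nat_eq_factorial m
    rw [h1, Nat.factorial_succ]
    have : (m.factorial : ℝ) ≠ 0 := by exact_mod_cast m.factorial_ne_zero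
    field_simp
    push_cast
    ring
  have hbeta : ∫ t in Set.Ioi (0 : ℝ), ProbabilityTheory.betaPDFReal n (lam - n) t = 1 := by
    have h1 := ProbabilityTheory.lintegral_betaPDF_eq_one hn0 (by linarith : 0 < lam - n)
    have h2 : ∫ t, ProbabilityTheory.betaPDFReal n (lam - n) t = 1 := by
      rw [integral_eq_lintegral_of_nonneg_ae]
      · change (∫⁻ t, ProbabilityTheory.betaPDF n (lam - n) t).toReal = 1
        rw [h1, ENNReal.toReal_one]
      · refine ae_of_all _ fun t => ?_
        rw [ProbabilityTheory.betaPDFReal]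
        split_ifs with h
        · have : 0 ≤ 1 - t := by linarith [h.2]
          have := h.1.le
          positivity
        · exact le_rfl
      · exact (ProbabilityTheory.measurable_betaPDFReal _ _).aestronglyMeasurable
    rw [← h2]
    refine setIntegral_eq_integral_of_forall_compl_eq_zero fun t ht => ?_
    rw [ProbabilityTheory.betaPDFReal, if_neg fun h => ht h.1]
  set f : ℝ → ℝ := (Set.Iio 1).indicator fun r => c * (1 - r ^ 2) ^ p with hf
  have hrad : ∫ z : Cn n, f ‖z‖ = (volume (UnitBall n)).toReal := by
    have h1 := integral_fun_norm_addHaar (volume : Measure (Cn n)) f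
    have hdim : Module.finrank ℝ (Cn n) = 2 * n := by
      rw [← Module.finrank_mul_finrank ℝ ℂ (Cn n), Complex.finrank_real_complex,
        finrank_euclideanSpace_fin]
    rw [h1, hdim]
    have h2 := integral_comp_rpow_Ioi_of_pos (g := ProbabilityTheory.betaPDFReal n (lam - n))
      (zero_lt_two' ℝ)
    rw [hbeta] at h2
    -- In polar coordinates the exponent is `2n - 1`, and `y^(2n-1) = (y²)^(n-1) y`. With `t = y²`
    -- the radial integrand is therefore a multiple of the Beta density with parameters `n` and `λ -
    -- n`.
    have h3 : ∫ y in Set.Ioi (0 : ℝ), y ^ (2 * n - 1) • f y = c * B / 2 *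
        ∫ x in Set.Ioi (0 : ℝ), (2 * x ^ ((2 : ℝ) - 1)) •
          ProbabilityTheory.betaPDFReal n (lam - n) (x ^ (2 : ℝ)) := by
      rw [← integral_const_mul]
      refine setIntegral_congr_fun measurableSet_Ioi fun y hy => ?_
      have hy : 0 < y := hy
      have h21 : (2 : ℝ) - 1 = 1 := by norm_num
      simp only [smul_eq_mul, hf, h21, Real.rpow_one, ProbabilityTheory.betaPDFReal, Real.rpow_two]
      by_cases hy1 : y < 1
      · have hy2 : y ^ 2 < 1 := by nlinarith
        rw [Set.indicator_of_mem (Set.mem_Iio.mpr hy1), if_pos ⟨by positivity, hy2⟩]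
        have h4 : (y ^ 2) ^ ((n : ℝ) - 1) * y = y ^ (2 * n - 1) := by
          have h5 : (n : ℝ) - 1 = ((n - 1 : ℕ) : ℝ) := by
            rw [Nat.cast_sub hn, Nat.cast_one]
          rw [h5, Real.rpow_natCast, ← pow_mul, ← pow_succ]
          congr 1
          omega
        rw [← h4, ← hB]
        have hp' : lam - n - 1 = p := rfl
        rw [hp']
        field_simp
      · have hy2 : ¬ y ^ 2 < 1 := by nlinarith
        rw [Set.indicator_of_notMem (by simpa using hy1), if_neg fun h => hy2 h.2]
        simp
    rw [h3, h2, nsmul_eq_mul, smul_eq_mul, mul_one, measureReal_def]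
    push_cast
    linear_combination (volume (UnitBall n)).toReal * hcB
  have hV0 : volume (UnitBall n) ≠ 0 := (measure_ball_pos volume _ one_pos).ne'
  have hVt : volume (UnitBall n) ≠ ∞ := measure_ball_lt_top.ne
  constructor
  rw [← lintegral_one, lintegral_bergmanMeasure]
  simp only [mul_one]
  have h1 : ∫⁻ z in UnitBall n, ENNReal.ofReal (dens n lam z) =
      ∫⁻ z : Cn n, ENNReal.ofReal (f ‖z‖) := by
    rw [← lintegral_indicator isOpen_ball.measurableSet]
    refine lintegral_congr fun z => ?_
    by_cases hz : z ∈ UnitBall n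
    · rw [Set.indicator_of_mem hz, hf, Set.indicator_of_mem (Set.mem_Iio.mpr (norm_lt_one hz))]
      rfl
    · rw [Set.indicator_of_notMem hz, hf, Set.indicator_of_notMem (by simpa using hz)]
      simp
  -- The integral of a nonintegrable function is zero by convention, whereas `hrad` shows this one
  -- to be the positive volume of the ball.
  have hint : Integrable fun z : Cn n => f ‖z‖ := by
    by_contra hcon
    rw [integral_undef hcon] at hrad
    exact (ENNReal.toReal_pos hV0 hVt).ne hrad
  have hnn : 0 ≤ᵐ[volume] fun z : Cn n => f ‖z‖ := by
    refine ae_of_all _ fun (z : Cn n) => ?_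
    refine Set.indicator_apply_nonneg (a := ‖z‖) fun h => mul_nonneg hc0.le (Real.rpow_nonneg ?_ _)
    have h : ‖z‖ < 1 := h
    nlinarith [norm_nonneg z]
  rw [h1, ← ofReal_integral_eq_lintegral_ofReal hint hnn, hrad, ENNReal.ofReal_toReal hVt,
    ENNReal.inv_mul_cancel hV0 hVt]

end BallToeplitz

end

noncomputable section

namespace BallToeplitz

variable {n : ℕ}

/-! ### Invariance of the measure -/

lemma map_eq_of_lintegral {α : Type*} [MeasurableSpace α] {μ ν : Measure α} {f : α → α}
    (hf : Measurable f) (h : ∀ F : α → ℝ≥0∞, ∫⁻ z, F (f z) ∂ν = ∫⁻ z, F z ∂μ) :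
    ν.map f = μ := by
  refine Measure.ext fun s hs => ?_
  rw [Measure.map_apply hf hs, ← lintegral_indicator_one hs, ← h, ← lintegral_indicator_one (hf hs)]
  rfl

lemma map_rotation (lam : ℝ) {c : ℂ} (hc : ‖c‖ = 1) :
    (bergmanMeasure n lam).map (fun z => c • z) = bergmanMeasure n lam := by
  have hc0 : c ≠ 0 := by
    rintro rfl
    simp at hc
  refine map_eq_of_lintegral (by fun_prop) fun F => ?_
  let e : Cn n ≃ₗᵢ[ℝ] Cn n :=
    ⟨(LinearEquiv.smulOfNeZero ℂ (Cn n) c hc0).restrictScalars ℝ, fun x => by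
      simp [norm_smul, hc]⟩
  have he : ∀ x, e x = c • x := fun x => rfl
  have h := e.measurePreserving.setLIntegral_comp_preimage_emb e.toHomeomorph.measurableEmbedding
    (fun z => ENNReal.ofReal (dens n lam z) * F z) (UnitBall n)
  have hpre : e ⁻¹' UnitBall n = UnitBall n := by
    ext u
    simp
  rw [hpre] at h
  rw [lintegral_bergmanMeasure, lintegral_bergmanMeasure, ← h]
  congr 1
  refine lintegral_congr fun z => ?_
  simp [dens, norm_smul, hc, he]

/-- Rewriting quasi-invariance as an equality of measures makes it usable for complex integrands and
for integrability. -/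
lemma map_moeb (lam : ℝ) (g : SU n) :
    ((bergmanMeasure n lam).withDensity fun z =>
      ((‖den (mat g) z‖₊ ^ (-(2 * lam)) : ℝ≥0) : ℝ≥0∞)).map (moeb (mat g)) =
        bergmanMeasure n lam := by
  have hm : Measurable fun z => ((‖den (mat g) z‖₊ ^ (-(2 * lam)) : ℝ≥0) : ℝ≥0∞) :=
    ((measurable_den _).nnnorm.pow_const _).coe_nnreal_ennreal
  refine map_eq_of_lintegral (measurable_moeb _) fun F => ?_
  rw [lintegral_withDensity_eq_lintegral_mul_non_measurable₀ _ hm.aemeasurable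
    (ae_of_all _ fun _ => ENNReal.coe_lt_top), lintegral_moeb lam g F]
  refine lintegral_congr fun z => ?_
  simp only [Pi.mul_apply]
  congr 1
  rw [← ENNReal.ofReal_coe_nnreal]
  simp

lemma measurable_density (lam : ℝ) (g : SU n) :
    Measurable fun z => ‖den (mat g) z‖₊ ^ (-(2 * lam)) :=
  (measurable_den _).nnnorm.pow_const _

lemma integral_moeb (lam : ℝ) (g : SU n) {F : Cn n → ℂ}
    (hF : AEStronglyMeasurable F (bergmanMeasure n lam)) :
    ∫ z, F z ∂bergmanMeasure n lam =
      ∫ z, ((‖den (mat g) z‖ ^ (-(2 * lam)) : ℝ) : ℂ) * F (moeb (mat g) z)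
        ∂bergmanMeasure n lam := by
  conv_lhs => rw [← map_moeb lam g]
  rw [integral_map (measurable_moeb _).aemeasurable (by rwa [map_moeb]),
    integral_withDensity_eq_integral_smul (measurable_density lam g)]
  refine integral_congr_ae (ae_of_all _ fun z => ?_)
  simp [NNReal.smul_def]

lemma integrable_moeb {lam : ℝ} (g : SU n) {F : Cn n → ℂ}
    (hF : Integrable F (bergmanMeasure n lam)) :
    Integrable (fun z => ((‖den (mat g) z‖ ^ (-(2 * lam)) : ℝ) : ℂ) * F (moeb (mat g) z))
      (bergmanMeasure n lam) := by
  rw [← map_moeb lam g] at hF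
  have h := (integrable_withDensity_iff_integrable_smul (measurable_density lam g)).mp
    (hF.comp_measurable (measurable_moeb _))
  refine h.congr (ae_of_all _ fun z => ?_)
  simp [NNReal.smul_def]

/-! ### The mean value property -/

/-- For fixed `z` the function `c ↦ F (c • z)` is holomorphic near the closed unit disc, so its
circle average is its value at the centre. -/
lemma integral_circleMap_smul {F : Cn n → ℂ} (hF : DifferentiableOn ℂ F (UnitBall n)) {z : Cn n}
    (hz : z ∈ UnitBall n) :
    ∫ θ in Set.Ioc 0 (2 * Real.pi), F (circleMap 0 1 θ • z) = (2 * Real.pi : ℝ) * F 0 := by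
  have hmem : ∀ c : ℂ, ‖c‖ ≤ 1 → c • z ∈ UnitBall n := by
    intro c hc
    have h1 := norm_lt_one hz
    rw [mem_ball_zero_iff, norm_smul]
    nlinarith [norm_nonneg z, norm_nonneg c]
  have hdiff : DiffContOnCl ℂ (fun c : ℂ => F (c • z)) (ball 0 |1|) := by
    have hd : DifferentiableOn ℂ (fun c : ℂ => F (c • z)) (closedBall 0 1) :=
      hF.comp (by fun_prop) fun c hc => hmem c (by simpa using hc)
    rw [abs_one]
    refine DifferentiableOn.diffContOnCl ?_
    rwa [closure_ball _ one_ne_zero]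
  have hca := hdiff.circleAverage
  rw [Real.circleAverage_def] at hca
  simp only [zero_smul] at hca
  rw [← intervalIntegral.integral_of_le (by positivity), ← hca, Complex.real_smul, ← mul_assoc,
    ← Complex.ofReal_mul, mul_inv_cancel₀ (by positivity), Complex.ofReal_one, one_mul]

/-- The mean value property for a rotation invariant measure on the ball. -/
lemma integral_eq_apply_zero {μ : Measure (Cn n)} [IsProbabilityMeasure μ]
    (hμ : ∀ c : ℂ, ‖c‖ = 1 → μ.map (fun z => c • z) = μ) (hball : ∀ᵐ z ∂μ, z ∈ UnitBall n)
    {F : Cn n → ℂ} (hF : DifferentiableOn ℂ F (UnitBall n)) (hint : Integrable F μ) :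
    ∫ z, F z ∂μ = F 0 := by
  classical
  obtain ⟨ν, hν⟩ : ∃ ν, ν = (volume : Measure ℝ).restrict (Set.Ioc 0 (2 * Real.pi)) := ⟨_, rfl⟩
  -- `F` is unconstrained off the ball; a measurable function agreeing with it on the ball is needed
  -- for Fubini.
  obtain ⟨G, hGm, hGF⟩ : ∃ G : Cn n → ℂ, Measurable G ∧ ∀ u ∈ UnitBall n, G u = F u :=
    ⟨(UnitBall n).piecewise F (fun _ => 0),
      hF.continuousOn.measurable_piecewise continuousOn_const isOpen_ball.measurableSet,
      fun u hu => Set.piecewise_eq_of_mem _ _ _ hu⟩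
  have : IsFiniteMeasure ν := by
    rw [hν]
    infer_instance
  have hae : G =ᵐ[μ] F := by
    filter_upwards [hball] with z hz using hGF z hz
  have hGint : Integrable G μ := hint.congr hae.symm
  have hrot : ∀ θ : ℝ, MeasurePreserving (fun z : Cn n => circleMap 0 1 θ • z) μ μ := fun θ =>
    ⟨by fun_prop, hμ _ (by simp)⟩
  have hm : Measurable fun p : ℝ × Cn n => G (circleMap 0 1 p.1 • p.2) :=
    hGm.comp (Continuous.measurable (by fun_prop))
  have hslice : ∀ θ, Integrable (fun z => G (circleMap 0 1 θ • z)) μ := fun θ =>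
    (hrot θ).integrable_comp_of_integrable hGint
  have hprod : Integrable (fun p : ℝ × Cn n => G (circleMap 0 1 p.1 • p.2)) (ν.prod μ) := by
    rw [integrable_prod_iff hm.aestronglyMeasurable]
    refine ⟨ae_of_all _ hslice, ?_⟩
    have hc : ∀ θ, ∫ z, ‖G (circleMap 0 1 θ • z)‖ ∂μ = ∫ z, ‖G z‖ ∂μ := fun θ => by
      have h := integral_map (μ := μ) (φ := fun z : Cn n => circleMap 0 1 θ • z)
        (hrot θ).measurable.aemeasurable (f := fun z => ‖G z‖) hGm.norm.aestronglyMeasurable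
      rw [(hrot θ).map_eq] at h
      exact h.symm
    simp only [hc]
    exact integrable_const _
  -- The average over all rotations is computed in both orders: rotation invariance leaves `∫ F`,
  -- and the mean value property on circles leaves `F 0`.
  have hswap := integral_integral_swap (f := fun θ z => G (circleMap 0 1 θ • z)) hprod
  have hL : ∫ θ, ∫ z, G (circleMap 0 1 θ • z) ∂μ ∂ν = (2 * Real.pi : ℝ) * ∫ z, G z ∂μ := by
    have hc : ∀ θ, ∫ z, G (circleMap 0 1 θ • z) ∂μ = ∫ z, G z ∂μ := fun θ => by
      have h := integral_map (μ := μ) (φ := fun z : Cn n => circleMap 0 1 θ • z)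
        (hrot θ).measurable.aemeasurable (f := G) hGm.aestronglyMeasurable
      rw [(hrot θ).map_eq] at h
      exact h.symm
    simp only [hc]
    rw [integral_const, hν, measureReal_restrict_apply_univ, Real.volume_real_Ioc_of_le (by positivity),
      sub_zero, Complex.real_smul]
  have hR : ∫ z, ∫ θ, G (circleMap 0 1 θ • z) ∂ν ∂μ = (2 * Real.pi : ℝ) * F 0 := by
    have h1 : (fun z => ∫ θ, G (circleMap 0 1 θ • z) ∂ν) =ᵐ[μ]
        fun _ => ((2 * Real.pi : ℝ) : ℂ) * F 0 := by
      filter_upwards [hball] with z hz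
      have h2 : ∀ θ : ℝ, G (circleMap 0 1 θ • z) = F (circleMap 0 1 θ • z) := fun θ => by
        refine hGF _ ?_
        rw [mem_ball_zero_iff, norm_smul]
        simpa using norm_lt_one hz
      simp only [h2, hν]
      exact integral_circleMap_smul hF hz
    rw [integral_congr_ae h1]
    simp
  rw [hL, hR] at hswap
  have h0 : ((2 * Real.pi : ℝ) : ℂ) ≠ 0 := by
    exact_mod_cast (by positivity : (2 * Real.pi) ≠ 0)
  rw [← integral_congr_ae hae]
  exact mul_left_cancel₀ h0 hswap

/-! ### Transitivity -/

/-- A family with the Gram matrix of the standard basis is, up to a phase, the image of the standard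
basis under an element of `SU(n,1)`. -/
lemma exists_mem_SU (v : Ix n → Ix n → ℂ) (hv : ∀ i j, herm (v i) (v j) = J n i j) :
    ∃ (a : Circle) (g : SU n), ∀ i, mat g *ᵥ Pi.single i 1 = (a : ℂ) • v i := by
  set A : Matrix (Ix n) (Ix n) ℂ := (Matrix.of v)ᵀ with hA
  have hJJ : J n * J n = 1 := by simp [J, Matrix.fromBlocks_multiply]
  have hcol : ∀ i, A *ᵥ Pi.single i 1 = v i := fun i => by
    rw [Matrix.mulVec_single_one]
    rfl
  have hform : Aᴴ * J n * A = J n := by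
    ext i j
    rw [← hv, herm, Matrix.mul_assoc, Matrix.mul_apply]
    rfl
  have hform' : A * J n * Aᴴ = J n := by
    have h1 : (J n * Aᴴ * J n) * A = 1 := by
      rw [Matrix.mul_assoc, Matrix.mul_assoc, ← Matrix.mul_assoc Aᴴ, hform, hJJ]
    have h2 := mul_eq_one_comm.mp h1
    calc A * J n * Aᴴ = A * J n * Aᴴ * (J n * J n) := by rw [hJJ, Matrix.mul_one]
      _ = (A * (J n * Aᴴ * J n)) * J n := by simp only [Matrix.mul_assoc]
      _ = J n := by rw [h2, Matrix.one_mul]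
  have hJ0 : (J n).det ≠ 0 := by
    have h : (J n).det * (J n).det = 1 := by rw [← Matrix.det_mul, hJJ, Matrix.det_one]
    exact left_ne_zero_of_mul_eq_one h
  have hdet : ‖A.det‖ = 1 := by
    have h := congrArg Matrix.det hform'
    rw [Matrix.det_mul, Matrix.det_mul, Matrix.det_conjTranspose] at h
    have h1 : A.det * star A.det = 1 := by
      apply mul_right_cancel₀ hJ0
      rw [one_mul]
      linear_combination h
    rw [RCLike.star_def, Complex.mul_conj'] at h1
    have h2 : ‖A.det‖ ^ 2 = 1 := by exact_mod_cast h1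
    exact (pow_eq_one_iff_of_nonneg (norm_nonneg _) two_ne_zero).mp h2
  -- The matrix of the family preserves the form but need not have determinant one; an `(n + 1)`-st
  -- root of the inverse determinant, of modulus one, corrects this.
  obtain ⟨a, ha⟩ := IsAlgClosed.exists_pow_nat_eq (A.det)⁻¹ (Nat.succ_pos n)
  have hna : ‖a‖ = 1 := by
    have h := congrArg norm ha
    rw [norm_pow, norm_inv, hdet, inv_one] at h
    exact (pow_eq_one_iff_of_nonneg (norm_nonneg _) (Nat.succ_ne_zero n)).mp h
  have hd0 : A.det ≠ 0 := by
    intro h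
    rw [h, norm_zero] at hdet
    exact zero_ne_one hdet
  have haa : a * star a = 1 := by
    rw [RCLike.star_def, Complex.mul_conj', hna]
    simp
  refine ⟨⟨a, mem_sphere_zero_iff_norm.mpr hna⟩, ⟨⟨a • A, ?_⟩, ?_⟩, fun i => ?_⟩
  · rw [Matrix.det_smul]
    have : Fintype.card (Ix n) = n + 1 := by simp
    rw [this, ha, inv_mul_cancel₀ hd0]
  · change (a • A) * J n * (a • A)ᴴ = J n
    rw [Matrix.conjTranspose_smul, Matrix.smul_mul, Matrix.smul_mul, Matrix.mul_smul, smul_smul,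
      hform', haa, one_smul]
  · change (a • A) *ᵥ _ = a • _
    rw [Matrix.smul_mulVec, hcol]

lemma herm_single (i j : Ix n) : herm (Pi.single i 1) (Pi.single j 1) = J n i j := by
  rw [herm, ← Pi.single_star, star_one, single_one_dotProduct, Matrix.mulVec_single_one]
  rfl

lemma hvec_zero : hvec (0 : Cn n) = Pi.single (Sum.inr ()) 1 := by
  funext i
  rcases i with i | i <;> simp [hvec]

lemma moeb_zero_of_column {A : Matrix (Ix n) (Ix n) ℂ} {b : ℂ} (hb : b ≠ 0) {w : Cn n}
    (h : A *ᵥ Pi.single (Sum.inr ()) 1 = b • hvec w) : moeb A 0 = w := by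
  rw [← hvec_zero] at h
  have hden : den A 0 = b := by rw [den, h]; simp [hvec]
  ext i
  change (A *ᵥ hvec 0) (Sum.inl i) / den A 0 = w i
  rw [hden, h]
  simp [hvec, hb]

/-- `SU(n,1)` acts transitively on the ball. -/
lemma exists_moeb_zero {w : Cn n} (hw : w ∈ UnitBall n) : ∃ g : SU n, moeb (mat g) 0 = w := by
  rcases eq_or_ne w 0 with rfl | hw0
  · exact ⟨1, by rw [mat_one, moeb_one]⟩
  have hw1 := norm_lt_one hw
  have hwpos : 0 < ‖w‖ := norm_pos_iff.mpr hw0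
  set s := 1 - ‖w‖ ^ 2 with hs
  have hs0 : 0 < s := by nlinarith
  have hs1 : s < 1 := by nlinarith [sq_pos_of_pos hwpos]
  set d := (Real.sqrt s)⁻¹ with hd
  have hq0 : 0 < Real.sqrt s := Real.sqrt_pos.mpr hs0
  have hdd : d * d * s = 1 := by
    rw [hd, ← mul_inv, Real.mul_self_sqrt hs0.le, inv_mul_cancel₀ hs0.ne']
  have hd0 : 0 < d := inv_pos.mpr hq0
  have hd1 : 1 < d := by
    by_contra hcon
    have : d * d ≤ 1 := by nlinarith
    nlinarith
  set e : Ix n → ℂ := Pi.single (Sum.inr ()) 1 with he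
  set u : Ix n → ℂ := (d : ℂ) • hvec w with hu
  have hee : herm e e = 1 := by rw [he, herm_single]; simp [J]
  have hew : herm e (hvec w) = 1 := by
    rw [he, ← hvec_zero, herm_hvec]
    simp
  have heu : herm e u = d := by rw [hu, herm_smul_right, hew, mul_one]
  have hue : herm u e = d := by rw [← herm_star, heu]; simp
  have huu : herm u u = 1 := by
    rw [hu, herm_smul_right, herm_smul_left, herm_hvec, one_sub_inner_self]
    simp only [RCLike.star_def, Complex.conj_ofReal]
    exact_mod_cast (by linarith : d * (d * s) = 1)
  -- The vector `u = d (w, 1)` has the same length one as `e`, and the reflection in `e - u`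
  -- interchanges them. Here `t = 1 - d` is half of `⟨v, v⟩`, and it is nonzero because `w ≠ 0`
  -- gives `d > 1`.
  set v : Ix n → ℂ := e + (-1 : ℂ) • u with hv
  set t : ℂ := 1 - d with ht
  have ht0 : t ≠ 0 := by
    rw [ht]
    exact_mod_cast (by linarith : (1 : ℝ) - d ≠ 0)
  have hvv : herm v v = 2 * t := by
    simp only [hv, herm_add_left, herm_add_right, herm_smul_left, herm_smul_right, hee, heu, hue,
      huu, ht, star_neg, star_one]
    ring
  have hst : star t = t := by simp [ht]
  set r : (Ix n → ℂ) → Ix n → ℂ := fun x => x + (-(herm v x / t)) • v with hr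
  have hrr : ∀ x y, herm (r x) (r y) = herm x y := by
    intro x y
    simp only [hr, herm_add_left, herm_add_right, herm_smul_left, herm_smul_right, hvv, star_neg,
      star_div₀, hst, herm_star]
    field_simp
    ring
  have hre : r e = u := by
    have h1 : herm v e = t := by
      simp only [hv, herm_add_left, herm_smul_left, hee, hue, star_neg, star_one, ht]
      ring
    have h2 : r e = e + (-(herm v e / t)) • v := rfl
    rw [h2, h1, div_self ht0, hv]
    module
  obtain ⟨a, g, hg⟩ := exists_mem_SU (fun i => r (Pi.single i 1)) fun i j => by
    rw [hrr, herm_single]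
  refine ⟨g, moeb_zero_of_column (b := a * d) (mul_ne_zero a.coe_ne_zero ?_) ?_⟩
  · exact_mod_cast hd0.ne'
  · rw [hg, ← he, hre, hu, smul_smul]

/-! ### Holomorphy of the cocycle -/

lemma differentiableAt_moeb (g : SU n) {z : Cn n} (hz : z ∈ UnitBall n) :
    DifferentiableAt ℂ (moeb (mat g)) z :=
  (hasFDerivAt_moeb _ (den_ne_zero g hz)).differentiableAt

lemma differentiableAt_den (A : Matrix (Ix n) (Ix n) ℂ) (z : Cn n) :
    DifferentiableAt ℂ (den A) z := by
  have h : den A = fun z => rowCLM A (Sum.inr ()) z + A (Sum.inr ()) (Sum.inr ()) :=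
    funext (den_eq_rowCLM A)
  rw [h]
  fun_prop

/-- By `Chart.continuous_logDen_sub` the logarithm of the denominator is its value at the origin
plus a difference of principal logarithms of a holomorphic function in the right half plane. This
expression makes sense off the ball and is visibly holomorphic on it. -/
lemma exists_holomorphic_j (lam : ℝ) (g : Cover n) : ∃ Φ : Cn n → ℂ,
    DifferentiableOn ℂ Φ (UnitBall n) ∧ ∀ z : UnitBall n, Φ z = Cover.j lam g z := by
  set z₀ : UnitBall n := ⟨0, by simp⟩ with hz₀
  set d := mat g.proj (Sum.inr ()) (Sum.inr ()) with hd
  refine ⟨fun z => Complex.exp (-(lam : ℂ) * (g.logDen z₀ + (Complex.log (den (mat g.proj) z / d) -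
    Complex.log (den (mat g.proj) z₀ / d)))), fun z hz => ?_, fun z => ?_⟩
  · refine DifferentiableAt.differentiableWithinAt ?_
    have h1 : DifferentiableAt ℂ (fun z => Complex.log (den (mat g.proj) z / d)) z :=
      DifferentiableAt.comp (g := Complex.log) (f := fun z => den (mat g.proj) z / d) z
        (Complex.differentiableAt_log (Or.inl (re_den_div_pos g.proj hz)))
        (by simpa only [div_eq_mul_inv] using (differentiableAt_den _ z).mul_const d⁻¹)
    exact (((h1.sub_const _).const_add _).const_mul _).cexp
  · simp only
    rw [Cover.j, hd, ← Chart.continuous_logDen_sub, add_sub_cancel]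

end BallToeplitz

end

noncomputable section

namespace BallToeplitz

variable {n : ℕ}

/-! ### The reproducing kernel -/

lemma Cover.conj_j_mul_j (lam : ℝ) (g : Cover n) (z : UnitBall n) :
    (starRingEnd ℂ) (j lam g z) * j lam g z =
      ((‖den (mat g.proj) z‖ ^ (-(2 * lam)) : ℝ) : ℂ) := by
  rw [Complex.conj_mul', norm_j, ← Complex.ofReal_pow]
  congr 1
  rw [← Real.rpow_natCast, ← Real.rpow_mul (norm_nonneg _)]
  congr 1
  push_cast
  ring

lemma differentiableOn_bergmanKernel (lam : ℝ) {w : Cn n} (hw : w ∈ UnitBall n) :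
    DifferentiableOn ℂ (fun z => bergmanKernel lam z w) (UnitBall n) := by
  intro z hz
  refine DifferentiableAt.differentiableWithinAt ?_
  have h1 : DifferentiableAt ℂ (fun z : Cn n => 1 - inner ℂ w z) z :=
    (differentiableAt_const _).sub (innerSL ℂ w).differentiableAt
  exact DifferentiableAt.cpow_const h1 (Or.inl (re_one_sub_inner_pos hz hw))

lemma norm_bergmanKernel_le {lam : ℝ} (hlam : 0 ≤ lam) {z w : Cn n} (hz : z ∈ UnitBall n)
    (hw : w ∈ UnitBall n) : ‖bergmanKernel lam z w‖ ≤ (1 - ‖w‖) ^ (-lam) := by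
  rw [norm_bergmanKernel]
  have hw' := norm_lt_one hw
  refine Real.rpow_le_rpow_of_nonpos (by linarith) ?_ (by linarith)
  have h1 : ‖inner ℂ w z‖ ≤ ‖w‖ := (norm_inner_le_norm w z).trans
    (mul_le_of_le_one_right (norm_nonneg _) (norm_lt_one hz).le)
  have h2 := norm_sub_norm_le (1 : ℂ) (inner ℂ w z)
  rw [norm_one] at h2
  linarith

lemma aestronglyMeasurable_of_differentiableOn (lam : ℝ) {F : Cn n → ℂ}
    (hF : DifferentiableOn ℂ F (UnitBall n)) :
    AEStronglyMeasurable F (bergmanMeasure n lam) := by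
  have h1 : bergmanMeasure n lam ≪ volume.restrict (UnitBall n) :=
    (withDensity_absolutelyContinuous _ _).trans
      (Measure.smul_absolutelyContinuous (c := (volume (UnitBall n))⁻¹))
  exact (hF.continuousOn.aestronglyMeasurable isOpen_ball.measurableSet).mono_ac h1

lemma memLp_top_bergmanKernel {lam : ℝ} (hlam : 0 ≤ lam) {w : Cn n} (hw : w ∈ UnitBall n) :
    MemLp (fun z => bergmanKernel lam z w) ∞ (bergmanMeasure n lam) := by
  refine memLp_top_of_bound (aestronglyMeasurable_of_differentiableOn lam
    (differentiableOn_bergmanKernel lam hw)) ((1 - ‖w‖) ^ (-lam)) ?_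
  filter_upwards [ae_mem_ball n lam] with z hz using norm_bergmanKernel_le hlam hz hw

open Classical in
/-- The reproducing kernel at `w` as an element of the Bergman space. -/
def kernelVec (lam : ℝ) (w : UnitBall n) : bergman n lam :=
  if h : MemLp (fun z => bergmanKernel lam z w.1) 2 (bergmanMeasure n lam) then
    ⟨h.toLp, _, differentiableOn_bergmanKernel lam w.2, h.coeFn_toLp⟩ else 0

section

variable {lam : ℝ} [IsProbabilityMeasure (bergmanMeasure n lam)]

lemma kernelVec_ae (hlam : 0 ≤ lam) (w : UnitBall n) :
    (kernelVec lam w).1 =ᵐ[bergmanMeasure n lam] fun z => bergmanKernel lam z w.1 := by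
  have h : MemLp (fun z => bergmanKernel lam z w.1) 2 (bergmanMeasure n lam) :=
    (memLp_top_bergmanKernel hlam w.2).mono_exponent le_top
  rw [kernelVec, dif_pos h]
  exact h.coeFn_toLp

/-- The reproducing property. -/
lemma inner_kernelVec (hlam : 0 ≤ lam) (f : bergman n lam) {F : Cn n → ℂ}
    (hF : DifferentiableOn ℂ F (UnitBall n)) (hf : f.1 =ᵐ[bergmanMeasure n lam] F)
    (w : UnitBall n) : inner ℂ (kernelVec lam w) f = F w := by
  -- The point `w` is moved to the origin, where the kernel is constant and the reproducing property
  -- is the mean value property.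
  obtain ⟨g', hg'⟩ := exists_moeb_zero w.2
  obtain ⟨g, rfl⟩ := Cover.p_surjective g'
  set z₀ : UnitBall n := ⟨0, by simp⟩ with hz₀
  have hgz : g • z₀ = w := Subtype.ext hg'
  set h : Cn n → ℂ := fun z => (starRingEnd ℂ) (bergmanKernel lam z w.1) * F z with hh
  have hinner : inner ℂ (kernelVec lam w) f = ∫ z, h z ∂bergmanMeasure n lam := by
    change inner ℂ (kernelVec lam w).1 f.1 = _
    rw [L2.inner_def]
    refine integral_congr_ae ?_
    filter_upwards [kernelVec_ae hlam w, hf] with z h1 h2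
    rw [h1, h2, RCLike.inner_apply, mul_comm]
  have hFint : MemLp F 2 (bergmanMeasure n lam) := (Lp.memLp f.1).ae_eq hf
  have hKint : MemLp (fun z => (starRingEnd ℂ) (bergmanKernel lam z w.1)) ∞
      (bergmanMeasure n lam) := (memLp_top_bergmanKernel hlam w.2).star
  have hint : Integrable h (bergmanMeasure n lam) :=
    (hFint.integrable one_le_two).bdd_mul hKint.1 (c := (1 - ‖w.1‖) ^ (-lam)) (by
      filter_upwards [ae_mem_ball n lam] with z hz
      rw [RCLike.norm_conj]
      exact norm_bergmanKernel_le hlam hz w.2)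
  obtain ⟨Φ, hΦ, hΦj⟩ := exists_holomorphic_j lam g
  -- Covariance gives `K(gz, w) j(g, z) conj j(g, 0) = 1`. After the factor `|j(g, z)|²` from the
  -- change of variables, the antiholomorphic parts cancel and the integrand becomes the holomorphic
  -- `j(g, z) F(gz) / j(g, 0)`.
  set G : Cn n → ℂ := fun z => Φ z * F (moeb (mat g.proj) z) * (Cover.j lam g z₀)⁻¹ with hG
  have hGd : DifferentiableOn ℂ G (UnitBall n) := by
    refine (hΦ.mul (hF.comp (fun z hz => (differentiableAt_moeb g.proj hz).differentiableWithinAt)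
      fun z hz => moeb_mem g.proj hz)).mul_const _
  have hae : (fun z => ((‖den (mat g.proj) z‖ ^ (-(2 * lam)) : ℝ) : ℂ) * h (moeb (mat g.proj) z))
      =ᵐ[bergmanMeasure n lam] G := by
    filter_upwards [ae_mem_ball n lam] with z hz
    have h1 := g.bergmanKernel_smul lam ⟨z, hz⟩ z₀
    rw [hgz] at h1
    change bergmanKernel lam (moeb (mat g.proj) z) w.1 * _ * _ = bergmanKernel lam z 0 at h1
    rw [bergmanKernel_zero] at h1
    have h2 := congrArg (starRingEnd ℂ) h1
    rw [map_mul, map_mul, Complex.conj_conj, map_one] at h2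
    have h3 := (Cover.conj_j_mul_j lam g ⟨z, hz⟩).symm
    have h4 := Cover.j_ne_zero lam g z₀
    simp only [hh, hG, hΦj ⟨z, hz⟩, h3]
    field_simp
    linear_combination (Cover.j lam g ⟨z, hz⟩ * F (moeb (mat g.proj) z)) * h2
  have hGint : Integrable G (bergmanMeasure n lam) := (integrable_moeb g.proj hint).congr hae
  rw [hinner, integral_moeb lam g.proj hint.1, integral_congr_ae hae,
    integral_eq_apply_zero (fun c hc => map_rotation lam hc) (ae_mem_ball n lam) hGd hGint]
  have h5 : Φ 0 = Cover.j lam g z₀ := hΦj z₀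
  have h6 : moeb (mat g.proj) 0 = w := hg'
  simp only [hG]
  rw [h5, h6]
  have h4 := Cover.j_ne_zero lam g z₀
  field_simp

lemma inner_kernelVec_holo (hlam : 0 ≤ lam) (f : bergman n lam) (w : UnitBall n) :
    inner ℂ (kernelVec lam w) f = holo f w :=
  inner_kernelVec hlam f (holo_spec f).1 (holo_spec f).2 w

lemma inner_kernelVec_kernelVec (hlam : 0 ≤ lam) (z w : UnitBall n) :
    inner ℂ (kernelVec lam z) (kernelVec lam w) = bergmanKernel lam z.1 w.1 :=
  inner_kernelVec hlam _ (differentiableOn_bergmanKernel lam w.2) (kernelVec_ae hlam w) z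

/-- The kernel vector lies in the Bergman space, so the projection inside the Toeplitz operator
disappears from the inner product. -/
lemma inner_kernelVec_toeplitz (hlam : 0 ≤ lam) (φ : Lp ℂ ∞ (bergmanMeasure n lam)) (z w : UnitBall n) :
    inner ℂ (kernelVec lam z) (toeplitz φ (kernelVec lam w)) =
      ∫ u, φ u * bergmanKernel lam u w.1 * (starRingEnd ℂ) (bergmanKernel lam u z.1)
        ∂bergmanMeasure n lam := by
  have h1 : inner ℂ (kernelVec lam z) (toeplitz φ (kernelVec lam w)) =
      inner ℂ (kernelVec lam z).1 (mulOp φ (kernelVec lam w).1) :=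
    Submodule.inner_orthogonalProjectionOnto_eq_of_mem_left (kernelVec lam z) _
  rw [h1, L2.inner_def]
  refine integral_congr_ae ?_
  filter_upwards [kernelVec_ae hlam z, kernelVec_ae hlam w, mulOp_ae φ (kernelVec lam w).1]
    with u h1 h2 h3
  rw [h3, h1, h2, RCLike.inner_apply]

/-- The integral is `‖K_w‖²`, which the reproducing property evaluates as `K(w, w)`. It is the exact
case from which the Forelli–Rudin estimate is derived. -/
lemma norm_kernelVec_sq (hlam : 0 ≤ lam) (w : UnitBall n) :
    ∫⁻ z, ENNReal.ofReal (‖(1 - inner ℂ w.1 z : ℂ)‖ ^ (-(2 * lam))) ∂bergmanMeasure n lam =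
      ENNReal.ofReal ((1 - ‖w.1‖ ^ 2) ^ (-lam)) := by
  have h1 := inner_kernelVec_kernelVec hlam w w
  rw [bergmanKernel_self lam w.2] at h1
  have h0 := (inner_self_eq_norm_sq_to_K (𝕜 := ℂ) (kernelVec lam w)).symm.trans h1
  have h2 : ‖kernelVec lam w‖ ^ 2 = (1 - ‖w.1‖ ^ 2) ^ (-lam) := Complex.ofReal_injective
    ((Complex.ofReal_pow _ _).trans h0)
  have h3 : ‖kernelVec lam w‖ = ‖(kernelVec lam w).1‖ := rfl
  rw [← h2, h3, ENNReal.ofReal_pow (norm_nonneg _), Lp.norm_def,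
    ENNReal.ofReal_toReal (Lp.eLpNorm_ne_top _)]
  have h4 := eLpNorm_nnreal_pow_eq_lintegral (p := 2) (μ := bergmanMeasure n lam)
    (f := (kernelVec lam w).1) two_ne_zero
  norm_num at h4
  rw [h4]
  refine lintegral_congr_ae ?_
  filter_upwards [kernelVec_ae hlam w] with z hz
  rw [hz, ← ofReal_norm, norm_bergmanKernel, ← ENNReal.ofReal_pow (by positivity)]
  congr 1
  rw [← Real.rpow_natCast, ← Real.rpow_mul (norm_nonneg _)]
  congr 1
  push_cast
  ring

end

end BallToeplitz

end

noncomputable section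

namespace BallToeplitz

variable {n : ℕ}

/-! ### The Forelli–Rudin estimate -/

/-- This trades the exponent `λ` for `2λ`, where the integral over the ball is known exactly. With
`a = |1 - x|` and `τ` between `1 - a/2` and `1 - a/4` one has `1 - τ ≥ a/4` and `|1 - τx| ≤ 2a`.
That interval of length `a/4` alone contributes at least `(a/4)^λ (2a)^(-2λ) = 16^(-λ) a^(-λ)`. -/
lemma rpow_norm_one_sub_le {lam : ℝ} (hlam : 1 ≤ lam) {x : ℂ} (hx : ‖x‖ < 1) :
    ENNReal.ofReal (‖1 - x‖ ^ (-lam)) ≤ ENNReal.ofReal (16 ^ lam) *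
      ∫⁻ τ in Set.Ioo (0 : ℝ) 1,
        ENNReal.ofReal ((1 - τ) ^ (lam - 1) * ‖1 - τ * x‖ ^ (-(2 * lam))) := by
  set a := ‖1 - x‖ with ha
  have ha2 : a < 2 := by
    have := norm_sub_le (1 : ℂ) x
    rw [norm_one] at this
    linarith
  have ha0 : 0 < a := by
    have := norm_sub_norm_le (1 : ℂ) x
    rw [norm_one] at this
    linarith
  have hsub : Set.Ioo (1 - a / 2) (1 - a / 4) ⊆ Set.Ioo (0 : ℝ) 1 := fun τ hτ =>
    ⟨by linarith [hτ.1], by linarith [hτ.2]⟩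
  have hpt : ∀ τ ∈ Set.Ioo (1 - a / 2) (1 - a / 4),
      ENNReal.ofReal ((a / 4) ^ (lam - 1) * (2 * a) ^ (-(2 * lam))) ≤
        ENNReal.ofReal ((1 - τ) ^ (lam - 1) * ‖1 - τ * x‖ ^ (-(2 * lam))) := by
    intro τ hτ
    have h01 := hsub hτ
    have hτx : ‖(τ : ℂ) * x‖ < 1 := by
      rw [norm_mul, Complex.norm_real, Real.norm_of_nonneg h01.1.le]
      nlinarith [norm_nonneg x, h01.1, h01.2]
    have h1 : 0 < ‖1 - τ * x‖ := by
      have := norm_sub_norm_le (1 : ℂ) (τ * x)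
      rw [norm_one] at this
      linarith
    have h2 : ‖1 - τ * x‖ ≤ 2 * a := by
      have h3 : 1 - τ * x = (1 - x) + ((1 - τ : ℝ) : ℂ) * x := by
        push_cast
        ring
      rw [h3]
      refine (norm_add_le _ _).trans ?_
      rw [norm_mul, Complex.norm_real, Real.norm_of_nonneg (by linarith [h01.2])]
      nlinarith [norm_nonneg x, hτ.1, h01.2]
    refine ENNReal.ofReal_le_ofReal (mul_le_mul ?_ ?_ (by positivity) ?_)
    · exact Real.rpow_le_rpow (by positivity) (by linarith [hτ.2]) (by linarith)
    · exact Real.rpow_le_rpow_of_nonpos h1 h2 (by linarith)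
    · exact Real.rpow_nonneg (by linarith [h01.2]) _
  have hval : a ^ (-lam) = 16 ^ lam * ((a / 4) ^ (lam - 1) * (2 * a) ^ (-(2 * lam)) * (a / 4)) := by
    have h4 : (a / 4) ^ (lam - 1) * (a / 4) = (a / 4) ^ lam := by
      rw [Real.rpow_sub_one (by positivity), div_mul_cancel₀ _ (by positivity)]
    have h5 : (2 * a) ^ (-(2 * lam)) = ((4 : ℝ) ^ lam)⁻¹ * (a ^ lam)⁻¹ * (a ^ lam)⁻¹ := by
      rw [Real.rpow_neg (by positivity), Real.rpow_mul (by positivity), Real.rpow_two, mul_pow,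
        Real.mul_rpow (by positivity) (by positivity), mul_inv, sq a,
        Real.mul_rpow (by positivity) (by positivity), mul_inv]
      norm_num [mul_assoc]
    have h6 : (16 : ℝ) ^ lam = 4 ^ lam * 4 ^ lam := by
      rw [← Real.mul_rpow (by norm_num) (by norm_num)]
      norm_num
    rw [mul_right_comm, h4, h5, h6, Real.div_rpow (by positivity) (by norm_num),
      Real.rpow_neg ha0.le]
    have h7 : 0 < a ^ lam := by positivity
    have h8 : (0 : ℝ) < 4 ^ lam := by positivity
    field_simp
  calc ENNReal.ofReal (a ^ (-lam))
      = ENNReal.ofReal (16 ^ lam) * ∫⁻ _ in Set.Ioo (1 - a / 2) (1 - a / 4),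
          ENNReal.ofReal ((a / 4) ^ (lam - 1) * (2 * a) ^ (-(2 * lam))) := by
        rw [setLIntegral_const, Real.volume_Ioo, ← ENNReal.ofReal_mul (by positivity),
          ← ENNReal.ofReal_mul (by positivity), hval]
        congr 4
        ring
    _ ≤ ENNReal.ofReal (16 ^ lam) * ∫⁻ τ in Set.Ioo (1 - a / 2) (1 - a / 4),
          ENNReal.ofReal ((1 - τ) ^ (lam - 1) * ‖1 - τ * x‖ ^ (-(2 * lam))) := by
        exact mul_le_mul' le_rfl (setLIntegral_mono' measurableSet_Ioo hpt)
    _ ≤ _ := mul_le_mul' le_rfl (lintegral_mono_set hsub)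

lemma lintegral_one_sub_rpow_ne_top {ε : ℝ} (hε : 0 < ε) :
    ∫⁻ τ in Set.Ioo (0 : ℝ) 1, ENNReal.ofReal ((1 - τ) ^ (ε - 1)) ≠ ∞ := by
  have h1 := (intervalIntegral.intervalIntegrable_rpow' (a := 0) (b := 1)
    (by linarith : -1 < ε - 1)).comp_sub_left 1
  rw [sub_zero, sub_self, intervalIntegrable_iff, Set.uIoc_of_ge zero_le_one] at h1
  have h2 : IntegrableOn (fun τ : ℝ => (1 - τ) ^ (ε - 1)) (Set.Ioo 0 1) :=
    h1.mono_set Set.Ioo_subset_Ioc_self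
  exact (h2.lintegral_lt_top).ne

/-- **The Forelli–Rudin estimate**. -/
lemma exists_lintegral_kernel_le {lam : ℝ} [IsProbabilityMeasure (bergmanMeasure n lam)]
    (hlam : 1 ≤ lam) {ε : ℝ} (hε : 0 < ε) (hεlam : ε ≤ lam) :
    ∃ C : ℝ≥0∞, C ≠ ∞ ∧ ∀ w : UnitBall n,
      ∫⁻ z, ENNReal.ofReal (‖(1 - inner ℂ w.1 z : ℂ)‖ ^ (-lam)) ∂bergmanMeasure n lam ≤
        C * ENNReal.ofReal ((1 - ‖w.1‖ ^ 2) ^ (-ε)) := by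
  refine ⟨ENNReal.ofReal (16 ^ lam) * ∫⁻ τ in Set.Ioo (0 : ℝ) 1, ENNReal.ofReal ((1 - τ) ^ (ε - 1)),
    ENNReal.mul_ne_top ENNReal.ofReal_ne_top (lintegral_one_sub_rpow_ne_top hε), fun w => ?_⟩
  have hw := norm_lt_one w.2
  have hr : 0 < 1 - ‖w.1‖ ^ 2 := by nlinarith [norm_nonneg w.1]
  have hmeas : Measurable fun p : Cn n × ℝ =>
      ENNReal.ofReal ((1 - p.2) ^ (lam - 1) * ‖1 - (p.2 : ℂ) * inner ℂ w.1 p.1‖ ^ (-(2 * lam))) := by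
    fun_prop
  calc ∫⁻ z, ENNReal.ofReal (‖(1 - inner ℂ w.1 z : ℂ)‖ ^ (-lam)) ∂bergmanMeasure n lam
      ≤ ∫⁻ z, (ENNReal.ofReal (16 ^ lam) * ∫⁻ τ in Set.Ioo (0 : ℝ) 1,
          ENNReal.ofReal ((1 - τ) ^ (lam - 1) * ‖1 - (τ : ℂ) * inner ℂ w.1 z‖ ^ (-(2 * lam))))
          ∂bergmanMeasure n lam := by
        refine lintegral_mono_ae ?_
        filter_upwards [ae_mem_ball n lam] with z hz
        exact rpow_norm_one_sub_le hlam (norm_inner_lt_one hz w.2)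
    _ = ENNReal.ofReal (16 ^ lam) * ∫⁻ τ in Set.Ioo (0 : ℝ) 1, ∫⁻ z,
          ENNReal.ofReal ((1 - τ) ^ (lam - 1) * ‖1 - (τ : ℂ) * inner ℂ w.1 z‖ ^ (-(2 * lam)))
          ∂bergmanMeasure n lam := by
        rw [lintegral_const_mul' _ _ ENNReal.ofReal_ne_top]
        congr 1
        exact lintegral_lintegral_swap (f := fun z (τ : ℝ) => ENNReal.ofReal
          ((1 - τ) ^ (lam - 1) * ‖1 - (τ : ℂ) * inner ℂ w.1 z‖ ^ (-(2 * lam)))) hmeas.aemeasurable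
    _ ≤ ENNReal.ofReal (16 ^ lam) * ∫⁻ τ in Set.Ioo (0 : ℝ) 1,
          ENNReal.ofReal ((1 - τ) ^ (ε - 1)) * ENNReal.ofReal ((1 - ‖w.1‖ ^ 2) ^ (-ε)) := by
        refine mul_le_mul' le_rfl (setLIntegral_mono' measurableSet_Ioo fun τ hτ => ?_)
        have hτ1 : 0 < 1 - τ := by linarith [hτ.2]
        have hmem : (τ : ℂ) • w.1 ∈ UnitBall n := by
          rw [mem_ball_zero_iff, norm_smul, Complex.norm_real, Real.norm_of_nonneg hτ.1.le]
          nlinarith [norm_nonneg w.1, hτ.1, hτ.2]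
        -- The factor `τ` is absorbed into the point: the inner integral is the squared norm of the
        -- kernel at `τ w`.
        have h1 := norm_kernelVec_sq (n := n) (lam := lam) (by linarith) ⟨_, hmem⟩
        simp only [inner_smul_left, Complex.conj_ofReal, norm_smul, Complex.norm_real,
          Real.norm_of_nonneg hτ.1.le] at h1
        simp only [ENNReal.ofReal_mul (Real.rpow_nonneg hτ1.le _)]
        rw [lintegral_const_mul' _ _ ENNReal.ofReal_ne_top, h1,
          ← ENNReal.ofReal_mul (by positivity), ← ENNReal.ofReal_mul (by positivity)]
        refine ENNReal.ofReal_le_ofReal ?_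
        have h2 : τ * ‖w.1‖ ≤ τ := mul_le_of_le_one_right hτ.1.le hw.le
        have h3 : τ * ‖w.1‖ ≤ ‖w.1‖ := mul_le_of_le_one_left (norm_nonneg _) hτ.2.le
        have h4 : 0 ≤ τ * ‖w.1‖ := mul_nonneg hτ.1.le (norm_nonneg _)
        have h5 : 1 - τ ≤ 1 - (τ * ‖w.1‖) ^ 2 := by nlinarith [hτ.1, hτ.2]
        have h6 : 1 - ‖w.1‖ ^ 2 ≤ 1 - (τ * ‖w.1‖) ^ 2 := by nlinarith
        have h7 : 0 < 1 - (τ * ‖w.1‖) ^ 2 := by linarith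
        -- The exponent is split as `(λ - ε) + ε`: the first part is estimated by `1 - τ`, leaving
        -- the integrable power `(1 - τ)^(ε-1)`, and the second by `1 - |w|²`.
        have h8 : (1 - (τ * ‖w.1‖) ^ 2) ^ (-lam) ≤
            (1 - τ) ^ (-(lam - ε)) * (1 - ‖w.1‖ ^ 2) ^ (-ε) := by
          have h9 : -lam = -(lam - ε) + -ε := by ring
          rw [h9, Real.rpow_add h7]
          exact mul_le_mul (Real.rpow_le_rpow_of_nonpos hτ1 h5 (by linarith))
            (Real.rpow_le_rpow_of_nonpos hr h6 (by linarith)) (by positivity) (by positivity)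
        calc (1 - τ) ^ (lam - 1) * (1 - (τ * ‖w.1‖) ^ 2) ^ (-lam)
            ≤ (1 - τ) ^ (lam - 1) * ((1 - τ) ^ (-(lam - ε)) * (1 - ‖w.1‖ ^ 2) ^ (-ε)) := by
              gcongr
          _ = (1 - τ) ^ (ε - 1) * (1 - ‖w.1‖ ^ 2) ^ (-ε) := by
              rw [← mul_assoc, ← Real.rpow_add hτ1]
              congr 2
              ring
    _ = _ := by
        rw [lintegral_mul_const' _ _ ENNReal.ofReal_ne_top, mul_assoc]

end BallToeplitz

end

noncomputable section

namespace BallToeplitz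

variable {n : ℕ}

/-! ### Growth of the denominators in the models -/

namespace Model

lemma dim_le (M : Model n) : M.dim ≤ n := by
  cases M with
  | elliptic => exact Nat.zero_le _
  | hyperbolic k e =>
    have := Fintype.card_congr e
    simp at this
    change 1 ≤ n
    omega
  | nilpotent k l e =>
    have := Fintype.card_congr e
    simp at this
    change l + 1 ≤ n
    omega

/-- The denominator is `cosh s` in the hyperbolic case, while in the nilpotent cases its real part
is `1 + |b|²/2` and its imaginary part `-s/2`. All of these dominate the norm of the noncompact
parameters linearly; the constant 4 serves every model. -/
lemma one_add_norm_le (M : Model n) (ξ : M.X) :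
    1 + ‖ξ.2‖ ≤ 4 * ‖den (M.core ξ) (M.z0 : Cn n)‖ := by
  cases M with
  | elliptic =>
    have h1 : ‖ξ.2‖ = 0 := by
      have h2 : ‖ξ.2‖ = Real.sqrt (∑ i : Fin 0, ‖ξ.2 i‖ ^ 2) := EuclideanSpace.norm_eq _
      rw [h2]
      simp
    rw [den_core_elliptic, h1, norm_one]
    norm_num
  | hyperbolic k e =>
    rw [den_core_hyperbolic, Complex.norm_real, Real.norm_of_nonneg (Real.cosh_pos _).le]
    have h1 : ‖ξ.2‖ = |ξ.2 (0 : Fin 1)| := by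
      have : ‖ξ.2‖ = Real.sqrt (∑ i : Fin 1, ‖ξ.2 i‖ ^ 2) := EuclideanSpace.norm_eq _
      rw [this]
      simp [Real.sqrt_sq_eq_abs]
    have h2 : Real.cosh (ξ.2 (0 : Fin 1)) =
        (Real.exp |ξ.2 (0 : Fin 1)| + Real.exp (-|ξ.2 (0 : Fin 1)|)) / 2 := by
      rw [← Real.cosh_eq, Real.cosh_abs]
    have h3 := Real.add_one_le_exp |ξ.2 (0 : Fin 1)|
    have h4 := Real.exp_pos (-|ξ.2 (0 : Fin 1)|)
    have h5 := abs_nonneg (ξ.2 (0 : Fin 1))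
    rw [h1, h2]
    linarith
  | nilpotent k l e =>
    rw [den_core_nilpotent]
    set β := ∑ i : Fin l, (ξ.2 i.castSucc : ℝ) ^ 2 with hβ
    set s := ξ.2 (Fin.last l) with hs
    set w : ℂ := ((1 + β / 2 : ℝ) : ℂ) + ((-s / 2 : ℝ) : ℂ) * Complex.I with hw
    have hβ0 : 0 ≤ β := Finset.sum_nonneg fun i _ => sq_nonneg _
    have h1 : ‖ξ.2‖ ≤ Real.sqrt β + |s| := by
      have h3 : ‖ξ.2‖ = Real.sqrt (∑ i : Fin (l + 1), ‖ξ.2 i‖ ^ 2) := EuclideanSpace.norm_eq _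
      rw [h3, Fin.sum_univ_castSucc]
      have h5 : ∑ i : Fin l, ‖ξ.2 i.castSucc‖ ^ 2 = β := by simp [hβ]
      have h6 : ‖ξ.2 (Fin.last l)‖ ^ 2 = |s| ^ 2 := rfl
      rw [h5, h6, Real.sqrt_le_left (by positivity)]
      have := Real.sq_sqrt hβ0
      nlinarith [Real.sqrt_nonneg β, abs_nonneg s, mul_nonneg (Real.sqrt_nonneg β) (abs_nonneg s)]
    have hre : w.re = 1 + β / 2 := by
      simp [hw]
    have him : w.im = -s / 2 := by
      simp [hw]
    have h2 := (le_abs_self _).trans (Complex.abs_re_le_norm w)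
    have h3 := Complex.abs_im_le_norm w
    rw [hre] at h2
    rw [him, abs_div, abs_neg, abs_two] at h3
    have h4 := Real.sq_sqrt hβ0
    nlinarith [sq_nonneg (Real.sqrt β - 1)]

lemma norm_den_core_pos (M : Model n) (ξ : M.X) : 0 < ‖den (M.core ξ) (M.z0 : Cn n)‖ := by
  have := M.one_add_norm_le ξ
  have := norm_nonneg ξ.2
  linarith

lemma continuous_core (M : Model n) : Continuous M.core := by
  have hc : Continuous fun x : UnitAddCircle => (x.toCircle : ℂ) :=
    continuous_subtype_val.comp AddCircle.continuous_toCircle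
  have key : ∀ {ι : Type} (e : ι ≃ Fin n) {Y : Type} [TopologicalSpace Y]
      (A : Y → Matrix (ι ⊕ Unit) (ι ⊕ Unit) ℂ), Continuous A →
      Continuous fun y => Matrix.reindex (e.sumCongr (Equiv.refl Unit))
        (e.sumCongr (Equiv.refl Unit)) (A y) := fun e Y _ A hA =>
    hA.matrix_submatrix _ _
  cases M with
  | elliptic =>
    refine Continuous.matrix_fromBlocks (Continuous.matrix_diagonal (continuous_pi fun i => ?_))
      continuous_const continuous_const continuous_const
    exact hc.comp ((continuous_apply i).comp continuous_fst)
  | hyperbolic k e =>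
    refine key e (fun ξ : (hyperbolic k e).X => hypCore (fun i => ((ξ.1 i).toCircle : ℂ))
      (ξ.2 (0 : Fin 1))) (continuous_matrix fun i j => ?_)
    have h0 : Continuous fun ξ : (hyperbolic k e).X => ((ξ.2 (0 : Fin 1) : ℝ) : ℂ) :=
      Complex.continuous_ofReal.comp ((PiLp.continuous_apply 2 (fun _ : Fin 1 => ℝ) 0).comp
        continuous_snd)
    rcases i with (i | i) | i <;> rcases j with (j | j) | j <;> simp only [hypCore]
    case inl.inl.inl.inl =>
      split_ifs
      · exact hc.comp ((continuous_apply i).comp continuous_fst)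
      · exact continuous_const
    all_goals first
      | exact continuous_const
      | exact Complex.continuous_cosh.comp h0
      | exact Complex.continuous_sinh.comp h0
  | nilpotent k l e =>
    refine key e (fun ξ : (nilpotent k l e).X => nilCore (fun i => ((ξ.1 i).toCircle : ℂ))
      (fun i : Fin l => ξ.2 i.castSucc) (ξ.2 (Fin.last l))) (continuous_matrix fun i j => ?_)
    have h0 : ∀ i : Fin (l + 1), Continuous fun ξ : (nilpotent k l e).X => ((ξ.2 i : ℝ) : ℂ) :=
      fun i => Complex.continuous_ofReal.comp
        ((PiLp.continuous_apply 2 (fun _ : Fin (l + 1) => ℝ) i).comp continuous_snd)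
    have h1 := fun i : Fin l => h0 i.castSucc
    have h2 := h0 (Fin.last l)
    rcases i with (i | i | i) | i <;> rcases j with (j | j | j) | j <;> simp only [nilCore]
    case inl.inl.inl.inl =>
      split_ifs
      · exact hc.comp ((continuous_apply i).comp continuous_fst)
      · exact continuous_const
    all_goals first
      | exact continuous_const
      | fun_prop

/-- The compact variables do not matter, and on `ℝᵐ` the function `(1 + |y|)^(-s)` is integrable for
`s > m`. -/
lemma integrable_den_core (M : Model n) {s : ℝ} (hs : (M.dim : ℝ) < s) :
    Integrable fun ξ : M.X => ‖den (M.core ξ) (M.z0 : Cn n)‖ ^ (-s) := by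
  have h1 : Integrable (fun y : EuclideanSpace ℝ (Fin M.dim) => (1 + ‖y‖) ^ (-s)) :=
    integrable_one_add_norm (by simpa using hs)
  have h2 : Integrable (fun ξ : M.X => (4 : ℝ) ^ s * (1 + ‖ξ.2‖) ^ (-s)) :=
    (h1.comp_snd (volume : Measure (UnitAddTorus (Fin M.tor)))).const_mul _
  have hs0 : 0 < s := (Nat.cast_nonneg _).trans_lt hs
  have hden : Continuous fun ξ : M.X => den (M.core ξ) (M.z0 : Cn n) :=
    (continuous_apply _).comp (M.continuous_core.matrix_mulVec continuous_const)
  refine h2.mono' (Continuous.aestronglyMeasurable ?_) (ae_of_all _ fun ξ => ?_)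
  · exact hden.norm.rpow_const fun ξ => Or.inl (M.norm_den_core_pos ξ).ne'
  · have h3 := M.one_add_norm_le ξ
    have h4 := norm_nonneg ξ.2
    rw [Real.norm_of_nonneg (by positivity)]
    have h5 : (1 + ‖ξ.2‖) / 4 ≤ ‖den (M.core ξ) (M.z0 : Cn n)‖ := by linarith
    refine (Real.rpow_le_rpow_of_nonpos (by positivity) h5 (by linarith)).trans_eq ?_
    rw [Real.div_rpow (by positivity) (by norm_num), Real.rpow_neg (by norm_num : (0 : ℝ) ≤ 4),
      div_inv_eq_mul, mul_comm]

end Model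

lemma exists_norm_den_le (A : Matrix (Ix n) (Ix n) ℂ) :
    ∃ M : ℝ, 0 < M ∧ ∀ z ∈ UnitBall n, ‖den A z‖ ≤ M := by
  refine ⟨‖rowCLM A (Sum.inr ())‖ + ‖A (Sum.inr ()) (Sum.inr ())‖ + 1, by positivity, fun z hz => ?_⟩
  rw [den_eq_rowCLM]
  have h1 := (rowCLM A (Sum.inr ())).le_opNorm z
  have h2 := norm_add_le (rowCLM A (Sum.inr ()) z) (A (Sum.inr ()) (Sum.inr ()))
  have h3 := mul_le_of_le_one_right (norm_nonneg (rowCLM A (Sum.inr ()))) (norm_lt_one hz).le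
  linarith

/-- The product of the denominators of `g⁻¹` at `gz` and of `g` at `z` is one, so the upper bound
for `g⁻¹` is a lower bound for `g`. -/
lemma exists_le_norm_den (g : SU n) : ∃ m : ℝ, 0 < m ∧ ∀ z ∈ UnitBall n, m ≤ ‖den (mat g) z‖ := by
  obtain ⟨M, hM, h⟩ := exists_norm_den_le (mat g⁻¹)
  refine ⟨M⁻¹, inv_pos.mpr hM, fun z hz => ?_⟩
  have h1 := den_mul (mat g⁻¹) (mat g) z (den_ne_zero g hz)
  rw [← mat_mul, inv_mul_cancel, mat_one, den_one] at h1
  have h2 := congrArg norm h1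
  rw [norm_one, norm_mul] at h2
  rw [inv_le_iff_one_le_mul₀' hM, h2]
  exact mul_le_mul_of_nonneg_right (h _ (moeb_mem g hz)) (norm_nonneg _)

namespace Chart

variable {H : Subgroup (SU n)} (c : Chart H) (lam : ℝ)

/-! ### The frame attached to a chart -/

/-- The kernel functions along the orbit of the base point. -/
def frame (ξ : c.model.X) : bergman n lam :=
  (starRingEnd ℂ) (c.chi lam (c.lift ξ) * c.D lam (c.lift ξ)) •
    kernelVec lam ((c.lift ξ : Cover n) • c.base)

lemma isCovariant_D_mul (S : UnitBall n → ℂ) :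
    c.IsCovariant lam fun h => c.D lam h * S ((h : Cover n) • c.base) := by
  intro h h₁ hs
  have h2 : ((h * h₁ : tilde H) : Cover n) • c.base = (h : Cover n) • c.base := by
    rw [Subgroup.coe_mul, mul_smul, hs]
  simp only [h2]
  rw [D_mul, hs]
  simp only [D]
  ring

/-- A kernel is `H`-covariant. -/
def IsCovariantKernel (S : UnitBall n → UnitBall n → ℂ) : Prop :=
  ∀ (k : tilde H) (z w : UnitBall n),
    S ((k : Cover n) • z) ((k : Cover n) • w) * Cover.j lam (k : Cover n) z *
      (starRingEnd ℂ) (Cover.j lam (k : Cover n) w) = S z w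

/-- If `h` and `k` lift `ξ` and `η`, then `k⁻¹ h` lifts `ξ - η` because the coordinates are
additive. Covariance under `k` carries `(k⁻¹ h · z₀, z₀)` to `(h · z₀, k · z₀)`, and the cocycles
combine to `D(h)` and the conjugate of `D(k)`. This is why the Gram matrices along the orbit are
convolution kernels. -/
lemma descend_sub {S : UnitBall n → UnitBall n → ℂ} (hS : IsCovariantKernel (H := H) lam S)
    (ξ η : c.model.X) :
    c.descend lam (fun h => c.D lam h * S ((h : Cover n) • c.base) c.base) (ξ - η) =
      c.chi lam (c.lift ξ) * c.D lam (c.lift ξ) *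
        ((starRingEnd ℂ) (c.chi lam (c.lift η) * c.D lam (c.lift η)) *
          S ((c.lift ξ : Cover n) • c.base) ((c.lift η : Cover n) • c.base)) := by
  set h := c.lift ξ with hh
  set k := c.lift η with hk
  have hcoord : (c.coord (k⁻¹ * h)).1 = ξ - η := by
    rw [coord_mul', coord_inv, Prod.fst_add, Prod.fst_neg, hh, hk, coord_lift, coord_lift]
    abel
  have h1 := c.descend_coord lam
    (c.isCovariant_D_mul lam fun z => S z c.base) (k⁻¹ * h)
  rw [hcoord] at h1
  have h2 : k * (k⁻¹ * h) = h := by group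
  have h3 := c.D_mul lam k (k⁻¹ * h)
  rw [h2] at h3
  have h4 := hS k (((k⁻¹ * h : tilde H) : Cover n) • c.base) c.base
  rw [← mul_smul, ← Subgroup.coe_mul, h2] at h4
  rw [h1, chi_inv_mul, ← h4, h3, map_mul]
  simp only [D]
  ring

lemma phiH_eq : c.phiH lam = c.descend lam fun h =>
    c.D lam h * bergmanKernel lam ((h : Cover n) • c.base : UnitBall n).1 c.base.1 := by
  unfold phiH kernelR
  simp [D_one]

lemma isCovariantKernel_bergmanKernel :
    IsCovariantKernel (H := H) lam fun z w : UnitBall n => bergmanKernel lam z.1 w.1 :=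
  fun k z w => Cover.bergmanKernel_smul lam k.1 z w

section

variable {lam} [IsProbabilityMeasure (bergmanMeasure n lam)]

lemma inner_frame (hlam : 0 ≤ lam) (ξ : c.model.X) (f : bergman n lam) :
    inner ℂ (c.frame lam ξ) f = c.descend lam
      (fun h => c.D lam h * holo f ((h : Cover n) • c.base : UnitBall n).1) ξ := by
  refine (inner_smul_left (𝕜 := ℂ) (E := bergman n lam) _ f _).trans ?_
  rw [Complex.conj_conj, inner_kernelVec_holo hlam, descend, mul_assoc]

lemma inner_frame_frame (hlam : 0 ≤ lam) (ξ η : c.model.X) :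
    inner ℂ (c.frame lam ξ) (c.frame lam η) = c.phiH lam (ξ - η) := by
  rw [phiH_eq, c.descend_sub lam (isCovariantKernel_bergmanKernel lam)]
  refine (inner_smul_left (𝕜 := ℂ) (E := bergman n lam) _ _ _).trans ?_
  rw [Complex.conj_conj]
  congr 1
  refine (inner_smul_right (𝕜 := ℂ) (E := bergman n lam) _ _ _).trans ?_
  rw [inner_kernelVec_kernelVec hlam]

/-- In the integral for `⟨K_z, T_φ K_w⟩` one substitutes `u ↦ k · u`. The symbol is unchanged by
invariance, and the factor `|j(k, u)|²` splits into exactly the cocycles needed for the covariance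
of the two kernels. -/
lemma isCovariantKernel_toeplitz (hlam : 0 ≤ lam) {φ : Lp ℂ ∞ (bergmanMeasure n lam)}
    (hφ : IsInvariant H φ) : IsCovariantKernel (H := H) lam fun z w : UnitBall n =>
      inner ℂ (kernelVec lam z) (toeplitz φ (kernelVec lam w)) := by
  intro k z w
  beta_reduce
  rw [inner_kernelVec_toeplitz hlam, inner_kernelVec_toeplitz hlam]
  set g : Cover n := k.1 with hg
  have hm : AEStronglyMeasurable (fun u => φ u * bergmanKernel lam u (g • w : UnitBall n).1 *
      (starRingEnd ℂ) (bergmanKernel lam u (g • z : UnitBall n).1)) (bergmanMeasure n lam) :=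
    ((Lp.aestronglyMeasurable φ).mul (memLp_top_bergmanKernel hlam (g • w).2).1).mul
      (memLp_top_bergmanKernel hlam (g • z).2).star.1
  rw [integral_moeb lam g.proj hm, mul_assoc, ← integral_mul_const]
  refine integral_congr_ae ?_
  filter_upwards [ae_mem_ball n lam, hφ g.proj k.2] with u hu h1
  have h2 := g.bergmanKernel_smul lam ⟨u, hu⟩ w
  have h3 := congrArg (starRingEnd ℂ) (g.bergmanKernel_smul lam ⟨u, hu⟩ z)
  rw [map_mul, map_mul, Complex.conj_conj] at h3
  have h4 := Cover.conj_j_mul_j lam g ⟨u, hu⟩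
  change bergmanKernel lam (moeb (mat g.proj) u) _ * _ * _ = _ at h2
  change (starRingEnd ℂ) (bergmanKernel lam (moeb (mat g.proj) u) _) * _ * _ = _ at h3
  rw [h1, ← h4, ← h2, ← h3]
  ring

lemma nu_eq (hlam : 0 ≤ lam) (φ : Lp ℂ ∞ (bergmanMeasure n lam)) :
    c.nu lam φ = c.descend lam fun h => c.D lam h *
      inner ℂ (kernelVec lam ((h : Cover n) • c.base)) (toeplitz φ (kernelVec lam c.base)) := by
  simp only [inner_kernelVec_toeplitz hlam]
  rfl

lemma inner_frame_toeplitz (hlam : 0 ≤ lam) {φ : Lp ℂ ∞ (bergmanMeasure n lam)}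
    (hφ : IsInvariant H φ) (ξ η : c.model.X) :
    inner ℂ (c.frame lam ξ) (toeplitz φ (c.frame lam η)) = c.nu lam φ (ξ - η) := by
  rw [nu_eq c hlam, c.descend_sub lam (isCovariantKernel_toeplitz hlam hφ)]
  refine (inner_smul_left (𝕜 := ℂ) (E := bergman n lam) _ _ _).trans ?_
  rw [Complex.conj_conj]
  congr 1
  rw [frame, map_smul]
  exact inner_smul_right (𝕜 := ℂ) (E := bergman n lam) _ _ _

end

end Chart

end BallToeplitz

end

/-! ### Integrability of `φ_H` and `ν_φ` -/

noncomputable section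

namespace BallToeplitz

variable {n : ℕ}

lemma Model.continuous_den_core (M : Model n) (z : Cn n) : Continuous fun ξ => den (M.core ξ) z :=
  (continuous_apply _).comp (M.continuous_core.matrix_mulVec continuous_const)

lemma Model.continuous_moeb_core (M : Model n) :
    Continuous fun ξ => moeb (M.core ξ) (M.z0 : Cn n) := by
  refine (PiLp.continuous_toLp 2 _).comp (continuous_pi fun i => ?_)
  refine Continuous.div ?_ (M.continuous_den_core _) fun ξ => Chart.core_den_ne_zero M ξ
  exact (continuous_apply (Sum.inl i)).comp (M.continuous_core.matrix_mulVec continuous_const)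

lemma Model.moeb_core_mem (M : Model n) (ξ : M.X) :
    moeb (M.core ξ) (M.z0 : Cn n) ∈ UnitBall n := by
  obtain ⟨a, g, hg⟩ := M.exists_mem ξ
  have h := moeb_mem g M.z0.2
  rwa [hg, Chart.moeb_smul (Circle.coe_ne_zero a)] at h

namespace Chart

variable {H : Subgroup (SU n)} (c : Chart H) (lam : ℝ)

lemma coe_mul_γ (h : tilde H) : (h : Cover n) * c.γ = c.γ * c.conj h := by
  rw [conj]
  group

/-- The cocycle identity for `h γ = γ (γ⁻¹ h γ)` reduces `D(h)` to the model. There `χ_λ` cancels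
the phase `2πix` in the logarithm of the denominator, and only the principal logarithm remains. -/
lemma chi_mul_D_mul (h : tilde H) :
    c.chi lam h * c.D lam h * Cover.j lam c.γ c.model.z0 =
      Cover.j lam c.γ (c.conj h • c.model.z0) *
        Complex.exp (-lam * Complex.log (den (c.model.core (c.coord h).1) c.model.z0)) := by
  have h1 : c.D lam h * Cover.j lam c.γ c.model.z0 =
      Cover.j lam c.γ (c.conj h • c.model.z0) * Cover.j lam (c.conj h) c.model.z0 := by
    rw [← Cover.j_mul, ← coe_mul_γ, Cover.j_mul]
    rfl
  have h2 : c.chi lam h * Cover.j lam (c.conj h) c.model.z0 =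
      Complex.exp (-lam * Complex.log (den (c.model.core (c.coord h).1) c.model.z0)) := by
    rw [chi, Cover.j, (c.coord_spec h).2, ← Complex.exp_add]
    congr 1
    ring
  rw [mul_assoc, h1, ← h2]
  ring

/-- The function `φ_H` in the coordinates of the model. -/
lemma phiH_mul (ξ : c.model.X) :
    c.phiH lam ξ * (‖Cover.j lam c.γ c.model.z0‖ ^ 2 : ℝ) =
      Complex.exp (-lam * Complex.log (den (c.model.core ξ) c.model.z0)) *
        bergmanKernel lam (moeb (c.model.core ξ) c.model.z0) c.model.z0 := by
  set h := c.lift ξ with hh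
  have hξ : (c.coord h).1 = ξ := c.coord_lift ξ
  have h1 := c.chi_mul_D_mul lam h
  have h2 := Cover.bergmanKernel_smul lam c.γ (c.conj h • c.model.z0) c.model.z0
  rw [← smul_base, c.coord_orbit (c.coord_spec h), hξ] at h2
  rw [hξ] at h1
  have h3 : c.phiH lam ξ = c.chi lam h * (c.D lam h *
      bergmanKernel lam ((h : Cover n) • c.base : UnitBall n).1 c.base.1) := by
    rw [phiH_eq, descend]
  rw [h3, Complex.ofReal_pow, ← Complex.mul_conj', ← h2]
  change _ = _ * (bergmanKernel lam ((h : Cover n) • c.base : UnitBall n).1 c.base.1 * _ * _)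
  linear_combination bergmanKernel lam ((h : Cover n) • c.base : UnitBall n).1 c.base.1 *
    (starRingEnd ℂ) (Cover.j lam c.γ c.model.z0) * h1

lemma continuous_phiH : Continuous (c.phiH lam) := by
  have h0 : ((‖Cover.j lam c.γ c.model.z0‖ ^ 2 : ℝ) : ℂ) ≠ 0 := by
    exact_mod_cast pow_ne_zero 2 (norm_ne_zero_iff.mpr (Cover.j_ne_zero lam c.γ c.model.z0))
  have h1 : c.phiH lam = fun ξ =>
      Complex.exp (-lam * Complex.log (den (c.model.core ξ) c.model.z0)) *
        bergmanKernel lam (moeb (c.model.core ξ) c.model.z0) c.model.z0 /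
          ((‖Cover.j lam c.γ c.model.z0‖ ^ 2 : ℝ) : ℂ) := by
    funext ξ
    rw [eq_div_iff h0, phiH_mul]
  rw [h1]
  refine Continuous.div_const (Continuous.mul ?_ ?_) _
  · refine Complex.continuous_exp.comp (continuous_const.mul ?_)
    refine (c.model.continuous_den_core _).clog fun ξ => Or.inl ?_
    exact zero_lt_one.trans_le (c.model.one_le_re_den_core ξ)
  · exact (differentiableOn_bergmanKernel lam c.model.z0.2).continuousOn.comp_continuous
      c.model.continuous_moeb_core c.model.moeb_core_mem

lemma norm_exp_log_den (s : ℝ) (ξ : c.model.X) :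
    ‖Complex.exp (-s * Complex.log (den (c.model.core ξ) c.model.z0))‖ =
      ‖den (c.model.core ξ) c.model.z0‖ ^ (-s) := by
  have h := c.model.norm_den_core_pos ξ
  rw [Complex.norm_exp, Real.rpow_def_of_pos h]
  congr 1
  rw [← Complex.ofReal_neg, Complex.re_ofReal_mul, Complex.log_re]
  ring

/-- The kernel with one argument fixed at the base point of the model is bounded on the ball, so the
decay is that of the denominator to the power `-λ`, and `λ > n ≥ m`. -/
lemma integrable_phiH (hlam : (n : ℝ) < lam) : Integrable (c.phiH lam) := by
  have hlam0 : 0 ≤ lam := (Nat.cast_nonneg n).trans hlam.le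
  have hd : (c.model.dim : ℝ) < lam :=
    lt_of_le_of_lt (by exact_mod_cast c.model.dim_le) hlam
  set p := ‖Cover.j lam c.γ c.model.z0‖ ^ 2 with hp
  have hp0 : 0 < p := pow_pos (norm_pos_iff.mpr (Cover.j_ne_zero lam c.γ c.model.z0)) 2
  refine ((c.model.integrable_den_core hd).mul_const
    ((1 - ‖c.model.z0.1‖) ^ (-lam) / p)).mono' (c.continuous_phiH lam).aestronglyMeasurable
    (ae_of_all _ fun ξ => ?_)
  have h1 := congrArg norm (c.phiH_mul lam ξ)
  rw [norm_mul, norm_mul, norm_exp_log_den, Complex.norm_real, Real.norm_of_nonneg hp0.le] at h1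
  rw [mul_div_assoc', le_div_iff₀ hp0, h1]
  exact mul_le_mul_of_nonneg_left
    (norm_bergmanKernel_le hlam0 (c.model.moeb_core_mem ξ) c.model.z0.2) (by positivity)

lemma exists_le_norm_den_lift : ∃ m : ℝ, 0 < m ∧ ∀ ξ : c.model.X,
    m * ‖den (c.model.core ξ) c.model.z0‖ ≤ ‖den (mat (c.lift ξ : Cover n).proj) c.base‖ := by
  obtain ⟨m, hm, h⟩ := exists_le_norm_den c.γ.proj
  have h0 : 0 < ‖den (mat c.γ.proj) c.model.z0‖ :=
    norm_pos_iff.mpr (den_ne_zero _ c.model.z0.2)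
  refine ⟨m / ‖den (mat c.γ.proj) c.model.z0‖, by positivity, fun ξ => ?_⟩
  set k := c.lift ξ with hk
  -- With exponent one, taking norms turns the identity for cocycles into one between inverse
  -- denominators.
  have h1 := c.chi_mul_D_mul 1 k
  have h2 := congrArg norm h1
  have hξ : (c.coord k).1 = ξ := c.coord_lift ξ
  rw [hξ, norm_mul, norm_mul, norm_mul, norm_chi, one_mul, norm_exp_log_den, D, Cover.norm_j,
    Cover.norm_j, Cover.norm_j, Real.rpow_neg_one, Real.rpow_neg_one, Real.rpow_neg_one,
    Real.rpow_neg_one, ← mul_inv, ← mul_inv, inv_inj] at h2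
  rw [div_mul_eq_mul_div, div_le_iff₀ h0, h2]
  exact mul_le_mul_of_nonneg_right (h _ (c.conj k • c.model.z0).2) (norm_nonneg _)

/-- The symbol and the kernel at `z₀` are bounded, and the remaining integral of `|K_{h · z₀}|` is
at most a constant times `(1 - |h · z₀|²)^(-ε)`. With `d` the modulus of the denominator this is a
constant times `d^(2ε)`. Hence `ν_φ` decays like `d^(-(λ - 2ε))`, and the choice `ε = (λ - n)/4`
keeps the exponent above `n`. -/
lemma integrable_nu [IsProbabilityMeasure (bergmanMeasure n lam)] (hn : 1 ≤ n)
    (hlam : (n : ℝ) < lam) {φ : Lp ℂ ∞ (bergmanMeasure n lam)} (hφ : IsInvariant H φ) :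
    Integrable (c.nu lam φ) := by
  have hn' : (1 : ℝ) ≤ n := by exact_mod_cast hn
  have hlam0 : 0 ≤ lam := by linarith
  have hdn : (c.model.dim : ℝ) ≤ n := by exact_mod_cast c.model.dim_le
  set ε := (lam - n) / 4 with hε
  obtain ⟨C, hC, hle⟩ := exists_lintegral_kernel_le (n := n) (lam := lam) (by linarith)
    (ε := ε) (by linarith) (by linarith)
  obtain ⟨m, hm, hden⟩ := c.exists_le_norm_den_lift
  have hs : (c.model.dim : ℝ) < lam - 2 * ε := by linarith
  have hb := norm_lt_one c.base.2
  have hb1 : 0 < 1 - ‖c.base.1‖ ^ 2 := by nlinarith [norm_nonneg c.base.1]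
  set M := ‖φ‖ * (1 - ‖c.base.1‖) ^ (-lam) with hM
  have hM0 : 0 ≤ M := mul_nonneg (norm_nonneg _) (Real.rpow_nonneg (by linarith) _)
  refine ((c.model.integrable_den_core hs).const_mul
    (M * C.toReal * (1 - ‖c.base.1‖ ^ 2) ^ (-ε) * m ^ (-(lam - 2 * ε)))).mono' ?_
    (ae_of_all _ fun ξ => ?_)
  -- As a matrix coefficient along the frame, `ν_φ` is continuous, in particular measurable.
  · have h1 : c.nu lam φ = fun ξ =>
        inner ℂ (c.frame lam ξ) (toeplitz φ (c.frame lam 0)) := by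
      funext ξ
      rw [c.inner_frame_toeplitz hlam0 hφ, sub_zero]
    rw [h1]
    exact ((continuous_frame (c.inner_frame_frame hlam0) (c.continuous_phiH lam)).inner
      continuous_const).aestronglyMeasurable
  · set h := c.lift ξ with hh
    set w : UnitBall n := (h : Cover n) • c.base with hw
    set d := ‖den (mat (h : Cover n).proj) c.base‖ with hd
    have hd0 : 0 < d := norm_pos_iff.mpr (den_ne_zero _ c.base.2)
    have hw1 : 1 - ‖w.1‖ ^ 2 = (1 - ‖c.base.1‖ ^ 2) / d ^ 2 :=
      one_sub_norm_sq_moeb (h : Cover n).proj c.base.2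
    have hint : ‖∫ z, φ z * bergmanKernel lam z c.base.1 *
        (starRingEnd ℂ) (bergmanKernel lam z w.1) ∂bergmanMeasure n lam‖ ≤
        M * (C.toReal * (1 - ‖w.1‖ ^ 2) ^ (-ε)) := by
      have hw0 : 0 ≤ (1 - ‖w.1‖ ^ 2) ^ (-ε) := by
        refine Real.rpow_nonneg ?_ _
        rw [hw1]
        positivity
      have h2 : ∫⁻ z, ‖φ z * bergmanKernel lam z c.base.1 *
          (starRingEnd ℂ) (bergmanKernel lam z w.1)‖ₑ ∂bergmanMeasure n lam ≤
          ENNReal.ofReal (M * (C.toReal * (1 - ‖w.1‖ ^ 2) ^ (-ε))) := by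
        rw [ENNReal.ofReal_mul hM0, ENNReal.ofReal_mul ENNReal.toReal_nonneg,
          ENNReal.ofReal_toReal hC]
        refine le_trans ?_ (mul_le_mul_right (hle w) _)
        rw [← lintegral_const_mul' _ _ ENNReal.ofReal_ne_top]
        refine lintegral_mono_ae ?_
        filter_upwards [ae_mem_ball n lam, ae_le_eLpNormEssSup (f := φ)
          (μ := bergmanMeasure n lam)] with z hz hφz
        have h3 : ‖φ z‖ ≤ ‖φ‖ := by
          rw [Lp.norm_def, eLpNorm_exponent_top]
          have h4 := ENNReal.toReal_mono (b := eLpNormEssSup φ (bergmanMeasure n lam)) ?_ hφz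
          · simpa using h4
          · rw [← eLpNorm_exponent_top]
            exact Lp.eLpNorm_ne_top φ
        rw [← ENNReal.ofReal_mul hM0, ← ofReal_norm]
        refine ENNReal.ofReal_le_ofReal ?_
        rw [norm_mul, norm_mul, RCLike.norm_conj, norm_bergmanKernel lam z w.1, hM]
        have h5 := norm_bergmanKernel_le hlam0 hz c.base.2
        gcongr
      have h3 := (enorm_integral_le_lintegral_enorm _).trans h2
      rw [← ofReal_norm] at h3
      exact (ENNReal.ofReal_le_ofReal_iff (by positivity)).mp h3
    have hnu : ‖c.nu lam φ ξ‖ ≤ d ^ (-lam) * (M * (C.toReal * (1 - ‖w.1‖ ^ 2) ^ (-ε))) := by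
      rw [nu, descend, norm_mul, norm_chi, one_mul, norm_mul, D, Cover.norm_j]
      exact mul_le_mul_of_nonneg_left hint (by positivity)
    refine hnu.trans ?_
    have h6 : d ^ (-lam) * (1 - ‖w.1‖ ^ 2) ^ (-ε) =
        (1 - ‖c.base.1‖ ^ 2) ^ (-ε) * d ^ (-(lam - 2 * ε)) := by
      rw [hw1, Real.div_rpow hb1.le (by positivity), ← Real.rpow_natCast d,
        ← Real.rpow_mul hd0.le, div_eq_mul_inv, ← Real.rpow_neg hd0.le,
        mul_left_comm, ← Real.rpow_add hd0]
      congr 2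
      push_cast
      ring
    have h7 : d ^ (-(lam - 2 * ε)) ≤
        m ^ (-(lam - 2 * ε)) * ‖den (c.model.core ξ) c.model.z0‖ ^ (-(lam - 2 * ε)) := by
      rw [← Real.mul_rpow hm.le (norm_nonneg _)]
      exact Real.rpow_le_rpow_of_nonpos (mul_pos hm (c.model.norm_den_core_pos ξ)) (hden ξ)
        (by linarith)
    calc d ^ (-lam) * (M * (C.toReal * (1 - ‖w.1‖ ^ 2) ^ (-ε)))
        = M * C.toReal * (d ^ (-lam) * (1 - ‖w.1‖ ^ 2) ^ (-ε)) := by ring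
      _ = M * C.toReal * (1 - ‖c.base.1‖ ^ 2) ^ (-ε) * d ^ (-(lam - 2 * ε)) := by rw [h6]; ring
      _ ≤ M * C.toReal * (1 - ‖c.base.1‖ ^ 2) ^ (-ε) * (m ^ (-(lam - 2 * ε)) *
            ‖den (c.model.core ξ) c.model.z0‖ ^ (-(lam - 2 * ε))) := by gcongr
      _ = _ := by ring

end Chart

end BallToeplitz

end

noncomputable section

namespace BallToeplitz

variable {n : ℕ}

/-! ### The orbits of the base points are sets of uniqueness -/

/-- A real segment has an accumulation point, so the identity theorem applies. It is used for real
translation and boost parameters, which are then allowed to become complex. -/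
lemma eq_zero_of_eventually_line {f : ℂ → ℂ} {U : Set ℂ} (hU : IsOpen U) (hUc : IsPreconnected U)
    (hf : DifferentiableOn ℂ f U) {c v : ℂ} (hc : c ∈ U) (hv : v ≠ 0)
    (h : ∀ᶠ t : ℝ in 𝓝 0, f (c + t * v) = 0) : ∀ ζ ∈ U, f ζ = 0 := by
  refine (hf.analyticOnNhd hU).eqOn_zero_of_preconnected_of_frequently_eq_zero hUc hc ?_
  have ht : Tendsto (fun t : ℝ => c + t * v) (𝓝[≠] 0) (𝓝[≠] c) := by
    refine tendsto_nhdsWithin_of_tendsto_nhds_of_eventually_within _ ?_ ?_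
    · have : Continuous fun t : ℝ => c + t * v := by fun_prop
      refine (this.tendsto' 0 c (by simp)).mono_left nhdsWithin_le_nhds
    · filter_upwards [self_mem_nhdsWithin] with t ht
      simpa [hv] using ht
  exact ht.frequently (h.filter_mono nhdsWithin_le_nhds).frequently

lemma eq_zero_of_sphere {f : ℂ → ℂ} {r : ℝ} (hr : r ≠ 0)
    (hf : DifferentiableOn ℂ f (closedBall 0 r)) (h : ∀ ζ, ‖ζ‖ = r → f ζ = 0) :
    ∀ ζ, ‖ζ‖ ≤ r → f ζ = 0 := by
  intro ζ hζ
  have hd : DiffContOnCl ℂ f (ball 0 r) := by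
    refine DifferentiableOn.diffContOnCl ?_
    rwa [closure_ball _ hr]
  refine Complex.eqOn_closure_of_eqOn_frontier (g := fun _ => 0) isBounded_ball hd
    diffContOnCl_const (fun w hw => ?_) (show ζ ∈ closure (ball 0 r) from ?_)
  · rw [frontier_ball _ hr] at hw
    exact h w (by simpa using hw)
  · rw [closure_ball _ hr]
    simpa using hζ

/-- This is induction on the number of coordinates already released from `A i` to `B i`, so that
one-variable uniqueness theorems apply in several variables. -/
lemma forall_of_update {ι α : Type*} [Finite ι] [DecidableEq ι] {A B : ι → Set α}
    (hAB : ∀ i, A i ⊆ B i) {Z : (ι → α) → Prop} (h0 : ∀ x, (∀ i, x i ∈ A i) → Z x)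
    (step : ∀ i x, (∀ j, x j ∈ B j) → (∀ ζ ∈ A i, Z (Function.update x i ζ)) → Z x)
    (x : ι → α) (hx : ∀ i, x i ∈ B i) : Z x := by
  have := Fintype.ofFinite ι
  have key : ∀ (S : Finset ι) (x : ι → α), (∀ i ∈ S, x i ∈ B i) → (∀ i ∉ S, x i ∈ A i) → Z x := by
    intro S
    induction S using Finset.induction_on with
    | empty => exact fun x _ h => h0 x fun i => h i (by simp)
    | insert i S hi ih =>
      intro x hB hA
      refine step i x (fun j => ?_) fun ζ hζ => ih _ (fun j hj => ?_) fun j hj => ?_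
      · by_cases hj : j ∈ insert i S
        · exact hB j hj
        · exact hAB j (hA j hj)
      · rw [Function.update_of_ne (by rintro rfl; exact hi hj)]
        exact hB j (Finset.mem_insert_of_mem hj)
      · rcases eq_or_ne j i with rfl | hji
        · rwa [Function.update_self]
        · rw [Function.update_of_ne hji]
          exact hA j (by simp [hji, hj])
  exact key Finset.univ x (fun i _ => hx i) (fun i hi => absurd (Finset.mem_univ i) hi)

/-- The point with the coordinates `y`, labelled through `e`. -/
def pt {ι : Type*} (e : ι ≃ Fin n) (y : ι → ℂ) : Cn n := WithLp.toLp 2 fun i => y (e.symm i)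

lemma pt_of {ι : Type*} (e : ι ≃ Fin n) (z : Cn n) : pt e (fun i => z (e i)) = z := by
  ext i
  simp [pt]

section pt

variable {ι : Type*} [Fintype ι] (e : ι ≃ Fin n)

lemma pt_mem {y : ι → ℂ} : pt e y ∈ UnitBall n ↔ ∑ i, ‖y i‖ ^ 2 < 1 := by
  have h : ‖pt e y‖ ^ 2 = ∑ i, ‖y i‖ ^ 2 := by
    rw [EuclideanSpace.norm_sq_eq, ← e.sum_comp]
    simp [pt]
  rw [mem_ball_zero_iff, ← h, sq_lt_one_iff₀ (norm_nonneg _)]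

lemma differentiableOn_comp_pt {F : Cn n → ℂ} (hF : DifferentiableOn ℂ F (UnitBall n))
    {y : ℂ → ι → ℂ} {s : Set ℂ} (hy : ∀ i, DifferentiableOn ℂ (fun ζ => y ζ i) s)
    (hs : ∀ ζ ∈ s, ∑ i, ‖y ζ i‖ ^ 2 < 1) : DifferentiableOn ℂ (fun ζ => F (pt e (y ζ))) s := by
  refine hF.comp (differentiableOn_euclidean.mpr fun i => ?_) fun ζ hζ => (pt_mem e).mpr (hs ζ hζ)
  exact hy (e.symm i)

end pt

lemma differentiable_update_apply {ι : Type*} [DecidableEq ι] (x : ι → ℂ) (i j : ι) :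
    Differentiable ℂ fun ζ => Function.update x i ζ j := by
  rcases eq_or_ne j i with rfl | h
  · simp only [Function.update_self]
    exact differentiable_id
  · simp only [Function.update_of_ne h]
    exact differentiable_const _

lemma exists_toCircle {z : ℂ} {r : ℝ} (h : ‖z‖ = r) :
    ∃ t : UnitAddCircle, z = (t.toCircle : ℂ) * r := by
  subst h
  rcases eq_or_ne z 0 with rfl | hz
  · exact ⟨0, by simp⟩
  · have h0 : (‖z‖ : ℂ) ≠ 0 := by exact_mod_cast (norm_pos_iff.mpr hz).ne'
    have h1 : ‖z / ‖z‖‖ = 1 := by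
      rw [norm_div, Complex.norm_real, norm_norm, div_self (norm_ne_zero_iff.mpr hz)]
    obtain ⟨t, ht⟩ := (AddCircle.homeomorphCircle one_ne_zero).surjective
      (⟨z / ‖z‖, mem_sphere_zero_iff_norm.mpr h1⟩ : Circle)
    rw [AddCircle.homeomorphCircle_apply] at ht
    refine ⟨t, ?_⟩
    rw [show t.toCircle = _ from ht]
    exact (div_mul_cancel₀ z h0).symm

lemma sum_sq_lt {k : ℕ} {R : ℝ} (hR : 0 < R) {x : Fin k → ℂ}
    (h : ∀ i, ‖x i‖ ≤ 1 / Real.sqrt (2 * k) * R) : ∑ i, ‖x i‖ ^ 2 < R ^ 2 := by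
  have h1 := Model.aux_sum k
  calc ∑ i, ‖x i‖ ^ 2 ≤ ∑ _i : Fin k, ‖((1 / Real.sqrt (2 * k) : ℝ) : ℂ)‖ ^ 2 * R ^ 2 := by
        refine Finset.sum_le_sum fun i _ => ?_
        rw [Complex.norm_real, Real.norm_of_nonneg (by positivity), ← mul_pow]
        exact pow_le_pow_left₀ (norm_nonneg _) (h i) 2
    _ = (∑ _i : Fin k, ‖((1 / Real.sqrt (2 * k) : ℝ) : ℂ)‖ ^ 2) * R ^ 2 := by
        rw [Finset.sum_mul]
    _ < 1 * R ^ 2 := by gcongr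
    _ = R ^ 2 := one_mul _

lemma radius_pos {k : ℕ} (i : Fin k) : (0 : ℝ) < 1 / Real.sqrt (2 * k) := by
  have hk : (0 : ℝ) < k := by exact_mod_cast i.pos
  positivity

/-- The orbit of a torus in some of the coordinates. -/
lemma eq_zero_of_torus {k : ℕ} {Z : (Fin k → ℂ) → ℂ} {R : ℝ} (hR : 0 < R)
    (hZ : ∀ i x, (∀ j, ‖x j‖ ≤ 1 / Real.sqrt (2 * k) * R) →
      DifferentiableOn ℂ (fun ζ => Z (Function.update x i ζ))
        (closedBall 0 (1 / Real.sqrt (2 * k) * R)))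
    (h : ∀ t : Fin k → UnitAddCircle,
      Z (fun i => ((t i).toCircle : ℂ) * ((1 / Real.sqrt (2 * k) * R : ℝ) : ℂ)) = 0)
    (x : Fin k → ℂ) (hx : ∀ i, ‖x i‖ ≤ 1 / Real.sqrt (2 * k) * R) : Z x = 0 := by
  refine forall_of_update (A := fun _ => {ζ : ℂ | ‖ζ‖ = 1 / Real.sqrt (2 * k) * R})
    (B := fun _ => {ζ : ℂ | ‖ζ‖ ≤ 1 / Real.sqrt (2 * k) * R}) (fun _ ζ hζ => le_of_eq hζ)
    (Z := fun x => Z x = 0) (fun x hx => ?_) (fun i x hx h1 => ?_) x hx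
  · choose t ht using fun i => exists_toCircle (hx i)
    rw [show x = _ from funext ht]
    exact h t
  · have h2 := eq_zero_of_sphere (mul_pos (radius_pos i) hR).ne' (hZ i x hx) h1 (x i) (hx i)
    simpa using h2

lemma sum_update_sq_lt {k : ℕ} {R : ℝ} (hR : 0 < R) {x : Fin k → ℂ}
    (h : ∀ i, ‖x i‖ ≤ 1 / Real.sqrt (2 * k) * R) (i : Fin k) {ζ : ℂ}
    (hζ : ζ ∈ closedBall (0 : ℂ) (1 / Real.sqrt (2 * k) * R)) :
    ∑ j, ‖Function.update x i ζ j‖ ^ 2 < R ^ 2 := by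
  refine sum_sq_lt hR fun j => ?_
  rcases eq_or_ne j i with rfl | hj
  · simpa using hζ
  · simpa [hj] using h j

namespace Model

lemma moeb_core_elliptic (ξ : (elliptic : Model n).X) :
    moeb ((elliptic : Model n).core ξ) ((elliptic : Model n).z0 : Cn n) =
      pt (Equiv.refl _) fun i => ((ξ.1 i).toCircle : ℂ) * ((1 / Real.sqrt (2 * n) : ℝ) : ℂ) := by
  ext i
  simp [pt, moeb, den, core, z0, z0vec, hvec, Matrix.fromBlocks, Matrix.mulVec, dotProduct,
    Fintype.sum_sum_type, Matrix.diagonal_apply]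

/-- The orbit is the distinguished boundary of a polydisc whose closure lies in the ball, since the
squared radii sum to less than one. -/
lemma eventually_eq_zero_elliptic {F : Cn n → ℂ} (hF : DifferentiableOn ℂ F (UnitBall n))
    (h : ∀ ξ, F (moeb ((elliptic : Model n).core ξ) (elliptic : Model n).z0) = 0) :
    ∀ᶠ z in 𝓝 (0 : Cn n), F z = 0 := by
  have h1 := eq_zero_of_torus (k := n) (Z := fun x => F (pt (Equiv.refl _) x)) one_pos
    (fun i x hx => differentiableOn_comp_pt _ hF
      (fun j => (differentiable_update_apply x i j).differentiableOn) fun ζ hζ => by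
        simpa using sum_update_sq_lt one_pos hx i hζ) fun t => by
    have h2 := h (t, (0 : EuclideanSpace ℝ (Fin 0)))
    rw [moeb_core_elliptic] at h2
    simp only [mul_one]
    exact h2
  have h3 : ∀ᶠ z in 𝓝 (0 : Cn n), ∀ i, ‖z i‖ ≤ 1 / Real.sqrt (2 * n) * 1 := by
    refine eventually_all.mpr fun i => ?_
    have hc : Continuous fun z : Cn n => ‖z i‖ := by fun_prop
    refine (hc.tendsto' 0 0 (by simp)).eventually_le_const ?_
    exact mul_pos (radius_pos i) one_pos
  filter_upwards [h3] with z hz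
  have := h1 z hz
  rwa [show pt (Equiv.refl _) (z : Fin n → ℂ) = z from pt_of (Equiv.refl _) z] at this

lemma moeb_core_hyperbolic {k : ℕ} (e : (Fin k ⊕ Unit) ≃ Fin n) (ξ : (hyperbolic k e).X) :
    moeb ((hyperbolic k e).core ξ) ((hyperbolic k e).z0 : Cn n) =
      pt e (Sum.elim (fun i => ((ξ.1 i).toCircle : ℂ) *
        ((1 / Real.sqrt (2 * k) * (Real.cosh (ξ.2 (0 : Fin 1)))⁻¹ : ℝ) : ℂ))
        fun _ => (Real.tanh (ξ.2 (0 : Fin 1)) : ℂ)) := by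
  ext i
  obtain ⟨i, rfl⟩ := e.surjective i
  refine (moeb_reindex e _ _ i).trans ?_
  rcases i with i | i
  · simp [hypCore, Fintype.sum_sum_type, z0, z0vec, pt, div_eq_mul_inv, mul_assoc]
  · simp [hypCore, Fintype.sum_sum_type, z0, z0vec, pt, Complex.tanh_eq_sinh_div_cosh]

/-- For fixed `s` the orbit is a torus in the slice where the last coordinate is `tanh s`, and the
torus argument fills a polydisc there. Letting `tanh s` run through a real interval then frees the
last coordinate by the identity theorem. -/
lemma eventually_eq_zero_hyperbolic {k : ℕ} (e : (Fin k ⊕ Unit) ≃ Fin n) {F : Cn n → ℂ}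
    (hF : DifferentiableOn ℂ F (UnitBall n))
    (h : ∀ ξ, F (moeb ((hyperbolic k e).core ξ) (hyperbolic k e).z0) = 0) :
    ∀ᶠ z in 𝓝 (0 : Cn n), F z = 0 := by
  have h1 : ∀ (s : ℝ) (x : Fin k → ℂ),
      (∀ i, ‖x i‖ ≤ 1 / Real.sqrt (2 * k) * (Real.cosh s)⁻¹) →
      F (pt e (Sum.elim x fun _ => (Real.tanh s : ℂ))) = 0 := by
    intro s
    have hR : 0 < (Real.cosh s)⁻¹ := inv_pos.mpr (Real.cosh_pos s)
    refine eq_zero_of_torus (Z := fun x => F (pt e (Sum.elim x fun _ => (Real.tanh s : ℂ)))) hR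
      (fun i x hx => differentiableOn_comp_pt e hF (fun j => ?_) fun ζ hζ => ?_) fun t => ?_
    · rcases j with j | j
      · exact (differentiable_update_apply x i j).differentiableOn
      · exact differentiableOn_const _
    · have h2 := sum_update_sq_lt hR hx i hζ
      have h3 : (Real.cosh s)⁻¹ ^ 2 + Real.tanh s ^ 2 = 1 := by
        have h4 := Real.cosh_sq s
        have h5 := (Real.cosh_pos s).ne'
        rw [Real.tanh_eq_sinh_div_cosh]
        field_simp
        linarith
      simp only [Fintype.sum_sum_type, Sum.elim_inl, Sum.elim_inr, Finset.univ_unique,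
        Finset.sum_singleton, Complex.norm_real, Real.norm_eq_abs, sq_abs]
      linarith
    · have h2 := h (t, (WithLp.toLp 2 fun _ => s : EuclideanSpace ℝ (Fin 1)))
      rw [moeb_core_hyperbolic] at h2
      exact h2
  -- The radius of the polydisc shrinks with `s`; half the radius at `s = 0` is available for all
  -- small `s`. The disc of radius `1/2` in `τ` keeps the point in the ball.
  have h2 : ∀ (x : Fin k → ℂ), (∀ i, ‖x i‖ ≤ 1 / Real.sqrt (2 * k) * (1 / 2)) →
      ∀ τ ∈ ball (0 : ℂ) (1 / 2), F (pt e (Sum.elim x fun _ => τ)) = 0 := by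
    intro x hx
    refine eq_zero_of_eventually_line isOpen_ball (convex_ball _ _).isPreconnected
      (differentiableOn_comp_pt e hF (y := fun τ => Sum.elim x fun _ => τ) (fun j => ?_)
        fun τ hτ => ?_) (mem_ball_self (by norm_num)) one_ne_zero ?_
    · rcases j with j | j
      · exact differentiableOn_const _
      · exact differentiableOn_id
    · have h3 := sum_sq_lt (by norm_num) hx
      simp only [Fintype.sum_sum_type, Sum.elim_inl, Sum.elim_inr, Finset.univ_unique,
        Finset.sum_singleton]
      rw [mem_ball_zero_iff] at hτ
      have := norm_nonneg τ
      nlinarith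
    · have h3 : ∀ᶠ t : ℝ in 𝓝 0, t ∈ Set.Ioo (-1 : ℝ) 1 ∧
          (1 / 2 : ℝ) ≤ (Real.cosh (Real.artanh t))⁻¹ := by
        refine Eventually.and (Ioo_mem_nhds (by norm_num) (by norm_num)) ?_
        have h4 : ∀ᶠ t : ℝ in 𝓝 0, (1 / 2 : ℝ) ≤ Real.sqrt (1 - t ^ 2) := by
          have hc : Continuous fun t : ℝ => Real.sqrt (1 - t ^ 2) := by fun_prop
          exact (hc.tendsto' 0 1 (by simp)).eventually_const_le (by norm_num)
        filter_upwards [h4, Ioo_mem_nhds (show (-1 : ℝ) < 0 by norm_num)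
          (show (0 : ℝ) < 1 by norm_num)] with t ht ht'
        rwa [Real.cosh_artanh ht', one_div √(1 - t ^ 2), inv_inv]
      filter_upwards [h3] with t ht
      have h4 := h1 (Real.artanh t) x fun i => (hx i).trans
        (mul_le_mul_of_nonneg_left ht.2 (radius_pos i).le)
      rw [Real.tanh_artanh ht.1] at h4
      simpa using h4
  have h3 : ∀ᶠ z in 𝓝 (0 : Cn n), (∀ i, ‖z (e (Sum.inl i))‖ ≤ 1 / Real.sqrt (2 * k) * (1 / 2)) ∧
      z (e (Sum.inr ())) ∈ ball (0 : ℂ) (1 / 2) := by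
    refine (eventually_all.mpr fun i => ?_).and ?_
    · have hc : Continuous fun z : Cn n => ‖z (e (Sum.inl i))‖ := by fun_prop
      refine (hc.tendsto' 0 0 (by simp)).eventually_le_const ?_
      exact mul_pos (radius_pos i) (by norm_num)
    · have hc : Continuous fun z : Cn n => z (e (Sum.inr ())) := by fun_prop
      exact (hc.tendsto' 0 0 (by simp)).eventually (ball_mem_nhds _ (by norm_num))
  filter_upwards [h3] with z hz
  have h4 := h2 _ hz.1 _ hz.2
  have h5 : (Sum.elim (fun i => z (e (Sum.inl i))) fun _ => z (e (Sum.inr ()))) =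
      fun i => z (e i) := by
    funext i
    rcases i with i | i <;> rfl
  rwa [h5, pt_of] at h4

/-- The affine coordinates of the unbounded realisation of the ball. -/
def siegel {k l : ℕ} (x : Fin k → ℂ) (b : Fin l → ℂ) (q : ℂ) : Fin k ⊕ Fin l ⊕ Unit → ℂ :=
  fun j => Sum.elim x (Sum.elim (fun i => -Complex.I * b i) fun _ => -q) j / (1 + q)

lemma one_add_ne_zero_of_siegel {k l : ℕ} {x : Fin k → ℂ} {b : Fin l → ℂ} {q : ℂ}
    (h : ∑ i, ‖x i‖ ^ 2 + ∑ i, ‖b i‖ ^ 2 < 1 + 2 * q.re) : 1 + q ≠ 0 := by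
  intro h0
  have h1 := congrArg Complex.re h0
  simp only [Complex.add_re, Complex.one_re, Complex.zero_re] at h1
  have h2 : 0 ≤ ∑ i, ‖x i‖ ^ 2 := Finset.sum_nonneg fun i _ => by positivity
  have h3 : 0 ≤ ∑ i, ‖b i‖ ^ 2 := Finset.sum_nonneg fun i _ => by positivity
  linarith

/-- After clearing the denominator this is the identity `|1 + q|² - |q|² = 1 + 2 Re q`. -/
lemma siegel_mem {k l : ℕ} {x : Fin k → ℂ} {b : Fin l → ℂ} {q : ℂ}
    (h : ∑ i, ‖x i‖ ^ 2 + ∑ i, ‖b i‖ ^ 2 < 1 + 2 * q.re) : ∑ j, ‖siegel x b q j‖ ^ 2 < 1 := by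
  have h0 : 0 < ‖1 + q‖ ^ 2 := pow_pos (norm_pos_iff.mpr (one_add_ne_zero_of_siegel h)) 2
  have h1 : ‖1 + q‖ ^ 2 = 1 + 2 * q.re + ‖q‖ ^ 2 := by
    rw [← Complex.normSq_eq_norm_sq, ← Complex.normSq_eq_norm_sq, Complex.normSq_apply,
      Complex.normSq_apply]
    simp
    ring
  simp only [siegel, norm_div, div_pow]
  rw [← Finset.sum_div, div_lt_one h0]
  simp only [Fintype.sum_sum_type, Sum.elim_inl, Sum.elim_inr, Finset.univ_unique,
    Finset.sum_singleton, norm_mul, norm_neg, Complex.norm_I, one_mul]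
  linarith

lemma moeb_core_nilpotent {k l : ℕ} (e : (Fin k ⊕ Fin l ⊕ Unit) ≃ Fin n)
    (ξ : (nilpotent k l e).X) :
    moeb ((nilpotent k l e).core ξ) ((nilpotent k l e).z0 : Cn n) =
      pt e (siegel (fun i => ((ξ.1 i).toCircle : ℂ) * ((1 / Real.sqrt (2 * k) * 1 : ℝ) : ℂ))
        (fun i : Fin l => (ξ.2 i.castSucc : ℂ))
        ((-Complex.I * (ξ.2 (Fin.last l)) + ∑ i : Fin l, (ξ.2 i.castSucc : ℂ) ^ 2) / 2)) := by
  ext i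
  obtain ⟨i, rfl⟩ := e.surjective i
  refine (moeb_reindex e _ _ i).trans ?_
  rcases i with i | i | i <;>
    simp [nilCore, Fintype.sum_sum_type, z0, z0vec, pt, siegel, add_comm (1 : ℂ)]
  congr 1
  ring

/-- In the affine coordinates `(x, b, q)` the orbit has `x` on a torus, `b` real and `q` on the
vertical line with real part `|b|²/2`. The variables are released in turn: `x` by the maximum
principle, then `q` and finally each `b i` by the identity theorem. -/
lemma eventually_eq_zero_nilpotent {k l : ℕ} (e : (Fin k ⊕ Fin l ⊕ Unit) ≃ Fin n) {F : Cn n → ℂ}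
    (hF : DifferentiableOn ℂ F (UnitBall n))
    (h : ∀ ξ, F (moeb ((nilpotent k l e).core ξ) (nilpotent k l e).z0) = 0) :
    ∀ᶠ z in 𝓝 (0 : Cn n), F z = 0 := by
  have hdiff : ∀ {x : ℂ → Fin k → ℂ} {b : ℂ → Fin l → ℂ} {q : ℂ → ℂ} {S : Set ℂ},
      (∀ i, DifferentiableOn ℂ (fun ζ => x ζ i) S) → (∀ i, DifferentiableOn ℂ (fun ζ => b ζ i) S) →
      DifferentiableOn ℂ q S →
      (∀ ζ ∈ S, ∑ i, ‖x ζ i‖ ^ 2 + ∑ i, ‖b ζ i‖ ^ 2 < 1 + 2 * (q ζ).re) →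
      DifferentiableOn ℂ (fun ζ => F (pt e (siegel (x ζ) (b ζ) (q ζ)))) S := by
    intro x b q S hx hb hq hS
    refine differentiableOn_comp_pt e hF (fun j => ?_) fun ζ hζ => siegel_mem (hS ζ hζ)
    refine DifferentiableOn.div ?_ (hq.const_add 1) fun ζ hζ =>
      one_add_ne_zero_of_siegel (hS ζ hζ)
    rcases j with j | j | j
    · exact hx j
    · exact (hb j).const_mul _
    · exact hq.neg
  have h1 : ∀ (b : Fin l → ℝ) (s : ℝ) (x : Fin k → ℂ),
      (∀ i, ‖x i‖ ≤ 1 / Real.sqrt (2 * k) * 1) →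
      F (pt e (siegel x (fun i => (b i : ℂ))
        (((∑ i, b i ^ 2) / 2 : ℝ) + s * Complex.I))) = 0 := by
    intro b s
    refine eq_zero_of_torus (Z := fun x => F (pt e (siegel x (fun i => (b i : ℂ))
      (((∑ i, b i ^ 2) / 2 : ℝ) + s * Complex.I)))) one_pos
      (fun i x hx => hdiff (fun j => (differentiable_update_apply x i j).differentiableOn)
        (fun j => differentiableOn_const _) (differentiableOn_const _) fun ζ hζ => ?_) fun t => ?_
    · have h2 := sum_update_sq_lt one_pos hx i hζ
      simp only [Complex.norm_real, Real.norm_eq_abs, sq_abs, Complex.add_re, Complex.ofReal_re,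
        Complex.re_ofReal_mul, Complex.I_re]
      linarith
    -- In the model the imaginary part of `q` is minus half of the last parameter, so the parameter
    -- `-2s` produces `s`.
    · have h2 := h (t, (WithLp.toLp 2 (Fin.snoc b (-2 * s) : Fin (l + 1) → ℝ) :
        EuclideanSpace ℝ (Fin (l + 1))))
      rw [moeb_core_nilpotent] at h2
      simp only [Fin.snoc_castSucc, Fin.snoc_last] at h2
      convert h2 using 4
      push_cast
      ring
  have h2 : ∀ (b : Fin l → ℝ) (x : Fin k → ℂ), (∀ i, ‖x i‖ ≤ 1 / Real.sqrt (2 * k) * 1) →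
      ∀ q : ℂ, ∑ i, ‖x i‖ ^ 2 + ∑ i, b i ^ 2 < 1 + 2 * q.re →
      F (pt e (siegel x (fun i => (b i : ℂ)) q)) = 0 := by
    intro b x hx
    have hx1 := sum_sq_lt one_pos hx
    set U : Set ℂ := {q | ∑ i, ‖x i‖ ^ 2 + ∑ i, b i ^ 2 < 1 + 2 * q.re} with hU
    have hUo : IsOpen U := isOpen_lt continuous_const
      (continuous_const.add (continuous_const.mul Complex.continuous_re))
    have hUc : Convex ℝ U := by
      have : U = {q : ℂ | (∑ i, ‖x i‖ ^ 2 + ∑ i, b i ^ 2 - 1) / 2 < q.re} := by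
        ext q
        change ∑ i, ‖x i‖ ^ 2 + ∑ i, b i ^ 2 < 1 + 2 * q.re ↔
          (∑ i, ‖x i‖ ^ 2 + ∑ i, b i ^ 2 - 1) / 2 < q.re
        constructor <;> intro h <;> linarith
      rw [this]
      exact convex_halfSpace_re_gt _
    refine eq_zero_of_eventually_line (c := (((∑ i, b i ^ 2) / 2 : ℝ) : ℂ)) (v := Complex.I)
      hUo hUc.isPreconnected (hdiff (fun j => differentiableOn_const _)
        (fun j => differentiableOn_const _) differentiableOn_id fun ζ hζ => ?_) ?_
        Complex.I_ne_zero (Eventually.of_forall fun s => h1 b s x hx)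
    · have h3 : ∑ i, ‖x i‖ ^ 2 + ∑ i, b i ^ 2 < 1 + 2 * ζ.re := hζ
      simpa using h3
    · change ∑ i, ‖x i‖ ^ 2 + ∑ i, b i ^ 2 < 1 + 2 * _
      rw [Complex.ofReal_re]
      linarith
  set κ : ℝ := ∑ _i : Fin k, ‖((1 / Real.sqrt (2 * k) : ℝ) : ℂ)‖ ^ 2 with hκ
  have hκ1 : κ < 1 := aux_sum k
  -- The choice makes the defining inequality of the domain hold whenever `|q|` and all `|b i|` are
  -- below `δ`: the left side is at most `κ + l δ²` and the right side exceeds `1 - 2δ`.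
  obtain ⟨δ, hδ1, hδ0⟩ : ∃ δ : ℝ, 2 * δ + l * δ ^ 2 < 1 - κ ∧ 0 < δ := by
    have hc : Continuous fun δ : ℝ => 2 * δ + l * δ ^ 2 := by fun_prop
    have h3 := (hc.tendsto' 0 0 (by simp)).eventually_lt_const (sub_pos.mpr hκ1)
    exact ((h3.filter_mono nhdsWithin_le_nhds).and
      (self_mem_nhdsWithin : Set.Ioi (0 : ℝ) ∈ 𝓝[>] 0)).exists
  have hx2 : ∀ x : Fin k → ℂ, (∀ i, ‖x i‖ ≤ 1 / Real.sqrt (2 * k) * 1) → ∑ i, ‖x i‖ ^ 2 ≤ κ := by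
    intro x hx
    refine Finset.sum_le_sum fun i _ => pow_le_pow_left₀ (norm_nonneg _) ?_ 2
    rw [Complex.norm_real, Real.norm_of_nonneg (by positivity)]
    simpa using hx i
  have hdom : ∀ {x : Fin k → ℂ} {b : Fin l → ℂ} {q : ℂ},
      (∀ i, ‖x i‖ ≤ 1 / Real.sqrt (2 * k) * 1) → (∀ i, ‖b i‖ < δ) → ‖q‖ < δ →
      ∑ i, ‖x i‖ ^ 2 + ∑ i, ‖b i‖ ^ 2 < 1 + 2 * q.re := by
    intro x b q hx hb hq
    have h3 := hx2 x hx
    have h4 : ∑ i, ‖b i‖ ^ 2 ≤ l * δ ^ 2 := by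
      refine (Finset.sum_le_sum fun i _ => pow_le_pow_left₀ (norm_nonneg _) (hb i).le 2).trans_eq ?_
      simp
    have h5 := (abs_le.mp (Complex.abs_re_le_norm q)).1
    linarith
  have h3 : ∀ (x : Fin k → ℂ) (q : ℂ), (∀ i, ‖x i‖ ≤ 1 / Real.sqrt (2 * k) * 1) → ‖q‖ < δ →
      ∀ b : Fin l → ℂ, (∀ i, ‖b i‖ < δ) → F (pt e (siegel x b q)) = 0 := by
    intro x q hx hq
    refine forall_of_update (A := fun _ => {ζ : ℂ | ‖ζ‖ < δ ∧ ∃ t : ℝ, ζ = t})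
      (B := fun _ => {ζ : ℂ | ‖ζ‖ < δ}) (fun _ ζ hζ => hζ.1)
      (Z := fun b => F (pt e (siegel x b q)) = 0) (fun b hb => ?_) fun i b hb h4 => ?_
    · choose hb1 t ht using hb
      have h5 := hdom hx hb1 hq
      rw [show b = fun i => (t i : ℂ) from funext ht] at h5 ⊢
      exact h2 t x hx q (by simpa using h5)
    · have hd : DifferentiableOn ℂ (fun ζ => F (pt e (siegel x (Function.update b i ζ) q)))
          (ball 0 δ) := by
        refine hdiff (fun j => differentiableOn_const _)
          (fun j => (differentiable_update_apply b i j).differentiableOn)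
          (differentiableOn_const _) fun ζ hζ => hdom hx (fun j => ?_) hq
        rcases eq_or_ne j i with rfl | hj
        · simpa using hζ
        · simpa [hj] using hb j
      have h5 := eq_zero_of_eventually_line isOpen_ball (convex_ball _ _).isPreconnected hd
        (mem_ball_self hδ0) one_ne_zero ?_ (b i) (by simpa using hb i)
      · simpa using h5
      · filter_upwards [ball_mem_nhds (0 : ℝ) hδ0] with t ht
        refine h4 _ ⟨?_, t, by simp⟩
        simpa using ht
  have hc : ∀ i, Continuous fun z : Cn n => z i := fun i => by fun_prop
  -- The last coordinate of the point is `-q/(1 + q)`, so `p = 1/(1 + q)`; inverting `siegel` gives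
  -- `q = 1/p - 1`, and `x` and `b` as below.
  set p : Cn n → ℂ := fun z => 1 + z (e (Sum.inr (Sum.inr ()))) with hp
  have hpc : ContinuousAt (fun z => (p z)⁻¹) 0 := by
    refine ContinuousAt.inv₀ (continuous_const.add (hc _)).continuousAt ?_
    simp [hp]
  have hp0 : (p 0)⁻¹ = 1 := by simp [hp]
  have h4 : ∀ᶠ z in 𝓝 (0 : Cn n), (∀ i, ‖z (e (Sum.inl i)) * (p z)⁻¹‖ ≤
      1 / Real.sqrt (2 * k) * 1) ∧ ‖(p z)⁻¹ - 1‖ < δ ∧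
      (∀ i, ‖Complex.I * (z (e (Sum.inr (Sum.inl i))) * (p z)⁻¹)‖ < δ) ∧ p z ≠ 0 := by
    refine (eventually_all.mpr fun i => ?_).and (Eventually.and ?_
      ((eventually_all.mpr fun i => ?_).and ?_))
    · have h5 := ((hc (e (Sum.inl i))).continuousAt.mul hpc).norm
      refine h5.tendsto.eventually_le_const ?_
      simpa using radius_pos i
    · have h5 := (hpc.sub (continuousAt_const (y := 1))).norm
      refine h5.tendsto.eventually_lt_const ?_
      simpa [hp0] using hδ0
    · have h5 := ((continuousAt_const (y := Complex.I)).mul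
        ((hc (e (Sum.inr (Sum.inl i)))).continuousAt.mul hpc)).norm
      refine h5.tendsto.eventually_lt_const ?_
      simpa using hδ0
    · exact (continuous_const.add (hc _)).continuousAt.eventually_ne (by simp)
  filter_upwards [h4] with z hz
  obtain ⟨hz1, hz2, hz3, hz4⟩ := hz
  have h5 := h3 _ _ hz1 hz2 _ hz3
  have h6 : siegel (fun i => z (e (Sum.inl i)) * (p z)⁻¹)
      (fun i => Complex.I * (z (e (Sum.inr (Sum.inl i))) * (p z)⁻¹)) ((p z)⁻¹ - 1) =
      fun i => z (e i) := by
    funext i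
    rcases i with i | i | i
    · simp [siegel, hz4]
    · simp only [siegel, Sum.elim_inr, Sum.elim_inl, add_sub_cancel]
      field_simp
      rw [Complex.I_sq]
      ring
    · simp only [siegel, Sum.elim_inr, add_sub_cancel]
      field_simp
      simp [hp]
  rwa [h6, pt_of] at h5

/-- The orbit of the base point is a set of uniqueness for holomorphic functions. -/
lemma eq_zero_of_orbit (M : Model n) {F : Cn n → ℂ} (hF : DifferentiableOn ℂ F (UnitBall n))
    (h : ∀ ξ, F (moeb (M.core ξ) M.z0) = 0) : ∀ z ∈ UnitBall n, F z = 0 := by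
  have h0 : ∀ᶠ z in 𝓝 (0 : Cn n), F z = 0 := by
    cases M with
    | elliptic => exact eventually_eq_zero_elliptic hF h
    | hyperbolic k e => exact eventually_eq_zero_hyperbolic e hF h
    | nilpotent k l e => exact eventually_eq_zero_nilpotent e hF h
  intro z hz
  have hc : Continuous fun ζ : ℂ => ζ • z := by fun_prop
  have hconv : Convex ℝ ((fun ζ : ℂ => ζ • z) ⁻¹' UnitBall n) :=
    (convex_ball (0 : Cn n) 1).linear_preimage
      (((LinearMap.toSpanSingleton ℂ (Cn n) z)).restrictScalars ℝ)
  -- Vanishing near the origin spreads to the ball along the complex line through the origin and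
  -- `z`.
  have h1 := eq_zero_of_eventually_line (f := fun ζ => F (ζ • z)) (c := 0) (v := 1)
    (isOpen_ball.preimage hc) hconv.isPreconnected
    (hF.comp (by fun_prop) fun ζ hζ => hζ) (by simp) one_ne_zero ?_ 1 (by simpa using hz)
  · simpa using h1
  · have hc' : Continuous fun t : ℝ => ((0 : ℂ) + t * 1) • z := by fun_prop
    exact (hc'.tendsto' 0 0 (by simp)).eventually h0

end Model

namespace Chart

variable {H : Subgroup (SU n)} (c : Chart H) {lam : ℝ}

/-- The frame of a chart is total. -/
lemma eq_zero_of_inner_frame [IsProbabilityMeasure (bergmanMeasure n lam)] (hlam : 0 ≤ lam)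
    (f : bergman n lam) (h : ∀ ξ, inner ℂ (c.frame lam ξ) f = 0) : f = 0 := by
  have hF := (holo_spec f).1
  have h1 : ∀ ξ, holo f (moeb (mat c.γ.proj) (moeb (c.model.core ξ) c.model.z0)) = 0 := by
    intro ξ
    have h2 := h ξ
    rw [c.inner_frame hlam, descend, smul_base] at h2
    have h3 := (mul_eq_zero.mp ((mul_eq_zero.mp h2).resolve_left (Complex.exp_ne_zero _))).resolve_left
      (Cover.j_ne_zero lam _ _)
    have h4 := c.coord_orbit (c.coord_spec (c.lift ξ))
    rw [coord_lift] at h4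
    rw [← h4]
    exact h3
  have h2 := c.model.eq_zero_of_orbit (F := fun z => holo f (moeb (mat c.γ.proj) z))
    (hF.comp (fun z hz => (differentiableAt_moeb c.γ.proj hz).differentiableWithinAt)
      fun z hz => moeb_mem _ hz) h1
  have h3 : ∀ z ∈ UnitBall n, holo f z = 0 := by
    intro z hz
    have h4 := h2 _ (moeb_mem c.γ.proj⁻¹ hz)
    have h5 : moeb (mat c.γ.proj) (moeb (mat c.γ.proj⁻¹) z) = z := by
      rw [← moeb_mul _ _ _ (den_ne_zero _ hz), ← mat_mul, mul_inv_cancel, mat_one, moeb_one]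
    rwa [h5] at h4
  apply Subtype.ext
  refine Lp.ext ?_
  filter_upwards [(holo_spec f).2, ae_mem_ball n lam, Lp.coeFn_zero ℂ 2 (bergmanMeasure n lam)]
    with z hz hzb h0
  rw [hz, h3 z hzb]
  exact h0.symm

end Chart

end BallToeplitz

end

noncomputable section

namespace BallToeplitz

variable {n : ℕ} {H : Subgroup (SU n)}

/-! ### Simultaneous diagonalisation -/

-- The abstract theorem is applied to the frame of the chart, whose Gram kernel is `φ_H`, and to the
-- Toeplitz operators, whose matrix coefficients along the frame are `ν_φ(ξ - η)`.
set_option maxHeartbeats 1000000 in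
theorem Chart.exists_diagonalization (hn : 1 ≤ n) {lam : ℝ} (hlam : (n : ℝ) < lam) (c : Chart H) :
    Integrable (c.phiH lam) ∧
      ∃ R : bergman n lam →L[ℂ] c.L2chi lam, c.IsRestriction lam R ∧ c.IsConvolution lam R ∧
      ∃ U : c.rangeClosure lam R ≃ₗᵢ[ℂ] bergman n lam, c.IsSegalBargmann lam R U ∧
      ∃ P : Lp ℂ 2 (volume : Measure c.model.X) ≃ₗᵢ[ℂ] Lp ℂ 2 c.dualMeasure, c.IsPlancherel P ∧
      ∃ F : c.rangeClosure lam R ≃ₗᵢ[ℂ] c.L2A lam,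
        (∀ f : c.rangeClosure lam R, (F f : Lp ℂ 2 c.dualMeasure) = P (c.toL2 lam f)) ∧
        ∀ φ : Lp ℂ ∞ (bergmanMeasure n lam), IsInvariant H φ →
          Integrable (c.nu lam φ) ∧
          ∀ ω : c.L2A lam, ∀ᵐ α ∂c.dualMeasure, α ∈ c.A lam →
            (F (U.symm (toeplitz φ (U (F.symm ω)))) : Lp ℂ 2 c.dualMeasure) α =
              c.hat (c.nu lam φ) α / c.hat (c.phiH lam) α * (ω : Lp ℂ 2 c.dualMeasure) α := by
  have hlam0 : 0 ≤ lam := (Nat.cast_nonneg n).trans hlam.le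
  have := isProbabilityMeasure_bergmanMeasure hn hlam
  have hint := c.integrable_phiH lam hlam
  have hκ := c.inner_frame_frame (lam := lam) hlam0
  have hφc := c.continuous_phiH lam
  have hK : ∀ ω : Lp ℂ 2 c.dualMeasure, ω ∈ c.L2A lam ↔
      ∀ᵐ α ∂c.dualMeasure, c.hat (c.phiH lam) α = 0 → ω α = 0 := by
    intro ω
    change (∀ᵐ α ∂c.dualMeasure, ¬ (c.hat (c.phiH lam) α ≠ 0) → ω α = 0) ↔ _
    simp only [ne_eq, not_not]
  obtain ⟨R, hR, hconv, U, hU, P, hP, F, hF, hdiag⟩ :=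
    BallToeplitz.exists_diagonalization (c.toL2ₗᵢ lam) hκ hφc hint
      (fun f hf => c.eq_zero_of_inner_frame hlam0 f hf) (c.L2A lam) hK
  refine ⟨hint, R, fun f => ?_, hconv, U, fun f => ⟨_, hU f⟩, P, hP, F, hF, fun φ hφ =>
    ⟨c.integrable_nu lam hn hlam hφ, fun ω => ?_⟩⟩
  · have h1 : c.descend lam (fun h : tilde H =>
        c.D lam h * holo f ((h : Cover n) • c.base : UnitBall n).1) =
        fun ξ => inner ℂ (c.frame lam ξ) f := funext fun ξ => (c.inner_frame hlam0 ξ f).symm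
    have h2 := memLp_frame hκ hφc hint f
    have hmem : (fun h : tilde H => c.D lam h * holo f ((h : Cover n) • c.base : UnitBall n).1) ∈
        c.sections lam :=
      ⟨c.isCovariant_D_mul lam fun z : UnitBall n => holo f z.1, by rw [h1]; exact h2⟩
    refine ⟨hmem, ?_⟩
    apply (c.toL2ₗᵢ lam).injective
    rw [hR]
    exact MemLp.toLp_congr h2 hmem.2 (Eventually.of_forall fun ξ => (congrFun h1 ξ).symm)
  · exact hdiag (toeplitz φ) (c.nu lam φ) (c.integrable_nu lam hn hlam hφ)
      (c.inner_frame_toeplitz hlam0 hφ) ω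

/-- After diagonalisation both products are multiplication by the same product of scalar functions
on `A`, and both images vanish off `A`. -/
lemma Chart.toeplitz_comm (hn : 1 ≤ n) {lam : ℝ} (hlam : (n : ℝ) < lam) (c : Chart H)
    {φ ψ : Lp ℂ ∞ (bergmanMeasure n lam)} (hφ : IsInvariant H φ) (hψ : IsInvariant H ψ) :
    toeplitz φ ∘L toeplitz ψ = toeplitz ψ ∘L toeplitz φ := by
  obtain ⟨-, R, -, -, U, -, P, -, F, -, h⟩ := c.exists_diagonalization hn hlam
  have key : ∀ {φ : Lp ℂ ∞ (bergmanMeasure n lam)}, IsInvariant H φ → ∀ x : bergman n lam,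
      ∀ᵐ α ∂c.dualMeasure, α ∈ c.A lam →
        (F (U.symm (toeplitz φ x)) : Lp ℂ 2 c.dualMeasure) α =
          c.hat (c.nu lam φ) α / c.hat (c.phiH lam) α *
            (F (U.symm x) : Lp ℂ 2 c.dualMeasure) α := by
    intro φ hφ x
    have h1 := (h φ hφ).2 (F (U.symm x))
    simpa only [LinearIsometryEquiv.symm_apply_apply, LinearIsometryEquiv.apply_symm_apply] using h1
  refine ContinuousLinearMap.ext fun x => ?_
  apply U.symm.injective
  apply F.injective
  apply Subtype.ext
  refine Lp.ext ?_
  filter_upwards [key hφ (toeplitz ψ x), key hψ x, key hψ (toeplitz φ x), key hφ x,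
    (F (U.symm (toeplitz φ (toeplitz ψ x)))).2, (F (U.symm (toeplitz ψ (toeplitz φ x)))).2]
    with α h1 h2 h3 h4 h5 h6
  rw [ContinuousLinearMap.comp_apply, ContinuousLinearMap.comp_apply]
  by_cases hα : α ∈ c.A lam
  · rw [h1 hα, h2 hα, h3 hα, h4 hα]
    ring
  · rw [h5 hα, h6 hα]

end BallToeplitz

end

noncomputable section

namespace BallToeplitz

variable {n : ℕ}

/-! ### Common eigenvectors of commuting operators -/

/-- If every operator is scalar on `W`, any nonzero vector serves. Otherwise an eigenspace in `W` of
a nonscalar one is a proper nonzero subspace that the others preserve, and induction on the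
dimension applies. -/
lemma exists_common_eigenvector {Q : Type*} [AddCommGroup Q] [Module ℂ Q] [FiniteDimensional ℂ Q]
    (S : Set (Module.End ℂ Q)) (hS : ∀ f ∈ S, ∀ g ∈ S, ∀ x, f (g x) = g (f x)) (W : Submodule ℂ Q)
    (hW : ∀ f ∈ S, ∀ x ∈ W, f x ∈ W) (h0 : W ≠ ⊥) :
    ∃ x ∈ W, x ≠ 0 ∧ ∀ f ∈ S, ∃ μ : ℂ, f x = μ • x := by
  induction hd : Module.finrank ℂ W using Nat.strong_induction_on generalizing W with
  | h d ih =>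
    by_cases hall : ∀ f ∈ S, ∃ μ : ℂ, ∀ x ∈ W, f x = μ • x
    · obtain ⟨x, hx, hx0⟩ := (Submodule.ne_bot_iff W).mp h0
      exact ⟨x, hx, hx0, fun f hf => (hall f hf).imp fun μ hμ => hμ x hx⟩
    · push Not at hall
      obtain ⟨f, hf, hne⟩ := hall
      have : Nontrivial W := Submodule.nontrivial_iff_ne_bot.mpr h0
      obtain ⟨μ, hμ⟩ := Module.End.exists_eigenvalue (f.restrict (hW f hf))
      obtain ⟨⟨x, hx⟩, hxμ⟩ := hμ.exists_hasEigenvector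
      have hfx : f x = μ • x := congrArg Subtype.val hxμ.apply_eq_smul
      have hx0 : x ≠ 0 := fun h => hxμ.2 (Subtype.ext h)
      set W' : Submodule ℂ Q := W ⊓ LinearMap.ker (f - μ • LinearMap.id) with hW'
      have hmem : ∀ y, y ∈ W' ↔ y ∈ W ∧ f y = μ • y := by
        intro y
        simp [hW', sub_eq_zero]
      have hlt : W' < W := by
        refine lt_of_le_of_ne inf_le_left fun h => ?_
        obtain ⟨y, hy, hyne⟩ := hne μ
        rw [← h] at hy
        exact hyne ((hmem y).mp hy).2
      obtain ⟨y, hy, hy0, hyS⟩ := ih _ (hd ▸ Submodule.finrank_lt_finrank_of_lt hlt) W'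
        (fun g hg y hy => by
          obtain ⟨hy1, hy2⟩ := (hmem y).mp hy
          exact (hmem _).mpr ⟨hW g hg y hy1, by rw [hS f hf g hg, hy2, map_smul]⟩)
        ((Submodule.ne_bot_iff W').mpr ⟨x, (hmem x).mpr ⟨hx, hfx⟩, hx0⟩) rfl
      exact ⟨y, ((hmem y).mp hy).1, hy0, hyS⟩

/-- The previous lemma is applied in the quotient by `L`. Working modulo `L` is what handles a null
eigenvector, for which no invariant complement need exist. -/
lemma exists_common_eigenvector_mod {V : Type*} [AddCommGroup V] [Module ℂ V]
    [FiniteDimensional ℂ V] (S : Set (Module.End ℂ V))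
    (hS : ∀ f ∈ S, ∀ g ∈ S, ∀ x, f (g x) = g (f x)) (W L : Submodule ℂ V)
    (hW : ∀ f ∈ S, ∀ x ∈ W, f x ∈ W) (hL : ∀ f ∈ S, ∀ x ∈ L, f x ∈ L) (hWL : ¬ W ≤ L) :
    ∃ x ∈ W, x ∉ L ∧ ∀ f ∈ S, ∃ μ : ℂ, f x - μ • x ∈ L := by
  set S' : Set (Module.End ℂ (V ⧸ L)) :=
    {g | ∃ f ∈ S, ∀ x, g (L.mkQ x) = L.mkQ (f x)} with hS'
  obtain ⟨y, hy, hy0, hyS⟩ := exists_common_eigenvector S' (fun f' hf' g' hg' y => by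
      obtain ⟨f, hf, hff⟩ := hf'
      obtain ⟨g, hg, hgg⟩ := hg'
      obtain ⟨x, rfl⟩ := L.mkQ_surjective y
      rw [hgg, hff, hff, hgg, hS f hf g hg]) (W.map L.mkQ) (fun f' hf' y hy => by
      obtain ⟨f, hf, hff⟩ := hf'
      obtain ⟨x, hx, rfl⟩ := hy
      rw [hff]
      exact ⟨_, hW f hf x hx, rfl⟩) (fun h => hWL fun x hx => by
      have h1 : L.mkQ x ∈ W.map L.mkQ := ⟨x, hx, rfl⟩
      rw [h, Submodule.mem_bot] at h1
      simpa using h1)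
  obtain ⟨x, hx, rfl⟩ := hy
  refine ⟨x, hx, fun h => hy0 (by simpa using h), fun f hf => ?_⟩
  obtain ⟨μ, hμ⟩ := hyS (L.mapQ L f fun z hz => hL f hf z hz) ⟨f, hf, fun z => by simp⟩
  refine ⟨μ, (Submodule.Quotient.mk_eq_zero L).mp ?_⟩
  have h1 : L.mkQ (f x) = μ • L.mkQ x := by
    rw [← hμ]
    simp
  rw [← Submodule.mkQ_apply, map_sub, map_smul, h1, sub_self]

/-! ### The Hermitian form -/

lemma herm_zero_right (u : Ix n → ℂ) : herm u 0 = 0 := by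
  rw [herm, Matrix.mulVec_zero, dotProduct_zero]

lemma herm_zero_left (u : Ix n → ℂ) : herm 0 u = 0 := by
  rw [herm, star_zero, zero_dotProduct]

lemma herm_sub_right (u v w : Ix n → ℂ) : herm u (v - w) = herm u v - herm u w := by
  rw [herm, Matrix.mulVec_sub, dotProduct_sub, herm, herm]

lemma herm_sum_right {ι : Type*} (s : Finset ι) (u : Ix n → ℂ) (v : ι → Ix n → ℂ) :
    herm u (∑ i ∈ s, v i) = ∑ i ∈ s, herm u (v i) := by
  induction s using Finset.cons_induction with
  | empty => simp [herm_zero_right]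
  | cons i s hi ih => rw [Finset.sum_cons, Finset.sum_cons, herm_add_right, ih]

lemma herm_sum_left {ι : Type*} (s : Finset ι) (u : Ix n → ℂ) (v : ι → Ix n → ℂ) :
    herm (∑ i ∈ s, v i) u = ∑ i ∈ s, herm (v i) u := by
  induction s using Finset.cons_induction with
  | empty => simp [herm_zero_left]
  | cons i s hi ih => rw [Finset.sum_cons, Finset.sum_cons, herm_add_left, ih]

lemma herm_comm_zero {u v : Ix n → ℂ} (h : herm u v = 0) : herm v u = 0 := by
  rw [← herm_star, h, star_zero]

/-- The values of the form on the diagonal. -/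
lemma herm_self (u : Ix n → ℂ) :
    herm u u = ((‖u (Sum.inr ())‖ ^ 2 - ∑ i, ‖u (Sum.inl i)‖ ^ 2 : ℝ) : ℂ) := star_J u

lemma herm_self_eq_re (u : Ix n → ℂ) : herm u u = ((herm u u).re : ℂ) := by
  rw [herm_self, Complex.ofReal_re]

lemma herm_smul_self (c : ℂ) (u : Ix n → ℂ) :
    (herm (c • u) (c • u)).re = ‖c‖ ^ 2 * (herm u u).re := by
  rw [herm_smul_left, herm_smul_right, ← mul_assoc, RCLike.star_def, Complex.conj_mul',
    ← Complex.ofReal_pow, Complex.re_ofReal_mul]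

/-- The form as a linear map in the second argument. -/
def hermL (u : Ix n → ℂ) : (Ix n → ℂ) →ₗ[ℂ] ℂ where
  toFun := herm u
  map_add' := herm_add_right u
  map_smul' c v := herm_smul_right c u v

/-- On the hyperplane where the last coordinate vanishes the form is negative definite. -/
lemma last_ne_zero {e : Ix n → ℂ} (he : e ≠ 0) (hee : 0 ≤ (herm e e).re) : e (Sum.inr ()) ≠ 0 := by
  intro h
  rw [herm_self, Complex.ofReal_re, h, norm_zero] at hee
  have h1 : ∑ i, ‖e (Sum.inl i)‖ ^ 2 = 0 := by
    have := Finset.sum_nonneg fun i (_ : i ∈ Finset.univ) => sq_nonneg ‖e (Sum.inl i)‖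
    linarith
  rw [Finset.sum_eq_zero_iff_of_nonneg fun i _ => sq_nonneg _] at h1
  apply he
  funext i
  rcases i with i | i
  · simpa using h1 i (Finset.mem_univ i)
  · exact h

/-- The orthogonal complement of a vector that is not spacelike is negative semidefinite. -/
lemma herm_self_neg_or_mem {e x : Ix n → ℂ} (he : e ≠ 0) (hee : 0 ≤ (herm e e).re)
    (hx : herm e x = 0) : (herm x x).re < 0 ∨ ∃ c : ℂ, x = c • e := by
  have he0 := last_ne_zero he hee
  -- The last coordinate of `x - c • e` vanishes, so this vector is spacelike unless it is zero;
  -- orthogonality to `e` compares its length with that of `x`.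
  set c := x (Sum.inr ()) / e (Sum.inr ()) with hc
  set y := x - c • e with hy
  have hxy : x = y + c • e := by rw [hy, sub_add_cancel]
  have hy0 : y (Sum.inr ()) = 0 := by
    simp [hy, hc, div_mul_cancel₀ _ he0]
  rcases eq_or_ne y 0 with h | h
  · right
    exact ⟨c, by rw [hxy, h, zero_add]⟩
  · left
    by_contra! hcon
    have h1 : herm y y = herm x x + (‖c‖ ^ 2 : ℝ) * herm e e := by
      have h2 : herm x e = 0 := herm_comm_zero hx
      have h3 : herm e y = -(c * herm e e) := by
        rw [hy, herm_sub_right, herm_smul_right, hx, zero_sub]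
      have h4 : herm x y = herm x x := by
        rw [hy, herm_sub_right, herm_smul_right, h2, mul_zero, sub_zero]
      have h5 : herm x y = herm y y + star c * herm e y := by
        conv_lhs => rw [hxy]
        rw [herm_add_left, herm_smul_left]
      rw [h4, h3] at h5
      rw [h5, Complex.ofReal_pow, ← Complex.conj_mul', RCLike.star_def]
      ring
    have h2 : 0 ≤ (herm y y).re := by
      rw [h1, Complex.add_re, Complex.re_ofReal_mul]
      positivity
    exact last_ne_zero h h2 hy0

/-- Normalisation of a spacelike vector. -/
lemma exists_smul_herm_eq_neg_one {x : Ix n → ℂ} (hx : (herm x x).re < 0) :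
    ∃ r : ℂ, r ≠ 0 ∧ herm (r • x) (r • x) = -1 := by
  set s := Real.sqrt (-(herm x x).re) with hs
  have hs0 : 0 < s := Real.sqrt_pos.mpr (by linarith)
  have hs2 : s ^ 2 = -(herm x x).re := Real.sq_sqrt (by linarith)
  refine ⟨((s⁻¹ : ℝ) : ℂ), by exact_mod_cast (inv_pos.mpr hs0).ne', ?_⟩
  rw [herm_self_eq_re, herm_smul_self, Complex.norm_real, Real.norm_of_nonneg (by positivity),
    inv_pow, hs2, inv_neg, neg_mul, inv_mul_cancel₀ hx.ne]
  simp

/-- The expansion with respect to an orthonormal basis. -/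
lemma eq_sum_herm (b : Ix n → Ix n → ℂ) (hb : ∀ i j, herm (b i) (b j) = J n i j) (x : Ix n → ℂ) :
    x = herm (b (Sum.inr ())) x • b (Sum.inr ()) -
      ∑ i, herm (b (Sum.inl i)) x • b (Sum.inl i) := by
  obtain ⟨a, g, hg⟩ := exists_mem_SU b hb
  have ha : star (a : ℂ) * a = 1 := by
    rw [RCLike.star_def, Complex.conj_mul', Circle.norm_coe]
    simp
  have hgb : ∀ i, b i = star (a : ℂ) • mat g *ᵥ Pi.single i 1 := fun i => by
    rw [hg, smul_smul, ha, one_smul]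
  set y := mat g⁻¹ *ᵥ x with hy
  have hx : x = mat g *ᵥ y := by
    rw [hy, Matrix.mulVec_mulVec, ← mat_mul, mul_inv_cancel, mat_one, Matrix.one_mulVec]
  have h1 : ∀ i, herm (b i) x • b i = herm (Pi.single i 1) y • mat g *ᵥ Pi.single i 1 := by
    intro i
    rw [hgb, hx, herm_smul_left, herm_mulVec, smul_smul, star_star]
    congr 1
    linear_combination (herm (Pi.single i 1) y) * ha
  simp only [h1]
  have h2 : y = herm (Pi.single (Sum.inr ()) 1) y • Pi.single (Sum.inr ()) 1 -
      ∑ i, herm (Pi.single (Sum.inl i) 1) y • Pi.single (Sum.inl i) 1 := by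
    funext j
    rcases j with j | j <;>
      simp [herm_eq, Pi.single_apply, Finset.sum_apply]
  conv_lhs => rw [hx, h2]
  rw [Matrix.mulVec_sub, Matrix.mulVec_smul, Matrix.mulVec_sum]
  simp only [Matrix.mulVec_smul]

/-! ### Abelian subgroups -/

/-- The elements of a set of matrices commute. -/
def IsCommSet (H : Subgroup (SU n)) : Prop := ∀ a ∈ H, ∀ b ∈ H, a * b = b * a

/-- The orthogonal complement of a set of vectors. -/
def hperp (s : Set (Ix n → ℂ)) : Submodule ℂ (Ix n → ℂ) where
  carrier := {x | ∀ u ∈ s, herm u x = 0}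
  zero_mem' := fun u _ => herm_zero_right u
  add_mem' := fun {x y} hx hy u hu => by rw [herm_add_right, hx u hu, hy u hu, add_zero]
  smul_mem' := fun c x hx u hu => by rw [herm_smul_right, hx u hu, mul_zero]

variable {H : Subgroup (SU n)}

lemma herm_mulVec_right (h : SU n) (u x : Ix n → ℂ) :
    herm u (mat h *ᵥ x) = herm (mat h⁻¹ *ᵥ u) x := by
  rw [← herm_mulVec h (mat h⁻¹ *ᵥ u), Matrix.mulVec_mulVec, ← mat_mul, mul_inv_cancel, mat_one,
    Matrix.one_mulVec]

/-- The adjoint of `h` for the form is `h⁻¹`, which also belongs to `H` and so preserves the span.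
-/
lemma mulVec_mem_hperp {s : Set (Ix n → ℂ)}
    (hs : ∀ h ∈ H, ∀ u ∈ s, mat h *ᵥ u ∈ Submodule.span ℂ s) :
    ∀ h ∈ H, ∀ x ∈ hperp s, mat h *ᵥ x ∈ hperp s := by
  intro h hh x hx u hu
  rw [herm_mulVec_right]
  refine Submodule.span_induction (p := fun y _ => herm y x = 0) (fun y hy => hx y hy)
    (herm_zero_left x) (fun y z _ _ hy hz => by rw [herm_add_left, hy, hz, add_zero])
    (fun c y _ hy => by rw [herm_smul_left, hy, mul_zero]) (hs h⁻¹ (H.inv_mem hh) u hu)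

lemma IsCommSet.exists_eigenvector (hH : IsCommSet H) (W L : Submodule ℂ (Ix n → ℂ))
    (hW : ∀ h ∈ H, ∀ x ∈ W, mat h *ᵥ x ∈ W) (hL : ∀ h ∈ H, ∀ x ∈ L, mat h *ᵥ x ∈ L)
    (hWL : ¬ W ≤ L) : ∃ x ∈ W, x ∉ L ∧ ∀ h ∈ H, ∃ μ : ℂ, mat h *ᵥ x - μ • x ∈ L := by
  obtain ⟨x, hx, hxL, hxS⟩ := exists_common_eigenvector_mod
    {f : Module.End ℂ (Ix n → ℂ) | ∃ h ∈ H, f = (mat h).mulVecLin} (by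
      rintro _ ⟨h, hh, rfl⟩ _ ⟨k, hk, rfl⟩ x
      simp only [Matrix.mulVecLin_apply, Matrix.mulVec_mulVec, ← mat_mul, hH h hh k hk]) W L
    (by rintro _ ⟨h, hh, rfl⟩ x hx; exact hW h hh x hx)
    (by rintro _ ⟨h, hh, rfl⟩ x hx; exact hL h hh x hx) hWL
  exact ⟨x, hx, hxL, fun h hh => hxS _ ⟨h, hh, rfl⟩⟩

/-- `W` contains a common eigenvector `y`. If `y` is spacelike, the complement of `y` in `W` is
invariant and smaller. It still contains a timelike vector, since removing the `y`-component of `x`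
removes a negative contribution to `⟨x, x⟩`. -/
lemma IsCommSet.exists_causal_eigenvector_aux (hH : IsCommSet H) (W : Submodule ℂ (Ix n → ℂ))
    (hW : ∀ h ∈ H, ∀ x ∈ W, mat h *ᵥ x ∈ W) (hpos : ∃ x ∈ W, 0 < (herm x x).re) :
    ∃ e : Ix n → ℂ, e ≠ 0 ∧ 0 ≤ (herm e e).re ∧ ∀ h ∈ H, ∃ μ : ℂ, mat h *ᵥ e = μ • e := by
  induction hd : Module.finrank ℂ W using Nat.strong_induction_on generalizing W with
  | h d ih =>
    obtain ⟨x, hx, hxx⟩ := hpos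
    have hW0 : ¬ W ≤ ⊥ := by
      intro h
      have := h hx
      rw [Submodule.mem_bot] at this
      rw [this, herm_zero_right] at hxx
      exact lt_irrefl _ hxx
    obtain ⟨y, hy, hy0, hyH⟩ := hH.exists_eigenvector W ⊥ hW
      (fun h _ x hx => by
        rw [Submodule.mem_bot] at hx ⊢
        rw [hx, Matrix.mulVec_zero]) hW0
    simp only [Submodule.mem_bot, sub_eq_zero] at hy0 hyH
    by_cases hyy : 0 ≤ (herm y y).re
    · exact ⟨y, hy0, hyy, hyH⟩
    · rw [not_le] at hyy
      have hyy0 : herm y y ≠ 0 := by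
        intro h
        rw [h] at hyy
        exact lt_irrefl _ hyy
      have hlt : W ⊓ hperp {y} < W := by
        refine lt_of_le_of_ne inf_le_left fun h => hyy0 ?_
        rw [← h] at hy
        exact hy.2 y rfl
      refine ih _ (hd ▸ Submodule.finrank_lt_finrank_of_lt hlt) (W ⊓ hperp {y})
        (fun h hh z hz => ⟨hW h hh z hz.1, mulVec_mem_hperp (H := H) (fun k hk u hu => ?_) h hh z hz.2⟩)
        ?_ rfl
      · obtain ⟨μ, hμ⟩ := hyH k hk
        rw [Set.mem_singleton_iff] at hu
        rw [hu, hμ]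
        exact Submodule.smul_mem _ _ (Submodule.mem_span_singleton_self y)
      · set c := herm y x / herm y y with hc
        set z := x - c • y with hz
        have hyz : herm y z = 0 := by
          rw [hz, herm_sub_right, herm_smul_right, hc, div_mul_cancel₀ _ hyy0, sub_self]
        refine ⟨z, ⟨W.sub_mem hx (W.smul_mem _ hy), fun u hu => ?_⟩, ?_⟩
        · rw [Set.mem_singleton_iff] at hu
          rw [hu, hyz]
        · have hxz : x = z + c • y := by rw [hz, sub_add_cancel]
          have h1 : herm x x = herm z z + (‖c‖ ^ 2 : ℝ) * herm y y := by
            conv_lhs => rw [hxz]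
            rw [herm_add_left, herm_add_right, herm_add_right, herm_smul_left, herm_smul_left,
              herm_smul_right, herm_smul_right, hyz, herm_comm_zero hyz, Complex.ofReal_pow,
              ← Complex.conj_mul', RCLike.star_def]
            ring
          rw [h1, Complex.add_re, Complex.re_ofReal_mul] at hxx
          have := mul_nonneg (sq_nonneg ‖c‖) (neg_nonneg.mpr hyy.le)
          linarith

/-- A commutative subgroup has a common eigenvector that is not spacelike. -/
lemma IsCommSet.exists_causal_eigenvector (hH : IsCommSet H) :
    ∃ e : Ix n → ℂ, e ≠ 0 ∧ 0 ≤ (herm e e).re ∧ ∀ h ∈ H, ∃ μ : ℂ, mat h *ᵥ e = μ • e := by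
  refine hH.exists_causal_eigenvector_aux ⊤ (fun _ _ _ _ => trivial)
    ⟨Pi.single (Sum.inr ()) 1, trivial, ?_⟩
  rw [herm_single]
  simp [J]

/-- The vectors are found one at a time. The complement of those already chosen and of `e` is
invariant and, by counting dimensions, not contained in `ℂe`. It therefore has a common eigenvector
modulo `ℂe`, which is spacelike because it is orthogonal to `e` and not a multiple of it. A null `e`
leaves room for one vector fewer. -/
lemma IsCommSet.exists_orthonormal (hH : IsCommSet H) {e : Ix n → ℂ} (he : e ≠ 0)
    (hee : 0 ≤ (herm e e).re) (heH : ∀ h ∈ H, ∃ μ : ℂ, mat h *ᵥ e = μ • e) (m : ℕ)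
    (hm : m + 1 ≤ n ∨ (m ≤ n ∧ herm e e ≠ 0)) :
    ∃ v : Fin m → Ix n → ℂ, (∀ i j, herm (v i) (v j) = if i = j then -1 else 0) ∧
      (∀ i, herm e (v i) = 0) ∧
      ∀ h ∈ H, ∀ i, ∃ ν c : ℂ, mat h *ᵥ v i = ν • v i + c • e := by
  induction m with
  | zero => exact ⟨fun i => i.elim0, fun i => i.elim0, fun i => i.elim0, fun _ _ i => i.elim0⟩
  | succ m ih =>
    obtain ⟨v, hv, hev, hvH⟩ := ih (by omega)
    set s : Set (Ix n → ℂ) := insert e (Set.range v) with hs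
    set L : Submodule ℂ (Ix n → ℂ) := Submodule.span ℂ {e} with hLdef
    have heL : L ≤ Submodule.span ℂ s :=
      Submodule.span_mono (Set.singleton_subset_iff.mpr (Set.mem_insert _ _))
    have hs1 : ∀ h ∈ H, ∀ u ∈ s, mat h *ᵥ u ∈ Submodule.span ℂ s := by
      rintro h hh u (rfl | ⟨i, rfl⟩)
      · obtain ⟨μ, hμ⟩ := heH h hh
        rw [hμ]
        exact Submodule.smul_mem _ _ (Submodule.subset_span (Set.mem_insert _ _))
      · obtain ⟨ν, c, hν⟩ := hvH h hh i
        rw [hν]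
        exact Submodule.add_mem _ (Submodule.smul_mem _ _ (Submodule.subset_span
          (Set.mem_insert_of_mem _ ⟨i, rfl⟩))) (Submodule.smul_mem _ _ (Submodule.subset_span
          (Set.mem_insert _ _)))
    have hmem : ∀ x, herm e x = 0 → (∀ i, herm (v i) x = 0) → x ∈ hperp s := by
      rintro x h1 h2 u (rfl | ⟨i, rfl⟩)
      · exact h1
      · exact h2 i
    have hcard : Module.finrank ℂ (Ix n → ℂ) = n + 1 := by simp
    have hnle : ¬ hperp s ≤ L := by
      intro hle
      rcases hm with hm | ⟨hm, hne⟩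
      -- When `e` may be null it may be orthogonal to itself, so vanishing of the last coordinate is
      -- imposed as an extra equation to exclude multiples of `e`; there are then `m + 2 < n + 1`
      -- equations.
      · let φ : (Ix n → ℂ) →ₗ[ℂ] (Fin m → ℂ) × ℂ × ℂ :=
          (LinearMap.pi fun i => hermL (v i)).prod
            ((hermL e).prod (LinearMap.proj (Sum.inr ())))
        have h1 : LinearMap.ker φ ≠ ⊥ := by
          apply LinearMap.ker_ne_bot_of_finrank_lt
          rw [hcard]
          simp
          omega
        obtain ⟨x, hx, hx0⟩ := (Submodule.ne_bot_iff _).mp h1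
        have hx' : φ x = 0 := hx
        have h2 : (fun i => herm (v i) x) = 0 := congrArg Prod.fst hx'
        have h3 : herm e x = 0 := congrArg (fun p => p.2.1) hx'
        have h4 : x (Sum.inr ()) = 0 := congrArg (fun p => p.2.2) hx'
        obtain ⟨c, hc⟩ := Submodule.mem_span_singleton.mp
          (hle (hmem x h3 fun i => congrFun h2 i))
        have h5 : c * e (Sum.inr ()) = 0 := by
          rw [← hc] at h4
          exact h4
        have h6 := (mul_eq_zero.mp h5).resolve_right (last_ne_zero he hee)
        exact hx0 (by rw [← hc, h6, zero_smul])
      · let φ : (Ix n → ℂ) →ₗ[ℂ] (Fin m → ℂ) × ℂ :=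
          (LinearMap.pi fun i => hermL (v i)).prod (hermL e)
        have h1 : LinearMap.ker φ ≠ ⊥ := by
          apply LinearMap.ker_ne_bot_of_finrank_lt
          rw [hcard]
          simp
          omega
        obtain ⟨x, hx, hx0⟩ := (Submodule.ne_bot_iff _).mp h1
        have hx' : φ x = 0 := hx
        have h2 : (fun i => herm (v i) x) = 0 := congrArg Prod.fst hx'
        have h3 : herm e x = 0 := congrArg (fun p => p.2) hx'
        obtain ⟨c, hc⟩ := Submodule.mem_span_singleton.mp
          (hle (hmem x h3 fun i => congrFun h2 i))
        rw [← hc, herm_smul_right] at h3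
        exact hx0 (by rw [← hc, (mul_eq_zero.mp h3).resolve_right hne, zero_smul])
    obtain ⟨x, hx, hxL, hxH⟩ := hH.exists_eigenvector (hperp s) L (mulVec_mem_hperp hs1)
      (fun h hh y hy => by
        obtain ⟨c, rfl⟩ := Submodule.mem_span_singleton.mp hy
        obtain ⟨μ, hμ⟩ := heH h hh
        rw [Matrix.mulVec_smul, hμ]
        exact L.smul_mem _ (L.smul_mem _ (Submodule.mem_span_singleton_self e))) hnle
    have hex : herm e x = 0 := hx e (Set.mem_insert _ _)
    have hvx : ∀ i, herm (v i) x = 0 := fun i => hx _ (Set.mem_insert_of_mem _ ⟨i, rfl⟩)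
    have hxx : (herm x x).re < 0 := by
      refine (herm_self_neg_or_mem he hee hex).resolve_right ?_
      rintro ⟨c, hc⟩
      exact hxL (Submodule.mem_span_singleton.mpr ⟨c, hc.symm⟩)
    obtain ⟨r, hr, hrx⟩ := exists_smul_herm_eq_neg_one hxx
    refine ⟨Fin.snoc v (r • x), fun i j => ?_, fun i => ?_, fun h hh i => ?_⟩
    · refine Fin.lastCases ?_ (fun i => ?_) i <;> refine Fin.lastCases ?_ (fun j => ?_) j
      · simp [hrx]
      · rw [Fin.snoc_last, Fin.snoc_castSucc, herm_smul_left, herm_comm_zero (hvx j), mul_zero,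
          if_neg (Fin.castSucc_lt_last j).ne']
      · rw [Fin.snoc_last, Fin.snoc_castSucc, herm_smul_right, hvx i, mul_zero,
          if_neg (Fin.castSucc_lt_last i).ne]
      · rw [Fin.snoc_castSucc, Fin.snoc_castSucc, hv]
        simp
    · refine Fin.lastCases ?_ (fun i => ?_) i
      · rw [Fin.snoc_last, herm_smul_right, hex, mul_zero]
      · rw [Fin.snoc_castSucc, hev]
    · refine Fin.lastCases ?_ (fun i => ?_) i
      · rw [Fin.snoc_last]
        obtain ⟨ν, hν⟩ := hxH h hh
        obtain ⟨c, hc⟩ := Submodule.mem_span_singleton.mp hν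
        refine ⟨ν, r * c, ?_⟩
        rw [Matrix.mulVec_smul, eq_add_of_sub_eq' hc.symm]
        module
      · rw [Fin.snoc_castSucc]
        exact hvH h hh i

end BallToeplitz

end

noncomputable section

namespace BallToeplitz

variable {n : ℕ} {H : Subgroup (SU n)}

/-! ### Charts from adapted bases -/

/-- The conjugate of the standard group of a model. -/
def stdGroup (M : Model n) (g : SU n) : Subgroup (SU n) where
  carrier := {h | ∃ (ξ : M.X) (a : Circle), mat (g⁻¹ * h * g) = (a : ℂ) • M.core ξ}
  one_mem' := ⟨0, 1, by
    rw [mul_one, inv_mul_cancel, mat_one, M.core_zero, Circle.coe_one, one_smul]⟩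
  mul_mem' := by
    rintro h k ⟨ξ, a, ha⟩ ⟨η, b, hb⟩
    refine ⟨ξ + η, a * b, ?_⟩
    have : g⁻¹ * (h * k) * g = (g⁻¹ * h * g) * (g⁻¹ * k * g) := by group
    rw [this, mat_mul, ha, hb, M.core_add, Matrix.smul_mul, Matrix.mul_smul, smul_smul,
      Circle.coe_mul]
  inv_mem' := by
    rintro h ⟨ξ, a, ha⟩
    refine ⟨-ξ, a⁻¹, ?_⟩
    have h1 : mat (g⁻¹ * h⁻¹ * g) * mat (g⁻¹ * h * g) = 1 := by
      rw [← mat_mul, ← mat_one]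
      congr 1
      group
    have h2 : mat (g⁻¹ * h * g) * (((a⁻¹ : Circle) : ℂ) • M.core (-ξ)) = 1 := by
      rw [ha, Matrix.smul_mul, Matrix.mul_smul, smul_smul, ← Circle.coe_mul, mul_inv_cancel,
        Circle.coe_one, one_smul, ← M.core_add, add_neg_cancel, M.core_zero]
    exact left_inv_eq_right_inv h1 h2

lemma stdGroup_comm (M : Model n) (g : SU n) :
    ∀ h ∈ stdGroup M g, ∀ k ∈ stdGroup M g, h * k = k * h := by
  rintro h ⟨ξ, a, ha⟩ k ⟨η, b, hb⟩
  have h1 : mat (g⁻¹ * h * g) * mat (g⁻¹ * k * g) = mat (g⁻¹ * k * g) * mat (g⁻¹ * h * g) := by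
    rw [ha, hb, Matrix.smul_mul, Matrix.mul_smul, Matrix.smul_mul, Matrix.mul_smul,
      ← M.core_add, ← M.core_add, add_comm, smul_comm]
  rw [← mat_mul, ← mat_mul] at h1
  have h2 : (g⁻¹ * h * g) * (g⁻¹ * k * g) = (g⁻¹ * k * g) * (g⁻¹ * h * g) :=
    Subtype.ext (Subtype.ext h1)
  have h3 : g * ((g⁻¹ * h * g) * (g⁻¹ * k * g)) * g⁻¹ = h * k := by group
  rw [← h3, h2]
  group

/-- The basis gives an element `g` conjugating `H` into the standard group. That group is
commutative, so a maximal abelian `H` fills the whole conjugate. -/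
lemma nonempty_chart_of_basis (hH : IsMaximalAbelian H) (M : Model n) (b : Ix n → Ix n → ℂ)
    (hb : ∀ i j, herm (b i) (b j) = J n i j)
    (hHb : ∀ h ∈ H, ∃ (ξ : M.X) (a : Circle), ∀ j,
      mat h *ᵥ b j = ∑ i, ((a : ℂ) * M.core ξ i j) • b i) : Nonempty (Chart H) := by
  obtain ⟨a₀, g, hg⟩ := exists_mem_SU b hb
  obtain ⟨γ, hγ⟩ := Cover.p_surjective g
  have hle : H ≤ stdGroup M g := by
    intro h hh
    obtain ⟨ξ, a, ha⟩ := hHb h hh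
    refine ⟨ξ, a, ?_⟩
    refine Matrix.ext_of_mulVec_single fun j => ?_
    have h1 : mat (h * g) *ᵥ Pi.single j 1 = mat g *ᵥ (((a : ℂ) • M.core ξ) *ᵥ Pi.single j 1) := by
      have h2 : ((a : ℂ) • M.core ξ) *ᵥ Pi.single j 1 =
          ∑ i, ((a : ℂ) * M.core ξ i j) • Pi.single i (1 : ℂ) := by
        funext i
        simp [Finset.sum_apply, Pi.single_apply]
      rw [h2, Matrix.mulVec_sum, mat_mul, ← Matrix.mulVec_mulVec, hg, Matrix.mulVec_smul, ha,
        Finset.smul_sum]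
      refine Finset.sum_congr rfl fun i _ => ?_
      rw [Matrix.mulVec_smul, hg, smul_comm]
    rw [mul_assoc, mat_mul, ← Matrix.mulVec_mulVec, h1, Matrix.mulVec_mulVec, ← mat_mul,
      inv_mul_cancel, mat_one, Matrix.one_mulVec]
  have hge := hH.2 (stdGroup_comm M g) hle
  exact ⟨⟨M, γ, fun h => by rw [hγ]; exact ⟨fun hh => hle hh, fun hh => hge hh⟩⟩⟩

/-- A version of `nonempty_chart_of_basis` for relabelled coordinates. -/
lemma nonempty_chart_of_reindex (hH : IsMaximalAbelian H) (M : Model n) {ι : Type} [Fintype ι]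
    [DecidableEq ι] (e : ι ≃ Fin n) (A : M.X → Matrix (ι ⊕ Unit) (ι ⊕ Unit) ℂ)
    (hA : ∀ ξ, M.core ξ = Matrix.reindex (e.sumCongr (Equiv.refl Unit))
      (e.sumCongr (Equiv.refl Unit)) (A ξ))
    (b : ι ⊕ Unit → Ix n → ℂ)
    (hb : ∀ i j, herm (b i) (b j) =
      (Matrix.fromBlocks (-1) 0 0 1 : Matrix (ι ⊕ Unit) (ι ⊕ Unit) ℂ) i j)
    (hHb : ∀ h ∈ H, ∃ (ξ : M.X) (a : Circle), ∀ j,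
      mat h *ᵥ b j = ∑ i, ((a : ℂ) * A ξ i j) • b i) : Nonempty (Chart H) := by
  set E := e.sumCongr (Equiv.refl Unit) with hE
  refine nonempty_chart_of_basis hH M (fun i => b (E.symm i)) (fun i j => ?_) fun h hh => ?_
  · obtain ⟨i, rfl⟩ := E.surjective i
    obtain ⟨j, rfl⟩ := E.surjective j
    simp only [Equiv.symm_apply_apply, hb]
    rcases i with i | i <;> rcases j with j | j <;>
      simp [J, E, Matrix.fromBlocks, Matrix.one_apply]
  · obtain ⟨ξ, a, ha⟩ := hHb h hh
    refine ⟨ξ, a, fun j => ?_⟩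
    obtain ⟨j, rfl⟩ := E.surjective j
    rw [← E.sum_comp]
    simp only [Equiv.symm_apply_apply, hA, Matrix.reindex_apply, Matrix.submatrix_apply]
    exact ha j

lemma norm_eq_one_of_eigenvector {h : SU n} {x : Ix n → ℂ} {μ : ℂ} (hμ : mat h *ᵥ x = μ • x)
    (hx : herm x x ≠ 0) : ‖μ‖ = 1 := by
  have h1 := herm_mulVec h x x
  have hx' : (herm x x).re ≠ 0 := by
    intro h0
    rw [herm_self_eq_re, h0] at hx
    exact hx rfl
  have h2 := congrArg Complex.re h1
  rw [hμ, herm_smul_self, mul_eq_right₀ hx'] at h2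
  exact (pow_eq_one_iff_of_nonneg (norm_nonneg _) two_ne_zero).mp h2

lemma eigenvalue_ne_zero {h : SU n} {x : Ix n → ℂ} {μ : ℂ} (hμ : mat h *ᵥ x = μ • x)
    (hx : x ≠ 0) : μ ≠ 0 := by
  rintro rfl
  apply hx
  have h1 : mat h⁻¹ *ᵥ (mat h *ᵥ x) = x := by
    rw [Matrix.mulVec_mulVec, ← mat_mul, inv_mul_cancel, mat_one, Matrix.one_mulVec]
  rw [← h1, hμ, zero_smul, Matrix.mulVec_zero]

lemma exists_circle_mul {μ ν : ℂ} (hμ : ‖μ‖ = 1) (hν : ‖ν‖ = 1) :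
    ∃ t : UnitAddCircle, μ * (t.toCircle : ℂ) = ν := by
  have hμ0 : μ ≠ 0 := norm_ne_zero_iff.mp (by rw [hμ]; exact one_ne_zero)
  obtain ⟨t, ht⟩ := exists_toCircle (z := ν / μ) (r := 1) (by rw [norm_div, hμ, hν, div_one])
  refine ⟨t, ?_⟩
  rw [Complex.ofReal_one, mul_one] at ht
  rw [← ht, mul_div_cancel₀ _ hμ0]

lemma exists_smul_herm_eq_one {x : Ix n → ℂ} (hx : 0 < (herm x x).re) :
    ∃ r : ℂ, r ≠ 0 ∧ herm (r • x) (r • x) = 1 := by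
  set s := Real.sqrt (herm x x).re with hs
  have hs0 : 0 < s := Real.sqrt_pos.mpr hx
  have hs2 : s ^ 2 = (herm x x).re := Real.sq_sqrt hx.le
  refine ⟨((s⁻¹ : ℝ) : ℂ), by exact_mod_cast (inv_pos.mpr hs0).ne', ?_⟩
  rw [herm_self_eq_re, herm_smul_self, Complex.norm_real, Real.norm_of_nonneg (by positivity),
    inv_pow, hs2, inv_mul_cancel₀ hx.ne']
  simp

/-- A common timelike eigenvector: the elliptic case. -/
lemma nonempty_chart_of_timelike (hH : IsMaximalAbelian H) {e : Ix n → ℂ}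
    (hee : 0 < (herm e e).re) (heH : ∀ h ∈ H, ∃ μ : ℂ, mat h *ᵥ e = μ • e) :
    Nonempty (Chart H) := by
  obtain ⟨r, hr, hr1⟩ := exists_smul_herm_eq_one hee
  have he0 : e ≠ 0 := by
    rintro rfl
    rw [herm_zero_right] at hee
    exact lt_irrefl _ hee
  have hne : herm e e ≠ 0 := by
    intro h
    rw [h] at hee
    exact lt_irrefl _ hee
  obtain ⟨v, hv, hev, hvH⟩ := IsCommSet.exists_orthonormal (H := H) hH.1 he0 hee.le heH n
    (Or.inr ⟨le_rfl, hne⟩)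
  refine nonempty_chart_of_basis hH Model.elliptic (Sum.elim v fun _ => r • e) (fun i j => ?_)
    fun h hh => ?_
  · rcases i with i | i <;> rcases j with j | j
    · rw [Sum.elim_inl, Sum.elim_inl, hv]
      simp [J, Matrix.one_apply, apply_ite]
    · simp [J, herm_smul_right, herm_comm_zero (hev i)]
    · simp [J, herm_smul_left, hev]
    · simp [J, hr1]
  · obtain ⟨μ, hμ⟩ := heH h hh
    have hμ1 := norm_eq_one_of_eigenvector hμ hne
    have hvH' : ∀ i, ∃ ν : ℂ, mat h *ᵥ v i = ν • v i := by
      intro i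
      obtain ⟨ν, c, hν⟩ := hvH h hh i
      refine ⟨ν, ?_⟩
      -- The image of `v i` stays orthogonal to `e`, and `e` is not null, so its `e`-component is
      -- zero.
      have h1 : herm (mat h *ᵥ e) (mat h *ᵥ v i) = 0 := by rw [herm_mulVec, hev]
      rw [hμ, hν, herm_smul_left, herm_add_right, herm_smul_right, herm_smul_right, hev, mul_zero,
        zero_add] at h1
      have h2 := (mul_eq_zero.mp h1).resolve_left
        (star_ne_zero.mpr (eigenvalue_ne_zero hμ he0))
      rw [hν, (mul_eq_zero.mp h2).resolve_right hne, zero_smul, add_zero]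
    choose ν hν using hvH'
    have hν1 : ∀ i, ‖ν i‖ = 1 := fun i => norm_eq_one_of_eigenvector (hν i) (by simp [hv])
    choose t ht using fun i => exists_circle_mul hμ1 (hν1 i)
    refine ⟨(t, (0 : EuclideanSpace ℝ (Fin 0))), ⟨μ, mem_sphere_zero_iff_norm.mpr hμ1⟩, fun j => ?_⟩
    rcases j with j | j
    · rw [Sum.elim_inl, hν, ← ht]
      simp [Model.core, Fintype.sum_sum_type, Matrix.diagonal_apply]
    · rw [Sum.elim_inr, Matrix.mulVec_smul, hμ]
      simpa [Model.core, Fintype.sum_sum_type] using smul_comm r μ e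

/-- Correction of a generalised eigenvector. -/
lemma exists_add_smul_eigenvector (hH : IsCommSet H) {e x : Ix n → ℂ} (he : e ≠ 0) {μ ν c : SU n → ℂ}
    (hμ : ∀ h ∈ H, mat h *ᵥ e = μ h • e) (hx : ∀ h ∈ H, mat h *ᵥ x = ν h • x + c h • e) {k : SU n}
    (hk : k ∈ H) (hne : ν k ≠ μ k) :
    ∃ d : ℂ, ∀ h ∈ H, mat h *ᵥ (x + d • e) = ν h • (x + d • e) := by
  have hne' : ν k - μ k ≠ 0 := sub_ne_zero.mpr hne
  -- This `d` turns `x + d • e` into an eigenvector of `k`. For any other `h` the remaining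
  -- `e`-component is killed by comparing `k h` with `h k`, as `ν k ≠ μ k`.
  set d := c k / (ν k - μ k) with hd
  have hdk : d * (ν k - μ k) = c k := div_mul_cancel₀ _ hne'
  refine ⟨d, fun h hh => ?_⟩
  set y := x + d • e with hy
  have hgen : ∀ h ∈ H, mat h *ᵥ y = ν h • y + (c h - d * (ν h - μ h)) • e := by
    intro h hh
    rw [hy, Matrix.mulVec_add, Matrix.mulVec_smul, hx h hh, hμ h hh]
    module
  have hk1 : mat k *ᵥ y = ν k • y := by
    rw [hgen k hk, hdk, sub_self, zero_smul, add_zero]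
  have h1 : mat k *ᵥ (mat h *ᵥ y) = mat h *ᵥ (mat k *ᵥ y) := by
    rw [Matrix.mulVec_mulVec, Matrix.mulVec_mulVec, ← mat_mul, ← mat_mul, hH k hk h hh]
  have hyh := hgen h hh
  clear_value y
  set c' := c h - d * (ν h - μ h) with hc'
  rw [hk1, Matrix.mulVec_smul, hyh, Matrix.mulVec_add, Matrix.mulVec_smul,
    Matrix.mulVec_smul, hk1, hμ k hk, smul_add, smul_comm (ν k), add_right_inj, smul_smul,
    smul_smul, ← sub_eq_zero, ← sub_smul, smul_eq_zero] at h1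
  have h2 := h1.resolve_right he
  have h3 : c' * (ν k - μ k) = 0 := by linear_combination -h2
  rw [hyh, (mul_eq_zero.mp h3).resolve_right hne', zero_smul, add_zero]

/-- An orthonormal family of spacelike vectors together with a hyperbolic pair. -/
structure IsWitt {κ : Type} [DecidableEq κ] (v : κ → Ix n → ℂ) (e f : Ix n → ℂ) : Prop where
  vv : ∀ i j, herm (v i) (v j) = if i = j then -1 else 0
  ev : ∀ i, herm e (v i) = 0
  fv : ∀ i, herm f (v i) = 0
  ee : herm e e = 0
  ff : herm f f = 0
  ef : herm e f = -2

namespace IsWitt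

variable {κ : Type} [DecidableEq κ] {v : κ → Ix n → ℂ} {e f : Ix n → ℂ}

lemma fe (w : IsWitt v e f) : herm f e = -2 := by
  rw [← herm_star, w.ef]
  simp

lemma ve (w : IsWitt v e f) (i : κ) : herm (v i) e = 0 := herm_comm_zero (w.ev i)

lemma vf (w : IsWitt v e f) (i : κ) : herm (v i) f = 0 := herm_comm_zero (w.fv i)

lemma ne_zero (w : IsWitt v e f) : e ≠ 0 := by
  rintro rfl
  have := w.ef
  rw [herm_zero_left] at this
  norm_num at this

/-- The orthonormal basis attached to a Witt basis. -/
def basis (v : κ → Ix n → ℂ) (e f : Ix n → ℂ) : (κ ⊕ Unit) ⊕ Unit → Ix n → ℂ :=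
  Sum.elim (Sum.elim v fun _ => (1 / 2 : ℂ) • (e + f)) fun _ => (1 / 2 : ℂ) • (f - e)

lemma herm_basis (w : IsWitt v e f) (i j : (κ ⊕ Unit) ⊕ Unit) :
    herm (basis v e f i) (basis v e f j) =
      (Matrix.fromBlocks (-1) 0 0 1 : Matrix ((κ ⊕ Unit) ⊕ Unit) ((κ ⊕ Unit) ⊕ Unit) ℂ) i j := by
  have hs : ∀ u v w : Ix n → ℂ, herm (u - v) w = herm u w - herm v w := by
    intro u v w
    rw [sub_eq_add_neg, ← neg_one_smul ℂ v, herm_add_left, herm_smul_left]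
    simp
    ring
  rcases i with (i | i) | i <;> rcases j with (j | j) | j <;>
    simp [basis, herm_smul_left, herm_smul_right, herm_add_left, herm_add_right, herm_sub_right, hs,
      w.vv, w.ev, w.fv, w.ee, w.ff, w.ef, w.fe, w.ve, w.vf, Matrix.one_apply, apply_ite]
  all_goals norm_num

lemma expand [Fintype κ] (w : IsWitt v e f) (E : κ ⊕ Unit ≃ Fin n) (x : Ix n → ℂ) :
    x = -(∑ i, herm (v i) x • v i) - (herm f x / 2) • e - (herm e x / 2) • f := by
  set E' := E.sumCongr (Equiv.refl Unit) with hE'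
  have h1 := eq_sum_herm (fun i => basis v e f (E'.symm i)) (fun i j => by
    obtain ⟨i, rfl⟩ := E'.surjective i
    obtain ⟨j, rfl⟩ := E'.surjective j
    simp only [Equiv.symm_apply_apply, w.herm_basis]
    rcases i with i | i <;> rcases j with j | j <;>
      simp [J, E', Matrix.fromBlocks, Matrix.one_apply]) x
  have hs : herm (f - e) x = herm f x - herm e x := by
    rw [sub_eq_add_neg, ← neg_one_smul ℂ e, herm_add_left, herm_smul_left]
    simp
    ring
  rw [← E.sum_comp, Fintype.sum_sum_type] at h1
  have h2 : ∀ i, E'.symm (Sum.inl (E i)) = Sum.inl i := fun i => by simp [E']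
  have h3 : E'.symm (Sum.inr ()) = Sum.inr () := by simp [E']
  simp only [h2, h3, basis, Sum.elim_inl, Sum.elim_inr, Finset.univ_unique,
    Finset.sum_singleton, herm_smul_left, herm_add_left, hs] at h1
  conv_lhs => rw [h1]
  have h4 : star (1 / 2 : ℂ) = 1 / 2 := by simp
  rw [h4]
  module

/-- A vector not orthogonal to `e` is made orthogonal to the `v i`; the sign is a plus because these
have length `-1`. It is then scaled and corrected by a multiple of `e`. The value `-2` makes `(e +
f)/2` and `(f - e)/2` have lengths `-1` and `1`. -/
lemma exists_of_null [Fintype κ] (hvv : ∀ i j, herm (v i) (v j) = if i = j then -1 else 0)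
    (hev : ∀ i, herm e (v i) = 0) (he : e ≠ 0) (hee : herm e e = 0) : ∃ f, IsWitt v e f := by
  have he0 := last_ne_zero he (by rw [hee]; exact le_rfl)
  set y : Ix n → ℂ := Pi.single (Sum.inr ()) 1 with hy
  have hey : herm e y = star (e (Sum.inr ())) := by
    rw [hy, herm_eq]
    simp
  have hey0 : herm e y ≠ 0 := by rw [hey]; exact star_ne_zero.mpr he0
  set z := y + ∑ i, herm (v i) y • v i with hz
  have hez : herm e z = herm e y := by
    rw [hz, herm_add_right, herm_sum_right]
    simp [herm_smul_right, hev]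
  have hvz : ∀ i, herm (v i) z = 0 := by
    intro i
    rw [hz, herm_add_right, herm_sum_right]
    simp [herm_smul_right, hvv]
  set f₀ := (-2 / herm e y) • z with hf₀
  have hef₀ : herm e f₀ = -2 := by
    rw [hf₀, herm_smul_right, hez, div_mul_cancel₀ _ hey0]
  have hvf₀ : ∀ i, herm (v i) f₀ = 0 := fun i => by rw [hf₀, herm_smul_right, hvz, mul_zero]
  have hf₀e : herm f₀ e = -2 := by
    rw [← herm_star, hef₀]
    simp
  set s := (herm f₀ f₀).re with hs
  have hff : herm f₀ f₀ = s := herm_self_eq_re f₀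
  clear_value s f₀
  -- Adding `a • e` with real `a` changes the length `s` into `s - 4a`.
  refine ⟨f₀ + ((s / 4 : ℝ) : ℂ) • e, hvv, hev, fun i => herm_comm_zero ?_, hee, ?_, ?_⟩
  · rw [herm_add_right, herm_smul_right, hvf₀, herm_comm_zero (hev i), mul_zero, add_zero]
  · rw [herm_add_left, herm_add_right, herm_add_right, herm_smul_left, herm_smul_left,
      herm_smul_right, herm_smul_right, hff, hef₀, hf₀e, hee, RCLike.star_def, Complex.conj_ofReal]
    push_cast
    ring
  · rw [herm_add_right, herm_smul_right, hee, hef₀, mul_zero, add_zero]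

end IsWitt

/-- Vectors with real scalar products have real coordinates in some orthonormal basis. -/
lemma exists_orthonormal_real {l : ℕ} {T : Type*} (c : T → EuclideanSpace ℂ (Fin l))
    (hc : ∀ g h, inner ℂ (c g) (c h) = inner ℂ (c h) (c g)) (r : ℕ) (hr : r ≤ l) :
    ∃ w : Fin r → EuclideanSpace ℂ (Fin l), Orthonormal ℂ w ∧
      ∀ i h, star (inner ℂ (w i) (c h)) = inner ℂ (w i) (c h) := by
  induction r with
  | zero => exact ⟨fun i => i.elim0, ⟨fun i => i.elim0, fun i => i.elim0⟩, fun i => i.elim0⟩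
  | succ r ih =>
    obtain ⟨w, hw, hwc⟩ := ih (by omega)
    have hww := orthonormal_iff_ite.mp hw
    suffices h : ∃ u : EuclideanSpace ℂ (Fin l), ‖u‖ = 1 ∧ (∀ i, inner ℂ (w i) u = 0) ∧
        ∀ h, star (inner ℂ u (c h)) = inner ℂ u (c h) by
      obtain ⟨u, hu, hwu, huc⟩ := h
      refine ⟨Fin.snoc w u, orthonormal_iff_ite.mpr fun i j => ?_, fun i h => ?_⟩
      · refine Fin.lastCases ?_ (fun i => ?_) i <;> refine Fin.lastCases ?_ (fun j => ?_) j
        · simp [inner_self_eq_norm_sq_to_K, hu]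
        · rw [Fin.snoc_last, Fin.snoc_castSucc, inner_eq_zero_symm.mp (hwu j),
            if_neg (Fin.castSucc_lt_last j).ne']
        · rw [Fin.snoc_last, Fin.snoc_castSucc, hwu, if_neg (Fin.castSucc_lt_last i).ne]
        · rw [Fin.snoc_castSucc, Fin.snoc_castSucc, hww]
          simp
      · refine Fin.lastCases ?_ (fun i => ?_) i
        · rw [Fin.snoc_last, huc]
        · rw [Fin.snoc_castSucc, hwc]
    -- Gram–Schmidt remainders. If one is nonzero, its normalisation works: the products of the `c
    -- h` are real by symmetry and those with the `w i` are real by induction. If all vanish, any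
    -- unit vector orthogonal to the `w i` is orthogonal to every `c h`.
    set p : T → EuclideanSpace ℂ (Fin l) := fun h => c h - ∑ i, inner ℂ (w i) (c h) • w i with hp
    have hwp : ∀ i h, inner ℂ (w i) (p h) = 0 := by
      intro i h
      rw [hp, inner_sub_right, inner_sum]
      simp [inner_smul_right, hww]
    by_cases hall : ∀ h, p h = 0
    · let φ : EuclideanSpace ℂ (Fin l) →ₗ[ℂ] (Fin r → ℂ) :=
        LinearMap.pi fun i => (innerSL ℂ (w i) : EuclideanSpace ℂ (Fin l) →ₗ[ℂ] ℂ)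
      have h1 : LinearMap.ker φ ≠ ⊥ := by
        apply LinearMap.ker_ne_bot_of_finrank_lt
        simp
        omega
      obtain ⟨x, hx, hx0⟩ := (Submodule.ne_bot_iff _).mp h1
      have hx' : ∀ i, inner ℂ (w i) x = 0 := fun i => congrFun (show φ x = 0 from hx) i
      refine ⟨((‖x‖⁻¹ : ℝ) : ℂ) • x, ?_, fun i => ?_, fun h => ?_⟩
      · rw [norm_smul, Complex.norm_real, norm_inv, norm_norm,
          inv_mul_cancel₀ (norm_ne_zero_iff.mpr hx0)]
      · rw [inner_smul_right, hx', mul_zero]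
      · have h2 : inner ℂ x (c h) = 0 := by
          have h3 : c h = ∑ i, inner ℂ (w i) (c h) • w i := sub_eq_zero.mp (hall h)
          rw [h3, inner_sum]
          refine Finset.sum_eq_zero fun i _ => ?_
          rw [inner_smul_right, inner_eq_zero_symm.mp (hx' i), mul_zero]
        rw [inner_smul_left, h2, mul_zero, star_zero]
    · push Not at hall
      obtain ⟨g, hg⟩ := hall
      refine ⟨((‖p g‖⁻¹ : ℝ) : ℂ) • p g, ?_, fun i => ?_, fun h => ?_⟩
      · rw [norm_smul, Complex.norm_real, norm_inv, norm_norm,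
          inv_mul_cancel₀ (norm_ne_zero_iff.mpr hg)]
      · rw [inner_smul_right, hwp, mul_zero]
      · have h2 : inner ℂ (p g) (c h) = inner ℂ (c g) (c h) -
            ∑ i, inner ℂ (w i) (c g) * inner ℂ (w i) (c h) := by
          rw [hp, inner_sub_left, sum_inner]
          congr 1
          refine Finset.sum_congr rfl fun i _ => ?_
          rw [inner_smul_left, ← RCLike.star_def, hwc]
        have h3 : star (inner ℂ (c g) (c h)) = inner ℂ (c g) (c h) := by
          rw [RCLike.star_def, inner_conj_symm, hc]
        rw [inner_smul_left, Complex.conj_ofReal, star_mul', h2, star_sub, h3, star_sum]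
        simp only [star_mul', hwc]
        congr 1
        simp

end BallToeplitz

end

/-! ### The hyperbolic and nilpotent models from Witt bases -/

noncomputable section

namespace BallToeplitz

variable {n : ℕ} {H : Subgroup (SU n)}

lemma half_smul_mulVec_add {h : SU n} {e f e' f' : Ix n → ℂ} (he : mat h *ᵥ e = e')
    (hf : mat h *ᵥ f = f') :
    mat h *ᵥ ((1 / 2 : ℂ) • (e + f)) = (1 / 2 : ℂ) • (e' + f') ∧
      mat h *ᵥ ((1 / 2 : ℂ) • (f - e)) = (1 / 2 : ℂ) • (f' - e') := by
  rw [Matrix.mulVec_smul, Matrix.mulVec_smul, Matrix.mulVec_add, Matrix.mulVec_sub, he, hf]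
  exact ⟨rfl, rfl⟩

/-- A common Witt basis of eigenvectors: the hyperbolic case. -/
lemma IsWitt.nonempty_chart_hyperbolic (hH : IsMaximalAbelian H) {k : ℕ} (E : Fin k ⊕ Unit ≃ Fin n)
    {v : Fin k → Ix n → ℂ} {e f : Ix n → ℂ} (w : IsWitt v e f)
    (hv : ∀ h ∈ H, ∀ i, ∃ ν : ℂ, mat h *ᵥ v i = ν • v i)
    (he : ∀ h ∈ H, ∃ μ : ℂ, mat h *ᵥ e = μ • e) (hf : ∀ h ∈ H, ∃ μ : ℂ, mat h *ᵥ f = μ • f) :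
    Nonempty (Chart H) := by
  refine nonempty_chart_of_reindex hH (Model.hyperbolic k E) E
    (fun ξ => Model.hypCore (fun i => ((ξ.1 i).toCircle : ℂ)) (ξ.2 (0 : Fin 1))) (fun ξ => rfl)
    (basis v e f) w.herm_basis fun h hh => ?_
  obtain ⟨μ, hμ⟩ := he h hh
  obtain ⟨μ', hμ'⟩ := hf h hh
  choose ν hν using hv h hh
  have hν1 : ∀ i, ‖ν i‖ = 1 := fun i => norm_eq_one_of_eigenvector (hν i) (by simp [w.vv])
  have hμ0 : μ ≠ 0 := eigenvalue_ne_zero hμ w.ne_zero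
  have hn0 : 0 < ‖μ‖ := norm_pos_iff.mpr hμ0
  have hprod : star μ * μ' = 1 := by
    have h1 := herm_mulVec h e f
    rw [hμ, hμ', herm_smul_left, herm_smul_right, w.ef] at h1
    linear_combination (-1 / 2 : ℂ) * h1
  have hnc : (‖μ‖ : ℂ) ≠ 0 := by exact_mod_cast hn0.ne'
  set a := μ / ‖μ‖ with ha
  have ha1 : ‖a‖ = 1 := by
    rw [ha, norm_div, Complex.norm_real, norm_norm, div_self hn0.ne']
  -- In the model, `e` and `f` are the eigenvectors of the boost with eigenvalues `e^(-s)` and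
  -- `e^s`. Invariance of `⟨e, f⟩` gives `μ' = 1 / conj μ`, so the two eigenvalues have the common
  -- phase `a`.
  set s := -Real.log ‖μ‖ with hs
  have hμa : μ = a * Complex.exp (-s) := by
    rw [hs, Complex.ofReal_neg, neg_neg, ← Complex.ofReal_exp, Real.exp_log hn0, ha,
      div_mul_cancel₀ _ hnc]
  have hμ'a : μ' = a * Complex.exp s := by
    rw [hs, ← Complex.ofReal_exp, Real.exp_neg, Real.exp_log hn0, ha]
    have h2 : star μ * μ = ((‖μ‖ : ℂ)) ^ 2 := by rw [RCLike.star_def, Complex.conj_mul']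
    have h3 : star μ ≠ 0 := star_ne_zero.mpr hμ0
    apply mul_left_cancel₀ h3
    rw [hprod]
    push_cast
    field_simp
    exact h2.symm
  choose t ht using fun i => exists_circle_mul ha1 (hν1 i)
  refine ⟨(t, (WithLp.toLp 2 fun _ => s : EuclideanSpace ℝ (Fin 1))),
    ⟨a, mem_sphere_zero_iff_norm.mpr ha1⟩, fun j => ?_⟩
  obtain ⟨h1, h2⟩ := half_smul_mulVec_add hμ hμ'
  have h3 : Complex.exp (-s) = Complex.cosh s - Complex.sinh s := by
    rw [Complex.cosh_sub_sinh]
  have h4 : Complex.exp s = Complex.cosh s + Complex.sinh s := by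
    rw [Complex.cosh_add_sinh]
  rcases j with (j | j) | j
  · simp only [basis, Sum.elim_inl, hν, ← ht]
    simp [Fintype.sum_sum_type, Model.hypCore]
  · simp only [basis, Sum.elim_inl, Sum.elim_inr, h1]
    simp only [Fintype.sum_sum_type, Model.hypCore, Sum.elim_inl, Sum.elim_inr,
      Finset.univ_unique, Finset.sum_singleton, mul_zero, zero_smul, Finset.sum_const_zero, zero_add]
    rw [hμa, hμ'a, h3, h4]
    module
  · simp only [basis, Sum.elim_inr, h2]
    simp only [Fintype.sum_sum_type, Model.hypCore, Sum.elim_inl, Sum.elim_inr,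
      Finset.univ_unique, Finset.sum_singleton, mul_zero, zero_smul, Finset.sum_const_zero, zero_add]
    rw [hμa, hμ'a, h3, h4]
    module

section Nilpotent

variable {k l : ℕ} {v : Fin k → Ix n → ℂ} {u : Fin l → Ix n → ℂ} {e f : Ix n → ℂ}

/-- The action on the second vector of the hyperbolic pair. -/
lemma IsWitt.mulVec_f (w : IsWitt (Sum.elim v u) e f) (E : (Fin k ⊕ Fin l) ⊕ Unit ≃ Fin n)
    {h : SU n} {μ : ℂ} (hμ : mat h *ᵥ e = μ • e) (hμ1 : ‖μ‖ = 1)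
    (hv : ∀ i, ∃ ν : ℂ, mat h *ᵥ v i = ν • v i) {c : Fin l → ℂ}
    (hu : ∀ j, mat h *ᵥ u j = μ • (u j + c j • e)) :
    ∃ q : ℂ, mat h *ᵥ f = μ • (f - ∑ j, (2 * star (c j)) • u j - (2 * q) • e) ∧
      q.re = (∑ j, ‖c j‖ ^ 2) / 2 := by
  have hμμ : star μ * μ = 1 := by
    rw [RCLike.star_def, Complex.conj_mul', hμ1]
    simp
  have hμ0 : star μ ≠ 0 := left_ne_zero_of_mul_eq_one hμμ
  have h1 : herm e (mat h *ᵥ f) = -2 * μ := by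
    have h2 := herm_mulVec h e f
    rw [hμ, herm_smul_left, w.ef] at h2
    linear_combination μ * h2 - (herm e (mat h *ᵥ f)) * hμμ
  have h2 : ∀ i, herm (v i) (mat h *ᵥ f) = 0 := by
    intro i
    obtain ⟨ν, hν⟩ := hv i
    have h3 := herm_mulVec h (v i) f
    have hne : v i ≠ 0 := by
      intro h0
      have h5 := w.vv (Sum.inl i) (Sum.inl i)
      rw [Sum.elim_inl, h0, herm_zero_left, if_pos rfl] at h5
      norm_num at h5
    have hf0 : herm (v i) f = 0 := w.vf (Sum.inl i)
    rw [hν, herm_smul_left, hf0] at h3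
    exact (mul_eq_zero.mp h3).resolve_left (star_ne_zero.mpr (eigenvalue_ne_zero hν hne))
  have h3 : ∀ j, herm (u j) (mat h *ᵥ f) = 2 * star (c j) * μ := by
    intro j
    have h4 := herm_mulVec h (u j) f
    have hf0 : herm (u j) f = 0 := w.vf (Sum.inr j)
    rw [hu, herm_smul_left, herm_add_left, herm_smul_left, hf0, h1] at h4
    have h5 := (mul_eq_zero.mp h4).resolve_left hμ0
    linear_combination h5
  -- Normalised so that the coefficient of `e` in the image of `f` is `-2μq`; this `q` is the entry
  -- of the same name in the nilpotent matrices.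
  set q := star μ * herm f (mat h *ᵥ f) / 4 with hq
  have hqf : herm f (mat h *ᵥ f) = 4 * μ * q := by
    rw [hq]
    linear_combination -(herm f (mat h *ᵥ f)) * hμμ
  clear_value q
  have hX : mat h *ᵥ f = μ • (f - ∑ j, (2 * star (c j)) • u j - (2 * q) • e) := by
    have h4 := w.expand E (mat h *ᵥ f)
    rw [Fintype.sum_sum_type] at h4
    simp only [Sum.elim_inl, Sum.elim_inr, h2, h3, zero_smul, Finset.sum_const_zero, zero_add, h1,
      hqf] at h4
    rw [h4, smul_sub, smul_sub, Finset.smul_sum]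
    simp only [smul_smul]
    have h5 : ∀ j, 2 * star (c j) * μ = μ * (2 * star (c j)) := fun j => by ring
    simp only [h5]
    module
  refine ⟨q, hX, ?_⟩
  -- The image of `f` is null again, and this determines `q + conj q`.
  have h6 := herm_mulVec h f f
  rw [w.ff] at h6
  have h7 : herm (mat h *ᵥ f) (mat h *ᵥ f) = star μ * (herm f (mat h *ᵥ f) -
      ∑ j, 2 * c j * herm (u j) (mat h *ᵥ f) - 2 * star q * herm e (mat h *ᵥ f)) := by
    have hs : ∀ x y z : Ix n → ℂ, herm (x - y) z = herm x z - herm y z := by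
      intro x y z
      rw [sub_eq_add_neg, ← neg_one_smul ℂ y, herm_add_left, herm_smul_left]
      simp
      ring
    have h8 : herm (mat h *ᵥ f) (mat h *ᵥ f) =
        herm (μ • (f - ∑ j, (2 * star (c j)) • u j - (2 * q) • e)) (mat h *ᵥ f) := by
      conv_lhs => rw [hX]
      rw [← hX]
    rw [h8, herm_smul_left, hs, hs, herm_sum_left]
    simp [herm_smul_left]
  rw [h6] at h7
  simp only [h1, h3, hqf] at h7
  have h9 : ∑ j, 2 * c j * (2 * star (c j) * μ) = 4 * μ * ((∑ j, ‖c j‖ ^ 2 : ℝ) : ℂ) := by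
    push_cast
    rw [Finset.mul_sum]
    refine Finset.sum_congr rfl fun j _ => ?_
    rw [← Complex.mul_conj', RCLike.star_def]
    ring
  rw [h9] at h7
  have h10 : q + star q = ((∑ j, ‖c j‖ ^ 2 : ℝ) : ℂ) := by
    linear_combination (-1 / 4 : ℂ) * h7 -
      (q + star q - ((∑ j, ‖c j‖ ^ 2 : ℝ) : ℂ)) * hμμ
  have h11 := congrArg Complex.re h10
  rw [Complex.add_re, RCLike.star_def, Complex.conj_re, Complex.ofReal_re] at h11
  linarith

/-- Commuting elements have translation vectors with real scalar products. -/
lemma IsWitt.sum_star_mul_comm (w : IsWitt (Sum.elim v u) e f)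
    (E : (Fin k ⊕ Fin l) ⊕ Unit ≃ Fin n) {g h : SU n} (hgh : g * h = h * g) {μ μ' : ℂ}
    (hμ : mat g *ᵥ e = μ • e) (hμ1 : ‖μ‖ = 1) (hμ' : mat h *ᵥ e = μ' • e) (hμ'1 : ‖μ'‖ = 1)
    (hv : ∀ i, ∃ ν : ℂ, mat g *ᵥ v i = ν • v i) (hv' : ∀ i, ∃ ν : ℂ, mat h *ᵥ v i = ν • v i)
    {c c' : Fin l → ℂ} (hu : ∀ j, mat g *ᵥ u j = μ • (u j + c j • e))
    (hu' : ∀ j, mat h *ᵥ u j = μ' • (u j + c' j • e)) :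
    ∑ j, star (c j) * c' j = ∑ j, star (c' j) * c j := by
  have hfu : ∀ j, herm f (u j) = 0 := fun j => w.fv (Sum.inr j)
  -- The coefficient of `e` in `h g f` contains the products of the translation vectors of `g` and
  -- `h` besides terms symmetric in the two. Equality of `h g f` and `g h f` thus makes the products
  -- symmetric.
  have key : ∀ {g h : SU n} {μ μ' : ℂ} {c c' : Fin l → ℂ} {q q' : ℂ},
      mat h *ᵥ e = μ' • e → (∀ j, mat h *ᵥ u j = μ' • (u j + c' j • e)) →
      mat g *ᵥ f = μ • (f - ∑ j, (2 * star (c j)) • u j - (2 * q) • e) →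
      mat h *ᵥ f = μ' • (f - ∑ j, (2 * star (c' j)) • u j - (2 * q') • e) →
      herm f (mat h *ᵥ (mat g *ᵥ f)) =
        4 * μ * μ' * (q + q' + ∑ j, star (c j) * c' j) := by
    intro g h μ μ' c c' q q' he hu hg hh
    have h1 : herm f (mat h *ᵥ f) = 4 * μ' * q' := by
      rw [hh, herm_smul_right, herm_sub_right, herm_sub_right, herm_sum_right, w.ff]
      simp only [herm_smul_right, hfu, w.fe, mul_zero, Finset.sum_const_zero]
      ring
    rw [hg, Matrix.mulVec_smul, Matrix.mulVec_sub, Matrix.mulVec_sub, Matrix.mulVec_sum,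
      herm_smul_right, herm_sub_right, herm_sub_right, herm_sum_right, h1]
    simp only [Matrix.mulVec_smul, hu, he, herm_smul_right, herm_add_right, hfu, w.fe, zero_add]
    have h2 : ∑ j, 2 * star (c j) * (μ' * (c' j * -2)) =
        -4 * μ' * ∑ j, star (c j) * c' j := by
      rw [Finset.mul_sum]
      exact Finset.sum_congr rfl fun j _ => by ring
    rw [h2]
    ring
  obtain ⟨q, hq, -⟩ := w.mulVec_f E hμ hμ1 hv hu
  obtain ⟨q', hq', -⟩ := w.mulVec_f E hμ' hμ'1 hv' hu'
  have h1 := key hμ' hu' hq hq'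
  have h2 := key hμ hu hq' hq
  have h3 : mat h *ᵥ (mat g *ᵥ f) = mat g *ᵥ (mat h *ᵥ f) := by
    rw [Matrix.mulVec_mulVec, Matrix.mulVec_mulVec, ← mat_mul, ← mat_mul, hgh]
  rw [h3, h2] at h1
  have hμ0 : μ ≠ 0 := norm_ne_zero_iff.mp (by rw [hμ1]; exact one_ne_zero)
  have hμ'0 : μ' ≠ 0 := norm_ne_zero_iff.mp (by rw [hμ'1]; exact one_ne_zero)
  have h4 : 4 * μ * μ' ≠ 0 := mul_ne_zero (mul_ne_zero (by norm_num : (4 : ℂ) ≠ 0) hμ0) hμ'0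
  apply mul_left_cancel₀ h4
  linear_combination -h1

/-- A Witt basis with real translations: the nilpotent cases. -/
lemma IsWitt.nonempty_chart_nilpotent (hH : IsMaximalAbelian H) (w : IsWitt (Sum.elim v u) e f)
    (E : (Fin k ⊕ Fin l) ⊕ Unit ≃ Fin n)
    (hHw : ∀ h ∈ H, ∃ μ : ℂ, ‖μ‖ = 1 ∧ mat h *ᵥ e = μ • e ∧
      (∀ i, ∃ ν : ℂ, mat h *ᵥ v i = ν • v i) ∧
      ∃ b : Fin l → ℝ, ∀ j, mat h *ᵥ u j = μ • (u j + (-Complex.I * b j) • e)) :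
    Nonempty (Chart H) := by
  set α : (Fin k ⊕ Fin l ⊕ Unit) ≃ (Fin k ⊕ Fin l) ⊕ Unit :=
    (Equiv.sumAssoc (Fin k) (Fin l) Unit).symm with hα
  set β : Fin k ⊕ Fin l ⊕ Unit → Ix n → ℂ :=
    Sum.elim v (Sum.elim u fun _ => (1 / 2 : ℂ) • (e + f)) with hβ
  set b₀ : (Fin k ⊕ Fin l ⊕ Unit) ⊕ Unit → Ix n → ℂ :=
    Sum.elim β fun _ => (1 / 2 : ℂ) • (f - e) with hb₀
  refine nonempty_chart_of_reindex hH (Model.nilpotent k l (α.trans E)) (α.trans E)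
    (fun ξ => Model.nilCore (fun i => ((ξ.1 i).toCircle : ℂ)) (fun i : Fin l => ξ.2 i.castSucc)
      (ξ.2 (Fin.last l))) (fun ξ => rfl) b₀ (fun i j => ?_) fun h hh => ?_
  · have h1 : ∀ i, b₀ i = basis (Sum.elim v u) e f (α.sumCongr (Equiv.refl Unit) i) := by
      rintro ((i | i | i) | i) <;> rfl
    rw [h1, h1, w.herm_basis]
    rcases i with (i | i | i) | i <;> rcases j with (j | j | j) | j <;>
      simp [α, Matrix.fromBlocks, Matrix.one_apply]
  · obtain ⟨μ, hμ1, hμ, hv, b, hu⟩ := hHw h hh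
    obtain ⟨q, hf, hq⟩ := w.mulVec_f E hμ hμ1 hv hu
    choose ν hν using hv
    have hν1 : ∀ i, ‖ν i‖ = 1 := fun i => norm_eq_one_of_eigenvector (hν i) (by
      have := w.vv (Sum.inl i) (Sum.inl i)
      simp only [Sum.elim_inl, if_true] at this
      rw [this]
      norm_num)
    choose t ht using fun i => exists_circle_mul hμ1 (hν1 i)
    -- The real part of `q` is already forced to be `|b|²/2`, so its imaginary part is the only free
    -- parameter; it corresponds to `s = -2 Im q`.
    have hq' : (-Complex.I * ((-2 * q.im : ℝ) : ℂ) + ∑ i, (b i : ℂ) ^ 2) / 2 = q := by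
      have h1 : ∀ j, ‖-Complex.I * (b j : ℂ)‖ ^ 2 = b j ^ 2 := fun j => by simp
      simp only [h1] at hq
      have h2 : ∑ i, (b i : ℂ) ^ 2 = ((∑ i, b i ^ 2 : ℝ) : ℂ) := by push_cast; rfl
      rw [h2]
      generalize ∑ i, b i ^ 2 = s at hq
      apply Complex.ext
      · rw [hq]
        simp
      · simp
    have hq2 : (Complex.I * ((-2 * q.im : ℝ) : ℂ) - ∑ i, (b i : ℂ) ^ 2) / 2 = -q := by
      linear_combination -hq'
    refine ⟨(t, (WithLp.toLp 2 (Fin.snoc b (-2 * q.im) : Fin (l + 1) → ℝ) :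
        EuclideanSpace ℝ (Fin (l + 1)))), ⟨μ, mem_sphere_zero_iff_norm.mpr hμ1⟩, fun j => ?_⟩
    obtain ⟨h1, h2⟩ := half_smul_mulVec_add hμ hf
    have hc : ∀ j, 2 * star (-Complex.I * (b j : ℂ)) = 2 * (Complex.I * b j) := fun j => by simp
    simp only [hc] at h1 h2
    simp only [Fin.snoc_castSucc, Fin.snoc_last]
    have hsum : ∀ x : ℂ, ∑ j, (x * (-Complex.I * b j)) • u j =
        -(x / 2) • ∑ j, (2 * (Complex.I * b j)) • u j := by
      intro x
      rw [Finset.smul_sum]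
      refine Finset.sum_congr rfl fun j _ => ?_
      rw [smul_smul]
      congr 1
      ring
    rcases j with (j | j | j) | j
    · simp only [hb₀, hβ, Sum.elim_inl, hν, ← ht]
      simp [Fintype.sum_sum_type, Model.nilCore]
    · simp only [hb₀, hβ, Sum.elim_inl, Sum.elim_inr, hu]
      simp only [Fintype.sum_sum_type, Model.nilCore, Sum.elim_inl, Sum.elim_inr,
        Finset.univ_unique, Finset.sum_singleton, mul_zero, zero_smul, Finset.sum_const_zero,
        zero_add, mul_ite, mul_one, ite_smul, Finset.sum_ite_eq', Finset.mem_univ, if_true]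
      module
    · simp only [hb₀, hβ, Sum.elim_inl, Sum.elim_inr, h1]
      simp only [Fintype.sum_sum_type, Model.nilCore, Sum.elim_inl, Sum.elim_inr,
        Finset.univ_unique, Finset.sum_singleton, mul_zero, zero_smul, Finset.sum_const_zero,
        zero_add, hsum, hq', hq2]
      module
    · simp only [hb₀, hβ, Sum.elim_inr, h2]
      simp only [Fintype.sum_sum_type, Model.nilCore, Sum.elim_inl, Sum.elim_inr,
        Finset.univ_unique, Finset.sum_singleton, mul_zero, zero_smul, Finset.sum_const_zero,
        zero_add, hsum, hq', hq2]
      module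

/-- A Witt basis in which all elements act by generalised translations: the nilpotent cases. -/
lemma IsWitt.nonempty_chart_of_translations (hH : IsMaximalAbelian H)
    (w : IsWitt (Sum.elim v u) e f) (E : (Fin k ⊕ Fin l) ⊕ Unit ≃ Fin n)
    (hHw : ∀ h ∈ H, ∃ μ : ℂ, ‖μ‖ = 1 ∧ mat h *ᵥ e = μ • e ∧
      (∀ i, ∃ ν : ℂ, mat h *ᵥ v i = ν • v i) ∧
      ∃ c : Fin l → ℂ, ∀ j, mat h *ᵥ u j = μ • (u j + c j • e)) :
    Nonempty (Chart H) := by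
  choose μ hμ1 hμ hv c hc using fun h : H => hHw h.1 h.2
  obtain ⟨o, ho, hoc⟩ := exists_orthonormal_real (fun h : H => (WithLp.toLp 2 (c h) :
    EuclideanSpace ℂ (Fin l))) (fun g h => by
      have h1 := w.sum_star_mul_comm E (hH.1 g.1 g.2 h.1 h.2) (hμ g) (hμ1 g) (hμ h) (hμ1 h)
        (hv g) (hv h) (hc g) (hc h)
      simp only [PiLp.inner_apply, RCLike.inner_apply]
      simp only [RCLike.star_def] at h1
      calc _ = ∑ j, (starRingEnd ℂ) (c g j) * c h j :=
            Finset.sum_congr rfl fun j _ => mul_comm _ _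
        _ = _ := h1
        _ = _ := Finset.sum_congr rfl fun j _ => mul_comm _ _) l le_rfl
  have hoo := orthonormal_iff_ite.mp ho
  -- A unitary change of the `u j` makes all translation coefficients real simultaneously. The
  -- factor `i` puts them in the form `-i b` of the model.
  set u' : Fin l → Ix n → ℂ := fun j => ∑ m, (Complex.I * star (o j m)) • u m with hu'
  have huu : ∀ i j, herm (u i) (u j) = if i = j then -1 else 0 := fun i j => by
    have := w.vv (Sum.inr i) (Sum.inr j)
    simpa using this
  have hzero : ∀ x : Ix n → ℂ, (∀ j, herm x (u j) = 0) → ∀ j, herm x (u' j) = 0 := by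
    intro x hx j
    rw [hu', herm_sum_right]
    exact Finset.sum_eq_zero fun m _ => by rw [herm_smul_right, hx, mul_zero]
  have hvu' : ∀ i j, herm (v i) (u' j) = 0 := fun i => hzero _ fun j => by
    simpa using w.vv (Sum.inl i) (Sum.inr j)
  have w' : IsWitt (Sum.elim v u') e f := by
    refine ⟨fun i j => ?_, fun i => ?_, fun i => ?_, w.ee, w.ff, w.ef⟩
    · rcases i with i | i <;> rcases j with j | j
      · simpa using w.vv (Sum.inl i) (Sum.inl j)
      · simp [hvu']
      · simp [herm_comm_zero (hvu' j i)]
      · have h1 : herm (u' i) (u' j) = -inner ℂ (o j) (o i) := by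
          simp only [hu', herm_sum_left, herm_sum_right, herm_smul_left, herm_smul_right, huu,
            mul_ite, mul_neg, mul_one, mul_zero, PiLp.inner_apply, RCLike.inner_apply]
          rw [← Finset.sum_neg_distrib]
          refine Finset.sum_congr rfl fun m _ => ?_
          simp
          linear_combination (o i m * (starRingEnd ℂ) (o j m)) * Complex.I_sq
        rw [Sum.elim_inr, Sum.elim_inr, h1, hoo]
        simp [eq_comm, apply_ite]
    · rcases i with i | i
      · exact w.ev (Sum.inl i)
      · exact hzero e (fun j => w.ev (Sum.inr j)) i
    · rcases i with i | i
      · exact w.fv (Sum.inl i)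
      · exact hzero f (fun j => w.fv (Sum.inr j)) i
  refine w'.nonempty_chart_nilpotent hH E fun h hh => ⟨μ ⟨h, hh⟩, hμ1 ⟨h, hh⟩, hμ ⟨h, hh⟩,
    hv ⟨h, hh⟩, fun j => -(inner ℂ (o j) (WithLp.toLp 2 (c ⟨h, hh⟩))).re, fun j => ?_⟩
  set κ := inner ℂ (o j) (WithLp.toLp 2 (c ⟨h, hh⟩) : EuclideanSpace ℂ (Fin l)) with hκ
  have h1 : ((κ.re : ℝ) : ℂ) = κ := Complex.conj_eq_iff_re.mp (hoc j ⟨h, hh⟩)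
  have h2 : κ = ∑ m, c ⟨h, hh⟩ m * star (o j m) := by
    rw [hκ]
    simp [PiLp.inner_apply]
  have h3 : -Complex.I * ((-κ.re : ℝ) : ℂ) = Complex.I * κ := by
    rw [Complex.ofReal_neg, h1]
    ring
  rw [h3, h2, hu', Matrix.mulVec_sum]
  simp only [Matrix.mulVec_smul, hc ⟨h, hh⟩]
  rw [smul_add, Finset.smul_sum, smul_smul, Finset.mul_sum, Finset.mul_sum, Finset.sum_smul,
    ← Finset.sum_add_distrib]
  refine Finset.sum_congr rfl fun m _ => ?_
  module

end Nilpotent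

end BallToeplitz

end

/-! ### Classification of the maximal abelian subgroups -/

noncomputable section

namespace BallToeplitz

variable {n : ℕ} {H : Subgroup (SU n)}

/-- The orthogonal complement of a null eigenvector: every vector of an adapted orthonormal family
can be chosen to be an eigenvector or to have the eigenvalues of the null vector. -/
lemma IsCommSet.exists_orthonormal_of_null (hH : IsCommSet H) {e : Ix n → ℂ} (he : e ≠ 0)
    (hee : herm e e = 0) {μ : SU n → ℂ} (hμ : ∀ h ∈ H, mat h *ᵥ e = μ h • e) {m : ℕ}
    (hm : m + 1 ≤ n) :
    ∃ v : Fin m → Ix n → ℂ, (∀ i j, herm (v i) (v j) = if i = j then -1 else 0) ∧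
      (∀ i, herm e (v i) = 0) ∧
      ∀ i, (∀ h ∈ H, ∃ ν : ℂ, mat h *ᵥ v i = ν • v i) ∨
        ∀ h ∈ H, ∃ c : ℂ, mat h *ᵥ v i = μ h • v i + c • e := by
  obtain ⟨v, hv, hev, hvH⟩ := hH.exists_orthonormal he (by rw [hee]; exact le_rfl)
    (fun h hh => ⟨_, hμ h hh⟩) m (Or.inl hm)
  choose! ν c hνc using hvH
  have hcor : ∀ i, ∃ d : ℂ, (∀ h ∈ H, ∃ ν : ℂ, mat h *ᵥ (v i + d • e) = ν • (v i + d • e)) ∨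
      ∀ h ∈ H, ∃ c : ℂ, mat h *ᵥ (v i + d • e) = μ h • (v i + d • e) + c • e := by
    intro i
    -- If one element separates the eigenvalue from that of `e`, the vector can be corrected by a
    -- multiple of `e` to an honest common eigenvector. Adding multiples of the null vector `e`, to
    -- which all `v i` are orthogonal, does not disturb orthonormality.
    by_cases hk : ∃ k ∈ H, ν k i ≠ μ k
    · obtain ⟨k, hk, hne⟩ := hk
      obtain ⟨d, hd⟩ := exists_add_smul_eigenvector hH he (ν := fun h => ν h i)
        (c := fun h => c h i) hμ (fun h hh => hνc h hh i) hk hne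
      exact ⟨d, Or.inl fun h hh => ⟨_, hd h hh⟩⟩
    · push Not at hk
      refine ⟨0, Or.inr fun h hh => ⟨c h i, ?_⟩⟩
      rw [zero_smul, add_zero, ← hk h hh, hνc h hh]
  choose d hd using hcor
  refine ⟨fun i => v i + d i • e, fun i j => ?_, fun i => ?_, hd⟩
  · rw [herm_add_left, herm_add_right, herm_add_right, herm_smul_left, herm_smul_left,
      herm_smul_right, herm_smul_right, hv, hev, herm_comm_zero (hev i), hee]
    ring
  · rw [herm_add_right, herm_smul_right, hev, hee, mul_zero, add_zero]

/-- In the presence of an eigenvalue of modulus other than one on a null eigenvector, there is a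
second null eigenvector. -/
lemma nonempty_chart_of_null_of_norm_ne_one (hH : IsMaximalAbelian H) {e : Ix n → ℂ} (he : e ≠ 0)
    (hee : herm e e = 0) {μ : SU n → ℂ} (hμ : ∀ h ∈ H, mat h *ᵥ e = μ h • e) {m : ℕ}
    (E : Fin m ⊕ Unit ≃ Fin n) {v : Fin m → Ix n → ℂ}
    (hv : ∀ i j, herm (v i) (v j) = if i = j then -1 else 0) (hev : ∀ i, herm e (v i) = 0)
    (hvH : ∀ h ∈ H, ∀ i, ∃ ν : ℂ, mat h *ᵥ v i = ν • v i) {k : SU n} (hk : k ∈ H)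
    (hk1 : ‖μ k‖ ≠ 1) : Nonempty (Chart H) := by
  obtain ⟨f, w⟩ := IsWitt.exists_of_null hv hev he hee
  have hf : ∀ h ∈ H, ∃ ν c : ℂ, star (μ h) * ν = 1 ∧ mat h *ᵥ f = ν • f + c • e := by
    intro h hh
    have h1 : star (μ h) * herm e (mat h *ᵥ f) = -2 := by
      rw [← herm_smul_left, ← hμ h hh, herm_mulVec, w.ef]
    refine ⟨-(herm e (mat h *ᵥ f) / 2), -(herm f (mat h *ᵥ f) / 2), ?_, ?_⟩
    · linear_combination (-1 / 2) * h1
    · have h2 : ∀ i, herm (v i) (mat h *ᵥ f) = 0 := by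
        intro i
        obtain ⟨ν, hν⟩ := hvH h hh i
        have h3 : herm (mat h *ᵥ v i) (mat h *ᵥ f) = 0 := by rw [herm_mulVec, w.vf]
        rw [hν, herm_smul_left] at h3
        refine (mul_eq_zero.mp h3).resolve_left (star_ne_zero.mpr (eigenvalue_ne_zero hν ?_))
        intro h0
        have := hv i i
        rw [h0, herm_zero_left, if_pos rfl] at this
        norm_num at this
      have h4 := w.expand E (mat h *ᵥ f)
      simp only [h2, zero_smul, Finset.sum_const_zero] at h4
      conv_lhs => rw [h4]
      module
  choose! ν c hνμ hνc using hf
  -- The moduli on `e` and on `f` modulo `e` are inverse to each other and different from one, so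
  -- the eigenvalues differ and `f` can be corrected to a common eigenvector.
  have hnorm : ‖μ k‖ * ‖ν k‖ = 1 := by rw [← norm_star, ← norm_mul, hνμ k hk, norm_one]
  have hνk : ‖ν k‖ ≠ 1 := by
    intro h
    rw [h, mul_one] at hnorm
    exact hk1 hnorm
  have hne : ν k ≠ μ k := by
    intro h
    rw [h] at hnorm
    exact hk1 ((mul_self_eq_one_iff.mp hnorm).resolve_right (by
      have := norm_nonneg (μ k)
      intro h'
      linarith))
  obtain ⟨d, hd⟩ := exists_add_smul_eigenvector hH.1 he hμ hνc hk hne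
  refine IsWitt.nonempty_chart_hyperbolic hH E (v := v) (e := e) (f := f + d • e)
    ⟨hv, hev, fun i => ?_, hee, ?_, ?_⟩ hvH (fun h hh => ⟨_, hμ h hh⟩) fun h hh => ⟨_, hd h hh⟩
  · rw [herm_add_left, herm_smul_left, w.fv, hev, mul_zero, add_zero]
  -- The corrected vector is automatically null: otherwise its eigenvalue under `k` would have
  -- modulus one.
  · by_contra h
    exact hνk (norm_eq_one_of_eigenvector (hd k hk) h)
  · rw [herm_add_right, herm_smul_right, hee, w.ef, mul_zero, add_zero]

/-- Every maximal abelian subgroup is conjugate to a standard one. -/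
theorem IsMaximalAbelian.nonempty_chart (hn : 1 ≤ n) (hH : IsMaximalAbelian H) :
    Nonempty (Chart H) := by
  have hHc : IsCommSet H := hH.1
  obtain ⟨e, he, hee, heH⟩ := hHc.exists_causal_eigenvector
  rcases hee.lt_or_eq with hpos | hnull
  · exact nonempty_chart_of_timelike hH hpos heH
  replace hee : herm e e = 0 := by rw [herm_self_eq_re, ← hnull, Complex.ofReal_zero]
  choose! μ hμ using heH
  obtain ⟨m, rfl⟩ : ∃ m, n = m + 1 := ⟨n - 1, by omega⟩
  obtain ⟨v, hv, hev, hvH⟩ := hHc.exists_orthonormal_of_null he hee hμ (m := m) le_rfl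
  have E : Fin m ⊕ Unit ≃ Fin (m + 1) := Fintype.equivOfCardEq (by simp)
  by_cases hk : ∃ k ∈ H, ‖μ k‖ ≠ 1
  · obtain ⟨k, hk, hk1⟩ := hk
    refine nonempty_chart_of_null_of_norm_ne_one hH he hee hμ E hv hev (fun h hh i => ?_) hk hk1
    -- The alternative is excluded: `k` would act on the spacelike `v i` with the eigenvalue `μ k`
    -- up to a null vector orthogonal to it, and invariance of its length would force `|μ k| = 1`.
    refine (hvH i).elim (fun h1 => h1 h hh) fun h1 => (hk1 ?_).elim
    obtain ⟨c, hc⟩ := h1 k hk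
    have h2 := herm_mulVec k (v i) (v i)
    have h3 : herm (v i) (v i) = -1 := by rw [hv, if_pos rfl]
    rw [hc, herm_add_left, herm_add_right, herm_add_right, herm_smul_left, herm_smul_left,
      herm_smul_left, herm_smul_right, herm_smul_right, herm_smul_right, hev,
      herm_comm_zero (hev i), herm_smul_left, herm_smul_right, hee, h3] at h2
    have h4 : star (μ k) * μ k = 1 := by linear_combination -h2
    have h5 := congrArg norm h4
    rw [norm_mul, norm_star, norm_one] at h5
    exact (mul_self_eq_one_iff.mp h5).resolve_right (by
      have := norm_nonneg (μ k)
      intro h'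
      linarith)
  · push Not at hk
    classical
    -- The common eigenvectors become the `k` compact directions of the nilpotent model. The others
    -- have the eigenvalue of `e` and become the `l` translation directions.
    set p : Fin m → Prop := fun i => ∀ h ∈ H, ∃ ν : ℂ, mat h *ᵥ v i = ν • v i with hp
    set a := Fintype.equivFin {i // p i}
    set b := Fintype.equivFin {i // ¬ p i}
    set σ := (a.symm.sumCongr b.symm).trans (Equiv.sumCompl p) with hσ
    set v₁ : Fin (Fintype.card {i // p i}) → Ix (m + 1) → ℂ := fun i => v (a.symm i) with hv₁
    set v₂ : Fin (Fintype.card {i // ¬ p i}) → Ix (m + 1) → ℂ := fun i => v (b.symm i) with hv₂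
    have hvσ : ∀ i, Sum.elim v₁ v₂ i = v (σ i) := by rintro (i | i) <;> rfl
    obtain ⟨f, w⟩ := IsWitt.exists_of_null (v := Sum.elim v₁ v₂) (e := e)
      (fun i j => by rw [hvσ, hvσ, hv]; simp only [σ.injective.eq_iff])
      (fun i => by rw [hvσ, hev]) he hee
    refine w.nonempty_chart_of_translations hH ((σ.sumCongr (Equiv.refl Unit)).trans E)
      fun h hh => ⟨μ h, hk h hh, hμ h hh, fun i => (a.symm i).2 h hh, ?_⟩
    have h1 : ∀ j, ∃ c : ℂ, mat h *ᵥ v₂ j = μ h • (v₂ j + c • e) := by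
      intro j
      obtain ⟨c, hc⟩ := (hvH (b.symm j)).resolve_left (b.symm j).2 h hh
      refine ⟨(μ h)⁻¹ * c, ?_⟩
      rw [smul_add, smul_smul, mul_inv_cancel_left₀ (eigenvalue_ne_zero (hμ h hh) he)]
      exact hc
    exact ⟨_, fun j => (h1 j).choose_spec⟩

end BallToeplitz

end

theorem mainTheorem2 (n : ℕ) (hn : 1 ≤ n) (lam : ℝ) (hlam : (n : ℝ) < lam)
    (H : Subgroup (SU n)) (hH : IsMaximalAbelian H) :
    -- up to conjugacy `H` is one of the standard groups, so that a base point is available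
    Nonempty (Chart H) ∧
    -- diagonalisation for each such choice of the base point `z₀`
    (∀ c : Chart H,
      Integrable (c.phiH lam) ∧
      ∃ R : bergman n lam →L[ℂ] c.L2chi lam, c.IsRestriction lam R ∧ c.IsConvolution lam R ∧
      ∃ U : c.rangeClosure lam R ≃ₗᵢ[ℂ] bergman n lam, c.IsSegalBargmann lam R U ∧
      ∃ P : Lp ℂ 2 (volume : Measure c.model.X) ≃ₗᵢ[ℂ] Lp ℂ 2 c.dualMeasure, c.IsPlancherel P ∧
      -- the modified Fourier transform
      ∃ F : c.rangeClosure lam R ≃ₗᵢ[ℂ] c.L2A lam,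
        (∀ f : c.rangeClosure lam R, (F f : Lp ℂ 2 c.dualMeasure) = P (c.toL2 lam f)) ∧
        ∀ φ : Lp ℂ ∞ (bergmanMeasure n lam), IsInvariant H φ →
          Integrable (c.nu lam φ) ∧
          ∀ ω : c.L2A lam, ∀ᵐ α ∂c.dualMeasure, α ∈ c.A lam →
            (F (U.symm (toeplitz φ (U (F.symm ω)))) : Lp ℂ 2 c.dualMeasure) α =
              c.hat (c.nu lam φ) α / c.hat (c.phiH lam) α * (ω : Lp ℂ 2 c.dualMeasure) α) ∧
    -- commutativity
    (∀ φ ψ : Lp ℂ ∞ (bergmanMeasure n lam), IsInvariant H φ → IsInvariant H ψ →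
      toeplitz φ ∘L toeplitz ψ = toeplitz ψ ∘L toeplitz φ) := by
  have hc : Nonempty (Chart H) := hH.nonempty_chart hn
  refine ⟨hc, fun c => c.exists_diagonalization hn hlam, fun φ ψ hφ hψ => ?_⟩
  obtain ⟨c⟩ := hc
  exact c.toeplitz_comm hn hlam hφ hψ
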